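/- **Setting.** Let $\mathfrak{psl}(4|4)=\mathfrak{sl}(4|4)/\langle 1\rangle$ be the complexification of $\mathfrak g=\mathfrak{psu}(2,2|4)$, with supertrace form $\mathrm{Str}$, $\mathbb Z_4$-grading $\mathfrak g_0+\mathfrak g_1+\mathfrak g_2+\mathfrak g_3$ (defined by $\Omega X=-\mathcal K X^{st}\mathcal K^{-1}$, $\Omega=i^k$ on $\mathfrak g_k$), projectors $P_i$, and $d_{PS}=P_1+2P_2+3P_3$, $\hat d_{PS}=3P_1+2P_2+P_3$. Let $R$ be an even linear operator, antisymmetric for $\mathrm{Str}$, solving the homogeneous classical Yang–Baxter equation $[RX,RY]=R([RX,Y]+[X,RY])$, and let $\eta\in\mathbb R$. Fields are smooth Grassmann-valued functions of the light-cone coordinates $\sigma^\pm$: $g$ with values in the supergroup $PSU(2,2|4)$ or, more generally, represented by an invertible even complex $(4|4)$ supermatrix with $\mathrm{Str}(\partial_\pm g\,g^{-1})=0$; $\omega_{3-},\lambda_3\in\mathfrak g_3$ and $\omega_{1+},\lambda_1\in\mathfrak g_1$ (complexified) with commuting components; and $\{\lambda_1,\lambda_1\}=\{\lambda_3,\lambda_3\}=0$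 (the pure spinor constraints). Supermatrices with Grassmann entries are multiplied as ordinary matrices, and an odd parameter $\epsilon$ multiplies entries from the left. Put $A_\pm=-\partial_\pm g\,g^{-1}$, $N_{0+}=-\{\omega_{1+},\lambda_3\}$, $N_{0-}=-\{\omega_{3-},\lambda_1\}$, $R_g=Ad_g\circ R\circ Ad_g^{-1}$, $$\mathcal O_{PS-}=1-\eta R_g d_{PS},\qquad \mathcal O_{PS+}=1+\eta R_g\hat d_{PS},\qquad J_-=\mathcal O_{PS-}^{-1}A_-,\qquad \bar J_+=\mathcal O_{PS+}^{-1}A_+,$$ where both operators $\mathcal O_{PS\pm}$ are assumed invertible. The deformed action is $S_{def}=\int\mathcal L_{def}$ with $$\mathcal L_{def}=\tfrac14\mathrm{Str}(A_+\,d_{PS}J_-)+\mathrm{Str}(N_{0+}J_{0-}+N_{0-}\bar J_{0+})-\mathrm{Str}\big(N_{0+}(1-4\eta\,\mathcal O_{PS-}^{-1}R_g)N_{0-}\big)+\mathrm{Str}(\omega_{1+}\partial_-\lambda_3+\omega_{3-}\partial_+\lambda_1),$$ and the BRST transformations, for a constant odd parameter $\epsilon$, are $Q(\lambda_1)=Q(\lambda_3)=0$,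 $$\epsilon Q(g)=\{(1-\eta R_g)\epsilon\lambda_1+(1+\eta R_g)\epsilon\lambda_3\}g,$$ $$Q(\omega_{3-})=-J_{3-}-4\eta P_3\mathcal O_{PS-}^{-1}R_gN_{0-},\qquad Q(\omega_{1+})=-\bar J_{1+}+4\eta P_1\mathcal O_{PS+}^{-1}R_gN_{0+}.$$ **Theorem.** 1. (Invariance.) $\epsilon Q$ preserves the constraints on the fields and the invertibility of $\mathcal O_{PS\pm}$, and under it $\mathcal L_{def}$ changes by the total derivative $\partial_+\big(\tfrac14\mathrm{Str}(\epsilon(\lambda_1-\lambda_3)A_-)\big)-\partial_-\big(\tfrac14\mathrm{Str}(\epsilon(\lambda_1-\lambda_3)A_+)\big)$. Hence $S_{def}$ is BRST invariant: on every closed world-sheet $\mathbb R^2/(\mathbb Zu+\mathbb Zv)$, with $u,v$ linearly independent, $S_{def}[\Phi+\epsilon Q\Phi]=S_{def}[\Phi]$ for all fields $\Phi$ with periods $u,v$ ($g$ being periodic up to even scalar factors). 2. (On-shell nilpotency.) If the equations of motion obtained by varying $\omega_{1+}$ and $\omega_{3-}$ hold, in particular on-shell, then $Q^2=0$ up to gauge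 transformations. That is, $\epsilon'Q(\epsilon Q)$ acts on the fields $g,\omega,\lambda$ as a local Lorentz transformation with parameter $M\in\mathfrak g_0$ (up to a scalar rescaling of the representative $g$), combined with $\delta\omega_{3-}=[\lambda_1,S]$ and $\delta\omega_{1+}=[\lambda_3,S']$, $S,S'\in\mathfrak g_2$. 3. (Only on-shell.) For every $R$ and all but finitely many $\eta\in\mathbb R$, there is a field configuration, with $g$ in $PSU(2,2|4)$ and $\mathcal O_{PS\pm}$ invertible, at which $Q^2$ is not such a gauge transformation. 4. (Expansion.) Let $S_{AdS}=\int\mathcal L_{AdS}$ be the undeformed action, $\mathcal L_{AdS}=\mathrm{Str}\big(\tfrac14A_+d_{PS}A_-+\omega_{1+}\partial_-\lambda_3+\omega_{3-}\partial_+\lambda_1+N_{0+}A_{0-}+N_{0-}A_{0+}-N_{0-}N_{0+}\big)$, and let $j_-=g^{-1}(d_{PS}A_-+4N_{0-})g$, $j_+=-g^{-1}(\hat d_{PS}A_++4N_{0+})g$. For each configuration and each world-sheet point there is $\delta>0$ such that, if $|\eta|<\delta$ and $\mathcal O_{PS\pm}$ are invertible, the following series converge at that point (for each Grassmann component) to the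 stated sums: $$\mathcal L_{def}=\mathcal L_{AdS}-\tfrac{\eta}{4}\sum_{n\ge0}\eta^n\,\mathrm{Str}\big(j_+\,(R\,Ad_g^{-1}d_{PS}Ad_g)^nR\,j_-\big),$$ $$Q(\omega_{3-})=-P_3\Big[\sum_{n\ge0}(\eta R_gd_{PS})^nA_-+4\eta\sum_{n\ge0}(\eta R_gd_{PS})^nR_gN_{0-}\Big],$$ $$Q(\omega_{1+})=-P_1\Big[\sum_{n\ge0}(-\eta R_g\hat d_{PS})^nA_+-4\eta\sum_{n\ge0}(-\eta R_g\hat d_{PS})^nR_gN_{0+}\Big].$$ 5. (Infinite series.) In general the series for $Q(\omega)$ do not terminate: there are an operator $R$ as above that preserves $\mathfrak{psu}(2,2|4)$ and a configuration with $g$ in $PSU(2,2|4)$ for which, for every $n\ge0$, the coefficients of $\eta^n$ in $Q(\omega_{3-})$ and in $Q(\omega_{1+})$ are not of the pure gauge forms $[\lambda_1,S]$ and $[\lambda_3,S']$, $S,S'\in\mathfrak g_2$. -/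

import Mathlib

open scoped TensorProduct ContDiff

noncomputable section

namespace PureSpinorYB

/-! ## Supermatrices over a ring of coefficients -/

/-- Row and column indices of `(4|4)` supermatrices. -/
abbrev Idx := Fin 4 ⊕ Fin 4

/-- `(4|4) × (4|4)` supermatrices with entries in `𝒪`, with ordinary matrix multiplication.  For a
supercommutative `𝒪`, the even supermatrices (even diagonal blocks, odd off-diagonal blocks) form
the Grassmann envelope of `gl(4|4)`, and its bracket is the ordinary commutator. -/
abbrev SMat (𝒪 : Type*) := Matrix Idx Idx 𝒪

section Algebra

variable {𝒪 : Type*} [Ring 𝒪] [Algebra ℂ 𝒪]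

/-- Supertrace. -/
def str (X : SMat 𝒪) : 𝒪 := X.toBlocks₁₁.trace - X.toBlocks₂₂.trace

/-- Removes the trace of each of the two diagonal blocks.  On `sl(4|4)`, where both block traces
agree, this subtracts a multiple of the identity: it is the quotient map
`sl(4|4) → psl(4|4) = sl(4|4)/⟨1⟩`, where a class is represented by its element whose two block
traces vanish. -/
def pr : Module.End ℂ (SMat 𝒪) where
  toFun X := X - Matrix.fromBlocks
    (((1 / 4 : ℂ) • X.toBlocks₁₁.trace) • (1 : Matrix (Fin 4) (Fin 4) 𝒪)) 0 0
    (((1 / 4 : ℂ) • X.toBlocks₂₂.trace) • (1 : Matrix (Fin 4) (Fin 4) 𝒪))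
  map_add' X Y := by
    ext (i | i) (j | j) <;>
      simp [Matrix.trace, Matrix.toBlocks₁₁, Matrix.toBlocks₂₂, Finset.sum_add_distrib,
        smul_add, add_mul] <;> abel
  map_smul' c X := by
    ext (i | i) (j | j) <;>
      simp [Matrix.trace, Matrix.toBlocks₁₁, Matrix.toBlocks₂₂, ← Finset.smul_sum, smul_sub,
        smul_comm c]

/-- Supertranspose `[[A, B], [C, D]] ↦ [[Aᵀ, -Cᵀ], [Bᵀ, Dᵀ]]`. -/
def superTranspose : SMat 𝒪 →ₗ[ℂ] SMat 𝒪 where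
  toFun X := Matrix.fromBlocks X.toBlocks₁₁.transpose (-X.toBlocks₂₁.transpose)
    X.toBlocks₁₂.transpose X.toBlocks₂₂.transpose
  map_add' X Y := by
    ext (i | i) (j | j) <;>
      simp [Matrix.toBlocks₁₁, Matrix.toBlocks₂₂, Matrix.toBlocks₁₂, Matrix.toBlocks₂₁, add_comm]
  map_smul' c X := by
    ext (i | i) (j | j) <;>
      simp [Matrix.toBlocks₁₁, Matrix.toBlocks₂₂, Matrix.toBlocks₁₂, Matrix.toBlocks₂₁]

variable (𝒪) in
/-- The `4 × 4` symplectic matrix `K`, with `K² = -1`. -/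
def symp : Matrix (Fin 4) (Fin 4) 𝒪 :=
  !![0, -1, 0, 0; 1, 0, 0, 0; 0, 0, 0, -1; 0, 0, 1, 0]

variable (𝒪) in
/-- `𝒦 = diag(K, K)`. -/
def bigSymp : SMat 𝒪 := Matrix.fromBlocks (symp 𝒪) 0 0 (symp 𝒪)

/-- The order-four automorphism `Ω X = -𝒦 Xˢᵗ 𝒦⁻¹` which defines the `ℤ₄` grading
(note `𝒦⁻¹ = -𝒦`). -/
def omega : Module.End ℂ (SMat 𝒪) where
  toFun X := bigSymp 𝒪 * superTranspose X * bigSymp 𝒪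
  map_add' X Y := by simp [mul_add, add_mul]
  map_smul' c X := by simp

/-- `P_k`, the projector on the grade `k` subspace `𝔤_k`, where `Ω = i^k`. -/
def proj (k : ℕ) : Module.End ℂ (SMat 𝒪) :=
  (1 / 4 : ℂ) • ∑ j ∈ Finset.range 4, ((-Complex.I) ^ (j * k)) • omega ^ j

/-- `d_PS = P₁ + 2 P₂ + 3 P₃`. -/
def dPS : Module.End ℂ (SMat 𝒪) := proj 1 + (2 : ℂ) • proj 2 + (3 : ℂ) • proj 3

/-- `d̂_PS = 3 P₁ + 2 P₂ + P₃`. -/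
def dPSHat : Module.End ℂ (SMat 𝒪) := (3 : ℂ) • proj 1 + (2 : ℂ) • proj 2 + proj 3

end Algebra

/-! ## The Lie superalgebra `psu(2,2|4)`, its supergroup, and `R`-matrices -/

/-- `psl(4|4)`, the complexification of `psu(2,2|4)`. -/
def psl : Submodule ℂ (SMat ℂ) where
  carrier := {X | X.toBlocks₁₁.trace = 0 ∧ X.toBlocks₂₂.trace = 0}
  add_mem' := by
    rintro X Y ⟨h1, h2⟩ ⟨h3, h4⟩
    simp only [Matrix.trace, Matrix.diag_apply, Matrix.toBlocks₁₁, Matrix.toBlocks₂₂,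
      Matrix.of_apply, Set.mem_ofPred_eq, Matrix.add_apply, Finset.sum_add_distrib] at *
    simp [h1, h2, h3, h4]
  zero_mem' := by simp [Matrix.trace, Matrix.toBlocks₁₁, Matrix.toBlocks₂₂]
  smul_mem' := by
    rintro c X ⟨h1, h2⟩
    simp only [Matrix.trace, Matrix.diag_apply, Matrix.toBlocks₁₁, Matrix.toBlocks₂₂,
      Matrix.of_apply, Set.mem_ofPred_eq, Matrix.smul_apply, ← Finset.smul_sum] at *
    simp [h1, h2]

/-- The projection `gl(4|4) → psl(4|4)`. -/
def toPsl : SMat ℂ →ₗ[ℂ] psl :=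
  LinearMap.codRestrict psl pr (by
    intro X
    constructor <;>
      simp [pr, Matrix.trace, Matrix.toBlocks₁₁, Matrix.toBlocks₂₂, Fin.sum_univ_four])

/-- The parity matrix `diag(1, -1)`. -/
def gam : SMat ℂ := Matrix.fromBlocks 1 0 0 (-1)

/-- The odd part (off-diagonal blocks) of a complex supermatrix. -/
def oddPart (X : SMat ℂ) : SMat ℂ := Matrix.fromBlocks 0 X.toBlocks₁₂ X.toBlocks₂₁ 0

/-- The superbracket of `psl(4|4)`: the anticommutator of two odd elements and the commutator
otherwise, modulo the identity matrix. -/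
def superBracket (X Y : psl) : psl :=
  toPsl (X.1 * Y.1 - Y.1 * X.1 + 2 • (oddPart Y.1 * oddPart X.1))

/-- The Hermitian form `𝓗 = diag(1, 1, -1, -1 | i, i, i, i)` of signature `(2,2|4)`. -/
def hermForm : SMat ℂ :=
  Matrix.fromBlocks (Matrix.diagonal ![1, 1, -1, -1]) 0 0 (Complex.I • 1)

/-- Membership in the real form `psu(2,2|4)` of `psl(4|4)`. -/
def IsPsu (X : psl) : Prop :=
  (superTranspose X.1).map (starRingEnd ℂ) * hermForm + hermForm * X.1 = 0

/-- An even linear operator on the Lie superalgebra which is antisymmetric with respect to the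
supertrace form and solves the homogeneous classical Yang-Baxter equation. -/
structure IsYangBaxter (R : Module.End ℂ psl) : Prop where
  even : ∀ X Y : psl, Y.1 = gam * X.1 * gam → (R Y).1 = gam * (R X).1 * gam
  antisymm : ∀ X Y : psl, str ((R X).1 * Y.1) = -str (X.1 * (R Y).1)
  cybe : ∀ X Y : psl, superBracket (R X) (R Y) =
    R (superBracket (R X) Y + superBracket X (R Y))

/-- `R` is (the complex linear extension of) an operator on the real superalgebra
`psu(2,2|4)`. -/
def IsRealOperator (R : Module.End ℂ psl) : Prop := ∀ X, IsPsu X → IsPsu (R X)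

section Model

variable {𝒪 : Type*} [Ring 𝒪] [Algebra ℂ 𝒪]

/-- The extension of `R` to supermatrices over `𝒪`, linear in the entries. -/
def extend (R : Module.End ℂ psl) : Module.End ℂ (SMat 𝒪) where
  toFun X := Matrix.of fun k l =>
    ∑ i, ∑ j, ((R (toPsl (Matrix.single i j 1))).1 k l) • X i j
  map_add' X Y := by
    ext k l
    simp [smul_add, Finset.sum_add_distrib]
  map_smul' c X := by
    ext k l
    simp only [Matrix.of_apply, Matrix.smul_apply, RingHom.id_apply, Finset.smul_sum]
    exact Finset.sum_congr rfl fun i _ => Finset.sum_congr rfl fun j _ => smul_comm _ _ _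

/-- `Ad_g X = g X g⁻¹`. -/
def adj (g : SMat 𝒪) : Module.End ℂ (SMat 𝒪) where
  toFun X := pr (g * X * Ring.inverse g)
  map_add' X Y := by simp [mul_add, add_mul]
  map_smul' c X := by simp

/-- `Ad_g⁻¹ X = g⁻¹ X g`. -/
def adjInv (g : SMat 𝒪) : Module.End ℂ (SMat 𝒪) where
  toFun X := pr (Ring.inverse g * X * g)
  map_add' X Y := by simp [mul_add, add_mul]
  map_smul' c X := by simp

/-- `R_g = Ad_g ∘ R ∘ Ad_g⁻¹`. -/
def Rg (R : Module.End ℂ psl) (g : SMat 𝒪) : Module.End ℂ (SMat 𝒪) :=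
  adj g * extend R * adjInv g

/-- `𝒪_PS₋ = 1 - η R_g d_PS`. -/
def opMinus (R : Module.End ℂ psl) (η : ℝ) (g : SMat 𝒪) : Module.End ℂ (SMat 𝒪) :=
  1 - (η : ℂ) • (Rg R g * dPS)

/-- `𝒪_PS₊ = 1 + η R_g d̂_PS`. -/
def opPlus (R : Module.End ℂ psl) (η : ℝ) (g : SMat 𝒪) : Module.End ℂ (SMat 𝒪) :=
  1 + (η : ℂ) • (Rg R g * dPSHat)

/-- `𝒪_PS₋⁻¹`. -/
def opMinusInv (R : Module.End ℂ psl) (η : ℝ) (g : SMat 𝒪) : Module.End ℂ (SMat 𝒪) :=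
  Ring.inverse (opMinus R η g)

/-- `𝒪_PS₊⁻¹`. -/
def opPlusInv (R : Module.End ℂ psl) (η : ℝ) (g : SMat 𝒪) : Module.End ℂ (SMat 𝒪) :=
  Ring.inverse (opPlus R η g)

/-- Component of the Maurer-Cartan form `A = -dg g⁻¹` along the derivation `D`. -/
def mcForm (D : 𝒪 →ₗ[ℂ] 𝒪) (g : SMat 𝒪) : SMat 𝒪 := -pr (g.map D * Ring.inverse g)

variable (𝒪) in
/-- The fields: the supergroup element `g`, the antighosts `ω_{3-}`, `ω_{1+}`, and the ghosts
`λ₁`, `λ₃`. -/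
@[ext] structure Fields where
  g : SMat 𝒪
  w3 : SMat 𝒪
  w1 : SMat 𝒪
  l1 : SMat 𝒪
  l3 : SMat 𝒪

instance : Add (Fields 𝒪) :=
  ⟨fun Φ Ψ => ⟨Φ.g + Ψ.g, Φ.w3 + Ψ.w3, Φ.w1 + Ψ.w1, Φ.l1 + Ψ.l1, Φ.l3 + Ψ.l3⟩⟩

instance : Sub (Fields 𝒪) :=
  ⟨fun Φ Ψ => ⟨Φ.g - Ψ.g, Φ.w3 - Ψ.w3, Φ.w1 - Ψ.w1, Φ.l1 - Ψ.l1, Φ.l3 - Ψ.l3⟩⟩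

/-- `N_{0+} = -{ω_{1+}, λ₃}`. -/
def nPlus (Φ : Fields 𝒪) : SMat 𝒪 := -pr (Φ.w1 * Φ.l3 + Φ.l3 * Φ.w1)

/-- `N_{0-} = -{ω_{3-}, λ₁}`. -/
def nMinus (Φ : Fields 𝒪) : SMat 𝒪 := -pr (Φ.w3 * Φ.l1 + Φ.l1 * Φ.w3)

variable (dp dm : 𝒪 →ₗ[ℂ] 𝒪) (R : Module.End ℂ psl) (η : ℝ)

/-- The deformed current `J₋ = -𝒪_PS₋⁻¹ (∂₋g g⁻¹)`. -/
def jMinus (Φ : Fields 𝒪) : SMat 𝒪 := opMinusInv R η Φ.g (mcForm dm Φ.g)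

/-- The deformed current `J̄₊ = -𝒪_PS₊⁻¹ (∂₊g g⁻¹)`. -/
def jBarPlus (Φ : Fields 𝒪) : SMat 𝒪 := opPlusInv R η Φ.g (mcForm dp Φ.g)

/-- The Lagrangian density of the deformed action:
`¼ Str(A₊ d_PS J₋) + Str(N₊ J_{0-} + N₋ J̄_{0+}) - Str(N₊ (1 - 4η 𝒪_PS₋⁻¹ R_g) N₋)
  + Str(ω_{1+} ∂₋λ₃ + ω_{3-} ∂₊λ₁)`. -/
def lagrangian (Φ : Fields 𝒪) : 𝒪 :=
  (1 / 4 : ℂ) • str (mcForm dp Φ.g * dPS (jMinus dm R η Φ))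
    + str (nPlus Φ * proj 0 (jMinus dm R η Φ) + nMinus Φ * proj 0 (jBarPlus dp R η Φ))
    - str (nPlus Φ * (nMinus Φ - (4 * η : ℂ) • opMinusInv R η Φ.g (Rg R Φ.g (nMinus Φ))))
    + str (Φ.w1 * Φ.l3.map dm + Φ.w3 * Φ.l1.map dp)

/-- The Lagrangian density of the undeformed `AdS₅ × S⁵` pure spinor action. -/
def lagrangianAdS (Φ : Fields 𝒪) : 𝒪 :=
  str ((1 / 4 : ℂ) • (mcForm dp Φ.g * dPS (mcForm dm Φ.g))
    + Φ.w1 * Φ.l3.map dm + Φ.w3 * Φ.l1.map dp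
    + nPlus Φ * proj 0 (mcForm dm Φ.g) + nMinus Φ * proj 0 (mcForm dp Φ.g)
    - nMinus Φ * nPlus Φ)

/-- The undeformed conserved current `j₋ = g⁻¹ (A_{1-} + 2A_{2-} + 3A_{3-} + 4N_{0-}) g`. -/
def noetherMinus (Φ : Fields 𝒪) : SMat 𝒪 :=
  adjInv Φ.g (dPS (mcForm dm Φ.g) + (4 : ℂ) • nMinus Φ)

/-- The undeformed conserved current `j₊ = -g⁻¹ (3A_{1+} + 2A_{2+} + A_{3+} + 4N_{0+}) g`. -/
def noetherPlus (Φ : Fields 𝒪) : SMat 𝒪 :=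
  -adjInv Φ.g (dPSHat (mcForm dp Φ.g) + (4 : ℂ) • nPlus Φ)

/-- The term of order `η ^ (n+1)` of the deformation:
`-¼ Str(j₊ (R Ad_g⁻¹ d_PS Ad_g)ⁿ R j₋)`. -/
def lagrangianCoeff (Φ : Fields 𝒪) (n : ℕ) : 𝒪 :=
  -(1 / 4 : ℂ) • str (noetherPlus dp Φ *
    ((extend R * adjInv Φ.g * dPS * adj Φ.g) ^ n : Module.End ℂ (SMat 𝒪)) (extend R (noetherMinus dm Φ)))

/-- `Q(ω_{3-}) = -J_{3-} - 4η P₃ 𝒪_PS₋⁻¹ R_g N_{0-}`. -/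
def brstW3 (Φ : Fields 𝒪) : SMat 𝒪 :=
  -proj 3 (jMinus dm R η Φ)
    - (4 * η : ℂ) • proj 3 (opMinusInv R η Φ.g (Rg R Φ.g (nMinus Φ)))

/-- `Q(ω_{1+}) = -J̄_{1+} + 4η P₁ 𝒪_PS₊⁻¹ R_g N_{0+}`. -/
def brstW1 (Φ : Fields 𝒪) : SMat 𝒪 :=
  -proj 1 (jBarPlus dp R η Φ)
    + (4 * η : ℂ) • proj 1 (opPlusInv R η Φ.g (Rg R Φ.g (nPlus Φ)))

/-- The infinitesimal BRST transformation `ε Q` of all fields: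
`ε Q(g) = {(1 - η R_g) ελ₁ + (1 + η R_g) ελ₃} g`, `ε Q(ω_{3-})`, `ε Q(ω_{1+})`, `Q(λ) = 0`. -/
def brst (ε : 𝒪) (Φ : Fields 𝒪) : Fields 𝒪 where
  g := (ε • Φ.l1 - (η : ℂ) • Rg R Φ.g (ε • Φ.l1)
    + (ε • Φ.l3 + (η : ℂ) • Rg R Φ.g (ε • Φ.l3))) * Φ.g
  w3 := ε • brstW3 dm R η Φ
  w1 := ε • brstW1 dp R η Φ
  l1 := 0
  l3 := 0

/-- Coefficient of `η ^ n` in `Q(ω_{3-})`. -/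
def brstW3Coeff (Φ : Fields 𝒪) : ℕ → SMat 𝒪
  | 0 => -proj 3 (mcForm dm Φ.g)
  | n + 1 => -proj 3 (((Rg R Φ.g * dPS) ^ (n + 1) : Module.End ℂ (SMat 𝒪)) (mcForm dm Φ.g)
      + (4 : ℂ) • ((Rg R Φ.g * dPS) ^ n : Module.End ℂ (SMat 𝒪)) (Rg R Φ.g (nMinus Φ)))

/-- Coefficient of `η ^ n` in `Q(ω_{1+})`. -/
def brstW1Coeff (Φ : Fields 𝒪) : ℕ → SMat 𝒪
  | 0 => -proj 1 (mcForm dp Φ.g)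
  | n + 1 => -proj 1 (((-(Rg R Φ.g * dPSHat)) ^ (n + 1) : Module.End ℂ (SMat 𝒪)) (mcForm dp Φ.g)
      - (4 : ℂ) • ((-(Rg R Φ.g * dPSHat)) ^ n : Module.End ℂ (SMat 𝒪)) (Rg R Φ.g (nPlus Φ)))

/-- The model is defined at `Φ`: both operators `𝒪_PS±` are invertible. -/
def Regular (Φ : Fields 𝒪) : Prop := IsUnit (opMinus R η Φ.g) ∧ IsUnit (opPlus R η Φ.g)

end Model

/-! ## Grassmann-valued smooth functions on the world-sheet -/

/-- Smooth complex functions of the light-cone coordinates `(σ⁺, σ⁻)`. -/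
def SmoothFn : Subalgebra ℂ (ℝ × ℝ → ℂ) where
  carrier := {f | ContDiff ℝ ∞ f}
  mul_mem' {f g} hf hg := by
    rw [Set.mem_ofPred_eq] at *
    exact hf.mul hg
  add_mem' {f g} hf hg := by
    rw [Set.mem_ofPred_eq] at *
    exact hf.add hg
  algebraMap_mem' c := by
    rw [Set.mem_ofPred_eq]
    exact contDiff_const

theorem mem_smoothFn_iff {f : ℝ × ℝ → ℂ} : f ∈ SmoothFn ↔ ContDiff ℝ ∞ f :=
  Iff.trans Subalgebra.mem_carrier.symm (by rw [SmoothFn, Set.mem_ofPred_eq])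

theorem smoothFn_contDiff (f : SmoothFn) : ContDiff ℝ ∞ f.1 := mem_smoothFn_iff.1 f.2

theorem mem_smoothFn {f : ℝ × ℝ → ℂ} (h : ContDiff ℝ ∞ f) : f ∈ SmoothFn := mem_smoothFn_iff.2 h

/-- The real Grassmann algebra on `N` generators. -/
abbrev Grassmann (N : ℕ) := ExteriorAlgebra ℝ (Fin N → ℝ)

/-- Smooth functions on the world-sheet with values in the complexified Grassmann algebra. -/
abbrev SF (N : ℕ) := SmoothFn ⊗[ℝ] Grassmann N

/-- Derivative of smooth functions in the direction `v`. -/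
def smoothDeriv (v : ℝ × ℝ) : SmoothFn →ₗ[ℂ] SmoothFn where
  toFun f := ⟨fun x => fderiv ℝ f.1 x v,
    mem_smoothFn (((smoothFn_contDiff f).fderiv_right (m := ∞) (by simp)).clm_apply contDiff_const)⟩
  map_add' f g := by
    ext x
    have hf : Differentiable ℝ f.1 := (smoothFn_contDiff f).differentiable (by simp)
    have hg : Differentiable ℝ g.1 := (smoothFn_contDiff g).differentiable (by simp)
    have : fderiv ℝ (f.1 + g.1) x v = fderiv ℝ f.1 x v + fderiv ℝ g.1 x v := by
      rw [fderiv_add (hf x) (hg x)]; rfl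
    exact this
  map_smul' c f := by
    ext x
    have hf : Differentiable ℝ f.1 := (smoothFn_contDiff f).differentiable (by simp)
    have : fderiv ℝ (c • f.1) x v = c • fderiv ℝ f.1 x v := by
      rw [fderiv_const_smul (hf x)]; rfl
    exact this

/-- Translation of smooth functions, `f ↦ f (· + u)`. -/
def smoothShift (u : ℝ × ℝ) : SmoothFn →ₗ[ℝ] SmoothFn where
  toFun f := ⟨fun x => f.1 (x + u), mem_smoothFn ((smoothFn_contDiff f).comp (contDiff_id.add contDiff_const))⟩
  map_add' _ _ := rfl
  map_smul' _ _ := rfl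

/-- Complex conjugation of smooth functions. -/
def smoothConj : SmoothFn →ₗ[ℝ] SmoothFn where
  toFun f := ⟨fun x => (starRingEnd ℂ) (f.1 x), mem_smoothFn (Complex.conjCLE.contDiff.comp (smoothFn_contDiff f))⟩
  map_add' f g := by ext x; exact map_add (starRingEnd ℂ) (f.1 x) (g.1 x)
  map_smul' c f := by
    ext x
    change (starRingEnd ℂ) (c • f.1 x) = c • (starRingEnd ℂ) (f.1 x)
    simp

/-- Integral, with respect to `dσ⁺ dσ⁻`, over the period parallelogram spanned by `u` and `v`. -/
def smoothIntegral (u v : ℝ × ℝ) : SmoothFn →ₗ[ℝ] ℂ where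
  toFun f := |u.1 * v.2 - u.2 * v.1| •
    ∫ p in Set.Icc (0 : ℝ) 1 ×ˢ Set.Icc (0 : ℝ) 1, f.1 (p.1 • u + p.2 • v)
  map_add' f g := by
    have key : ∀ f : SmoothFn, MeasureTheory.IntegrableOn
        (fun p : ℝ × ℝ => f.1 (p.1 • u + p.2 • v)) (Set.Icc (0 : ℝ) 1 ×ˢ Set.Icc (0 : ℝ) 1) := by
      intro f
      have hf : Continuous f.1 := (smoothFn_contDiff f).continuous
      exact (Continuous.continuousOn (by fun_prop)).integrableOn_compact
        (isCompact_Icc.prod isCompact_Icc)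
    rw [← smul_add, ← MeasureTheory.integral_add (key f) (key g)]
    rfl
  map_smul' c f := by
    rw [RingHom.id_apply, smul_comm c, ← MeasureTheory.integral_smul c]
    rfl

variable {N : ℕ}

/-- `∂₊`. -/
def dPlus : SF N →ₗ[ℂ] SF N :=
  TensorProduct.AlgebraTensorModule.map (smoothDeriv (1, 0)) LinearMap.id

/-- `∂₋`. -/
def dMinus : SF N →ₗ[ℂ] SF N :=
  TensorProduct.AlgebraTensorModule.map (smoothDeriv (0, 1)) LinearMap.id

/-- Translation on the world-sheet. -/
def shift (u : ℝ × ℝ) : SF N →ₗ[ℝ] SF N := TensorProduct.map (smoothShift u) LinearMap.id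

/-- Complex conjugation; the Grassmann generators are real. -/
def conj : SF N →ₗ[ℝ] SF N := TensorProduct.map smoothConj LinearMap.id

/-- Grassmann parity: `+1` on even and `-1` on odd elements. -/
def parity : SF N →ₗ[ℝ] SF N :=
  TensorProduct.map LinearMap.id
    (CliffordAlgebra.involute (Q := (0 : QuadraticForm ℝ (Fin N → ℝ)))).toLinearMap

def IsEven (x : SF N) : Prop := parity x = x

def IsOdd (x : SF N) : Prop := parity x = -x

/-- A constant (global) Grassmann parameter. -/
def const (e : Grassmann N) : SF N := 1 ⊗ₜ e

/-- `e` is an odd element of the Grassmann algebra. -/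
def IsOddConst (e : Grassmann N) : Prop :=
  CliffordAlgebra.involute (Q := (0 : QuadraticForm ℝ (Fin N → ℝ))) e = -e

/-- Value at the point `x` of the world-sheet, paired with a linear functional `φ` on the Grassmann
algebra. -/
def evalAt (x : ℝ × ℝ) (φ : Module.Dual ℝ (Grassmann N)) : SF N →ₗ[ℝ] ℂ :=
  TensorProduct.lift
    { toFun := fun f => φ.smulRight (f.1 x)
      map_add' := fun f g => by ext; simp [smul_add]
      map_smul' := fun c f => by
        ext
        simp [mul_left_comm] }

/-- Even supermatrices: even diagonal and odd off-diagonal blocks. -/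
def IsEvenSMat (X : SMat (SF N)) : Prop :=
  (∀ i j, IsEven (X (Sum.inl i) (Sum.inl j)) ∧ IsEven (X (Sum.inr i) (Sum.inr j))) ∧
  (∀ i j, IsOdd (X (Sum.inl i) (Sum.inr j)) ∧ IsOdd (X (Sum.inr i) (Sum.inl j)))

/-- A field `X = X^A t_A` in the grade `k` subspace of `psl(4|4)` whose components `X^A` are
commuting (even). -/
def IsBosonicOfGrade (k : ℕ) (X : SMat (SF N)) : Prop :=
  proj k X = X ∧ pr X = X ∧ ∀ i j, IsEven (X i j)

/-- The determinant of a `4 × 4` matrix with commuting (even) entries. -/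
def evenDet (X : Matrix (Fin 4) (Fin 4) (SF N)) : SF N :=
  ∑ σ : Equiv.Perm (Fin 4), ((Equiv.Perm.sign σ : ℤ)) •
    (X (σ 0) 0 * X (σ 1) 1 * X (σ 2) 2 * X (σ 3) 3)

/-- `g` represents a `PSU(2,2|4)`-valued field: it is an even supermatrix, unitary for the form
`𝓗`, and of Berezinian `1`, i.e. `det (A - B D⁻¹ C) = det D`. -/
def IsPSU (g : SMat (SF N)) : Prop :=
  IsEvenSMat g ∧
  (superTranspose g).map conj * hermForm.map (algebraMap ℂ (SF N)) * g =
    hermForm.map (algebraMap ℂ (SF N)) ∧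
  IsUnit g.toBlocks₂₂ ∧
  evenDet (g.toBlocks₁₁ - g.toBlocks₁₂ * Ring.inverse g.toBlocks₂₂ * g.toBlocks₂₁) =
    evenDet g.toBlocks₂₂

/-- Field configurations.  The matrix `g` is an invertible even supermatrix such that
`A = -dg g⁻¹` takes values in `sl(4|4)` (equivalently, its Berezinian is constant); `g` and its
multiples by even scalars represent the same element of the projective supergroup.  This contains
all `PSU(2,2|4)`-valued fields and is stable under variations along the complexification, as the
pure spinors are necessarily complex.  The pure spinor constraints `λγᵃλ = λ̂γᵃλ̂ = 0` say that the
anticommutators `{λ₁, λ₁}` and `{λ₃, λ₃}` vanish in `psl(4|4)`. -/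
structure IsConfig (Φ : Fields (SF N)) : Prop where
  g_even : IsEvenSMat Φ.g
  g_unit : IsUnit Φ.g
  g_plus : str (Φ.g.map dPlus * Ring.inverse Φ.g) = 0
  g_minus : str (Φ.g.map dMinus * Ring.inverse Φ.g) = 0
  w3_mem : IsBosonicOfGrade 3 Φ.w3
  w1_mem : IsBosonicOfGrade 1 Φ.w1
  l1_mem : IsBosonicOfGrade 1 Φ.l1
  l3_mem : IsBosonicOfGrade 3 Φ.l3
  l1_pure : pr (Φ.l1 * Φ.l1) = 0
  l3_pure : pr (Φ.l3 * Φ.l3) = 0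

/-- The fields have period `u`; `g` is periodic as a field valued in the projective supergroup. -/
def HasPeriod (u : ℝ × ℝ) (Φ : Fields (SF N)) : Prop :=
  (∃ z : SF N, IsEven z ∧ IsUnit z ∧ Φ.g.map (shift u) = z • Φ.g) ∧
  Φ.w3.map (shift u) = Φ.w3 ∧ Φ.w1.map (shift u) = Φ.w1 ∧
  Φ.l1.map (shift u) = Φ.l1 ∧ Φ.l3.map (shift u) = Φ.l3

/-- The deformed action on the closed world-sheet `ℝ² / (ℤu + ℤv)`. -/
def action (u v : ℝ × ℝ) (R : Module.End ℂ psl) (η : ℝ) (Φ : Fields (SF N)) :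
    ℂ ⊗[ℝ] Grassmann N :=
  TensorProduct.map (smoothIntegral u v) LinearMap.id (lagrangian dPlus dMinus R η Φ)

/-- `Φ` solves the equations of motion obtained by varying `ω_{1+}` and `ω_{3-}`.  The Lagrangian
is affine in each of them and contains none of their derivatives, so stationarity says that the
density does not change under arbitrary variations. -/
def GhostOnShell (R : Module.End ℂ psl) (η : ℝ) (Φ : Fields (SF N)) : Prop :=
  (∀ χ, IsBosonicOfGrade 1 χ → lagrangian dPlus dMinus R η { Φ with w1 := Φ.w1 + χ } =
    lagrangian dPlus dMinus R η Φ) ∧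
  (∀ χ, IsBosonicOfGrade 3 χ → lagrangian dPlus dMinus R η { Φ with w3 := Φ.w3 + χ } =
    lagrangian dPlus dMinus R η Φ)

/-- `Ψ` is an infinitesimal gauge transformation of `Φ`: a local Lorentz transformation with
parameter `M ∈ 𝔤₀` (up to a rescaling `c` of the representative `g`), combined with the gauge
transformations `δω_{3-} = [λ₁, S]`, `δω_{1+} = [λ₃, S']`, `S, S' ∈ 𝔤₂`, due to the pure spinor
constraints. -/
def IsGauge (Φ Ψ : Fields (SF N)) : Prop :=
  ∃ (M S S' : SMat (SF N)) (c : SF N), IsBosonicOfGrade 0 M ∧ IsBosonicOfGrade 2 S ∧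
    IsBosonicOfGrade 2 S' ∧ IsEven c ∧
    Ψ.g = M * Φ.g + c • Φ.g ∧
    Ψ.w3 = M * Φ.w3 - Φ.w3 * M + (Φ.l1 * S - S * Φ.l1) ∧
    Ψ.w1 = M * Φ.w1 - Φ.w1 * M + (Φ.l3 * S' - S' * Φ.l3) ∧
    Ψ.l1 = M * Φ.l1 - Φ.l1 * M ∧
    Ψ.l3 = M * Φ.l3 - Φ.l3 * M

/-- The BRST transformation `ε Q` acting on field configurations. -/
def Q (R : Module.End ℂ psl) (η : ℝ) (e : Grassmann N) (Φ : Fields (SF N)) : Fields (SF N) :=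
  brst dPlus dMinus R η (const e) Φ

/-- The square of the BRST operator, `ε'Q (εQ Φ)`: the variation of `εQ Φ` when `Φ` is varied by
`ε'Q Φ`; this is exact as `ε'² = 0`. -/
def QQ (R : Module.End ℂ psl) (η : ℝ) (e' e : Grassmann N) (Φ : Fields (SF N)) :
    Fields (SF N) :=
  Q R η e (Φ + Q R η e' Φ) - Q R η e Φ

end PureSpinorYB

end

/-!
# BRST symmetry of the Yang-Baxter deformed pure spinor superstring

All identities take place in the Grassmann envelope `Env 𝒪` of `psl(4|4)`: the even supermatrices
over a supercommutative ring `𝒪`, modulo the block traces.  It is an ordinary Lie algebra with an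
invariant symmetric form, the supertrace, and a `ℤ₄`-grading for which only opposite grades pair; in
particular `d_PS` and `d̂_PS` are transposes of each other.  The dressed operator `R_g` acts on it
as an antisymmetric solution of the classical Yang-Baxter equation.  A ghost enters the envelope
after multiplication with an odd parameter, and the pure spinor constraint says that it commutes
with its anticommutators.

*Invariance.*  The deformed currents are `K₋ = A₋ + η V₋` and `K₊ = A₊ - η V₊`, where
`V₋ = R_g (d_PS K₋ + 4 N₋)` and `V₊ = R_g (d̂_PS K₊ + 4 N₊)`; these are exactly the combinations
which occur in the transformations of the antighosts.  By `lagrangian_eq_sForm` the density is the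
undeformed one plus the pairing of `d̂_PS A₊ + 4 N₊` with `η V₋ / 4`.  Its first variation needs no
variation of the inverse operators (`IsInvariantForm.lagrangian_variation`), and for the BRST
variation what remains is an identity of the graded Lie algebra, which holds by the Yang-Baxter
equation and the pure spinor constraints (`IsInvariantForm.brst_variation`).  The parameters
generate an ideal with vanishing products, so that the variations are exact.  The operators
`𝒪_PS±` differ from their bodies by a nilpotent part; hence their invertibility depends on the body
of `g` only, and their inverses preserve ideals of coefficients
(`BodyData.isUnit_dressOp_of_body_eq`, `BodyData.mem_entriesIn_of_dressOp_mem`).  The divergence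
theorem on the period parallelogram yields the invariance of the action (`brst_invariance`).

*Nilpotency.*  On the equation of motion of `λ₃`, the BRST variation of the deformed current `K₋` is
the gauge variation `-[∂₋ + K₋, ελ₁ + ελ₃]`, without any dressed operator (`envCur_varied`); the
statement for `K₊` is the same one for the opposite grading.  The Jacobi identity rewrites the
iterated variations of the antighosts as a Lorentz transformation with parameter `εε' {λ₁, λ₃}`
and an antighost gauge transformation (`brst_square`, `brst_nilpotent`).

*Off-shell.*  At `g = 1` with vanishing antighosts, `λ₁ = u` constant and `λ₃ = σ⁻ v`, the iterated
variation of `ω_{3-}` is `εε' P₃ κ` up to a sign, where `𝒪_PS₋ κ = (1 + η R) v`.  The supports of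
`u` and `v` are disjoint, so that gauge transformations have no entry at the position of `v`.  The
corresponding entry of `P₃ κ` equals `1` at `η = 0`, and it vanishes only where one more operator of
the form `1 + η T` is singular, which happens finitely often (`finite_not_isUnit_one_add`,
`finite_nilpotent`).

*Expansion.*  Evaluation at a point of the world-sheet intertwines `R_g d_PS` with an operator on a
finite-dimensional space, whose Neumann series converges for small `η` (`exists_hasSum_inverse`,
`expansion`).

*Infinite series.*  For two commuting Cartan elements `h₁` and `h₂` the abelian operator
`X ↦ h₁ Str (h₂ X) - h₂ Str (h₁ X)` solves the Yang-Baxter equation.  The geodesic generated by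
`h = h₁ + h₂`, dressed by a constant fermionic direction `ψ`, has the current `h + θ [ψ, h]` up to a
sign, and this current is an eigenvector of `R_g d_PS` and of `R_g d̂_PS` with eigenvalue `8`
(`Rg_weightOp_geoK`).  All coefficients of the series are thus nonzero multiples of its odd
components, and these are not commutators with suitable constant ghosts
(`exists_nonterminating`).
-/

noncomputable section

namespace PureSpinorYB

/-! ### Entrywise description of the linear operations on supermatrices -/

/-- The sign `+1` on the indices of the first block and `-1` on those of the second one. -/
def sgn : Idx → ℂ := Sum.elim (fun _ => 1) (fun _ => -1)

@[simp] theorem sgn_inl (i : Fin 4) : sgn (Sum.inl i) = 1 := rfl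
@[simp] theorem sgn_inr (i : Fin 4) : sgn (Sum.inr i) = -1 := rfl

theorem sgn_mul_self (i : Idx) : sgn i * sgn i = 1 := by
  rcases i with i | i <;> simp

/-- The involution of the indices underlying the symplectic matrix. -/
def swp : Idx → Idx := Sum.map ![1, 0, 3, 2] ![1, 0, 3, 2]

/-- The signs of the nonzero entries of the symplectic matrix. -/
def kap : Idx → ℂ := Sum.elim ![-1, 1, -1, 1] ![-1, 1, -1, 1]

/-- The sign which appears in the supertranspose. -/
def tau : Idx → Idx → ℂ
  | Sum.inl _, Sum.inr _ => -1
  | _, _ => 1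

theorem swp_swp (i : Idx) : swp (swp i) = i := by
  rcases i with i | i <;> fin_cases i <;> rfl

theorem sgn_swp (i : Idx) : sgn (swp i) = sgn i := by
  rcases i with i | i <;> rfl

theorem kap_swp (i : Idx) : kap (swp i) = -kap i := by
  rcases i with i | i <;> fin_cases i <;> simp [kap, swp]

theorem kap_mul_self (i : Idx) : kap i * kap i = 1 := by
  rcases i with i | i <;> fin_cases i <;> simp [kap]

theorem tau_swp (i j : Idx) : tau (swp i) (swp j) = tau i j := by
  rcases i with i | i <;> rcases j with j | j <;> rfl

theorem tau_mul_tau (i j : Idx) : tau i j * tau j i = sgn i * sgn j := by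
  rcases i with i | i <;> rcases j with j | j <;> simp [tau, sgn]

/-- The involution `swp` as a permutation. -/
def swpEquiv : Equiv.Perm Idx := ⟨swp, swp, swp_swp, swp_swp⟩

theorem sum_swp {M : Type*} [AddCommMonoid M] (f : Idx → M) : ∑ i, f (swp i) = ∑ i, f i :=
  Equiv.sum_comp swpEquiv f

section Entry

variable {𝒪 : Type*} [Ring 𝒪] [Algebra ℂ 𝒪]

theorem str_eq_sum (X : SMat 𝒪) : str X = ∑ i, sgn i • X i i := by
  simp [str, Matrix.trace, Matrix.toBlocks₁₁, Matrix.toBlocks₂₂, sub_eq_add_neg]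

theorem pr_eq (X : SMat 𝒪) : pr X = X - Matrix.fromBlocks
    (((1 / 4 : ℂ) • X.toBlocks₁₁.trace) • (1 : Matrix (Fin 4) (Fin 4) 𝒪)) 0 0
    (((1 / 4 : ℂ) • X.toBlocks₂₂.trace) • (1 : Matrix (Fin 4) (Fin 4) 𝒪)) := rfl

theorem trace_pr (X : SMat 𝒪) :
    (pr X).toBlocks₁₁.trace = 0 ∧ (pr X).toBlocks₂₂.trace = 0 := by
  constructor <;>
  · simp only [pr_eq, Matrix.trace, Matrix.toBlocks₁₁, Matrix.toBlocks₂₂, Fin.sum_univ_four,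
      Matrix.diag_apply, Matrix.of_apply, Matrix.sub_apply, Matrix.fromBlocks_apply₁₁,
      Matrix.fromBlocks_apply₂₂, Matrix.smul_apply, Matrix.one_apply_eq, smul_eq_mul, mul_one]
    module

theorem pr_eq_self_iff (X : SMat 𝒪) :
    pr X = X ↔ X.toBlocks₁₁.trace = 0 ∧ X.toBlocks₂₂.trace = 0 := by
  constructor
  · intro h
    rw [← h]
    exact trace_pr X
  · rintro ⟨h1, h2⟩
    rw [pr_eq, h1, h2]
    simp

@[simp] theorem pr_pr (X : SMat 𝒪) : pr (pr X) = pr X := (pr_eq_self_iff _).2 (trace_pr X)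

/-- A supermatrix with vanishing supertrace differs from its projection by a multiple of the
identity. -/
theorem eq_pr_add_smul_one {X : SMat 𝒪} (h : str X = 0) :
    X = pr X + ((1 / 4 : ℂ) • X.toBlocks₁₁.trace) • (1 : SMat 𝒪) := by
  have h' : X.toBlocks₂₂.trace = X.toBlocks₁₁.trace := (sub_eq_zero.1 h).symm
  rw [pr_eq, h', ← Matrix.fromBlocks_one, Matrix.fromBlocks_smul]
  simp

theorem str_add (X Y : SMat 𝒪) : str (X + Y) = str X + str Y := by
  simp [str_eq_sum, Finset.sum_add_distrib]

theorem str_sub (X Y : SMat 𝒪) : str (X - Y) = str X - str Y := by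
  simp [str_eq_sum, smul_sub, Finset.sum_sub_distrib]

theorem str_zero : str (0 : SMat 𝒪) = 0 := by
  simp [str_eq_sum]

theorem str_sum {ι : Type*} (s : Finset ι) (f : ι → SMat 𝒪) :
    str (∑ p ∈ s, f p) = ∑ p ∈ s, str (f p) := by
  simp only [str_eq_sum, Matrix.sum_apply, Finset.smul_sum]
  exact Finset.sum_comm

theorem str_smul (c : ℂ) (X : SMat 𝒪) : str (c • X) = c • str X := by
  simp only [str_eq_sum, Matrix.smul_apply, Finset.smul_sum]
  exact Finset.sum_congr rfl fun i _ => smul_comm _ _ _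

theorem str_smul_left (x : 𝒪) (X : SMat 𝒪) : str (x • X) = x * str X := by
  simp only [str_eq_sum, Matrix.smul_apply, Finset.mul_sum, smul_eq_mul]
  exact Finset.sum_congr rfl fun i _ => (mul_smul_comm _ _ _).symm

theorem str_pr (X : SMat 𝒪) : str (pr X) = 0 := by
  rw [str, (trace_pr X).1, (trace_pr X).2, sub_zero]

/-- `pr X = X` when the diagonal of `X` vanishes. -/
theorem pr_eq_self_of_diag {X : SMat 𝒪} (h : ∀ i, X i i = 0) : pr X = X := by
  rw [pr_eq_self_iff]
  simp [Matrix.trace, Matrix.toBlocks₁₁, Matrix.toBlocks₂₂, h]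

theorem bigSymp_apply (i j : Idx) :
    bigSymp 𝒪 i j = if j = swp i then algebraMap ℂ 𝒪 (kap i) else 0 := by
  rcases i with i | i <;> rcases j with j | j
  · fin_cases i <;> fin_cases j <;> simp [bigSymp, symp, kap, swp]
  · simp [bigSymp, swp]
  · simp [bigSymp, swp]
  · fin_cases i <;> fin_cases j <;> simp [bigSymp, symp, kap, swp]

theorem superTranspose_apply (X : SMat 𝒪) (i j : Idx) : superTranspose X i j = tau i j • X j i := by
  rcases i with i | i <;> rcases j with j | j <;>
    simp [superTranspose, tau, Matrix.toBlocks₁₁, Matrix.toBlocks₂₂, Matrix.toBlocks₁₂,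
      Matrix.toBlocks₂₁]

theorem omega_apply (X : SMat 𝒪) (i j : Idx) :
    omega X i j = (-(kap i * kap j * tau i j)) • X (swp j) (swp i) := by
  have hj : ∀ k, (j = swp k ↔ k = swp j) := fun k =>
    ⟨fun h => by rw [h, swp_swp], fun h => by rw [h, swp_swp]⟩
  have : omega X i j = (bigSymp 𝒪 * superTranspose X * bigSymp 𝒪) i j := rfl
  rw [this]
  simp only [Matrix.mul_apply, bigSymp_apply, superTranspose_apply, ite_mul, zero_mul, mul_ite,
    mul_zero, Finset.sum_ite_eq', Finset.mem_univ, if_true, hj]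
  rw [kap_swp, tau_swp, map_neg, mul_neg, ← Algebra.commutes, ← Algebra.smul_def,
    ← Algebra.smul_def]
  simp only [smul_smul, ← neg_smul]
  congr 1
  ring

theorem omega_omega_apply (X : SMat 𝒪) (i j : Idx) :
    omega (omega X) i j = (sgn i * sgn j) • X i j := by
  rw [omega_apply, omega_apply, smul_smul, swp_swp, swp_swp, tau_swp, kap_swp, kap_swp,
    ← tau_mul_tau]
  congr 1
  linear_combination (tau i j * tau j i) * (kap j * kap j * kap_mul_self i + kap_mul_self j)

theorem omega_four (X : SMat 𝒪) : omega (omega (omega (omega X))) = X := by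
  ext i j
  rw [omega_omega_apply, omega_omega_apply, smul_smul]
  have : sgn i * sgn j * (sgn i * sgn j) = 1 := by
    linear_combination sgn i * sgn i * sgn_mul_self j + sgn_mul_self i
  rw [this, one_smul]

theorem pr_apply (X : SMat 𝒪) (i j : Idx) : pr X i j =
    X i j - if i = j then (1 / 8 : ℂ) • ∑ k, (1 + sgn i * sgn k) • X k k else 0 := by
  have h1 : (1 : ℂ) + 1 = 2 := by norm_num
  have h2 : (1 / 8 : ℂ) * 2 = 1 / 4 := by norm_num
  rcases i with i | i <;> rcases j with j | j
  · by_cases h : i = j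
    · simp [pr_eq, h, Matrix.trace, Matrix.toBlocks₁₁, h1, ← Finset.smul_sum, smul_smul]
      norm_num
    · simp [pr_eq, h, Matrix.one_apply_ne h]
  · simp [pr_eq]
  · simp [pr_eq]
  · by_cases h : i = j
    · simp [pr_eq, h, Matrix.trace, Matrix.toBlocks₂₂, h1, ← Finset.smul_sum, smul_smul]
      norm_num
    · simp [pr_eq, h, Matrix.one_apply_ne h]

theorem pr_smul_one (x : 𝒪) : pr (x • (1 : SMat 𝒪)) = 0 := by
  ext i j
  rw [pr_apply]
  by_cases h : i = j
  · subst h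
    rw [if_pos rfl]
    rcases i with i | i <;> simp [smul_smul, one_add_one_eq_two,
      ← Nat.cast_smul_eq_nsmul ℂ] <;> norm_num
  · simp [h]

theorem omega_apply_self (X : SMat 𝒪) (i : Idx) : omega X i i = -X (swp i) (swp i) := by
  rw [omega_apply, kap_mul_self]
  rcases i with i | i <;> simp [tau]

theorem pr_omega (X : SMat 𝒪) : pr (omega X) = omega (pr X) := by
  ext i j
  by_cases h : i = j
  · subst h
    rw [omega_apply_self, pr_apply, pr_apply, omega_apply_self, if_pos rfl, if_pos rfl, neg_sub',
      ← smul_neg, ← Finset.sum_neg_distrib, ← sum_swp]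
    congr 2
    refine Finset.sum_congr rfl fun k _ => ?_
    rw [omega_apply_self, swp_swp, sgn_swp, sgn_swp, smul_neg]
  · have h' : swp j ≠ swp i := fun h' => h (by rw [← swp_swp i, ← h', swp_swp])
    rw [omega_apply, pr_apply, pr_apply, if_neg h, if_neg h', sub_zero, sub_zero, omega_apply]

theorem str_pr_mul {X Y : SMat 𝒪} (hX : str X = 0) (hY : str Y = 0) :
    str (pr X * Y) = str (X * Y) := by
  conv_rhs => rw [eq_pr_add_smul_one hX]
  rw [add_mul, smul_mul_assoc, one_mul, str_add, str_smul_left, hY, mul_zero, add_zero]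

/-- The supertrace form is invariant under `Ω`. -/
theorem str_omega_mul_omega (X Y : SMat 𝒪) : str (omega X * omega Y) = str (X * Y) := by
  simp only [str_eq_sum, Matrix.mul_apply, Finset.smul_sum]
  rw [Finset.sum_comm, ← sum_swp]
  refine Finset.sum_congr rfl fun i _ => ?_
  rw [← sum_swp]
  refine Finset.sum_congr rfl fun k _ => ?_
  rw [omega_apply, omega_apply, swp_swp, swp_swp, smul_mul_smul_comm, smul_smul, sgn_swp, kap_swp,
    kap_swp, tau_swp, tau_swp]
  congr 1
  linear_combination (sgn k * (kap i * kap i) * (kap k * kap k)) * tau_mul_tau k i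
    + sgn i * (kap i * kap i) * (kap k * kap k) * sgn_mul_self k
    + sgn i * (kap k * kap k) * kap_mul_self i + sgn i * kap_mul_self k

theorem proj_apply (k : ℕ) (X : SMat 𝒪) : proj k X = (1 / 4 : ℂ) •
    (X + (-Complex.I) ^ k • omega X + (-1 : ℂ) ^ k • omega (omega X)
      + Complex.I ^ k • omega (omega (omega X))) := by
  have h2 : (-Complex.I) ^ (2 * k) = (-1 : ℂ) ^ k := by rw [pow_mul]; simp
  have h3 : (-Complex.I) ^ (3 * k) = Complex.I ^ k := by
    rw [pow_mul]
    congr 1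
    linear_combination (-Complex.I) * Complex.I_sq
  simp [proj, Finset.sum_range_succ, h2, h3, pow_succ]

theorem omega_proj (k : ℕ) (X : SMat 𝒪) : omega (proj k X) = Complex.I ^ k • proj k X := by
  have h1 : Complex.I ^ k * (-Complex.I) ^ k = 1 := by rw [← mul_pow]; simp
  have h2 : Complex.I ^ k * Complex.I ^ k = (-1 : ℂ) ^ k := by rw [← mul_pow]; simp
  have h3 : Complex.I ^ k * (-1) ^ k = (-Complex.I) ^ k := by rw [← mul_pow]; simp
  simp only [proj_apply, map_smul, map_add, omega_four, smul_add, smul_smul]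
  match_scalars
  all_goals first
    | linear_combination -(1 / 4 : ℂ) * h1
    | linear_combination -(1 / 4 : ℂ) * h2
    | linear_combination -(1 / 4 : ℂ) * h3

theorem proj_eq_self_iff {k : ℕ} {X : SMat 𝒪} : proj k X = X ↔ omega X = Complex.I ^ k • X := by
  constructor
  · intro h
    rw [← h, omega_proj]
  · intro h
    have h1 : (-Complex.I) ^ k * Complex.I ^ k = 1 := by rw [← mul_pow]; simp
    have h2 : (-1 : ℂ) ^ k * (Complex.I ^ k * Complex.I ^ k) = 1 := by
      rw [← mul_pow, ← mul_pow]; simp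
    have h3 : Complex.I ^ k * (Complex.I ^ k * (Complex.I ^ k * Complex.I ^ k)) = 1 := by
      rw [← mul_pow, ← mul_pow, ← mul_pow]; simp
    simp only [proj_apply, h, map_smul, smul_smul]
    rw [h1, mul_assoc, h2, h3]
    module

/-- Elements of different grades are annihilated by the projectors of each other. -/
theorem proj_eq_zero {j k : ℕ} {X : SMat 𝒪} (h : omega X = Complex.I ^ k • X)
    (hjk : Complex.I ^ j ≠ Complex.I ^ k) : proj j X = 0 := by
  have h1 := omega_proj j X
  have h2 : omega (proj j X) = Complex.I ^ k • proj j X := by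
    simp only [proj_apply, h, map_smul, map_add, smul_add, smul_smul]
    match_scalars
    all_goals ring
  rw [h1, ← sub_eq_zero, ← sub_smul] at h2
  exact (smul_eq_zero.1 h2).resolve_left (sub_ne_zero.2 hjk)

theorem sum_proj (X : SMat 𝒪) : proj 0 X + proj 1 X + proj 2 X + proj 3 X = X := by
  simp only [proj_apply, pow_zero, pow_succ, one_mul, neg_mul, mul_neg, Complex.I_mul_I]
  module

theorem pr_proj (k : ℕ) (X : SMat 𝒪) : pr (proj k X) = proj k (pr X) := by
  simp only [proj_apply, map_smul, map_add, pr_omega]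

/-- The components of odd grade are exactly those with vanishing diagonal blocks. -/
theorem apply_eq_zero_of_odd_grade {X : SMat 𝒪} (h : omega (omega X) = -X) {i j : Idx}
    (hij : sgn i = sgn j) : X i j = 0 := by
  have h1 := omega_omega_apply X i j
  rw [h, hij, sgn_mul_self, one_smul, Matrix.neg_apply, neg_eq_iff_add_eq_zero, ← two_smul ℂ] at h1
  exact (smul_eq_zero.1 h1).resolve_left two_ne_zero

theorem apply_eq_zero_of_even_grade {X : SMat 𝒪} (h : omega (omega X) = X) {i j : Idx}
    (hij : sgn i = -sgn j) : X i j = 0 := by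
  have h1 := omega_omega_apply X i j
  rw [h, hij, neg_mul, sgn_mul_self, neg_smul, one_smul, eq_neg_iff_add_eq_zero, ← two_smul ℂ] at h1
  exact (smul_eq_zero.1 h1).resolve_left two_ne_zero

theorem extend_apply (R : Module.End ℂ psl) (X : SMat 𝒪) (k l : Idx) :
    extend R X k l = ∑ i, ∑ j, ((R (toPsl (Matrix.single i j 1))).1 k l) • X i j := rfl

theorem pr_extend (R : Module.End ℂ psl) (X : SMat 𝒪) : pr (extend R X) = extend R X := by
  have key : ∀ (Z : psl), (∑ k : Fin 4, Z.1 (Sum.inl k) (Sum.inl k) = 0) ∧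
      (∑ k : Fin 4, Z.1 (Sum.inr k) (Sum.inr k) = 0) := fun Z => Z.2
  rw [pr_eq_self_iff]
  constructor
  · simp only [Matrix.trace, Matrix.diag_apply, Matrix.toBlocks₁₁, Matrix.of_apply, extend_apply]
    rw [Finset.sum_comm]
    refine Finset.sum_eq_zero fun i _ => ?_
    rw [Finset.sum_comm]
    refine Finset.sum_eq_zero fun j _ => ?_
    rw [← Finset.sum_smul, (key _).1, zero_smul]
  · simp only [Matrix.trace, Matrix.diag_apply, Matrix.toBlocks₂₂, Matrix.of_apply, extend_apply]
    rw [Finset.sum_comm]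
    refine Finset.sum_eq_zero fun i _ => ?_
    rw [Finset.sum_comm]
    refine Finset.sum_eq_zero fun j _ => ?_
    rw [← Finset.sum_smul, (key _).2, zero_smul]

theorem pr_adj (g X : SMat 𝒪) : pr (adj g X) = adj g X := pr_pr _

theorem adj_apply (g X : SMat 𝒪) : adj g X = pr (g * X * Ring.inverse g) := rfl

theorem adjInv_apply (g X : SMat 𝒪) : adjInv g X = pr (Ring.inverse g * X * g) := rfl

theorem Rg_apply (R : Module.End ℂ psl) (g X : SMat 𝒪) :
    Rg R g X = adj g (extend R (adjInv g X)) := rfl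

theorem pr_Rg (R : Module.End ℂ psl) (g X : SMat 𝒪) : pr (Rg R g X) = Rg R g X := pr_adj _ _

theorem opMinus_apply (R : Module.End ℂ psl) (η : ℝ) (g X : SMat 𝒪) :
    opMinus R η g X = X - (η : ℂ) • Rg R g (dPS X) := rfl

/-! ### Maps of the coefficients -/

section Map

variable {𝒪' : Type*} [Ring 𝒪'] [Algebra ℂ 𝒪'] (D : 𝒪 →ₗ[ℂ] 𝒪')

theorem str_map (X : SMat 𝒪) : str (X.map D) = D (str X) := by
  simp [str_eq_sum]

theorem pr_map (X : SMat 𝒪) : pr (X.map D) = (pr X).map D := by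
  ext i j
  simp only [pr_apply, Matrix.map_apply, map_sub]
  split_ifs <;> simp

theorem omega_map (X : SMat 𝒪) : omega (X.map D) = (omega X).map D := by
  ext i j
  simp only [omega_apply, Matrix.map_apply, map_smul]

theorem proj_map (k : ℕ) (X : SMat 𝒪) : proj k (X.map D) = (proj k X).map D := by
  ext i j
  simp [proj_apply, omega_map]

theorem extend_map (R : Module.End ℂ psl) (X : SMat 𝒪) :
    extend R (X.map D) = (extend R X).map D := by
  ext i j
  simp [extend_apply]

end Map

/-! ### Operations with all entries in a given subspace -/

/-- Supermatrices with all entries in the subspace `F`. -/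
def entriesIn (F : Submodule ℂ 𝒪) : Submodule ℂ (SMat 𝒪) where
  carrier := {X | ∀ i j, X i j ∈ F}
  add_mem' hX hY i j := F.add_mem (hX i j) (hY i j)
  zero_mem' _ _ := F.zero_mem
  smul_mem' c _ hX i j := F.smul_mem c (hX i j)

variable {F : Submodule ℂ 𝒪} {X : SMat 𝒪}

theorem pr_mem_entriesIn (h : X ∈ entriesIn F) : pr X ∈ entriesIn F := by
  intro i j
  rw [pr_apply]
  refine F.sub_mem (h i j) ?_
  split_ifs
  · exact F.smul_mem _ (F.sum_mem fun k _ => F.smul_mem _ (h k k))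
  · exact F.zero_mem

theorem omega_mem_entriesIn (h : X ∈ entriesIn F) : omega X ∈ entriesIn F := by
  intro i j
  rw [omega_apply]
  exact F.smul_mem _ (h _ _)

theorem proj_mem_entriesIn (k : ℕ) (h : X ∈ entriesIn F) : proj k X ∈ entriesIn F := by
  have h1 := omega_mem_entriesIn h
  have h2 := omega_mem_entriesIn h1
  have h3 := omega_mem_entriesIn h2
  rw [proj_apply]
  exact Submodule.smul_mem _ _ (Submodule.add_mem _ (Submodule.add_mem _ (Submodule.add_mem _ h
    (Submodule.smul_mem _ _ h1)) (Submodule.smul_mem _ _ h2)) (Submodule.smul_mem _ _ h3))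

theorem extend_mem_entriesIn (R : Module.End ℂ psl) (h : X ∈ entriesIn F) :
    extend R X ∈ entriesIn F := by
  intro k l
  rw [extend_apply]
  exact F.sum_mem fun i _ => F.sum_mem fun j _ => F.smul_mem _ (h i j)

end Entry

/-! ### Supercommutative rings and even supermatrices -/

/-- A supercommutative `ℂ`-algebra, with its parity automorphism. -/
class SuperRing (𝒪 : Type*) [Ring 𝒪] [Algebra ℂ 𝒪] where
  /-- The parity automorphism, `+1` on even and `-1` on odd elements. -/
  par : 𝒪 →ₐ[ℂ] 𝒪
  par_par : ∀ x, par (par x) = x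
  mul_comm_of_even : ∀ x, par x = x → ∀ y, x * y = y * x
  mul_anticomm_of_odd : ∀ x y, par x = -x → par y = -y → x * y = -(y * x)

open SuperRing

section Super

variable {𝒪 : Type*} [Ring 𝒪] [Algebra ℂ 𝒪] [SuperRing 𝒪]

theorem mul_comm_of_parity {s : ℂ} (hs : s = 1 ∨ s = -1) {x y : 𝒪} (hx : par x = s • x)
    (hy : par y = s • y) : x * y = s • (y * x) := by
  rcases hs with rfl | rfl
  · rw [one_smul] at *
    exact mul_comm_of_even x hx y
  · rw [neg_one_smul] at *
    exact mul_anticomm_of_odd x y hx hy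

theorem mul_comm_of_parities {s t : ℂ} (hs : s = 1 ∨ s = -1) (ht : t = 1 ∨ t = -1) {x y : 𝒪}
    (hx : par x = s • x) (hy : par y = t • y) :
    x * y = ((1 + s + t - s * t) / 2) • (y * x) := by
  rcases hs with rfl | rfl
  · rw [one_smul] at hx
    rw [mul_comm_of_even x hx]
    ring_nf
    rw [one_smul]
  · rcases ht with rfl | rfl
    · rw [one_smul] at hy
      rw [← mul_comm_of_even y hy]
      ring_nf
      rw [one_smul]
    · rw [neg_one_smul] at hx hy
      rw [mul_anticomm_of_odd x y hx hy]
      ring_nf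
      rw [neg_one_smul]

theorem sgn_mul_eq_or (i j : Idx) : sgn i * sgn j = 1 ∨ sgn i * sgn j = -1 := by
  rcases i with i | i <;> rcases j with j | j <;> simp

/-- The parity automorphism of supermatrices; its fixed points are the even supermatrices. -/
def sPar : SMat 𝒪 →ₐ[ℂ] SMat 𝒪 :=
  AlgHom.ofLinearMap
    { toFun := fun X => Matrix.of fun i j => (sgn i * sgn j) • par (X i j)
      map_add' := fun X Y => by ext i j; simp
      map_smul' := fun c X => by
        ext i j
        simp [smul_comm c] }
    (by
      ext i j
      by_cases h : i = j
      · subst h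
        simp [sgn_mul_self]
      · simp [h])
    (by
      intro X Y
      ext i j
      change (sgn i * sgn j) • par (∑ k, X i k * Y k j) =
        ∑ k, ((sgn i * sgn k) • par (X i k)) * ((sgn k * sgn j) • par (Y k j))
      rw [map_sum, Finset.smul_sum]
      refine Finset.sum_congr rfl fun k _ => ?_
      rw [map_mul, smul_mul_smul_comm]
      congr 1
      linear_combination -(sgn i * sgn j) * sgn_mul_self k)

theorem sPar_apply (X : SMat 𝒪) (i j : Idx) :
    sPar X i j = (sgn i * sgn j) • par (X i j) := rfl

theorem sPar_eq_self_iff {X : SMat 𝒪} :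
    sPar X = X ↔ ∀ i j, par (X i j) = (sgn i * sgn j) • X i j := by
  have key : ∀ i j, (sgn i * sgn j) * (sgn i * sgn j) = 1 := fun i j => by
    linear_combination sgn i * sgn i * sgn_mul_self j + sgn_mul_self i
  constructor
  · intro h i j
    conv_rhs => rw [← h]
    rw [sPar_apply, smul_smul, key, one_smul]
  · intro h
    ext i j
    rw [sPar_apply, h, smul_smul, key, one_smul]

theorem sPar_pr (X : SMat 𝒪) : sPar (pr X) = pr (sPar X) := by
  ext i j
  rw [sPar_apply, pr_apply, pr_apply, map_sub, smul_sub, sPar_apply]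
  congr 1
  split_ifs with h
  · subst h
    simp only [sgn_mul_self, one_smul, map_smul, map_sum, sPar_apply]
  · simp

theorem sPar_omega (X : SMat 𝒪) : sPar (omega X) = omega (sPar X) := by
  ext i j
  rw [sPar_apply, omega_apply, omega_apply, map_smul, sPar_apply, smul_comm, sgn_swp, sgn_swp,
    mul_comm (sgn i)]

theorem sPar_proj (k : ℕ) (X : SMat 𝒪) : sPar (proj k X) = proj k (sPar X) := by
  simp only [proj_apply, map_smul, map_add, sPar_omega]

theorem sPar_inverse {g : SMat 𝒪} (h : sPar g = g) :
    sPar (Ring.inverse g) = Ring.inverse g := by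
  by_cases hg : IsUnit g
  · have h1 : g * sPar (Ring.inverse g) = 1 := by
      conv_lhs => rw [← h]
      rw [h, ← h, ← map_mul, h, Ring.mul_inverse_cancel g hg, map_one]
    calc sPar (Ring.inverse g) = Ring.inverse g * (g * sPar (Ring.inverse g)) := by
          rw [← mul_assoc, Ring.inverse_mul_cancel g hg, one_mul]
      _ = Ring.inverse g := by rw [h1, mul_one]
  · rw [Ring.inverse_non_unit g hg, map_zero]

/-- The supertrace is cyclic on even supermatrices. -/
theorem str_mul_comm {X Y : SMat 𝒪} (hX : sPar X = X) (hY : sPar Y = Y) :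
    str (X * Y) = str (Y * X) := by
  rw [sPar_eq_self_iff] at hX hY
  simp only [str_eq_sum, Matrix.mul_apply, Finset.smul_sum]
  rw [Finset.sum_comm]
  refine Finset.sum_congr rfl fun j _ => Finset.sum_congr rfl fun i _ => ?_
  rw [mul_comm_of_parity (sgn_mul_eq_or i j) (hX i j) (by rw [hY, mul_comm]), smul_smul]
  congr 1
  linear_combination sgn j * sgn_mul_self i

theorem str_commutator {X Y : SMat 𝒪} (hX : sPar X = X) (hY : sPar Y = Y) :
    str (X * Y - Y * X) = 0 := by
  rw [str_sub, str_mul_comm hX hY, sub_self]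

theorem par_block_trace {X : SMat 𝒪} (hX : sPar X = X) :
    par ((1 / 4 : ℂ) • X.toBlocks₁₁.trace) = (1 / 4 : ℂ) • X.toBlocks₁₁.trace := by
  rw [sPar_eq_self_iff] at hX
  simp [Matrix.trace, Matrix.toBlocks₁₁, hX]

theorem smul_mul_of_even {x : 𝒪} (hx : par x = x) (X Y : SMat 𝒪) :
    X * (x • Y) = x • (X * Y) := by
  ext i j
  simp only [Matrix.mul_apply, Matrix.smul_apply, smul_eq_mul, Finset.mul_sum]
  refine Finset.sum_congr rfl fun k _ => ?_
  rw [← mul_assoc, ← mul_comm_of_even x hx, mul_assoc]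

/-- An even supermatrix with vanishing supertrace differs from its projection by an even multiple
of the identity. -/
theorem exists_eq_pr_add {X : SMat 𝒪} (hX : sPar X = X) (h : str X = 0) :
    ∃ c : 𝒪, par c = c ∧ X = pr X + c • (1 : SMat 𝒪) :=
  ⟨_, par_block_trace hX, eq_pr_add_smul_one h⟩

theorem pr_commutator_pr_right {X Y : SMat 𝒪} (hY : sPar Y = Y) (h : str Y = 0) :
    pr (X * pr Y - pr Y * X) = pr (X * Y - Y * X) := by
  obtain ⟨c, hc, hY'⟩ := exists_eq_pr_add hY h
  conv_rhs => rw [hY']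
  rw [mul_add, add_mul, smul_mul_of_even hc, mul_one, smul_mul_assoc, one_mul,
    add_sub_add_right_eq_sub]

theorem pr_commutator_pr_left {X Y : SMat 𝒪} (hX : sPar X = X) (h : str X = 0) :
    pr (pr X * Y - Y * pr X) = pr (X * Y - Y * X) := by
  rw [← neg_sub (Y * pr X), map_neg, pr_commutator_pr_right hX h, ← map_neg, neg_sub]

theorem str_mul_pr {X Y : SMat 𝒪} (hY' : sPar Y = Y) (hX : str X = 0)
    (hY : str Y = 0) : str (X * pr Y) = str (X * Y) := by
  obtain ⟨c, hc, h⟩ := exists_eq_pr_add hY' hY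
  conv_rhs => rw [h]
  rw [mul_add, smul_mul_of_even hc, mul_one, str_add, str_smul_left, hX, mul_zero, add_zero]

/-- The automorphism `Ω` reverses products of even supermatrices, up to a sign. -/
theorem omega_mul {X Y : SMat 𝒪} (hX : sPar X = X) (hY : sPar Y = Y) :
    omega (X * Y) = -(omega Y * omega X) := by
  rw [sPar_eq_self_iff] at hX hY
  ext i j
  rw [omega_apply, Matrix.neg_apply, Matrix.mul_apply, Matrix.mul_apply, Finset.smul_sum,
    ← Finset.sum_neg_distrib, ← sum_swp]
  refine Finset.sum_congr rfl fun k _ => ?_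
  rw [omega_apply, omega_apply, smul_mul_smul_comm]
  have h1 := hX (swp j) (swp k)
  have h2 := hY (swp k) (swp i)
  simp only [sgn_swp] at h1 h2
  rw [mul_comm_of_parities (sgn_mul_eq_or j k) (sgn_mul_eq_or k i) h1 h2, smul_smul, ← neg_smul]
  congr 1
  have h3 := kap_mul_self k
  have h4 : tau i k * tau k j = tau i j * ((1 + sgn j * sgn k + sgn k * sgn i
      - sgn j * sgn k * (sgn k * sgn i)) / 2) := by
    rcases i with i | i <;> rcases j with j | j <;> rcases k with k | k <;> norm_num [tau, sgn]
  linear_combination (kap i * kap j * tau i k * tau k j) * h3 + (kap i * kap j) * h4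

end Super

/-! ### Complex supermatrices with coefficients -/

section Complex

variable {𝒪 : Type*} [Ring 𝒪] [Algebra ℂ 𝒪]

variable (𝒪) in
/-- A complex supermatrix as a supermatrix over `𝒪`. -/
def ofComplex (Z : SMat ℂ) : SMat 𝒪 := Z.map (Algebra.linearMap ℂ 𝒪)

theorem ofComplex_apply (Z : SMat ℂ) (i j : Idx) :
    ofComplex 𝒪 Z i j = algebraMap ℂ 𝒪 (Z i j) := rfl

theorem smul_ofComplex_apply (x : 𝒪) (Z : SMat ℂ) (i j : Idx) :
    (x • ofComplex 𝒪 Z) i j = Z i j • x := by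
  rw [Matrix.smul_apply, ofComplex_apply, smul_eq_mul, ← Algebra.commutes, Algebra.smul_def]

theorem smul_ofComplex_mul (x y : 𝒪) (Z W : SMat ℂ) :
    (x • ofComplex 𝒪 Z) * (y • ofComplex 𝒪 W) = (x * y) • ofComplex 𝒪 (Z * W) := by
  ext i j
  simp only [Matrix.mul_apply, smul_ofComplex_apply, smul_mul_smul_comm, Finset.sum_smul]

theorem pr_smul_ofComplex (x : 𝒪) (Z : SMat ℂ) :
    pr (x • ofComplex 𝒪 Z) = x • ofComplex 𝒪 (toPsl Z).1 := by
  ext i j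
  have : (toPsl Z).1 = pr Z := rfl
  rw [pr_apply, smul_ofComplex_apply, smul_ofComplex_apply, this, pr_apply]
  split_ifs
  · simp only [smul_ofComplex_apply, sub_smul, smul_smul, ← Finset.sum_smul, smul_eq_mul]
  · simp

theorem extend_smul_left (R : Module.End ℂ psl) (x : 𝒪) (X : SMat 𝒪) :
    extend R (x • X) = x • extend R X := by
  ext i j
  simp only [extend_apply, Matrix.smul_apply, Finset.smul_sum]
  exact Finset.sum_congr rfl fun _ _ => Finset.sum_congr rfl fun _ _ => smul_comm _ _ _

theorem extend_ofComplex (R : Module.End ℂ psl) (Z : SMat ℂ) :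
    extend R (ofComplex 𝒪 Z) = ofComplex 𝒪 (R (toPsl Z)).1 := by
  have h1 : Z = ∑ i, ∑ j, Z i j • Matrix.single i j (1 : ℂ) := by
    conv_lhs => rw [Matrix.matrix_eq_sum_single Z]
    simp
  ext k l
  rw [extend_apply, ofComplex_apply]
  conv_rhs => rw [h1]
  simp only [map_sum, map_smul, Submodule.coe_sum, Submodule.coe_smul, Matrix.sum_apply,
    Matrix.smul_apply, ofComplex_apply, smul_eq_mul, map_mul]
  refine Finset.sum_congr rfl fun _ _ => Finset.sum_congr rfl fun _ _ => ?_
  rw [Algebra.smul_def, ← map_mul, ← map_mul, mul_comm]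

/-- The class in `psl(4|4)` of an elementary matrix. -/
def unitPsl (p : Idx × Idx) : psl := toPsl (Matrix.single p.1 p.2 1)

theorem eq_sum_unitPsl {X : SMat 𝒪} (h : pr X = X) :
    X = ∑ p : Idx × Idx, X p.1 p.2 • ofComplex 𝒪 (unitPsl p).1 := by
  have h1 : X = ∑ p : Idx × Idx, X p.1 p.2 • ofComplex 𝒪 (Matrix.single p.1 p.2 1) := by
    conv_lhs => rw [Matrix.matrix_eq_sum_single X]
    rw [Fintype.sum_prod_type]
    refine Finset.sum_congr rfl fun i _ => Finset.sum_congr rfl fun j _ => ?_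
    ext k l
    rw [smul_ofComplex_apply, Matrix.single_apply, Matrix.single_apply]
    split_ifs <;> simp
  conv_lhs => rw [← h, h1, map_sum]
  exact Finset.sum_congr rfl fun p _ => pr_smul_ofComplex _ _

theorem toPsl_coe (Z : psl) : toPsl Z.1 = Z := Subtype.ext ((pr_eq_self_iff Z.1).2 Z.2)

theorem extend_smul_ofComplex (R : Module.End ℂ psl) (x : 𝒪) (Z : psl) :
    extend R (x • ofComplex 𝒪 Z.1) = x • ofComplex 𝒪 (R Z).1 := by
  rw [extend_smul_left, extend_ofComplex, toPsl_coe]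

theorem extend_add_smul_ofComplex (R : Module.End ℂ psl) (x : 𝒪) (Z W : psl) :
    extend R (x • ofComplex 𝒪 Z.1 + x • ofComplex 𝒪 W.1) = x • ofComplex 𝒪 (R (Z + W)).1 := by
  rw [map_add, extend_smul_ofComplex, extend_smul_ofComplex, map_add, Submodule.coe_add]
  ext i j
  simp only [Matrix.add_apply, smul_ofComplex_apply, add_smul]

theorem extend_eq_sum (R : Module.End ℂ psl) {X : SMat 𝒪} (h : pr X = X) :
    extend R X = ∑ p : Idx × Idx, X p.1 p.2 • ofComplex 𝒪 (R (unitPsl p)).1 := by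
  conv_lhs => rw [eq_sum_unitPsl h, map_sum]
  refine Finset.sum_congr rfl fun p _ => ?_
  rw [extend_smul_ofComplex]

end Complex

/-! ### The Grassmann envelope of `psl(4|4)` as a Lie algebra with an invariant form -/

section Env

open SuperRing

variable (𝒪 : Type*) [Ring 𝒪] [Algebra ℂ 𝒪] [SuperRing 𝒪]

/-- The Grassmann envelope of `psl(4|4)`: even supermatrices whose two block traces vanish. -/
def envelope : Submodule ℂ (SMat 𝒪) where
  carrier := {X | sPar X = X ∧ pr X = X}
  add_mem' hX hY := ⟨by rw [map_add, hX.1, hY.1], by rw [map_add, hX.2, hY.2]⟩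
  zero_mem' := ⟨map_zero _, map_zero _⟩
  smul_mem' c X hX := ⟨by rw [map_smul, hX.1], by rw [map_smul, hX.2]⟩

/-- The Grassmann envelope as a type. -/
abbrev Env := ↥(envelope 𝒪)

variable {𝒪}

theorem Env.even (X : Env 𝒪) : sPar X.1 = X.1 := X.2.1

theorem Env.pr_eq (X : Env 𝒪) : pr X.1 = X.1 := X.2.2

theorem Env.str_eq (X : Env 𝒪) : str X.1 = 0 := by rw [← X.pr_eq, str_pr]

/-- The class of an even supermatrix in the envelope. -/
def toEnv (X : SMat 𝒪) (h : sPar X = X) : Env 𝒪 := ⟨pr X, by rw [sPar_pr, h], pr_pr X⟩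

theorem sPar_commutator {X Y : SMat 𝒪} (hX : sPar X = X) (hY : sPar Y = Y) :
    sPar (X * Y - Y * X) = X * Y - Y * X := by
  rw [map_sub, map_mul, map_mul, hX, hY]

instance : Bracket (Env 𝒪) (Env 𝒪) :=
  ⟨fun X Y => toEnv (X.1 * Y.1 - Y.1 * X.1) (sPar_commutator X.even Y.even)⟩

theorem Env.coe_lie (X Y : Env 𝒪) : (⁅X, Y⁆ : Env 𝒪).1 = pr (X.1 * Y.1 - Y.1 * X.1) := rfl

instance : LieRing (Env 𝒪) where
  add_lie X Y Z := by
    apply Subtype.ext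
    change pr ((X.1 + Y.1) * Z.1 - Z.1 * (X.1 + Y.1)) = pr _ + pr _
    rw [← map_add]
    congr 1
    noncomm_ring
  lie_add X Y Z := by
    apply Subtype.ext
    change pr (X.1 * (Y.1 + Z.1) - (Y.1 + Z.1) * X.1) = pr _ + pr _
    rw [← map_add]
    congr 1
    noncomm_ring
  lie_self X := by
    apply Subtype.ext
    rw [Env.coe_lie, sub_self, map_zero]
    rfl
  leibniz_lie X Y Z := by
    apply Subtype.ext
    change pr (X.1 * pr _ - pr _ * X.1) = pr (pr _ * Z.1 - Z.1 * pr _) + pr (Y.1 * pr _ - pr _ * Y.1)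
    rw [pr_commutator_pr_right (sPar_commutator Y.even Z.even) (str_commutator Y.even Z.even),
      pr_commutator_pr_left (sPar_commutator X.even Y.even) (str_commutator X.even Y.even),
      pr_commutator_pr_right (sPar_commutator X.even Z.even) (str_commutator X.even Z.even),
      ← map_add]
    congr 1
    noncomm_ring

instance : LieAlgebra ℂ (Env 𝒪) where
  lie_smul c X Y := by
    apply Subtype.ext
    change pr (X.1 * (c • Y.1) - (c • Y.1) * X.1) = c • pr _
    rw [← map_smul, smul_sub, mul_smul_comm, smul_mul_assoc]

/-- The supertrace form on the envelope. -/
def sForm : Env 𝒪 →ₗ[ℂ] Env 𝒪 →ₗ[ℂ] 𝒪 :=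
  LinearMap.mk₂ ℂ (fun X Y => str (X.1 * Y.1))
    (fun X Y Z => by rw [← str_add, ← add_mul]; rfl)
    (fun c X Y => by rw [← str_smul, ← smul_mul_assoc]; rfl)
    (fun X Y Z => by rw [← str_add, ← mul_add]; rfl)
    (fun c X Y => by rw [← str_smul, ← mul_smul_comm]; rfl)

theorem sForm_apply (X Y : Env 𝒪) : sForm X Y = str (X.1 * Y.1) := rfl

theorem sForm_comm (X Y : Env 𝒪) : sForm X Y = sForm Y X := str_mul_comm X.even Y.even

theorem sForm_lie (X Y Z : Env 𝒪) : sForm ⁅X, Y⁆ Z = sForm X ⁅Y, Z⁆ := by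
  rw [sForm_apply, sForm_apply, Env.coe_lie, Env.coe_lie,
    str_pr_mul (str_commutator X.even Y.even) Z.str_eq,
    str_mul_pr (sPar_commutator Y.even Z.even) X.str_eq (str_commutator Y.even Z.even),
    sub_mul, mul_sub, str_sub, str_sub, mul_assoc, mul_assoc]
  congr 1
  rw [str_mul_comm Y.even (by rw [map_mul, X.even, Z.even]), mul_assoc]

/-- The automorphism `Ω` of the envelope. -/
def envOmega : Module.End ℂ (Env 𝒪) :=
  omega.restrict fun X hX => ⟨by rw [sPar_omega, hX.1], by rw [pr_omega, hX.2]⟩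

theorem coe_envOmega (X : Env 𝒪) : (envOmega X).1 = omega X.1 := rfl

theorem envOmega_lie (X Y : Env 𝒪) : envOmega ⁅X, Y⁆ = ⁅envOmega X, envOmega Y⁆ := by
  apply Subtype.ext
  rw [coe_envOmega, Env.coe_lie, Env.coe_lie, ← pr_omega, map_sub, omega_mul X.even Y.even,
    omega_mul Y.even X.even, coe_envOmega, coe_envOmega]
  congr 1
  abel

theorem sForm_envOmega (X Y : Env 𝒪) : sForm (envOmega X) (envOmega Y) = sForm X Y :=
  str_omega_mul_omega X.1 Y.1

/-- The projectors on the graded components of the envelope. -/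
def envProj (k : ℕ) : Module.End ℂ (Env 𝒪) :=
  (proj k).restrict fun X hX => ⟨by rw [sPar_proj, hX.1], by rw [pr_proj, hX.2]⟩

/-! ### The extension of an `R`-matrix to the envelope -/

section Extend

/-- Homogeneity of a complex supermatrix: `s = 1` for the even and `s = -1` for the odd ones. -/
def IsHomog (s : ℂ) (Z : SMat ℂ) : Prop := ∀ i j, (sgn i * sgn j) • Z i j = s • Z i j

theorem gam_mul_mul_gam_apply (Z : SMat ℂ) (i j : Idx) :
    (gam * Z * gam) i j = (sgn i * sgn j) * Z i j := by
  have : gam = Matrix.diagonal sgn := by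
    ext (i | i) (j | j) <;> simp [gam, Matrix.diagonal_apply, Matrix.one_apply]
    split_ifs <;> simp
  rw [this, Matrix.mul_diagonal, Matrix.diagonal_mul]
  ring

theorem isHomog_iff {s : ℂ} {Z : SMat ℂ} : IsHomog s Z ↔ gam * Z * gam = s • Z := by
  rw [← Matrix.ext_iff]
  simp only [gam_mul_mul_gam_apply, IsHomog, Matrix.smul_apply, smul_eq_mul]

theorem isHomog_unitPsl (p : Idx × Idx) : IsHomog (sgn p.1 * sgn p.2) (unitPsl p).1 := by
  intro i j
  have h : (unitPsl p).1 = pr (Matrix.single p.1 p.2 1) := rfl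
  rw [h, pr_apply, Matrix.single_apply]
  by_cases h1 : p.1 = i ∧ p.2 = j
  · rw [← h1.1, ← h1.2]
  · rw [if_neg h1, zero_sub]
    split_ifs with h2
    · subst h2
      by_cases h3 : p.1 = p.2
      · rw [h3, sgn_mul_self, sgn_mul_self]
      · have : ∀ k, (1 + sgn i * sgn k) • (Matrix.single p.1 p.2 (1 : ℂ)) k k = 0 := fun k => by
          rw [Matrix.single_apply, if_neg (fun h => h3 (h.1.trans h.2.symm)), smul_zero]
        rw [Finset.sum_congr rfl fun k _ => this k]
        simp
    · simp

theorem IsYangBaxter.isHomog {R : Module.End ℂ psl} (hR : IsYangBaxter R) {s : ℂ} {Z : psl}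
    (h : IsHomog s Z.1) : IsHomog s (R Z).1 := by
  rw [isHomog_iff] at *
  have := hR.even Z (s • Z) h.symm
  rw [← this, map_smul]
  rfl

/-- The bilinear extension of the superbracket to complex supermatrices, before the projection. -/
def preBracket (Z W : SMat ℂ) : SMat ℂ := Z * W - W * Z + 2 • (oddPart W * oddPart Z)

theorem oddPart_apply (Z : SMat ℂ) (i j : Idx) :
    oddPart Z i j = ((1 - sgn i * sgn j) / 2) * Z i j := by
  rcases i with i | i <;> rcases j with j | j <;> norm_num [oddPart, sgn] <;> rfl

theorem preBracket_of_isHomog {s t : ℂ} (hs : s = 1 ∨ s = -1) (ht : t = 1 ∨ t = -1)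
    {Z W : SMat ℂ} (hZ : IsHomog s Z) (hW : IsHomog t W) :
    preBracket Z W = Z * W - ((1 + s + t - s * t) / 2) • (W * Z) := by
  have h1 : ∀ {s : ℂ} {Z : SMat ℂ}, IsHomog s Z → oddPart Z = ((1 - s) / 2) • Z := by
    intro s Z hZ
    ext i j
    have := hZ i j
    rw [smul_eq_mul, smul_eq_mul] at this
    rw [oddPart_apply, Matrix.smul_apply, smul_eq_mul]
    linear_combination -(1 / 2 : ℂ) * this
  rw [preBracket, h1 hZ, h1 hW, smul_mul_smul_comm]
  rcases hs with rfl | rfl <;> rcases ht with rfl | rfl <;> module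

theorem commutator_smul_ofComplex {s t : ℂ} (hs : s = 1 ∨ s = -1) (ht : t = 1 ∨ t = -1)
    {x y : 𝒪} (hx : par x = s • x) (hy : par y = t • y) {Z W : SMat ℂ}
    (hZ : IsHomog s Z) (hW : IsHomog t W) :
    (x • ofComplex 𝒪 Z) * (y • ofComplex 𝒪 W) - (y • ofComplex 𝒪 W) * (x • ofComplex 𝒪 Z) =
      (x * y) • ofComplex 𝒪 (preBracket Z W) := by
  rw [smul_ofComplex_mul, smul_ofComplex_mul, preBracket_of_isHomog hs ht hZ hW,
    mul_comm_of_parities ht hs hy hx]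
  ext i j
  rw [Matrix.sub_apply, smul_ofComplex_apply, smul_ofComplex_apply, smul_ofComplex_apply,
    Matrix.sub_apply, Matrix.smul_apply, sub_smul, smul_smul, smul_eq_mul]
  congr 2
  ring

/-- The bracket of two elements of the envelope in terms of the superbracket of `psl(4|4)`. -/
theorem pr_commutator_sum {X Y : SMat 𝒪} (hX : sPar X = X) (hY : sPar Y = Y)
    {F G : Idx × Idx → psl} (hF : ∀ p, IsHomog (sgn p.1 * sgn p.2) (F p).1)
    (hG : ∀ p, IsHomog (sgn p.1 * sgn p.2) (G p).1) {A B : SMat 𝒪}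
    (hA : A = ∑ p : Idx × Idx, X p.1 p.2 • ofComplex 𝒪 (F p).1)
    (hB : B = ∑ q : Idx × Idx, Y q.1 q.2 • ofComplex 𝒪 (G q).1) :
    pr (A * B - B * A) = ∑ p : Idx × Idx, ∑ q : Idx × Idx,
      (X p.1 p.2 * Y q.1 q.2) • ofComplex 𝒪 (superBracket (F p) (G q)).1 := by
  rw [sPar_eq_self_iff] at hX hY
  have h : ∀ p q : Idx × Idx, pr (
      (X p.1 p.2 • ofComplex 𝒪 (F p).1) * (Y q.1 q.2 • ofComplex 𝒪 (G q).1) -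
      (Y q.1 q.2 • ofComplex 𝒪 (G q).1) * (X p.1 p.2 • ofComplex 𝒪 (F p).1)) =
      (X p.1 p.2 * Y q.1 q.2) • ofComplex 𝒪 (superBracket (F p) (G q)).1 := fun p q => by
    rw [commutator_smul_ofComplex (sgn_mul_eq_or _ _) (sgn_mul_eq_or _ _) (hX _ _) (hY _ _)
      (hF p) (hG q), pr_smul_ofComplex]
    rfl
  rw [hA, hB, Finset.sum_mul_sum, Finset.sum_mul_sum]
  conv_lhs =>
    enter [2, 2]
    rw [Finset.sum_comm]
  simp only [← Finset.sum_sub_distrib, map_sum, h]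

theorem sPar_extend {R : Module.End ℂ psl} (hR : IsYangBaxter R) (X : SMat 𝒪) :
    sPar (extend R X) = extend R (sPar X) := by
  ext k l
  rw [sPar_apply, extend_apply, extend_apply, map_sum, Finset.smul_sum]
  refine Finset.sum_congr rfl fun i _ => ?_
  rw [map_sum, Finset.smul_sum]
  refine Finset.sum_congr rfl fun j _ => ?_
  have := hR.isHomog (isHomog_unitPsl (i, j)) k l
  simp only [smul_eq_mul] at this
  rw [map_smul, sPar_apply, smul_smul, smul_smul, mul_comm (_ : ℂ) (sgn i * sgn j)]
  exact congrArg (· • par (X i j)) this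

/-- The classical Yang-Baxter equation holds on the Grassmann envelope. -/
theorem extend_cybe {R : Module.End ℂ psl} (hR : IsYangBaxter R) (X Y : Env 𝒪) :
    pr (extend R X.1 * extend R Y.1 - extend R Y.1 * extend R X.1) =
      extend R (pr (extend R X.1 * Y.1 - Y.1 * extend R X.1) +
        pr (X.1 * extend R Y.1 - extend R Y.1 * X.1)) := by
  have h1 := eq_sum_unitPsl X.pr_eq
  have h2 := eq_sum_unitPsl Y.pr_eq
  have h3 := extend_eq_sum R X.pr_eq
  have h4 := extend_eq_sum R Y.pr_eq
  have hh : ∀ p, IsHomog (sgn p.1 * sgn p.2) (R (unitPsl p)).1 :=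
    fun p => hR.isHomog (isHomog_unitPsl p)
  have e1 := pr_commutator_sum X.even Y.even hh hh h3 h4
  have e2 := pr_commutator_sum X.even Y.even hh isHomog_unitPsl h3 h2
  have e3 := pr_commutator_sum X.even Y.even isHomog_unitPsl hh h1 h4
  rw [e1, e2, e3, ← Finset.sum_add_distrib, map_sum]
  refine Finset.sum_congr rfl fun p _ => ?_
  rw [← Finset.sum_add_distrib, map_sum]
  refine Finset.sum_congr rfl fun q _ => ?_
  rw [extend_add_smul_ofComplex]
  have h := hR.cybe (unitPsl p) (unitPsl q)
  rw [h]

theorem extend_antisymm {R : Module.End ℂ psl} (hR : IsYangBaxter R) (X Y : Env 𝒪) :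
    str (extend R X.1 * Y.1) = -str (X.1 * extend R Y.1) := by
  have hs : ∀ (x : 𝒪) (Z : SMat ℂ), str (x • ofComplex 𝒪 Z) = str Z • x := fun x Z => by
    simp only [str_eq_sum, smul_ofComplex_apply, smul_smul, Finset.sum_smul, smul_eq_mul]
  have hm : ∀ {A B : SMat 𝒪} {F G : Idx × Idx → psl},
      (A = ∑ p : Idx × Idx, X.1 p.1 p.2 • ofComplex 𝒪 (F p).1) →
      (B = ∑ p : Idx × Idx, Y.1 p.1 p.2 • ofComplex 𝒪 (G p).1) →
      str (A * B) = ∑ p : Idx × Idx, ∑ q : Idx × Idx,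
        str ((F p).1 * (G q).1) • (X.1 p.1 p.2 * Y.1 q.1 q.2) := by
    intro A B F G hA hB
    rw [hA, hB, Finset.sum_mul_sum, str_sum]
    refine Finset.sum_congr rfl fun p _ => ?_
    rw [str_sum]
    refine Finset.sum_congr rfl fun q _ => ?_
    rw [smul_ofComplex_mul, hs]
  rw [hm (extend_eq_sum R X.pr_eq) (eq_sum_unitPsl Y.pr_eq),
    hm (eq_sum_unitPsl X.pr_eq) (extend_eq_sum R Y.pr_eq), ← Finset.sum_neg_distrib]
  refine Finset.sum_congr rfl fun p _ => ?_
  rw [← Finset.sum_neg_distrib]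
  refine Finset.sum_congr rfl fun q _ => ?_
  rw [hR.antisymm, neg_smul]

end Extend

end Env

section Entries

variable {𝒪 : Type*} [Ring 𝒪] [Algebra ℂ 𝒪] {F : Submodule ℂ 𝒪}

/-- A two-sided ideal of the ring of coefficients, with vanishing products, which contains all
parameters of a variation; variations with parameters in it are exact to first order. -/
structure IsNilIdeal (F : Submodule ℂ 𝒪) : Prop where
  mul_right : ∀ x ∈ F, ∀ y, x * y ∈ F
  mul_left : ∀ x ∈ F, ∀ y, y * x ∈ F
  mul_eq_zero : ∀ x ∈ F, ∀ y ∈ F, x * y = 0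

theorem mul_mem_entriesIn_right (hF : ∀ x ∈ F, ∀ y, x * y ∈ F) {X : SMat 𝒪}
    (hX : X ∈ entriesIn F) (Y : SMat 𝒪) : X * Y ∈ entriesIn F := fun i j => by
  rw [Matrix.mul_apply]
  exact F.sum_mem fun k _ => hF _ (hX i k) _

theorem mul_mem_entriesIn_left (hF : ∀ x ∈ F, ∀ y, y * x ∈ F) {X : SMat 𝒪}
    (hX : X ∈ entriesIn F) (Y : SMat 𝒪) : Y * X ∈ entriesIn F := fun i j => by
  rw [Matrix.mul_apply]
  exact F.sum_mem fun k _ => hF _ (hX k j) _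

theorem adj_mem_entriesIn (hF : ∀ x ∈ F, ∀ y, x * y ∈ F) (hF' : ∀ x ∈ F, ∀ y, y * x ∈ F)
    {X : SMat 𝒪} (hX : X ∈ entriesIn F) (g : SMat 𝒪) : adj g X ∈ entriesIn F :=
  pr_mem_entriesIn (mul_mem_entriesIn_right hF (mul_mem_entriesIn_left hF' hX g) _)

theorem adjInv_mem_entriesIn (hF : ∀ x ∈ F, ∀ y, x * y ∈ F) (hF' : ∀ x ∈ F, ∀ y, y * x ∈ F)
    {X : SMat 𝒪} (hX : X ∈ entriesIn F) (g : SMat 𝒪) : adjInv g X ∈ entriesIn F :=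
  pr_mem_entriesIn (mul_mem_entriesIn_right hF (mul_mem_entriesIn_left hF' hX _) g)

theorem Rg_mem_entriesIn (hF : ∀ x ∈ F, ∀ y, x * y ∈ F) (hF' : ∀ x ∈ F, ∀ y, y * x ∈ F)
    {X : SMat 𝒪} (hX : X ∈ entriesIn F) (R : Module.End ℂ psl) (g : SMat 𝒪) :
    Rg R g X ∈ entriesIn F :=
  adj_mem_entriesIn hF hF' (extend_mem_entriesIn R (adjInv_mem_entriesIn hF hF' hX g)) g

theorem IsNilIdeal.mul_eq_zero_of_mem (hF : IsNilIdeal F) {X Y : SMat 𝒪} (hX : X ∈ entriesIn F)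
    (hY : Y ∈ entriesIn F) : X * Y = 0 := by
  ext i j
  rw [Matrix.mul_apply, Matrix.zero_apply]
  exact Finset.sum_eq_zero fun k _ => hF.mul_eq_zero _ (hX i k) _ (hY k j)

theorem IsNilIdeal.mul_mul_eq_zero (hF : IsNilIdeal F) {X Y : SMat 𝒪} (hX : X ∈ entriesIn F)
    (hY : Y ∈ entriesIn F) (Z : SMat 𝒪) : X * Z * Y = 0 :=
  hF.mul_eq_zero_of_mem (mul_mem_entriesIn_right hF.mul_right hX Z) hY

theorem IsNilIdeal.one_add_mul_one_sub (hF : IsNilIdeal F) {Λ : SMat 𝒪}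
    (hΛ : Λ ∈ entriesIn F) : (1 + Λ) * (1 - Λ) = 1 := by
  rw [mul_sub, add_mul, add_mul, hF.mul_eq_zero_of_mem hΛ hΛ]
  noncomm_ring

theorem IsNilIdeal.one_sub_mul_one_add (hF : IsNilIdeal F) {Λ : SMat 𝒪}
    (hΛ : Λ ∈ entriesIn F) : (1 - Λ) * (1 + Λ) = 1 := by
  rw [sub_mul, mul_add, mul_add, hF.mul_eq_zero_of_mem hΛ hΛ]
  noncomm_ring

end Entries

/-! ### The adjoint action and the dressed operator `R_g` on the envelope -/

section Dressed

open SuperRing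

variable {𝒪 : Type*} [Ring 𝒪] [Algebra ℂ 𝒪] [SuperRing 𝒪]

theorem pr_conj_pr {a b : SMat 𝒪} (hab : a * b = 1) {X : SMat 𝒪} (hX : sPar X = X)
    (h : str X = 0) : pr (a * pr X * b) = pr (a * X * b) := by
  obtain ⟨c, hc, h'⟩ := exists_eq_pr_add hX h
  conv_rhs => rw [h']
  rw [mul_add, smul_mul_of_even hc, mul_one, add_mul, smul_mul_assoc, hab, map_add, pr_smul_one,
    add_zero]

theorem sPar_conj {a b X : SMat 𝒪} (ha : sPar a = a) (hb : sPar b = b) (hX : sPar X = X) :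
    sPar (a * X * b) = a * X * b := by
  rw [map_mul, map_mul, ha, hb, hX]

theorem str_conj {a b X : SMat 𝒪} (ha : sPar a = a) (hb : sPar b = b) (hba : b * a = 1)
    (hX : sPar X = X) : str (a * X * b) = str X := by
  rw [mul_assoc, str_mul_comm ha (by rw [map_mul, hX, hb]), mul_assoc, hba, mul_one]

/-- Conjugation `X ↦ a X b` of the envelope, where `b = a⁻¹` in the applications. -/
def envConj (a b : SMat 𝒪) (ha : sPar a = a) (hb : sPar b = b) : Module.End ℂ (Env 𝒪) where
  toFun X := toEnv (a * X.1 * b) (sPar_conj ha hb X.even)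
  map_add' X Y := by
    apply Subtype.ext
    change pr (a * (X.1 + Y.1) * b) = pr _ + pr _
    rw [mul_add, add_mul, map_add]
  map_smul' c X := by
    apply Subtype.ext
    change pr (a * (c • X.1) * b) = c • pr _
    rw [mul_smul_comm, smul_mul_assoc, map_smul]

theorem coe_envConj {a b : SMat 𝒪} (ha : sPar a = a) (hb : sPar b = b) (X : Env 𝒪) :
    (envConj a b ha hb X).1 = pr (a * X.1 * b) := rfl

theorem envConj_envConj {a b : SMat 𝒪} (ha : sPar a = a) (hb : sPar b = b) (hab : a * b = 1)
    (X : Env 𝒪) : envConj a b ha hb (envConj b a hb ha X) = X := by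
  apply Subtype.ext
  rw [coe_envConj, coe_envConj, pr_conj_pr hab (sPar_conj hb ha X.even)
    ((str_conj hb ha hab X.even).trans X.str_eq)]
  rw [← mul_assoc, ← mul_assoc, hab, one_mul, mul_assoc, hab, mul_one, X.pr_eq]

theorem envConj_lie {a b : SMat 𝒪} (ha : sPar a = a) (hb : sPar b = b) (hab : a * b = 1)
    (hba : b * a = 1) (X Y : Env 𝒪) :
    envConj a b ha hb ⁅X, Y⁆ = ⁅envConj a b ha hb X, envConj a b ha hb Y⁆ := by
  have hs : ∀ X : Env 𝒪, str (a * X.1 * b) = 0 := fun X =>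
    (str_conj ha hb hba X.even).trans X.str_eq
  have h1 : ∀ X Y : Env 𝒪, a * X.1 * b * (a * Y.1 * b) = a * (X.1 * Y.1) * b := fun X Y => by
    rw [show a * X.1 * b * (a * Y.1 * b) = a * X.1 * (b * a) * (Y.1 * b) by noncomm_ring, hba]
    noncomm_ring
  apply Subtype.ext
  rw [coe_envConj, Env.coe_lie, Env.coe_lie, coe_envConj, coe_envConj,
    pr_commutator_pr_left (sPar_conj ha hb X.even) (hs X),
    pr_commutator_pr_right (sPar_conj ha hb Y.even) (hs Y),
    pr_conj_pr hab (sPar_commutator X.even Y.even) (str_commutator X.even Y.even), h1, h1, mul_sub,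
    sub_mul]

theorem sForm_envConj {a b : SMat 𝒪} (ha : sPar a = a) (hb : sPar b = b) (hab : a * b = 1)
    (hba : b * a = 1) (X Y : Env 𝒪) :
    sForm (envConj a b ha hb X) Y = sForm X (envConj b a hb ha Y) := by
  rw [sForm_apply, sForm_apply, coe_envConj, coe_envConj,
    str_pr_mul ((str_conj ha hb hba X.even).trans X.str_eq) Y.str_eq,
    str_mul_pr (sPar_conj hb ha Y.even) X.str_eq ((str_conj hb ha hab Y.even).trans Y.str_eq),
    mul_assoc, mul_assoc, str_mul_comm ha (by rw [map_mul, map_mul, X.even, hb, Y.even])]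
  congr 1
  noncomm_ring

/-- The extension of an `R`-matrix to the envelope. -/
def envExtend {R : Module.End ℂ psl} (hR : IsYangBaxter R) : Module.End ℂ (Env 𝒪) :=
  (extend R).restrict fun X hX => ⟨by rw [sPar_extend hR, hX.1], pr_extend R X⟩

theorem envExtend_lie {R : Module.End ℂ psl} (hR : IsYangBaxter R) (X Y : Env 𝒪) :
    ⁅envExtend hR X, envExtend hR Y⁆ =
      envExtend hR (⁅envExtend hR X, Y⁆ + ⁅X, envExtend hR Y⁆) :=
  Subtype.ext (extend_cybe hR X Y)

theorem sForm_envExtend {R : Module.End ℂ psl} (hR : IsYangBaxter R) (X Y : Env 𝒪) :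
    sForm (envExtend hR X) Y = -sForm X (envExtend hR Y) := extend_antisymm hR X Y

/-- An even invertible supermatrix. -/
structure IsEvenUnit (g : SMat 𝒪) : Prop where
  even : sPar g = g
  unit : IsUnit g

namespace IsEvenUnit

variable {g : SMat 𝒪} (hg : IsEvenUnit g)

include hg

theorem inv_even : sPar (Ring.inverse g) = Ring.inverse g := sPar_inverse hg.even

theorem mul_inv : g * Ring.inverse g = 1 := Ring.mul_inverse_cancel g hg.unit

theorem inv_mul : Ring.inverse g * g = 1 := Ring.inverse_mul_cancel g hg.unit

end IsEvenUnit

/-- `Ad_g` on the envelope. -/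
def envAdj {g : SMat 𝒪} (hg : IsEvenUnit g) : Module.End ℂ (Env 𝒪) :=
  envConj g (Ring.inverse g) hg.even hg.inv_even

/-- `Ad_g⁻¹` on the envelope. -/
def envAdjInv {g : SMat 𝒪} (hg : IsEvenUnit g) : Module.End ℂ (Env 𝒪) :=
  envConj (Ring.inverse g) g hg.inv_even hg.even

theorem coe_envAdj {g : SMat 𝒪} (hg : IsEvenUnit g) (X : Env 𝒪) :
    (envAdj hg X).1 = adj g X.1 := rfl

theorem envAdj_envAdjInv {g : SMat 𝒪} (hg : IsEvenUnit g) (X : Env 𝒪) :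
    envAdj hg (envAdjInv hg X) = X := envConj_envConj _ _ hg.mul_inv X

theorem envAdjInv_envAdj {g : SMat 𝒪} (hg : IsEvenUnit g) (X : Env 𝒪) :
    envAdjInv hg (envAdj hg X) = X := envConj_envConj _ _ hg.inv_mul X

/-- `R_g` on the envelope. -/
def envRg {R : Module.End ℂ psl} (hR : IsYangBaxter R) {g : SMat 𝒪} (hg : IsEvenUnit g) :
    Module.End ℂ (Env 𝒪) := envAdj hg * envExtend hR * envAdjInv hg

section

variable {R : Module.End ℂ psl} (hR : IsYangBaxter R) {g : SMat 𝒪} (hg : IsEvenUnit g)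

theorem envRg_apply (X : Env 𝒪) :
    envRg hR hg X = envAdj hg (envExtend hR (envAdjInv hg X)) := rfl

theorem sForm_envRg (X Y : Env 𝒪) :
    sForm (envRg hR hg X) Y = -sForm X (envRg hR hg Y) := by
  rw [envRg_apply, envRg_apply, envAdj, sForm_envConj _ _ hg.mul_inv hg.inv_mul,
    sForm_envExtend, envAdjInv, sForm_envConj _ _ hg.inv_mul hg.mul_inv]

/-- The dressed operator solves the classical Yang-Baxter equation. -/
theorem envRg_lie (X Y : Env 𝒪) :
    ⁅envRg hR hg X, envRg hR hg Y⁆ =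
      envRg hR hg (⁅envRg hR hg X, Y⁆ + ⁅X, envRg hR hg Y⁆) := by
  have h1 : ∀ X Y, envAdj hg ⁅X, Y⁆ = ⁅envAdj hg X, envAdj hg Y⁆ :=
    envConj_lie _ _ hg.mul_inv hg.inv_mul
  have h2 : ∀ X Y, envAdjInv hg ⁅X, Y⁆ = ⁅envAdjInv hg X, envAdjInv hg Y⁆ :=
    envConj_lie _ _ hg.inv_mul hg.mul_inv
  simp only [envRg_apply]
  rw [← h1, envExtend_lie, map_add (envAdjInv hg), h2, h2, envAdjInv_envAdj, envAdjInv_envAdj]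

end

/-! ### Derivations of the coefficients -/

/-- An even derivation of the ring of coefficients. -/
structure IsEvenDerivation (D : 𝒪 →ₗ[ℂ] 𝒪) : Prop where
  leibniz : ∀ x y, D (x * y) = D x * y + x * D y
  par : ∀ x, par (D x) = D (par x)

namespace IsEvenDerivation

variable {D : 𝒪 →ₗ[ℂ] 𝒪} (hD : IsEvenDerivation D)

include hD

theorem map_mul (X Y : SMat 𝒪) : (X * Y).map D = X.map D * Y + X * Y.map D := by
  ext i j
  simp only [Matrix.map_apply, Matrix.mul_apply, Matrix.add_apply, map_sum, hD.leibniz,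
    Finset.sum_add_distrib]

theorem map_one : D 1 = 0 := by
  have h := hD.leibniz 1 1
  rw [mul_one, one_mul, mul_one] at h
  exact left_eq_add.1 h

theorem map_one_matrix : (1 : SMat 𝒪).map D = 0 := by
  ext i j
  rw [Matrix.map_apply, Matrix.one_apply]
  split_ifs
  · rw [hD.map_one]; rfl
  · rw [map_zero]; rfl

theorem sPar_map {X : SMat 𝒪} (hX : sPar X = X) : sPar (X.map D) = X.map D := by
  rw [sPar_eq_self_iff] at *
  intro i j
  rw [Matrix.map_apply, hD.par, hX, map_smul]

theorem map_inverse {g : SMat 𝒪} (hg : IsUnit g) :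
    (Ring.inverse g).map D = -(Ring.inverse g * g.map D * Ring.inverse g) := by
  have h : (g * Ring.inverse g).map D = 0 := by
    rw [Ring.mul_inverse_cancel g hg, hD.map_one_matrix]
  rw [hD.map_mul] at h
  calc (Ring.inverse g).map D = Ring.inverse g * g * (Ring.inverse g).map D := by
        rw [Ring.inverse_mul_cancel g hg, one_mul]
    _ = Ring.inverse g * (g.map D * Ring.inverse g + g * (Ring.inverse g).map D)
        - Ring.inverse g * g.map D * Ring.inverse g := by noncomm_ring
    _ = _ := by rw [h, mul_zero, zero_sub]

end IsEvenDerivation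

/-- The action of an even derivation on the envelope. -/
def envD {D : 𝒪 →ₗ[ℂ] 𝒪} (hD : IsEvenDerivation D) : Module.End ℂ (Env 𝒪) where
  toFun X := ⟨X.1.map D, hD.sPar_map X.even, by rw [pr_map, X.pr_eq]⟩
  map_add' X Y := by
    apply Subtype.ext
    ext i j
    exact map_add D _ _
  map_smul' c X := by
    apply Subtype.ext
    ext i j
    exact map_smul D _ _

section Derivation

variable {D : 𝒪 →ₗ[ℂ] 𝒪} (hD : IsEvenDerivation D)

theorem coe_envD (X : Env 𝒪) : (envD hD X).1 = X.1.map D := rfl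

theorem map_sForm (X Y : Env 𝒪) :
    D (sForm X Y) = sForm (envD hD X) Y + sForm X (envD hD Y) := by
  rw [sForm_apply, ← str_map, hD.map_mul, str_add]
  rfl

theorem envD_envOmega (X : Env 𝒪) : envD hD (envOmega X) = envOmega (envD hD X) :=
  Subtype.ext (omega_map D X.1).symm

/-- The Maurer-Cartan form as an element of the envelope. -/
def envMc (hD : IsEvenDerivation D) {g : SMat 𝒪} (hg : IsEvenUnit g) : Env 𝒪 :=
  -toEnv (g.map D * Ring.inverse g) (by rw [map_mul, hD.sPar_map hg.even, hg.inv_even])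

theorem coe_envMc {g : SMat 𝒪} (hg : IsEvenUnit g) : (envMc hD hg).1 = mcForm D g := rfl

variable {g : SMat 𝒪} (hg : IsEvenUnit g) (h0 : str (g.map D * Ring.inverse g) = 0)

theorem lie_envMc (h0 : str (g.map D * Ring.inverse g) = 0) (X : Env 𝒪) :
    (⁅envMc hD hg, X⁆ : Env 𝒪).1 =
      -pr ((g.map D * Ring.inverse g) * X.1 - X.1 * (g.map D * Ring.inverse g)) := by
  rw [envMc, neg_lie]
  change -pr (pr _ * X.1 - X.1 * pr _) = _
  rw [pr_commutator_pr_left (by rw [map_mul, hD.sPar_map hg.even, hg.inv_even]) h0]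

theorem envD_envAdj (h0 : str (g.map D * Ring.inverse g) = 0) (X : Env 𝒪) :
    envD hD (envAdj hg X) = envAdj hg (envD hD X) - ⁅envMc hD hg, envAdj hg X⁆ := by
  apply Subtype.ext
  have hY : sPar (g * X.1 * Ring.inverse g) = g * X.1 * Ring.inverse g :=
    sPar_conj hg.even hg.inv_even X.even
  rw [Submodule.coe_sub, lie_envMc hD hg h0, coe_envD, coe_envAdj, coe_envAdj, adj_apply,
    adj_apply, pr_commutator_pr_right hY ((str_conj hg.even hg.inv_even hg.inv_mul X.even).trans
      X.str_eq), sub_neg_eq_add, ← map_add, ← pr_map, hD.map_mul, hD.map_mul,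
      hD.map_inverse hg.unit, coe_envD]
  congr 1
  rw [show g.map D * Ring.inverse g * (g * X.1 * Ring.inverse g) =
    g.map D * (Ring.inverse g * g) * X.1 * Ring.inverse g by noncomm_ring, hg.inv_mul]
  noncomm_ring

theorem envD_envAdjInv (h0 : str (g.map D * Ring.inverse g) = 0) (X : Env 𝒪) :
    envD hD (envAdjInv hg X) = envAdjInv hg (envD hD X + ⁅envMc hD hg, X⁆) := by
  have h := envD_envAdj hD hg h0 (envAdjInv hg X)
  rw [envAdj_envAdjInv, eq_sub_iff_add_eq] at h
  rw [h, envAdjInv_envAdj]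

theorem envD_envExtend {R : Module.End ℂ psl} (hR : IsYangBaxter R) (X : Env 𝒪) :
    envD hD (envExtend hR X) = envExtend hR (envD hD X) :=
  Subtype.ext (extend_map D R X.1).symm

/-- `R_g` commutes with the covariant derivative `D + [A, ·]`. -/
theorem envD_envRg {R : Module.End ℂ psl} (hR : IsYangBaxter R)
    (h0 : str (g.map D * Ring.inverse g) = 0) (X : Env 𝒪) :
    envD hD (envRg hR hg X) + ⁅envMc hD hg, envRg hR hg X⁆ =
      envRg hR hg (envD hD X + ⁅envMc hD hg, X⁆) := by
  rw [envRg_apply, envD_envAdj hD hg h0, envD_envExtend, envD_envAdjInv hD hg h0, sub_add_cancel,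
    envRg_apply]

/-- The Maurer-Cartan equation. -/
theorem envD_envMc {D' : 𝒪 →ₗ[ℂ] 𝒪} (hD' : IsEvenDerivation D')
    (h0 : str (g.map D * Ring.inverse g) = 0) (h0' : str (g.map D' * Ring.inverse g) = 0)
    (hDD' : ∀ x, D (D' x) = D' (D x)) :
    envD hD (envMc hD' hg) - envD hD' (envMc hD hg) = -⁅envMc hD hg, envMc hD' hg⁆ := by
  apply Subtype.ext
  have hh : (g.map D').map D = (g.map D).map D' := by
    ext i j
    exact hDD' _
  have hn : ∀ (D : 𝒪 →ₗ[ℂ] 𝒪) (X : SMat 𝒪), (-X).map D = -X.map D := fun D X => by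
    ext i j
    exact map_neg D _
  have h1 : sPar (g.map D' * Ring.inverse g) = g.map D' * Ring.inverse g := by
    rw [map_mul, hD'.sPar_map hg.even, hg.inv_even]
  rw [Submodule.coe_neg, lie_envMc hD hg h0, neg_neg, Submodule.coe_sub, coe_envD,
    coe_envD, coe_envMc, coe_envMc, mcForm, mcForm, hn, hn, mul_neg, neg_mul, ← neg_sub', ← neg_sub', map_neg,
    pr_commutator_pr_right h1 h0', ← pr_map, ← pr_map, hD.map_mul, hD'.map_mul,
    hD.map_inverse hg.unit, hD'.map_inverse hg.unit, hh, ← map_sub]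
  congr 2
  noncomm_ring

end Derivation

/-! ### Nilpotent variations -/

section Variation

variable {F : Submodule ℂ 𝒪}

namespace IsNilIdeal

variable (hF : IsNilIdeal F)

include hF

theorem lie_mem {X : Env 𝒪} (hX : X.1 ∈ entriesIn F) (Y : Env 𝒪) :
    (⁅X, Y⁆ : Env 𝒪).1 ∈ entriesIn F :=
  pr_mem_entriesIn ((entriesIn F).sub_mem (mul_mem_entriesIn_right hF.mul_right hX _)
    (mul_mem_entriesIn_left hF.mul_left hX _))

theorem lie_eq_zero {X Y : Env 𝒪} (hX : X.1 ∈ entriesIn F) (hY : Y.1 ∈ entriesIn F) :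
    ⁅X, Y⁆ = 0 := by
  apply Subtype.ext
  rw [Env.coe_lie, hF.mul_eq_zero_of_mem hX hY, hF.mul_eq_zero_of_mem hY hX, sub_zero, map_zero]
  rfl

theorem sForm_eq_zero {X Y : Env 𝒪} (hX : X.1 ∈ entriesIn F) (hY : Y.1 ∈ entriesIn F) :
    sForm X Y = 0 := by
  rw [sForm_apply, hF.mul_eq_zero_of_mem hX hY, str_zero]

theorem isEvenUnit {g : SMat 𝒪} (hg : IsEvenUnit g) {Λ : Env 𝒪} (hΛ : Λ.1 ∈ entriesIn F) :
    IsEvenUnit ((1 + Λ.1) * g) where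
  even := by rw [map_mul, map_add, map_one, Λ.even, hg.even]
  unit := IsUnit.mul ⟨⟨1 + Λ.1, 1 - Λ.1, hF.one_add_mul_one_sub hΛ, hF.one_sub_mul_one_add hΛ⟩, rfl⟩
    hg.unit

theorem inverse_varied {g : SMat 𝒪} (hg : IsEvenUnit g) {Λ : Env 𝒪} (hΛ : Λ.1 ∈ entriesIn F) :
    Ring.inverse ((1 + Λ.1) * g) = Ring.inverse g * (1 - Λ.1) := by
  have h1 : (1 + Λ.1) * g * (Ring.inverse g * (1 - Λ.1)) = 1 := by
    rw [show (1 + Λ.1) * g * (Ring.inverse g * (1 - Λ.1)) =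
      (1 + Λ.1) * (g * Ring.inverse g) * (1 - Λ.1) by noncomm_ring, hg.mul_inv, mul_one,
      hF.one_add_mul_one_sub hΛ]
  have h2 := (hF.isEvenUnit hg hΛ).inv_mul
  calc Ring.inverse ((1 + Λ.1) * g) = Ring.inverse ((1 + Λ.1) * g) *
        ((1 + Λ.1) * g * (Ring.inverse g * (1 - Λ.1))) := by rw [h1, mul_one]
    _ = _ := by rw [← mul_assoc, h2, one_mul]

theorem envAdj_varied {g : SMat 𝒪} (hg : IsEvenUnit g) {Λ : Env 𝒪} (hΛ : Λ.1 ∈ entriesIn F)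
    (X : Env 𝒪) : envAdj (hF.isEvenUnit hg hΛ) X = envAdj hg X + ⁅Λ, envAdj hg X⁆ := by
  apply Subtype.ext
  have hY : sPar (g * X.1 * Ring.inverse g) = g * X.1 * Ring.inverse g :=
    sPar_conj hg.even hg.inv_even X.even
  rw [Submodule.coe_add, Env.coe_lie, coe_envAdj, coe_envAdj, adj_apply, adj_apply,
    hF.inverse_varied hg hΛ, pr_commutator_pr_right hY
      ((str_conj hg.even hg.inv_even hg.inv_mul X.even).trans X.str_eq), ← map_add]
  congr 1
  have h0 := hF.mul_mul_eq_zero hΛ hΛ (g * X.1 * Ring.inverse g)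
  calc (1 + Λ.1) * g * X.1 * (Ring.inverse g * (1 - Λ.1)) =
      g * X.1 * Ring.inverse g + (Λ.1 * (g * X.1 * Ring.inverse g) -
        g * X.1 * Ring.inverse g * Λ.1) - Λ.1 * (g * X.1 * Ring.inverse g) * Λ.1 := by noncomm_ring
    _ = _ := by rw [h0, sub_zero]

theorem envAdjInv_varied {g : SMat 𝒪} (hg : IsEvenUnit g) {Λ : Env 𝒪} (hΛ : Λ.1 ∈ entriesIn F)
    (X : Env 𝒪) : envAdjInv (hF.isEvenUnit hg hΛ) X = envAdjInv hg (X - ⁅Λ, X⁆) := by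
  have h1 := hF.envAdj_varied hg hΛ (envAdjInv hg (X - ⁅Λ, X⁆))
  rw [envAdj_envAdjInv, lie_sub, hF.lie_eq_zero hΛ (hF.lie_mem hΛ X), sub_zero,
    sub_add_cancel] at h1
  rw [← envAdjInv_envAdj (hF.isEvenUnit hg hΛ) (envAdjInv hg (X - ⁅Λ, X⁆)), h1]

/-- The variation of `R_g` is the commutator with the adjoint action of the parameter. -/
theorem envRg_varied {R : Module.End ℂ psl} (hR : IsYangBaxter R) {g : SMat 𝒪}
    (hg : IsEvenUnit g) {Λ : Env 𝒪} (hΛ : Λ.1 ∈ entriesIn F) (X : Env 𝒪) :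
    envRg hR (hF.isEvenUnit hg hΛ) X =
      envRg hR hg X + (⁅Λ, envRg hR hg X⁆ - envRg hR hg ⁅Λ, X⁆) := by
  have h0 : ⁅Λ, envRg hR hg ⁅Λ, X⁆⁆ = 0 := hF.lie_eq_zero hΛ
    (Rg_mem_entriesIn hF.mul_right hF.mul_left (hF.lie_mem hΛ X) R g)
  rw [envRg_apply, hF.envAdjInv_varied hg hΛ, hF.envAdj_varied hg hΛ, ← envRg_apply, map_sub,
    lie_sub, h0]
  abel

/-- The variation of the Maurer-Cartan form. -/
theorem envMc_varied {D : 𝒪 →ₗ[ℂ] 𝒪} (hD : IsEvenDerivation D) (hDF : ∀ x ∈ F, D x ∈ F)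
    {g : SMat 𝒪} (hg : IsEvenUnit g) (h0 : str (g.map D * Ring.inverse g) = 0) {Λ : Env 𝒪}
    (hΛ : Λ.1 ∈ entriesIn F) :
    envMc hD (hF.isEvenUnit hg hΛ) = envMc hD hg + (-envD hD Λ + ⁅Λ, envMc hD hg⁆) := by
  apply Subtype.ext
  have hs : (⁅Λ, envMc hD hg⁆ : Env 𝒪).1 = pr ((g.map D * Ring.inverse g) * Λ.1
      - Λ.1 * (g.map D * Ring.inverse g)) := by
    rw [← lie_skew, Submodule.coe_neg, lie_envMc hD hg h0, neg_neg]
  have h1 : (1 + Λ.1).map D = Λ.1.map D := by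
    rw [Matrix.map_add _ (map_add D), hD.map_one_matrix, zero_add]
  have h5 : pr (Λ.1.map D) = Λ.1.map D := (envD hD Λ).pr_eq
  have h2 : Λ.1.map D ∈ entriesIn F := fun i j => hDF _ (hΛ i j)
  rw [Submodule.coe_add, Submodule.coe_add, hs, coe_envMc, coe_envMc, Submodule.coe_neg,
    coe_envD, mcForm, mcForm, ← h5, ← map_neg, ← map_neg, ← map_neg, ← map_add, ← map_add,
    hF.inverse_varied hg hΛ, hD.map_mul, h1]
  congr 1
  have h3 := hF.mul_mul_eq_zero hΛ hΛ (g.map D * Ring.inverse g)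
  have h4 := hF.mul_eq_zero_of_mem h2 hΛ
  calc -((Λ.1.map D * g + (1 + Λ.1) * g.map D) * (Ring.inverse g * (1 - Λ.1))) =
      -(Λ.1.map D * (g * Ring.inverse g) + (g.map D * Ring.inverse g)
        + (Λ.1 * (g.map D * Ring.inverse g) - (g.map D * Ring.inverse g) * Λ.1)
        - Λ.1.map D * (g * Ring.inverse g) * Λ.1
        - Λ.1 * (g.map D * Ring.inverse g) * Λ.1) := by noncomm_ring
    _ = _ := by
      rw [hg.mul_inv, h3, mul_one, h4]
      noncomm_ring

end IsNilIdeal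

end Variation

end Dressed

/-! ### The first-order formalism in a graded Lie algebra with an invariant form -/

section Graded

variable {L W : Type*} [LieRing L] [LieAlgebra ℂ L] [AddCommGroup W] [Module ℂ W]

/-- A `ℤ₄`-grading of a Lie algebra by the eigenspaces of an automorphism `Ω`, where `ζ = ±i` is
the eigenvalue of grade one, together with the projectors on the graded components.  Exchanging
`ζ` for `-ζ` exchanges the grades one and three. -/
structure IsGrading (ζ : ℂ) (Ω : Module.End ℂ L) (P : Fin 4 → Module.End ℂ L) : Prop where
  sq : ζ * ζ = -1
  omega_lie : ∀ x y, Ω ⁅x, y⁆ = ⁅Ω x, Ω y⁆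
  omega_proj : ∀ k x, Ω (P k x) = ζ ^ (k : ℕ) • P k x
  sum_proj : ∀ x, P 0 x + P 1 x + P 2 x + P 3 x = x
  proj_eq_zero : ∀ (j k : Fin 4) x, Ω x = ζ ^ (k : ℕ) • x → j ≠ k → P j x = 0

/-- The element `x` has grade `k`. -/
def HasGrade (ζ : ℂ) (Ω : Module.End ℂ L) (k : ℕ) (x : L) : Prop := Ω x = ζ ^ k • x

namespace IsGrading

variable {ζ : ℂ} {Ω : Module.End ℂ L} {P : Fin 4 → Module.End ℂ L} (hP : IsGrading ζ Ω P)

include hP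

theorem pow_four (n : ℕ) : ζ ^ (n + 4) = ζ ^ n := by
  have := hP.sq
  linear_combination (ζ ^ n) * (ζ * ζ - 1) * this

theorem pow_ne_one {n : ℕ} (h : n % 4 ≠ 0) : ζ ^ n ≠ 1 := by
  have h2 := hP.sq
  have h4 : ζ ^ 4 = 1 := by linear_combination (ζ * ζ - 1) * h2
  have h1 : ζ ≠ 1 := fun h => by rw [h] at h2; norm_num at h2
  rw [← Nat.div_add_mod n 4, pow_add, pow_mul, h4, one_pow, one_mul]
  have : n % 4 < 4 := Nat.mod_lt _ (by norm_num)
  interval_cases hn : n % 4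
  · exact absurd rfl h
  · rwa [pow_one]
  · rw [pow_two, h2]
    norm_num
  · intro h3
    have : ζ = -1 := by linear_combination ζ * h2 - h3
    rw [this] at h2
    norm_num at h2

theorem hasGrade_proj (k : Fin 4) (x : L) : HasGrade ζ Ω k (P k x) := hP.omega_proj k x

theorem hasGrade_lie {a b : ℕ} {x y : L} (hx : HasGrade ζ Ω a x) (hy : HasGrade ζ Ω b y) :
    HasGrade ζ Ω (a + b) ⁅x, y⁆ := by
  rw [HasGrade, hP.omega_lie, hx, hy, smul_lie, lie_smul, smul_smul, pow_add]

theorem hasGrade_of_add_four {a : ℕ} {x : L} (hx : HasGrade ζ Ω (a + 4) x) : HasGrade ζ Ω a x := by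
  rw [HasGrade, ← hP.pow_four]
  exact hx

theorem proj_self {k : Fin 4} {x : L} (hx : HasGrade ζ Ω k x) : P k x = x := by
  have h := hP.sum_proj x
  have h0 := fun j => hP.proj_eq_zero j k x hx
  fin_cases k
  · rw [h0 1 (by decide), h0 2 (by decide), h0 3 (by decide)] at h
    simpa using h
  · rw [h0 0 (by decide), h0 2 (by decide), h0 3 (by decide)] at h
    simpa using h
  · rw [h0 0 (by decide), h0 1 (by decide), h0 3 (by decide)] at h
    simpa using h
  · rw [h0 0 (by decide), h0 1 (by decide), h0 2 (by decide)] at h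
    simpa using h

theorem proj_apply_of_hasGrade (j : Fin 4) {k : Fin 4} {x : L} (hx : HasGrade ζ Ω k x) :
    P j x = if j = k then x else 0 := by
  split_ifs with h
  · rw [h, hP.proj_self hx]
  · exact hP.proj_eq_zero j k x hx h

/-- The operator `P₁ + 2 P₂ + 3 P₃` multiplies by the grade. -/
theorem weight_apply (k : Fin 4) {x : L} (hx : HasGrade ζ Ω k x) :
    P 1 x + (2 : ℂ) • P 2 x + (3 : ℂ) • P 3 x = ((k : ℕ) : ℂ) • x := by
  rw [hP.proj_apply_of_hasGrade 1 hx, hP.proj_apply_of_hasGrade 2 hx,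
    hP.proj_apply_of_hasGrade 3 hx]
  fin_cases k <;> simp

theorem pow_three : ζ ^ 3 = -ζ := by linear_combination ζ * hP.sq

/-- The same grading with the grades one and three exchanged. -/
theorem neg : IsGrading (-ζ) Ω ![P 0, P 3, P 2, P 1] where
  sq := by rw [neg_mul_neg, hP.sq]
  omega_lie := hP.omega_lie
  omega_proj k x := by
    have h0 := hP.omega_proj 0 x
    have h1 := hP.omega_proj 1 x
    have h2 := hP.omega_proj 2 x
    have h3 := hP.omega_proj 3 x
    have h := hP.pow_three
    fin_cases k
    · simpa using h0
    · simpa [h] using h3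
    · simpa using h2
    · simpa [Odd.neg_pow (show Odd 3 by decide), h] using h1
  sum_proj x := by
    refine Eq.trans ?_ (hP.sum_proj x)
    change P 0 x + P 3 x + P 2 x + P 1 x = _
    abel
  proj_eq_zero j k x hx hjk := by
    have hx' : HasGrade ζ Ω ((-k : Fin 4) : ℕ) x := by
      have h := hP.pow_three
      rw [HasGrade, hx]
      fin_cases k
      · simp
      · change (-ζ) ^ 1 • x = ζ ^ 3 • x
        rw [h, pow_one]
      · change (-ζ) ^ 2 • x = ζ ^ 2 • x
        rw [neg_sq]
      · change (-ζ) ^ 3 • x = ζ ^ 1 • x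
        rw [Odd.neg_pow (show Odd 3 by decide), h, neg_neg, pow_one]
    have h : P (-j) x = 0 := hP.proj_eq_zero (-j) (-k) x hx' fun h => hjk (neg_injective h)
    fin_cases j <;> exact h

/-- The algebraic identity behind nilpotency: it expresses the obstruction for
`-[D + K, l₁ + l₃]` to be the variation of the current `K` through the equation of motion of
`l₃`. -/
theorem weight_variation {l1 l3 x1 x3 K N : L} (hl1 : HasGrade ζ Ω 1 l1) (hl3 : HasGrade ζ Ω 3 l3)
    (hx1 : HasGrade ζ Ω 1 x1) (hx3 : HasGrade ζ Ω 3 x3)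
    (hpure : ⁅l1, N⁆ = 0) {d : Module.End ℂ L}
    (hd : ∀ x, d x = P 1 x + (2 : ℂ) • P 2 x + (3 : ℂ) • P 3 x) :
    d (-(x1 + x3) - ⁅K, l1 + l3⁆) + (x1 - x3) + ⁅K, l1 - l3⁆ - ⁅l1 + l3, d K + (4 : ℂ) • N⁆
      + (4 : ℂ) • ⁅l1, P 3 K⁆ = -(4 : ℂ) • (x3 + ⁅P 0 K, l3⁆ - ⁅N, l3⁆) := by
  have hw : ∀ (k : Fin 4) {x : L}, HasGrade ζ Ω k x → d x = ((k : ℕ) : ℂ) • x := fun k x hx => by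
    rw [hd, hP.weight_apply k hx]
  have hg := hP.hasGrade_proj
  have hdK := hd K
  have hK := hP.sum_proj K
  have e1 := hw 1 hx1
  have e2 := hw 3 hx3
  -- on brackets of graded components with `l₁`, `l₃` the operator `d` acts as the grade mod `4`
  have a0 := hw 1 (hP.hasGrade_lie (hg 0 K) hl1)
  have a1 := hw 2 (hP.hasGrade_lie (hg 1 K) hl1)
  have a2 := hw 3 (hP.hasGrade_lie (hg 2 K) hl1)
  have a3 := hw 0 (hP.hasGrade_of_add_four (a := 0) (hP.hasGrade_lie (hg 3 K) hl1 :))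
  have b0 := hw 3 (hP.hasGrade_lie (hg 0 K) hl3)
  have b1 := hw 0 (hP.hasGrade_of_add_four (a := 0) (hP.hasGrade_lie (hg 1 K) hl3 :))
  have b2 := hw 1 (hP.hasGrade_of_add_four (a := 1) (hP.hasGrade_lie (hg 2 K) hl3 :))
  have b3 := hw 2 (hP.hasGrade_of_add_four (a := 2) (hP.hasGrade_lie (hg 3 K) hl3 :))
  rw [hdK]
  generalize P 0 K = k0 at *
  generalize P 1 K = k1 at *
  generalize P 2 K = k2 at *
  generalize P 3 K = k3 at *
  subst hK
  simp only [map_sub, map_neg, map_add, add_lie, lie_add, lie_sub, lie_smul, hpure,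
    e1, e2, a0, a1, a2, a3, b0, b1, b2, b3]
  simp only [← lie_skew l1 k1, ← lie_skew l1 k2, ← lie_skew l1 k3, ← lie_skew l3 k1,
    ← lie_skew l3 k2, ← lie_skew l3 k3, ← lie_skew l3 N]
  simp only [Fin.val_zero, Fin.val_one, Fin.val_two, show ((3 : Fin 4) : ℕ) = 3 from rfl]
  push_cast
  module

/-- On the equation of motion of `l₃`, the BRST variation of the current `K` is
`-[D + K, l₁ + l₃]`, without any dressed operator. -/
theorem current_variation {𝓡 : Module.End ℂ L}
    (hcybe : ∀ x y, ⁅𝓡 x, 𝓡 y⁆ = 𝓡 (⁅𝓡 x, y⁆ + ⁅x, 𝓡 y⁆)) (η : ℂ)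
    {d : Module.End ℂ L} (hd : ∀ x, d x = P 1 x + (2 : ℂ) • P 2 x + (3 : ℂ) • P 3 x)
    (hinj : ∀ x, x - η • 𝓡 (d x) = 0 → x = 0)
    {K V C N A l1 l3 y1 y3 κ : L} (hl1 : HasGrade ζ Ω 1 l1) (hl3 : HasGrade ζ Ω 3 l3)
    (hy1 : HasGrade ζ Ω 1 y1) (hy3 : HasGrade ζ Ω 3 y3) (hpure : ⁅l1, N⁆ = 0)
    (hV : V = 𝓡 C) (hC : C = d K + (4 : ℂ) • N) (hA : A = K - η • V)
    (hκ : κ = -(y1 + y3 + ⁅A, l1 + l3⁆) + η • 𝓡 (y1 - y3 + ⁅A, l1 - l3⁆)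
      + η • (𝓡 (d κ + (4 : ℂ) • ⁅l1, P 3 K⁆)
        + (⁅l1 + l3 - η • 𝓡 (l1 - l3), V⁆ - 𝓡 ⁅l1 + l3 - η • 𝓡 (l1 - l3), C⁆)))
    (heom : y3 + ⁅P 0 K, l3⁆ - ⁅N, l3⁆ = 0) : κ = -(y1 + y3) - ⁅K, l1 + l3⁆ := by
  have hw := hP.weight_variation (K := K) hl1 hl3 hy1 hy3 hpure hd
  rw [heom, smul_zero, ← hC] at hw
  have hw' := congrArg 𝓡 hw
  -- the difference of the two sides is annihilated by the injective operator `1 - η 𝓡 d`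
  rw [← sub_eq_zero]
  apply hinj
  -- the Yang-Baxter equation removes the terms of second order in `η`
  have h1 : ⁅𝓡 (l1 - l3), V⁆ = 𝓡 ⁅𝓡 (l1 - l3), C⁆ + 𝓡 ⁅l1 - l3, V⁆ := by
    rw [hV, hcybe, map_add]
  have h2 : ⁅l1 - l3, V⁆ = -⁅V, l1 - l3⁆ := (lie_skew _ _).symm
  have h3 : ⁅l1 + l3, V⁆ = -⁅V, l1 + l3⁆ := (lie_skew _ _).symm
  rw [h2, map_neg] at h1
  rw [hA] at hκ
  generalize l1 + l3 = s at *
  generalize l1 - l3 = m at *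
  simp only [map_add, map_sub, map_neg, map_zero, map_smul, sub_lie, smul_lie, h1, h3] at hκ hw' ⊢
  linear_combination (norm := module) hκ + η • hw'

end IsGrading

/-- An invariant symmetric form which is preserved by the automorphism `Ω`. -/
structure IsInvariantForm (Ω : Module.End ℂ L) (B : L →ₗ[ℂ] L →ₗ[ℂ] W) : Prop where
  symm : ∀ x y, B x y = B y x
  lie : ∀ x y z, B ⁅x, y⁆ z = B x ⁅y, z⁆
  omega : ∀ x y, B (Ω x) (Ω y) = B x y

namespace IsInvariantForm

variable {ζ : ℂ} {Ω : Module.End ℂ L} {P : Fin 4 → Module.End ℂ L} (hP : IsGrading ζ Ω P)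
  {B : L →ₗ[ℂ] L →ₗ[ℂ] W} (hB : IsInvariantForm Ω B)

include hB

theorem eq_zero_of_grade {a b : ℕ} {x y : L} (hx : HasGrade ζ Ω a x) (hy : HasGrade ζ Ω b y)
    (hab : ζ ^ (a + b) ≠ 1) : B x y = 0 := by
  have h := hB.omega x y
  rw [hx, hy, map_smul, map_smul, LinearMap.smul_apply, smul_smul, ← pow_add, ← sub_eq_zero,
    add_comm b,
    ← one_smul ℂ (B x y), smul_smul, mul_one, ← sub_smul] at h
  exact (smul_eq_zero.1 h).resolve_left (sub_ne_zero.2 hab)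

theorem apply_lie_comm (x y z : L) : B x ⁅y, z⁆ = -B y ⁅x, z⁆ := by
  rw [← hB.lie, ← lie_skew, map_neg, LinearMap.neg_apply, hB.lie]

include hP

/-- Only the component of opposite grade contributes to the pairing. -/
theorem apply_proj {a : ℕ} (b : Fin 4) {x : L} (hx : HasGrade ζ Ω a x) (hab : (a + b) % 4 = 0)
    (y : L) : B x y = B x (P b y) := by
  have h : ∀ c : Fin 4, c ≠ b → B x (P c y) = 0 := fun c hc =>
    eq_zero_of_grade hB hx (hP.hasGrade_proj c y) (hP.pow_ne_one (by omega))
  conv_lhs => rw [← hP.sum_proj y, map_add, map_add, map_add]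
  fin_cases b
  · rw [h 1 (by decide), h 2 (by decide), h 3 (by decide)]; simp
  · rw [h 0 (by decide), h 2 (by decide), h 3 (by decide)]; simp
  · rw [h 0 (by decide), h 1 (by decide), h 3 (by decide)]; simp
  · rw [h 0 (by decide), h 1 (by decide), h 2 (by decide)]; simp

theorem apply_lie_proj {a c : ℕ} (b : Fin 4) {x l : L} (hx : HasGrade ζ Ω a x)
    (hl : HasGrade ζ Ω c l) (habc : (a + b + c) % 4 = 0) (y : L) :
    B x ⁅y, l⁆ = B x ⁅P b y, l⁆ := by
  have hl' := hP.hasGrade_lie hl hx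
  rw [← lie_skew, ← lie_skew (P b y), map_neg, map_neg, hB.symm, hB.lie, hB.symm x ⁅l, P b y⁆,
    hB.lie, hB.symm l, hB.symm l, hB.lie, hB.lie]
  rw [hB.symm y, hB.symm (P b y), apply_proj hP hB b (hP.hasGrade_lie hx hl) (by omega)]

variable {d d' : Module.End ℂ L} (hd : ∀ x, d x = P 1 x + (2 : ℂ) • P 2 x + (3 : ℂ) • P 3 x)
  (hd' : ∀ x, d' x = (3 : ℂ) • P 1 x + (2 : ℂ) • P 2 x + P 3 x)

include hd hd'

/-- The operators `d_PS` and `d̂_PS` are transposes of each other. -/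
theorem transpose (x y : L) : B (d x) y = B x (d' y) := by
  have h : ∀ a b : Fin 4, ((a : ℕ) + (b : ℕ)) % 4 = 0 → B (P a x) y = B x (P b y) := by
    intro a b hab
    rw [apply_proj hP hB b (hP.hasGrade_proj a x) hab, hB.symm, hB.symm x,
      ← apply_proj hP hB a (hP.hasGrade_proj b y) (by omega)]
  rw [hd, hd']
  simp only [map_add, map_smul, LinearMap.add_apply, LinearMap.smul_apply]
  rw [h 1 3 rfl, h 2 2 rfl, h 3 1 rfl]
  abel

/-- The density in terms of the undeformed currents: the deformation is the pairing with `V₋`. -/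
theorem lagrangian_eq {𝓡 : Module.End ℂ L} (h𝓡 : ∀ x y, B (𝓡 x) y = -B x (𝓡 y)) (η : ℂ)
    (hinj : ∀ x, x - η • 𝓡 (d x) = 0 → x = 0)
    {Ap Am Np Nm J J' b V : L} (hNp : HasGrade ζ Ω 0 Np) (hNm : HasGrade ζ Ω 0 Nm)
    (hJ : J - η • 𝓡 (d J) = Am) (hJ' : J' + η • 𝓡 (d' J') = Ap) (hb : b - η • 𝓡 (d b) = 𝓡 Nm)
    (hV : V = 𝓡 (d Am + η • d V + (4 : ℂ) • Nm)) :
    (1 / 4 : ℂ) • B Ap (d J) + (B Np (P 0 J) + B Nm (P 0 J')) - B Np (Nm - (4 * η) • b) =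
      (1 / 4 : ℂ) • B Ap (d Am) + B Np Am + B Nm Ap - B Nm Np
      + (η / 4) • B (d' Ap + (4 : ℂ) • Np) V := by
  have ht := transpose hP hB hd hd'
  -- `J₋ = A₋ + η V - 4 η 𝒪₋⁻¹ R_g N₋`: both sides solve the same equation
  have hJV : J = Am + η • V - (4 * η) • b := by
    rw [← sub_eq_zero]
    apply hinj
    simp only [map_add, map_sub, map_smul] at hV ⊢
    linear_combination (norm := module) hJ - η • hV + (4 * η) • hb
  have h0 := apply_proj hP hB 0 hNp rfl J
  have h0' := apply_proj hP hB 0 hNm rfl J'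
  -- `𝒪₊` is the transpose of `𝒪₋`, up to the interchange of `R_g d` and `d R_g`
  have h1 : B Nm J' = B Nm Ap + η • B b (d' Ap) := by
    have e1 : B (𝓡 Nm) (d' J') = B b (d' Ap) := by
      rw [← hb, ← hJ']
      have : B (𝓡 (d b)) (d' J') = -B b (d' (𝓡 (d' J'))) := by rw [h𝓡, ht]
      simp only [map_add, map_sub, map_smul, LinearMap.sub_apply, LinearMap.smul_apply, this]
      module
    have e2 : B Nm (𝓡 (d' J')) = -B (𝓡 Nm) (d' J') := by rw [h𝓡, neg_neg]
    rw [← hJ', map_add, map_smul, e2, e1, ← hJ', map_add d', map_smul d', map_add (B b),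
      map_smul (B b)]
    module
  have h2 : B Ap (d b) = B b (d' Ap) := by rw [hB.symm, ht]
  have h3 : B (d' Ap) V = B Ap (d V) := by rw [hB.symm, ← ht, hB.symm]
  have h4 := hB.symm Nm Np
  rw [← h0, ← h0', h1, hJV]
  simp only [map_add, map_sub, map_smul, LinearMap.add_apply, LinearMap.smul_apply, h2, h3, h4]
  module

/-- Variation of the Lagrangian density without the kinetic terms of the ghosts, expressed by the
deformed currents `K± = A± ∓ η V±` and by `C- = d K- + 4 N-`, `C+ = d̂ K+ + 4 N+`.  Here `ρ` is
the part of the variation `v` of `V-` which is due to the variation of `𝓡`, and the hypotheses `h1`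
to `h5` say that the variation is of first order. -/
theorem lagrangian_variation {𝓡 : Module.End ℂ L} (h𝓡 : ∀ x y, B (𝓡 x) y = -B x (𝓡 y)) (η : ℂ)
    {Ap Am Np Nm Vp Vm Cp Cm ap am np nm v ρ : L}
    (hVp : Vp = 𝓡 Cp) (hCm : Cm = d Am + η • d Vm + (4 : ℂ) • Nm)
    (hCp : Cp = d' Ap - η • d' Vp + (4 : ℂ) • Np)
    (hv : v = 𝓡 (d am + η • d v + (4 : ℂ) • nm) + ρ)
    (h1 : B ap (d am) = 0) (h2 : B np am = 0) (h3 : B nm ap = 0) (h4 : B nm np = 0)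
    (h5 : B (d' ap + (4 : ℂ) • np) v = 0) :
    ((1 / 4 : ℂ) • B (Ap + ap) (d (Am + am)) + B (Np + np) (Am + am) + B (Nm + nm) (Ap + ap)
      - B (Nm + nm) (Np + np)
      + (η / 4) • B (d' (Ap + ap) + (4 : ℂ) • (Np + np)) (Vm + v))
    - ((1 / 4 : ℂ) • B Ap (d Am) + B Np Am + B Nm Ap - B Nm Np
      + (η / 4) • B (d' Ap + (4 : ℂ) • Np) Vm) =
    (1 / 4 : ℂ) • B Cm ap + (1 / 4 : ℂ) • B Cp am + (η / 4) • B Cp ρ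
      + B np (Am + η • Vm - Nm) + B nm (Ap - η • Vp - Np) := by
  have ht := transpose hP hB hd hd'
  have e1 : B Cp v = B Cp ρ - B Vp (d am) - η • B Vp (d v) - (4 : ℂ) • B Vp nm := by
    have : B Cp (𝓡 (d am + η • d v + (4 : ℂ) • nm)) =
        -B Vp (d am + η • d v + (4 : ℂ) • nm) := by
      rw [hVp, h𝓡, neg_neg]
    conv_lhs => rw [hv]
    rw [map_add, this]
    simp only [map_add, map_smul]
    module
  have e2 : B (d' Ap + (4 : ℂ) • Np) v = B Cp v + η • B (d' Vp) v := by
    rw [show d' Ap + (4 : ℂ) • Np = Cp + η • d' Vp by rw [hCp]; abel]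
    simp only [map_add, map_smul, LinearMap.add_apply, LinearMap.smul_apply]
  have e3 : B Ap (d am) = B (d' Ap) am := by rw [hB.symm, ht, hB.symm]
  have e4 : B Vp (d am) = B (d' Vp) am := by rw [hB.symm, ht, hB.symm]
  have e5 : B Vp (d v) = B (d' Vp) v := by rw [hB.symm, ht, hB.symm]
  have e6 : B (d' ap) Vm = B (d Vm) ap := by rw [hB.symm, ← ht]
  have e7 : B ap (d Am) = B (d Am) ap := hB.symm _ _
  have e8 := hB.symm Nm np
  have e9 := hB.symm Vp nm
  have e10 : B Cm ap = B (d Am) ap + η • B (d Vm) ap + (4 : ℂ) • B Nm ap := by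
    rw [hCm]
    simp only [map_add, map_smul, LinearMap.add_apply, LinearMap.smul_apply]
  have e11 : B Cp am = B (d' Ap) am - η • B (d' Vp) am + (4 : ℂ) • B Np am := by
    rw [hCp]
    simp only [map_add, map_sub, map_smul, LinearMap.add_apply, LinearMap.sub_apply,
      LinearMap.smul_apply]
  simp only [map_add, map_sub, map_smul, LinearMap.add_apply, LinearMap.smul_apply]
    at e2 h5 ⊢
  linear_combination (norm := module) (1 / 4 : ℂ) • h1 + h2 + h3 - h4 + (η / 4) • h5 + (η / 4) • e2
    + (η / 4) • e1 + (1 / 4 : ℂ) • e3 - (η / 4) • e4 - (η ^ 2 / 4) • e5 + (η / 4) • e6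
    + (1 / 4 : ℂ) • e7 - e8 - η • e9 - (1 / 4 : ℂ) • e10 - (1 / 4 : ℂ) • e11

/-- The terms of the BRST variation of the density which involve no dressed operator. -/
theorem cubic_identity {Kp Km Np Nm l1 l3 : L} (hl1 : HasGrade ζ Ω 1 l1)
    (hl3 : HasGrade ζ Ω 3 l3) (hNp : HasGrade ζ Ω 0 Np) (hNm : HasGrade ζ Ω 0 Nm)
    (hpure1 : ⁅l1, Nm⁆ = 0) (hpure3 : ⁅l3, Np⁆ = 0) :
    -B (d Km + (4 : ℂ) • Nm) ⁅Kp, l1 + l3⁆ - B (d' Kp + (4 : ℂ) • Np) ⁅Km, l1 + l3⁆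
      + (4 : ℂ) • B ⁅l3, P 1 Kp⁆ (Km - Nm) + (4 : ℂ) • B ⁅l1, P 3 Km⁆ (Kp - Np) =
    B ⁅Kp, l1 - l3⁆ Km := by
  have hg := hP.hasGrade_proj
  have hc := apply_lie_comm hB
  -- decomposition of the pairing into graded components: the brackets of a component of `K₋` with
  -- `l₁`, `l₃` pair with a single component of `K₊`
  have t10 := apply_lie_proj hP hB 3 (hg 0 Km) hl1 rfl Kp
  have t11 := apply_lie_proj hP hB 2 (hg 1 Km) hl1 rfl Kp
  have t12 := apply_lie_proj hP hB 1 (hg 2 Km) hl1 rfl Kp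
  have t13 := apply_lie_proj hP hB 0 (hg 3 Km) hl1 rfl Kp
  have t30 := apply_lie_proj hP hB 1 (hg 0 Km) hl3 rfl Kp
  have t31 := apply_lie_proj hP hB 0 (hg 1 Km) hl3 rfl Kp
  have t32 := apply_lie_proj hP hB 3 (hg 2 Km) hl3 rfl Kp
  have t33 := apply_lie_proj hP hB 2 (hg 3 Km) hl3 rfl Kp
  have s11 : B (P 1 Kp) ⁅Km, l1⁆ = -B (P 2 Km) ⁅P 1 Kp, l1⁆ := by
    rw [apply_lie_proj hP hB 2 (hg 1 Kp) hl1 rfl Km, hc]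
  have s12 : B (P 2 Kp) ⁅Km, l1⁆ = -B (P 1 Km) ⁅P 2 Kp, l1⁆ := by
    rw [apply_lie_proj hP hB 1 (hg 2 Kp) hl1 rfl Km, hc]
  have s13 : B (P 3 Kp) ⁅Km, l1⁆ = -B (P 0 Km) ⁅P 3 Kp, l1⁆ := by
    rw [apply_lie_proj hP hB 0 (hg 3 Kp) hl1 rfl Km, hc]
  have s31 : B (P 1 Kp) ⁅Km, l3⁆ = -B (P 0 Km) ⁅P 1 Kp, l3⁆ := by
    rw [apply_lie_proj hP hB 0 (hg 1 Kp) hl3 rfl Km, hc]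
  have s32 : B (P 2 Kp) ⁅Km, l3⁆ = -B (P 3 Km) ⁅P 2 Kp, l3⁆ := by
    rw [apply_lie_proj hP hB 3 (hg 2 Kp) hl3 rfl Km, hc]
  have s33 : B (P 3 Kp) ⁅Km, l3⁆ = -B (P 2 Km) ⁅P 3 Kp, l3⁆ := by
    rw [apply_lie_proj hP hB 2 (hg 3 Kp) hl3 rfl Km, hc]
  -- the pure spinor constraints enter through the brackets of `l₁` with `N₋` and of `l₃` with `N₊`
  have n1 : B Nm ⁅Kp, l1⁆ = 0 := by
    rw [hc, ← lie_skew, hpure1, neg_zero, map_zero, neg_zero]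
  have n2 := apply_lie_proj hP hB 1 hNm hl3 rfl Kp
  have n3 : B Np ⁅Km, l3⁆ = 0 := by
    rw [hc, ← lie_skew, hpure3, neg_zero, map_zero, neg_zero]
  have n4 := apply_lie_proj hP hB 3 hNp hl1 rfl Km
  have r1 : B ⁅l3, P 1 Kp⁆ Nm = -B Nm ⁅P 1 Kp, l3⁆ := by
    rw [hB.symm, ← lie_skew, map_neg]
  have r2 : B ⁅l1, P 3 Km⁆ Np = -B Np ⁅P 3 Km, l1⁆ := by
    rw [hB.symm, ← lie_skew, map_neg]
  have r3 : B ⁅l3, P 1 Kp⁆ Km = -B (P 0 Km) ⁅P 1 Kp, l3⁆ := by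
    rw [← lie_skew, map_neg, LinearMap.neg_apply, hB.lie, ← lie_skew, map_neg, neg_neg, s31]
  have r4 : B ⁅l1, P 3 Km⁆ Kp = B (P 3 Km) ⁅P 0 Kp, l1⁆ := by
    rw [← lie_skew, map_neg, LinearMap.neg_apply, hB.lie, ← lie_skew, map_neg, neg_neg, t13]
  have r5 : ∀ l, B ⁅Kp, l⁆ Km = B (P 0 Km) ⁅Kp, l⁆ + B (P 1 Km) ⁅Kp, l⁆ + B (P 2 Km) ⁅Kp, l⁆
      + B (P 3 Km) ⁅Kp, l⁆ := fun l => by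
    rw [hB.symm]
    conv_lhs => rw [← hP.sum_proj Km]
    simp only [map_add, LinearMap.add_apply]
  have e1 := r5 l1
  have e3 := r5 l3
  rw [t10, t11, t12, t13] at e1
  rw [t30, t31, t32, t33] at e3
  rw [hd, hd']
  simp only [lie_add, lie_sub, map_add, map_sub, map_smul, LinearMap.add_apply,
    LinearMap.sub_apply, LinearMap.smul_apply]
  rw [e1, e3, t11, t12, t13, t31, t32, t33, s11, s12, s13, s31, s32, s33, n1, n2, n3, n4, r1, r2,
    r3, r4]
  module

/-- The BRST variation of the density, in terms of the currents: up to a total derivative it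
vanishes, by the classical Yang-Baxter equation. -/
theorem brst_variation {𝓡 : Module.End ℂ L} (h𝓡 : ∀ x y, B (𝓡 x) y = -B x (𝓡 y))
    (hcybe : ∀ x y, ⁅𝓡 x, 𝓡 y⁆ = 𝓡 (⁅𝓡 x, y⁆ + ⁅x, 𝓡 y⁆)) (η : ℂ)
    {Kp Km Vp Vm Cp Cm Np Nm l1 l3 x1 x3 y1 y3 Ap Am : L}
    (hl1 : HasGrade ζ Ω 1 l1) (hl3 : HasGrade ζ Ω 3 l3)
    (hx1 : HasGrade ζ Ω 1 x1) (hx3 : HasGrade ζ Ω 3 x3)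
    (hy1 : HasGrade ζ Ω 1 y1) (hy3 : HasGrade ζ Ω 3 y3)
    (hNp : HasGrade ζ Ω 0 Np) (hNm : HasGrade ζ Ω 0 Nm)
    (hpure1 : ⁅l1, Nm⁆ = 0) (hpure3 : ⁅l3, Np⁆ = 0)
    (hVp : Vp = 𝓡 Cp) (hVm : Vm = 𝓡 Cm)
    (hCp : Cp = d' Kp + (4 : ℂ) • Np) (hCm : Cm = d Km + (4 : ℂ) • Nm)
    (hAp : Ap = Kp + η • Vp) (hAm : Am = Km - η • Vm) :
    B Cm (-(x1 + x3 + ⁅Ap, l1 + l3⁆) + η • 𝓡 (x1 - x3 + ⁅Ap, l1 - l3⁆))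
      + B Cp (-(y1 + y3 + ⁅Am, l1 + l3⁆) + η • 𝓡 (y1 - y3 + ⁅Am, l1 - l3⁆))
      + η • B Cp (⁅l1 + l3 - η • 𝓡 (l1 - l3), Vm⁆ - 𝓡 ⁅l1 + l3 - η • 𝓡 (l1 - l3), Cm⁆)
      + (4 : ℂ) • B ⁅l3, P 1 Kp⁆ (Km - Nm) + (4 : ℂ) • B ⁅l1, P 3 Km⁆ (Kp - Np)
      + (4 : ℂ) • B (P 3 Km) x1 + (4 : ℂ) • B (P 1 Kp) y3 =
    B (x1 - x3 + ⁅Ap, l1 - l3⁆) Am - B (y1 - y3) Ap := by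
  have hcub := cubic_identity hP hB hd hd' (Kp := Kp) (Km := Km) hl1 hl3 hNp hNm hpure1 hpure3
  rw [← hCm, ← hCp] at hcub
  have hw : ∀ (k : Fin 4) {x : L}, HasGrade ζ Ω k x → d x = ((k : ℕ) : ℂ) • x := fun k x hx => by
    rw [hd, hP.weight_apply k hx]
  have hw1 : ∀ {x : L}, HasGrade ζ Ω 1 x → d' x = (3 : ℂ) • x := fun {x} hx => by
    rw [hd', hP.proj_self (k := 1) hx, hP.proj_eq_zero 2 1 x hx (by decide),
      hP.proj_eq_zero 3 1 x hx (by decide)]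
    module
  have hw3 : ∀ {x : L}, HasGrade ζ Ω 3 x → d' x = x := fun {x} hx => by
    rw [hd', hP.proj_self (k := 3) hx, hP.proj_eq_zero 2 3 x hx (by decide),
      hP.proj_eq_zero 1 3 x hx (by decide)]
    module
  have ht := transpose hP hB hd hd'
  have hN : ∀ (k : Fin 4) {x N : L}, HasGrade ζ Ω 0 N → HasGrade ζ Ω k x → k ≠ 0 → B N x = 0 :=
    fun k x N hN hx hk => eq_zero_of_grade hB hN hx (hP.pow_ne_one (by omega))
  -- the terms with derivatives of the ghosts
  have d1 : B Cm x1 = (3 : ℂ) • B Km x1 := by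
    rw [hCm, map_add, LinearMap.add_apply, map_smul, LinearMap.smul_apply,
      hN 1 hNm hx1 (by decide), ht, hw1 hx1, map_smul]
    norm_num
  have d2 : B Cm x3 = B Km x3 := by
    rw [hCm, map_add, LinearMap.add_apply, map_smul, LinearMap.smul_apply,
      hN 3 hNm hx3 (by decide), ht, hw3 hx3]
    norm_num
  have ht' : ∀ x y, B (d' x) y = B x (d y) := fun x y => by rw [hB.symm, ← ht, hB.symm]
  have d3 : B Cp y1 = B Kp y1 := by
    rw [hCp, map_add, LinearMap.add_apply, map_smul, LinearMap.smul_apply,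
      hN 1 hNp hy1 (by decide), ht', hw 1 hy1, map_smul]
    norm_num
  have d4 : B Cp y3 = (3 : ℂ) • B Kp y3 := by
    rw [hCp, map_add, LinearMap.add_apply, map_smul, LinearMap.smul_apply,
      hN 3 hNp hy3 (by decide), ht', hw 3 hy3, map_smul]
    norm_num
  have d5 : B (P 3 Km) x1 = B Km x1 := by
    rw [hB.symm, hB.symm Km, ← apply_proj hP hB 3 hx1 rfl]
  have d6 : B (P 1 Kp) y3 = B Kp y3 := by
    rw [hB.symm, hB.symm Kp, ← apply_proj hP hB 1 hy3 rfl]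
  rw [d5, d6]
  generalize l1 + l3 = s at *
  generalize l1 - l3 = m at *
  -- the terms of first and second order in the deformation parameter
  have q0 : ∀ z, B Cm (𝓡 z) = -B Vm z := fun z => by rw [hVm, h𝓡, neg_neg]
  have q0' : ∀ z, B Cp (𝓡 z) = -B Vp z := fun z => by rw [hVp, h𝓡, neg_neg]
  have q1 : B Cm ⁅Vp, s⁆ = B Vp ⁅s, Cm⁆ := by rw [hB.symm, hB.lie]
  have q2 : B Cp ⁅Vm, s⁆ = -B Cp ⁅s, Vm⁆ := by rw [← lie_skew, map_neg]
  have q3 : B ⁅Kp, m⁆ Vm = B Vm ⁅Kp, m⁆ := hB.symm _ _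
  have q4 : B ⁅Vp, m⁆ Km = -B Vp ⁅Km, m⁆ := by rw [hB.lie, ← lie_skew, map_neg]
  have q5 : B ⁅Vp, m⁆ Vm = B Vp ⁅m, Vm⁆ := hB.lie _ _ _
  have q6 : B Vm ⁅Vp, m⁆ = B Vp ⁅m, Vm⁆ := by rw [hB.symm, hB.lie]
  have q7 : B Vp ⁅Vm, m⁆ = -B Vp ⁅m, Vm⁆ := by rw [← lie_skew, map_neg]
  -- the only place where the Yang-Baxter equation is used
  have q8 : B Cp ⁅𝓡 m, Vm⁆ = -(B Vp ⁅𝓡 m, Cm⁆ + B Vp ⁅m, Vm⁆) := by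
    rw [hVm, hcybe, q0', map_add]
  have q9 := hB.symm x1 Km
  have q10 := hB.symm x3 Km
  have q11 := hB.symm x1 Vm
  have q12 := hB.symm x3 Vm
  have q13 := hB.symm y1 Kp
  have q14 := hB.symm y3 Kp
  have q15 := hB.symm y1 Vp
  have q16 := hB.symm y3 Vp
  rw [hAp, hAm]
  simp only [map_neg, map_add, map_sub, map_smul, LinearMap.add_apply,
    LinearMap.sub_apply, LinearMap.smul_apply, add_lie, sub_lie, smul_lie, q0, q0', d1, d2, d3, d4,
    q1, q2, q3, q4, q5, q6, q7, q8, q9, q10, q11, q12, q13, q14, q15, q16] at hcub ⊢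
  linear_combination (norm := module) hcub

end IsInvariantForm

end Graded

/-! ### Invertibility of the dressed operators -/

theorem mul_smul_left_of_central {𝒪 : Type*} [Ring 𝒪] {g : SMat 𝒪}
    (hg : ∀ i j x, g i j * x = x * g i j) (x : 𝒪) (X : SMat 𝒪) :
    g * (x • X) = x • (g * X) := by
  ext i j
  simp only [Matrix.mul_apply, Matrix.smul_apply, smul_eq_mul, Finset.mul_sum]
  refine Finset.sum_congr rfl fun k _ => ?_
  rw [← mul_assoc, hg, mul_assoc]

section Dress

variable {𝒪 : Type*} [Ring 𝒪] [Algebra ℂ 𝒪]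

/-- The operator `w₁ P₁ + w₂ P₂ + w₃ P₃`. -/
def weightOp (w : Fin 3 → ℂ) : Module.End ℂ (SMat 𝒪) :=
  w 0 • proj 1 + w 1 • proj 2 + w 2 • proj 3

theorem weightOp_apply (w : Fin 3 → ℂ) (X : SMat 𝒪) :
    weightOp w X = w 0 • proj 1 X + w 1 • proj 2 X + w 2 • proj 3 X := rfl

/-- The coefficients of `d_PS`. -/
def wMinus : Fin 3 → ℂ := ![1, 2, 3]

/-- The coefficients of `d̂_PS`. -/
def wPlus : Fin 3 → ℂ := ![3, 2, 1]

/-- The common form `1 + c R_g d` of the operators `𝒪_PS±`. -/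
def dressOp (R : Module.End ℂ psl) (c : ℂ) (w : Fin 3 → ℂ) (g : SMat 𝒪) :
    Module.End ℂ (SMat 𝒪) := 1 + c • (Rg R g * weightOp w)

variable (R : Module.End ℂ psl) (c : ℂ) (w : Fin 3 → ℂ)

theorem dressOp_apply (g X : SMat 𝒪) : dressOp R c w g X = X + c • Rg R g (weightOp w X) := rfl

theorem dPS_eq_weightOp : (dPS : Module.End ℂ (SMat 𝒪)) = weightOp wMinus := by
  simp [dPS, weightOp, wMinus]

theorem dPSHat_eq_weightOp : (dPSHat : Module.End ℂ (SMat 𝒪)) = weightOp wPlus := by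
  simp [dPSHat, weightOp, wPlus]

theorem opMinus_eq (η : ℝ) (g : SMat 𝒪) : opMinus R η g = dressOp R (-η) wMinus g := by
  refine LinearMap.ext fun X => ?_
  rw [opMinus_apply, dressOp_apply, dPS_eq_weightOp, neg_smul, sub_eq_add_neg]

theorem opPlus_eq (η : ℝ) (g : SMat 𝒪) : opPlus R η g = dressOp R η wPlus g := by
  rw [opPlus, dressOp, dPSHat_eq_weightOp]

section Map

variable {𝒪' : Type*} [Ring 𝒪'] [Algebra ℂ 𝒪'] (f : 𝒪 →ₐ[ℂ] 𝒪')

theorem map_inverse_of_isUnit {g : SMat 𝒪} (hg : IsUnit g) :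
    Ring.inverse (g.map f) = (Ring.inverse g).map f := by
  have h : ∀ a b : SMat 𝒪, a * b = 1 → a.map f * b.map f = 1 := fun a b hab => by
    rw [← Matrix.map_mul, hab, Matrix.map_one _ (map_zero f) (map_one f)]
  have h1 := h _ _ (Ring.mul_inverse_cancel g hg)
  have h2 := h _ _ (Ring.inverse_mul_cancel g hg)
  exact Ring.inverse_unit ⟨g.map f, (Ring.inverse g).map f, h1, h2⟩

theorem adj_map {g : SMat 𝒪} (hg : IsUnit g) (X : SMat 𝒪) :
    adj (g.map f) (X.map f) = (adj g X).map f := by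
  rw [adj_apply, adj_apply, map_inverse_of_isUnit f hg, ← Matrix.map_mul, ← Matrix.map_mul]
  exact pr_map f.toLinearMap _

theorem adjInv_map {g : SMat 𝒪} (hg : IsUnit g) (X : SMat 𝒪) :
    adjInv (g.map f) (X.map f) = (adjInv g X).map f := by
  rw [adjInv_apply, adjInv_apply, map_inverse_of_isUnit f hg, ← Matrix.map_mul, ← Matrix.map_mul]
  exact pr_map f.toLinearMap _

theorem Rg_map {g : SMat 𝒪} (hg : IsUnit g) (X : SMat 𝒪) :
    Rg R (g.map f) (X.map f) = (Rg R g X).map f := by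
  rw [Rg_apply, Rg_apply, adjInv_map f hg, ← adj_map f hg]
  congr 1
  exact extend_map f.toLinearMap R _

theorem weightOp_map (X : SMat 𝒪) : weightOp w (X.map f) = (weightOp w X).map f := by
  have h := fun k => proj_map f.toLinearMap k X
  simp only [AlgHom.coe_toLinearMap] at h
  ext i j
  simp [weightOp_apply, h]

theorem dressOp_map {g : SMat 𝒪} (hg : IsUnit g) (X : SMat 𝒪) :
    dressOp R c w (g.map f) (X.map f) = (dressOp R c w g X).map f := by
  rw [dressOp_apply, dressOp_apply, weightOp_map, Rg_map R f hg]
  ext i j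
  simp

end Map

section Central

theorem pr_smul_left (x : 𝒪) (X : SMat 𝒪) : pr (x • X) = x • pr X := by
  ext i j
  simp only [pr_apply, Matrix.smul_apply, smul_eq_mul]
  split_ifs
  · simp only [mul_sub, Finset.mul_sum, mul_smul_comm, Finset.smul_sum]
  · simp

theorem omega_smul_left (x : 𝒪) (X : SMat 𝒪) : omega (x • X) = x • omega X := by
  ext i j
  simp only [omega_apply, Matrix.smul_apply, smul_eq_mul, mul_smul_comm]

theorem proj_smul_left (k : ℕ) (x : 𝒪) (X : SMat 𝒪) : proj k (x • X) = x • proj k X := by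
  simp only [proj_apply, omega_smul_left, smul_comm _ x, ← smul_add]

theorem weightOp_smul_left (x : 𝒪) (X : SMat 𝒪) : weightOp w (x • X) = x • weightOp w X := by
  simp only [weightOp_apply, proj_smul_left, smul_comm _ x, ← smul_add]

/-- Over central coefficients the dressed operator is linear in the entries. -/
theorem dressOp_smul_left {g : SMat 𝒪} (hg : ∀ i j x, g i j * x = x * g i j)
    (hg' : ∀ i j x, Ring.inverse g i j * x = x * Ring.inverse g i j) (x : 𝒪) (X : SMat 𝒪) :
    dressOp R c w g (x • X) = x • dressOp R c w g X := by
  rw [dressOp_apply, dressOp_apply, weightOp_smul_left, Rg_apply, Rg_apply, adjInv_apply,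
    adjInv_apply, mul_smul_left_of_central hg', smul_mul_assoc, pr_smul_left, extend_smul_left,
    adj_apply, adj_apply, mul_smul_left_of_central hg, smul_mul_assoc, pr_smul_left, smul_add,
    smul_comm c]

end Central

/-- A two-sided ideal of the ring of coefficients. -/
structure IsIdeal (I : Submodule ℂ 𝒪) : Prop where
  mul_right : ∀ x ∈ I, ∀ y, x * y ∈ I
  mul_left : ∀ x ∈ I, ∀ y, y * x ∈ I

theorem weightOp_mem_entriesIn {I : Submodule ℂ 𝒪} {X : SMat 𝒪} (h : X ∈ entriesIn I) :
    weightOp w X ∈ entriesIn I :=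
  Submodule.add_mem _ (Submodule.add_mem _ (Submodule.smul_mem _ _ (proj_mem_entriesIn 1 h))
    (Submodule.smul_mem _ _ (proj_mem_entriesIn 2 h)))
    (Submodule.smul_mem _ _ (proj_mem_entriesIn 3 h))

variable (𝒪) in
/-- A Grassmann-like ring of coefficients: a commutative ring `S` of bodies, embedded as central
elements, and a finite filtration by ideals whose degree is raised by multiplication with elements
of vanishing body. -/
structure BodyData (S : Type*) [CommRing S] [Algebra ℂ S] where
  /-- The body of an element. -/
  body : 𝒪 →ₐ[ℂ] S
  /-- The inclusion of the bodies. -/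
  incl : S →ₐ[ℂ] 𝒪
  body_incl : ∀ s, body (incl s) = s
  central : ∀ s x, incl s * x = x * incl s
  /-- The filtration by the degree in the generators. -/
  fil : ℕ → Submodule ℂ 𝒪
  fil_zero : fil 0 = ⊤
  isIdeal_fil : ∀ k, IsIdeal (fil k)
  mul_mem : ∀ k x y, body x = 0 → y ∈ fil k → x * y ∈ fil (k + 1)
  mul_mem' : ∀ k x y, body x = 0 → y ∈ fil k → y * x ∈ fil (k + 1)
  /-- The length of the filtration. -/
  len : ℕ
  fil_len : fil len = ⊥

section Product

variable {I I' : Submodule ℂ 𝒪} {p : 𝒪 → Prop}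

theorem mul_mem_entriesIn_of_left (h : ∀ x y, p x → y ∈ I → x * y ∈ I') {n X : SMat 𝒪}
    (hn : ∀ i j, p (n i j)) (hX : X ∈ entriesIn I) : n * X ∈ entriesIn I' := fun i j => by
  rw [Matrix.mul_apply]
  exact I'.sum_mem fun k _ => h _ _ (hn i k) (hX k j)

theorem mul_mem_entriesIn_of_right (h : ∀ x y, p x → y ∈ I → y * x ∈ I') {n X : SMat 𝒪}
    (hn : ∀ i j, p (n i j)) (hX : X ∈ entriesIn I) : X * n ∈ entriesIn I' := fun i j => by
  rw [Matrix.mul_apply]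
  exact I'.sum_mem fun k _ => h _ _ (hn k j) (hX i k)

end Product

/-- Conjugations by matrices with the same body agree modulo the next ideal. -/
theorem conj_sub_mem {I I' : Submodule ℂ 𝒪} (hI : IsIdeal I) (hI' : IsIdeal I') {p : 𝒪 → Prop}
    (h : ∀ x y, p x → y ∈ I → x * y ∈ I') (h' : ∀ x y, p x → y ∈ I → y * x ∈ I')
    {a b a' b' : SMat 𝒪} (ha : ∀ i j, p ((a - a') i j)) (hb : ∀ i j, p ((b - b') i j))
    {X : SMat 𝒪} (hX : X ∈ entriesIn I) : pr (a * X * b) - pr (a' * X * b') ∈ entriesIn I' := by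
  rw [← map_sub]
  apply pr_mem_entriesIn
  rw [show a * X * b - a' * X * b' = (a - a') * X * b + a' * X * (b - b') by noncomm_ring]
  exact Submodule.add_mem _
    (mul_mem_entriesIn_right hI'.mul_right (mul_mem_entriesIn_of_left h ha hX) b)
    (mul_mem_entriesIn_of_right h' hb (mul_mem_entriesIn_left hI.mul_left hX a'))

theorem dressOp_sub_mem {I I' : Submodule ℂ 𝒪} (hI : IsIdeal I) (hI' : IsIdeal I') {p : 𝒪 → Prop}
    (h : ∀ x y, p x → y ∈ I → x * y ∈ I') (h' : ∀ x y, p x → y ∈ I → y * x ∈ I')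
    {g g' : SMat 𝒪} (hg : ∀ i j, p ((g - g') i j))
    (hgi : ∀ i j, p ((Ring.inverse g - Ring.inverse g') i j))
    {X : SMat 𝒪} (hX : X ∈ entriesIn I) :
    dressOp R c w g X - dressOp R c w g' X ∈ entriesIn I' := by
  have hY := weightOp_mem_entriesIn w hX
  have h1 := extend_mem_entriesIn R (conj_sub_mem hI hI' h h' hgi hg hY)
  have h2 := extend_mem_entriesIn R (adjInv_mem_entriesIn hI.mul_right hI.mul_left hY g)
  have h3 := conj_sub_mem hI hI' h h' hg hgi h2
  have h4 := adj_mem_entriesIn hI'.mul_right hI'.mul_left h1 g'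
  have key : dressOp R c w g X - dressOp R c w g' X =
      c • ((adj g (extend R (adjInv g (weightOp w X)))
        - adj g' (extend R (adjInv g (weightOp w X))))
      + adj g' (extend R (adjInv g (weightOp w X) - adjInv g' (weightOp w X)))) := by
    rw [dressOp_apply, dressOp_apply, Rg_apply, Rg_apply, map_sub, map_sub]
    module
  rw [key]
  exact Submodule.smul_mem _ _ (Submodule.add_mem _ h3 h4)

namespace BodyData

variable {S : Type*} [CommRing S] [Algebra ℂ S] (β : BodyData 𝒪 S) {g : SMat 𝒪}

/-- The matrix of the bodies. -/
def bodyMat (g : SMat 𝒪) : SMat 𝒪 := (g.map β.body).map β.incl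

theorem body_sub_bodyMat (X : SMat 𝒪) (i j : Idx) : β.body ((X - β.bodyMat X) i j) = 0 := by
  rw [Matrix.sub_apply, map_sub, bodyMat, Matrix.map_apply, Matrix.map_apply, β.body_incl, sub_self]

theorem inverse_bodyMat (hg : IsUnit g) :
    Ring.inverse (β.bodyMat g) = β.bodyMat (Ring.inverse g) := by
  have h : IsUnit (g.map β.body) := hg.map (β.body.toRingHom.mapMatrix (m := Idx))
  rw [bodyMat, map_inverse_of_isUnit _ h, map_inverse_of_isUnit _ hg, bodyMat]

/-- If the dressed operator at `g` is surjective, the dressed operator at the body of `g` has a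
two-sided inverse whose matrix coefficients are bodies; in particular the inverse preserves all
right ideals of coefficients. -/
theorem exists_inverse_bodyMat (hg : IsUnit g) (hO : Function.Surjective (dressOp R c w g)) :
    ∃ W : Module.End ℂ (SMat 𝒪), (∀ X, dressOp R c w (β.bodyMat g) (W X) = X) ∧
      (∀ X, W (dressOp R c w (β.bodyMat g) X) = X) ∧
      ∀ I : Submodule ℂ 𝒪, (∀ x ∈ I, ∀ y, x * y ∈ I) → ∀ X ∈ entriesIn I, W X ∈ entriesIn I := by
  have hb : IsUnit (g.map β.body) := hg.map (β.body.toRingHom.mapMatrix (m := Idx))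
  set gS : SMat S := g.map β.body with hgS
  -- the operator over the commutative ring of bodies is linear and surjective
  let T : SMat S →ₗ[S] SMat S :=
    { toFun := dressOp R c w gS
      map_add' := map_add _
      map_smul' := fun x X => dressOp_smul_left R c w (fun _ _ _ => mul_comm _ _)
        (fun _ _ _ => mul_comm _ _) x X }
  have hT : Function.Surjective T := fun Y => by
    obtain ⟨X, hX⟩ := hO (Y.map β.incl)
    refine ⟨X.map β.body, ?_⟩
    change dressOp R c w gS (X.map β.body) = Y
    rw [hgS, dressOp_map R c w β.body hg, hX]
    ext i j
    exact β.body_incl _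
  -- a surjective endomorphism of a finite module over a commutative ring is bijective
  have hT' : Function.Injective T := OrzechProperty.injective_of_surjective_endomorphism T hT
  let T' := LinearEquiv.ofBijective T ⟨hT', hT⟩
  have hTT' : ∀ X, dressOp R c w gS (T'.symm X) = X := fun X => T'.apply_symm_apply X
  have hT'T : ∀ X, T'.symm (dressOp R c w gS X) = X := fun X => T'.symm_apply_apply X
  have hnat : ∀ Y : SMat S, dressOp R c w (β.bodyMat g) (Y.map β.incl) =
      (dressOp R c w gS Y).map β.incl := fun Y => dressOp_map R c w β.incl hb Y
  have hcen : ∀ (X : SMat S) (i j : Idx) (x : 𝒪), X.map β.incl i j * x = x * X.map β.incl i j :=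
    fun X i j x => β.central _ _
  have hlin : ∀ (x : 𝒪) (X : SMat 𝒪), dressOp R c w (β.bodyMat g) (x • X) =
      x • dressOp R c w (β.bodyMat g) X := dressOp_smul_left R c w (hcen _)
    (by rw [β.inverse_bodyMat hg]; exact hcen _)
  have hsum : ∀ X : SMat 𝒪, X = ∑ p : Idx × Idx,
      X p.1 p.2 • (Matrix.single p.1 p.2 (1 : S)).map β.incl := fun X => by
    conv_lhs => rw [Matrix.matrix_eq_sum_single X]
    rw [Fintype.sum_prod_type]
    refine Finset.sum_congr rfl fun i _ => Finset.sum_congr rfl fun j _ => ?_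
    ext k l
    rw [Matrix.smul_apply, Matrix.map_apply, Matrix.single_apply, Matrix.single_apply]
    split_ifs <;> simp
  have hsumS : ∀ Y : SMat S, Y = ∑ p : Idx × Idx, Y p.1 p.2 • Matrix.single p.1 p.2 (1 : S) :=
    fun Y => by
      conv_lhs => rw [Matrix.matrix_eq_sum_single Y]
      rw [Fintype.sum_prod_type]
      refine Finset.sum_congr rfl fun i _ => Finset.sum_congr rfl fun j _ => ?_
      rw [Matrix.smul_single, smul_eq_mul, mul_one]
  -- extension of scalars of the inverse along the inclusion of the bodies
  let W : Module.End ℂ (SMat 𝒪) :=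
    { toFun := fun X => ∑ p : Idx × Idx,
        X p.1 p.2 • (T'.symm (Matrix.single p.1 p.2 1)).map β.incl
      map_add' := fun X Y => by simp only [Matrix.add_apply, add_smul, Finset.sum_add_distrib]
      map_smul' := fun c X => by
        simp only [Matrix.smul_apply, smul_assoc, Finset.smul_sum, RingHom.id_apply] }
  have hW : ∀ X, W X = ∑ p : Idx × Idx,
    X p.1 p.2 • (T'.symm (Matrix.single p.1 p.2 1)).map β.incl := fun X => rfl
  have hWS : ∀ Y : SMat S, W (Y.map β.incl) = (T'.symm Y).map β.incl := fun Y => by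
    conv_rhs => rw [hsumS Y, map_sum]
    rw [hW]
    ext i j
    simp only [Matrix.sum_apply, Matrix.smul_apply, Matrix.map_apply, map_smul, smul_eq_mul,
      map_sum, map_mul]
  refine ⟨W, fun X => ?_, fun X => ?_, fun I hI X hX i j => ?_⟩
  · conv_rhs => rw [hsum X]
    rw [hW, map_sum]
    refine Finset.sum_congr rfl fun p _ => ?_
    rw [hlin, hnat, hTT']
  · have hWlin : ∀ (x : 𝒪) (X : SMat 𝒪), W (x • X) = x • W X := fun x X => by
      simp only [hW, Matrix.smul_apply, smul_assoc, Finset.smul_sum]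
    conv_lhs => rw [hsum X]
    conv_rhs => rw [hsum X]
    rw [map_sum, map_sum]
    refine Finset.sum_congr rfl fun p _ => ?_
    rw [hlin, hnat, hWlin, hWS, hT'T]
  · rw [hW, Matrix.sum_apply]
    exact I.sum_mem fun p _ => hI _ (hX _ _) _

theorem dressOp_sub_bodyMat_mem (hg : IsUnit g) {I : Submodule ℂ 𝒪} (hI : IsIdeal I) (k : ℕ)
    {X : SMat 𝒪} (hX : X ∈ entriesIn (I ⊔ β.fil k)) :
    dressOp R c w g X - dressOp R c w (β.bodyMat g) X ∈ entriesIn (I ⊔ β.fil (k + 1)) := by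
  have hid : ∀ k, IsIdeal (I ⊔ β.fil k) := fun k =>
    ⟨fun x hx y => by
      obtain ⟨a, ha, b, hb, rfl⟩ := Submodule.mem_sup.1 hx
      rw [add_mul]
      exact Submodule.add_mem_sup (hI.mul_right a ha y) ((β.isIdeal_fil k).mul_right b hb y),
    fun x hx y => by
      obtain ⟨a, ha, b, hb, rfl⟩ := Submodule.mem_sup.1 hx
      rw [mul_add]
      exact Submodule.add_mem_sup (hI.mul_left a ha y) ((β.isIdeal_fil k).mul_left b hb y)⟩
  refine dressOp_sub_mem R c w (hid k) (hid (k + 1)) (p := fun x => β.body x = 0) ?_ ?_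
    (β.body_sub_bodyMat g) (by rw [β.inverse_bodyMat hg]; exact β.body_sub_bodyMat _) hX
  · intro x y hx hy
    obtain ⟨a, ha, b, hb, rfl⟩ := Submodule.mem_sup.1 hy
    rw [mul_add]
    exact Submodule.add_mem_sup (hI.mul_left a ha x) (β.mul_mem k x b hx hb)
  · intro x y hx hy
    obtain ⟨a, ha, b, hb, rfl⟩ := Submodule.mem_sup.1 hy
    rw [add_mul]
    exact Submodule.add_mem_sup (hI.mul_right a ha x) (β.mul_mem' k x b hx hb)

/-- The inverse of a dressed operator preserves all ideals of coefficients. -/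
theorem mem_entriesIn_of_dressOp_mem (β : BodyData 𝒪 S) (hg : IsUnit g)
    (hO : Function.Surjective (dressOp R c w g)) {I : Submodule ℂ 𝒪} (hI : IsIdeal I)
    {X : SMat 𝒪} (hX : dressOp R c w g X ∈ entriesIn I) : X ∈ entriesIn I := by
  obtain ⟨W, -, hW, hWI⟩ := β.exists_inverse_bodyMat R c w hg hO
  -- induction on the filtration: `X = W (O X - (O - O_body) X)` for the inverse `W` of `O_body`,
  -- and `O - O_body` raises the degree
  have hk : ∀ k, X ∈ entriesIn (I ⊔ β.fil k) := by
    intro k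
    induction k with
    | zero =>
      rw [β.fil_zero, sup_top_eq]
      exact fun _ _ => Submodule.mem_top
    | succ k ih =>
      have h1 := β.dressOp_sub_bodyMat_mem R c w hg hI k ih
      have h2 : X = W (dressOp R c w g X - (dressOp R c w g X - dressOp R c w (β.bodyMat g) X)) := by
        rw [sub_sub_cancel, hW]
      rw [h2]
      refine hWI _ ?_ _ (Submodule.sub_mem _ (fun i j => Submodule.mem_sup_left (hX i j)) h1)
      intro x hx y
      obtain ⟨a, ha, b, hb, rfl⟩ := Submodule.mem_sup.1 hx
      rw [add_mul]
      exact Submodule.add_mem_sup (hI.mul_right a ha y)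
        ((β.isIdeal_fil (k + 1)).mul_right b hb y)
  have := hk β.len
  rwa [β.fil_len, sup_bot_eq] at this

/-- The invertibility of a dressed operator depends only on the body of `g`. -/
theorem isUnit_dressOp_of_body_eq {g' : SMat 𝒪} (hg : IsUnit g) (hg' : IsUnit g')
    (hgg' : ∀ i j, β.body (g' i j) = β.body (g i j)) (hO : IsUnit (dressOp R c w g)) :
    IsUnit (dressOp R c w g') := by
  obtain ⟨W, hW', hW, hWI⟩ := β.exists_inverse_bodyMat R c w hg
    ((Module.End.isUnit_iff _).1 hO).surjective
  have hb : β.bodyMat g = β.bodyMat g' := by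
    ext i j
    simp only [bodyMat, Matrix.map_apply, hgg']
  rw [hb] at hW hW'
  set O' := dressOp R c w g'
  set O := dressOp R c w (β.bodyMat g')
  have hbot : IsIdeal (⊥ : Submodule ℂ 𝒪) := by
    constructor
    · intro x hx y
      rw [(Submodule.mem_bot ℂ).1 hx, zero_mul]
      exact Submodule.zero_mem _
    · intro x hx y
      rw [(Submodule.mem_bot ℂ).1 hx, mul_zero]
      exact Submodule.zero_mem _
  -- both operators have the same part of degree zero, which is invertible; the remainder raises the
  -- degree and is nilpotent
  have hnil : ∀ k X, (W * (O' - O)) ^ k • X ∈ entriesIn (β.fil k) := by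
    intro k
    induction k with
    | zero =>
      intro X
      rw [β.fil_zero]
      exact fun _ _ => Submodule.mem_top
    | succ k ih =>
      intro X
      rw [pow_succ', mul_smul]
      refine hWI _ (β.isIdeal_fil _).mul_right _ ?_
      have := β.dressOp_sub_bodyMat_mem R c w hg' hbot k (X := (W * (O' - O)) ^ k • X)
        (by rw [bot_sup_eq]; exact ih X)
      rwa [bot_sup_eq] at this
  have hN : IsNilpotent (W * (O' - O)) := ⟨β.len, by
    ext X i j
    have := hnil β.len X i j
    rw [β.fil_len, Submodule.mem_bot] at this
    exact this⟩
  have hOW : O * W = 1 := LinearMap.ext hW'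
  have hWO : W * O = 1 := LinearMap.ext hW
  have : O' = O * (1 + W * (O' - O)) := by
    rw [mul_add, ← mul_assoc, hOW, mul_one, one_mul, add_sub_cancel]
  rw [this]
  exact IsUnit.mul ⟨⟨O, W, hOW, hWO⟩, rfl⟩ hN.isUnit_one_add

end BodyData

end Dress

/-! ### Ghosts: odd supermatrices with commuting components -/

section OddIdeal

variable {𝒪 : Type*} [Ring 𝒪] [Algebra ℂ 𝒪]

variable (𝒪) in
/-- The ideal generated by an odd parameter. -/
def oddIdeal (ε : 𝒪) : Submodule ℂ 𝒪 := LinearMap.range (LinearMap.mulLeft ℂ ε)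

theorem smul_mem_oddIdeal (ε : 𝒪) (X : SMat 𝒪) : ε • X ∈ entriesIn (oddIdeal 𝒪 ε) :=
  fun i j => ⟨X i j, rfl⟩

end OddIdeal

section Ghost

open SuperRing

variable {𝒪 : Type*} [Ring 𝒪] [Algebra ℂ 𝒪] [SuperRing 𝒪]

theorem eq_zero_of_eq_neg {M : Type*} [AddCommGroup M] [Module ℂ M] {x : M} (h : x = -x) :
    x = 0 := by
  have : (2 : ℂ) • x = 0 := by rw [two_smul]; nth_rewrite 1 [h]; exact neg_add_cancel x
  exact (smul_eq_zero.1 this).resolve_left two_ne_zero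

theorem odd_mul_self {ε : 𝒪} (hε : par ε = -ε) : ε * ε = 0 :=
  eq_zero_of_eq_neg (mul_anticomm_of_odd ε ε hε hε)

theorem mul_odd {ε : 𝒪} (hε : par ε = -ε) (x : 𝒪) : x * ε = ε * par x := by
  have h0 : par ((1 / 2 : ℂ) • (x + par x)) = (1 / 2 : ℂ) • (x + par x) := by
    rw [map_smul, map_add, par_par, add_comm]
  have h1 : par ((1 / 2 : ℂ) • (x - par x)) = -((1 / 2 : ℂ) • (x - par x)) := by
    rw [map_smul, map_sub, par_par, ← smul_neg, neg_sub]
  have e0 := mul_comm_of_even _ h0 ε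
  have e1 := mul_anticomm_of_odd _ _ h1 hε
  have hx : x = (1 / 2 : ℂ) • (x + par x) + (1 / 2 : ℂ) • (x - par x) := by module
  have hx' : par x = (1 / 2 : ℂ) • (x + par x) - (1 / 2 : ℂ) • (x - par x) := by module
  rw [hx', mul_sub, ← e0, sub_eq_add_neg, ← e1, ← add_mul, ← hx]

theorem par_odd_mul_odd {ε ε' : 𝒪} (hε : par ε = -ε) (hε' : par ε' = -ε') :
    par (ε * ε') = ε * ε' := by
  rw [map_mul, hε, hε', neg_mul_neg]

theorem mul_smul_odd {ε : 𝒪} (hε : par ε = -ε) (X Y : SMat 𝒪) :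
    X * (ε • Y) = ε • (X.map par * Y) := by
  ext i j
  simp only [Matrix.mul_apply, Matrix.smul_apply, smul_eq_mul, Finset.mul_sum, Matrix.map_apply]
  refine Finset.sum_congr rfl fun k _ => ?_
  rw [← mul_assoc, mul_odd hε, mul_assoc]

theorem isNilIdeal_oddIdeal {ε : 𝒪} (hε : par ε = -ε) : IsNilIdeal (oddIdeal 𝒪 ε) where
  mul_right := by
    rintro _ ⟨x, rfl⟩ y
    exact ⟨x * y, (mul_assoc _ _ _).symm⟩
  mul_left := by
    rintro _ ⟨x, rfl⟩ y
    refine ⟨par y * x, ?_⟩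
    rw [LinearMap.mulLeft_apply, LinearMap.mulLeft_apply, ← mul_assoc, ← mul_assoc, mul_odd hε]
  mul_eq_zero := by
    rintro _ ⟨x, rfl⟩ _ ⟨y, rfl⟩
    rw [LinearMap.mulLeft_apply, LinearMap.mulLeft_apply, mul_assoc, ← mul_assoc x, mul_odd hε,
      mul_assoc, ← mul_assoc, odd_mul_self hε, zero_mul]

/-- A supermatrix with vanishing diagonal blocks and even entries: an odd element of `gl(4|4)` with
commuting components. -/
structure IsGhost (X : SMat 𝒪) : Prop where
  even : ∀ i j, par (X i j) = X i j
  off : ∀ i j, sgn i = sgn j → X i j = 0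

theorem sgn_mul_of_ne {i j : Idx} (h : sgn i ≠ sgn j) : sgn i * sgn j = -1 := by
  rcases i with i | i <;> rcases j with j | j <;> simp_all

theorem sgn_mul_of_eq {i j : Idx} (h : sgn i = sgn j) : sgn i * sgn j = 1 := by
  rw [h, sgn_mul_self]

theorem map_par_of_off {X : SMat 𝒪} (hX : sPar X = X) (h : ∀ i j, sgn i = sgn j → X i j = 0) :
    X.map par = -X := by
  ext i j
  rw [Matrix.map_apply, sPar_eq_self_iff.1 hX, Matrix.neg_apply]
  by_cases hij : sgn i = sgn j
  · rw [h i j hij, smul_zero, neg_zero]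
  · rw [sgn_mul_of_ne hij, neg_one_smul]

theorem map_par_of_diag {X : SMat 𝒪} (hX : sPar X = X) (h : ∀ i j, sgn i ≠ sgn j → X i j = 0) :
    X.map par = X := by
  ext i j
  rw [Matrix.map_apply, sPar_eq_self_iff.1 hX]
  by_cases hij : sgn i = sgn j
  · rw [sgn_mul_of_eq hij, one_smul]
  · rw [h i j hij, smul_zero]

theorem isGhost_odd_smul {ε : 𝒪} (hε : par ε = -ε) {X : SMat 𝒪} (hX : sPar X = X)
    (h : ∀ i j, sgn i = sgn j → X i j = 0) : IsGhost (ε • X) where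
  even i j := by
    have := congrFun (congrFun (map_par_of_off hX h) i) j
    rw [Matrix.map_apply, Matrix.neg_apply] at this
    rw [Matrix.smul_apply, smul_eq_mul, map_mul, hε, this, neg_mul_neg]
  off i j hij := by rw [Matrix.smul_apply, h i j hij, smul_zero]

namespace IsGhost

variable {X Y : SMat 𝒪} (hX : IsGhost X) (hY : IsGhost Y)

include hX

theorem map_par : X.map par = X := by
  ext i j
  exact hX.even i j

theorem pr_eq : pr X = X := pr_eq_self_of_diag fun i => hX.off i i rfl

theorem sPar_smul {ε : 𝒪} (hε : par ε = -ε) : sPar (ε • X) = ε • X := by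
  rw [sPar_eq_self_iff]
  intro i j
  rw [Matrix.smul_apply, smul_eq_mul, map_mul, hε, hX.even]
  by_cases hij : sgn i = sgn j
  · rw [hX.off i j hij, mul_zero, mul_zero, smul_zero]
  · rw [sgn_mul_of_ne hij, neg_one_smul, neg_mul]

theorem omega : IsGhost (omega X) where
  even i j := by rw [omega_apply, map_smul, hX.even]
  off i j hij := by rw [omega_apply, hX.off _ _ (by rw [sgn_swp, sgn_swp, hij]), smul_zero]

theorem mul_smul_odd {ε : 𝒪} (hε : par ε = -ε) (Z : SMat 𝒪) : X * (ε • Z) = ε • (X * Z) := by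
  rw [PureSpinorYB.mul_smul_odd hε, hX.map_par]

theorem str_mul (Y : SMat 𝒪) : str (X * Y) = -str (Y * X) := by
  simp only [str_eq_sum, Matrix.mul_apply, Finset.smul_sum]
  rw [Finset.sum_comm, ← Finset.sum_neg_distrib]
  refine Finset.sum_congr rfl fun j _ => ?_
  rw [← Finset.sum_neg_distrib]
  refine Finset.sum_congr rfl fun i _ => ?_
  rw [mul_comm_of_even _ (hX.even i j)]
  by_cases hij : sgn i = sgn j
  · rw [hX.off i j hij, mul_zero, smul_zero, smul_zero, neg_zero]
  · rw [← neg_smul]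
    congr 1
    rcases i with i | i <;> rcases j with j | j <;> simp_all

theorem str_anticomm (Y : SMat 𝒪) : str (X * Y + Y * X) = 0 := by
  rw [str_add, str_mul hX Y, neg_add_cancel]

include hY

theorem add : IsGhost (X + Y) where
  even i j := by rw [Matrix.add_apply, map_add, hX.even, hY.even]
  off i j hij := by rw [Matrix.add_apply, hX.off i j hij, hY.off i j hij, add_zero]

theorem mul_apply_even (i j : Idx) : par ((X * Y) i j) = (X * Y) i j := by
  rw [Matrix.mul_apply, map_sum]
  exact Finset.sum_congr rfl fun k _ => by rw [map_mul, hX.even, hY.even]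

theorem mul_apply_off (i j : Idx) (hij : sgn i ≠ sgn j) : (X * Y) i j = 0 := by
  rw [Matrix.mul_apply]
  refine Finset.sum_eq_zero fun k _ => ?_
  by_cases hik : sgn i = sgn k
  · rw [hX.off i k hik, zero_mul]
  · rw [hY.off k j, mul_zero]
    rcases i with i | i <;> rcases j with j | j <;> rcases k with k | k <;> simp_all

theorem sPar_mul : sPar (X * Y) = X * Y := by
  rw [sPar_eq_self_iff]
  intro i j
  rw [mul_apply_even hX hY]
  by_cases hij : sgn i = sgn j
  · rw [sgn_mul_of_eq hij, one_smul]
  · rw [mul_apply_off hX hY i j hij, smul_zero]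

theorem sPar_anticomm : sPar (X * Y + Y * X) = X * Y + Y * X := by
  rw [map_add, sPar_mul hX hY, sPar_mul hY hX]

theorem omega_mul : PureSpinorYB.omega (X * Y) =
    PureSpinorYB.omega Y * PureSpinorYB.omega X := by
  ext i j
  rw [omega_apply, Matrix.mul_apply, Matrix.mul_apply, Finset.smul_sum, ← sum_swp]
  refine Finset.sum_congr rfl fun k _ => ?_
  rw [omega_apply, omega_apply, smul_mul_smul_comm, mul_comm_of_even _ (hX.even _ _)]
  have h3 := kap_mul_self k
  by_cases hik : sgn i = sgn k
  · rw [hY.off _ _ (by rw [sgn_swp, sgn_swp, hik]), zero_mul, smul_zero, smul_zero]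
  by_cases hkj : sgn k = sgn j
  · rw [hX.off _ _ (by rw [sgn_swp, sgn_swp, hkj]), mul_zero, smul_zero, smul_zero]
  · congr 1
    have h4 : tau i k * tau k j = -tau i j := by
      rcases i with i | i <;> rcases j with j | j <;> rcases k with k | k <;>
        simp_all [tau, sgn]
    linear_combination (-kap i * kap j * tau i k * tau k j) * h3 - (kap i * kap j) * h4

theorem omega_anticomm {z z' : ℂ} (h : PureSpinorYB.omega X = z • X)
    (h' : PureSpinorYB.omega Y = z' • Y) :
    PureSpinorYB.omega (X * Y + Y * X) = (z * z') • (X * Y + Y * X) := by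
  rw [map_add, omega_mul hX hY, omega_mul hY hX, h, h', smul_mul_smul_comm, smul_mul_smul_comm,
    add_comm, smul_add, mul_comm z]

end IsGhost

/-- The class of a ghost, multiplied by an odd parameter, in the envelope. -/
def ghostEnv {ε : 𝒪} (hε : par ε = -ε) {X : SMat 𝒪} (hX : IsGhost X) : Env 𝒪 :=
  ⟨ε • X, hX.sPar_smul hε, by rw [pr_smul_left, hX.pr_eq]⟩

theorem coe_ghostEnv {ε : 𝒪} (hε : par ε = -ε) {X : SMat 𝒪} (hX : IsGhost X) :
    (ghostEnv hε hX).1 = ε • X := rfl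

/-- The class of the anticommutator of two ghosts in the envelope. -/
def antiEnv {X Y : SMat 𝒪} (hX : IsGhost X) (hY : IsGhost Y) : Env 𝒪 :=
  toEnv (X * Y + Y * X) (hX.sPar_anticomm hY)

theorem coe_antiEnv {X Y : SMat 𝒪} (hX : IsGhost X) (hY : IsGhost Y) :
    (antiEnv hX hY).1 = pr (X * Y + Y * X) := rfl

theorem omega_antiEnv {X Y : SMat 𝒪} (hX : IsGhost X) (hY : IsGhost Y) {z z' : ℂ}
    (h : omega X = z • X) (h' : omega Y = z' • Y) :
    envOmega (antiEnv hX hY) = (z * z') • antiEnv hX hY := by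
  apply Subtype.ext
  rw [coe_envOmega, Submodule.coe_smul, coe_antiEnv, ← pr_omega, hX.omega_anticomm hY h h',
    map_smul]

theorem mul_self_eq_smul_one {X : SMat 𝒪} (hX : IsGhost X) (hpure : pr (X * X) = 0) :
    ∃ z : 𝒪, par z = z ∧ X * X = z • (1 : SMat 𝒪) := by
  obtain ⟨z, hz, h⟩ := exists_eq_pr_add (hX.sPar_mul hX) (eq_zero_of_eq_neg (hX.str_mul X))
  exact ⟨z, hz, by rw [hpure, zero_add] at h; exact h⟩

/-- The consequence of the pure spinor constraint: a ghost commutes with its anticommutators. -/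
theorem lie_antiEnv_eq_zero {ε : 𝒪} (hε : par ε = -ε) {X W : SMat 𝒪} (hX : IsGhost X)
    (hW : IsGhost W) (hpure : pr (X * X) = 0) : ⁅ghostEnv hε hX, antiEnv hW hX⁆ = 0 := by
  apply Subtype.ext
  obtain ⟨z, hz, h⟩ := mul_self_eq_smul_one hX hpure
  have h1 : (W * X + X * W) * (ε • X) = ε • ((W * X + X * W) * X) := by
    rw [add_mul, mul_assoc, mul_assoc, hX.mul_smul_odd hε, hW.mul_smul_odd hε, hW.mul_smul_odd hε,
      hX.mul_smul_odd hε, ← smul_add, add_mul, mul_assoc, mul_assoc]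
  rw [Env.coe_lie, coe_ghostEnv, coe_antiEnv, pr_commutator_pr_right (hW.sPar_anticomm hX)
    (hW.str_anticomm X), h1, smul_mul_assoc, ← smul_sub,
    show X * (W * X + X * W) - (W * X + X * W) * X = X * X * W - W * (X * X) by noncomm_ring, h,
    smul_mul_of_even hz, mul_one, smul_mul_assoc, one_mul, sub_self, smul_zero, map_zero]
  rfl

/-- The bracket of two ghosts with odd parameters. -/
theorem lie_ghostEnv {ε ε' : 𝒪} (hε : par ε = -ε) (hε' : par ε' = -ε') {X Y : SMat 𝒪}
    (hX : IsGhost X) (hY : IsGhost Y) :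
    (⁅ghostEnv hε hX, ghostEnv hε' hY⁆ : Env 𝒪).1 = (ε * ε') • pr (X * Y + Y * X) := by
  rw [Env.coe_lie, coe_ghostEnv, coe_ghostEnv, smul_mul_assoc, smul_mul_assoc,
    hX.mul_smul_odd hε', hY.mul_smul_odd hε, smul_smul, smul_smul,
    mul_anticomm_of_odd ε' ε hε' hε, neg_smul, sub_neg_eq_add, ← smul_add, pr_smul_left]

theorem lie_ghostEnv_self_eq_zero {ε ε' : 𝒪} (hε : par ε = -ε) (hε' : par ε' = -ε') {X : SMat 𝒪}
    (hX : IsGhost X) (hpure : pr (X * X) = 0) : ⁅ghostEnv hε hX, ghostEnv hε' hX⁆ = 0 := by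
  apply Subtype.ext
  rw [lie_ghostEnv hε hε' hX hX, map_add, hpure, add_zero, smul_zero]
  rfl

/-! ### The grading of the envelope -/

variable (𝒪) in
/-- The projectors on the graded components, in the order of the grades. -/
def gradeProj : Fin 4 → Module.End ℂ (Env 𝒪) := ![envProj 0, envProj 1, envProj 2, envProj 3]

theorem I_pow_ne {j k : Fin 4} (h : j ≠ k) : Complex.I ^ (j : ℕ) ≠ Complex.I ^ (k : ℕ) := by
  fin_cases j <;> fin_cases k <;>
    first | exact absurd rfl h | norm_num [Complex.ext_iff, pow_succ]

theorem isGrading_env : IsGrading Complex.I (envOmega (𝒪 := 𝒪)) (gradeProj 𝒪) where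
  sq := Complex.I_mul_I
  omega_lie := envOmega_lie
  omega_proj k X := by fin_cases k <;> exact Subtype.ext (omega_proj _ X.1)
  sum_proj X := Subtype.ext (sum_proj X.1)
  proj_eq_zero j k X h hjk := by
    have h' := I_pow_ne hjk
    fin_cases j <;> exact Subtype.ext (proj_eq_zero (Subtype.ext_iff.1 h) h')

theorem isInvariantForm_sForm : IsInvariantForm (envOmega (𝒪 := 𝒪)) sForm :=
  ⟨sForm_comm, sForm_lie, sForm_envOmega⟩

end Ghost

/-! ### The deformed currents in the envelope -/

section Current

open SuperRing

variable {𝒪 : Type*} [Ring 𝒪] [Algebra ℂ 𝒪] [SuperRing 𝒪]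

/-- The operator `w₁ P₁ + w₂ P₂ + w₃ P₃` on the envelope. -/
def envWeight (w : Fin 3 → ℂ) : Module.End ℂ (Env 𝒪) :=
  w 0 • envProj 1 + w 1 • envProj 2 + w 2 • envProj 3

theorem envWeight_minus (X : Env 𝒪) : envWeight wMinus X =
    gradeProj 𝒪 1 X + (2 : ℂ) • gradeProj 𝒪 2 X + (3 : ℂ) • gradeProj 𝒪 3 X := by
  change (1 : ℂ) • envProj 1 X + _ + _ = _
  rw [one_smul]
  rfl

theorem envWeight_plus (X : Env 𝒪) : envWeight wPlus X =
    (3 : ℂ) • gradeProj 𝒪 1 X + (2 : ℂ) • gradeProj 𝒪 2 X + gradeProj 𝒪 3 X := by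
  change _ + _ + (1 : ℂ) • envProj 3 X = _
  rw [one_smul]
  rfl

theorem sPar_weightOp (w : Fin 3 → ℂ) (X : SMat 𝒪) :
    sPar (weightOp w X) = weightOp w (sPar X) := by
  simp only [weightOp_apply, map_add, map_smul, sPar_proj]

theorem sPar_Rg {R : Module.End ℂ psl} (hR : IsYangBaxter R) {g : SMat 𝒪} (hg : IsEvenUnit g)
    (X : SMat 𝒪) : sPar (Rg R g X) = Rg R g (sPar X) := by
  rw [Rg_apply, Rg_apply, adj_apply, adj_apply, adjInv_apply, adjInv_apply, sPar_pr,
    map_mul sPar, map_mul sPar, sPar_extend hR, sPar_pr, map_mul sPar, map_mul sPar, hg.even,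
    hg.inv_even]

section

variable {R : Module.End ℂ psl} (hR : IsYangBaxter R) {g : SMat 𝒪} (hg : IsEvenUnit g) (c : ℂ)
  (w : Fin 3 → ℂ)

include hR hg in
theorem dressOp_inverse_mem (X : SMat 𝒪) (hX : X ∈ envelope 𝒪) :
    Ring.inverse (dressOp R c w g) X ∈ envelope 𝒪 := by
  by_cases hO : IsUnit (dressOp R c w g)
  · have h : ∀ Y, dressOp R c w g (Ring.inverse (dressOp R c w g) Y) = Y :=
      fun Y => LinearMap.congr_fun (Ring.mul_inverse_cancel _ hO) Y
    have hinj := ((Module.End.isUnit_iff _).1 hO).injective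
    have h1 := h X
    have h2 : ∀ Y : SMat 𝒪, sPar (dressOp R c w g Y) = dressOp R c w g (sPar Y) := fun Y => by
      rw [dressOp_apply, dressOp_apply, map_add, map_smul, sPar_Rg hR hg, sPar_weightOp]
    refine ⟨hinj ?_, ?_⟩
    · rw [← h2, h1, hX.1]
    · rw [dressOp_apply] at h1
      rw [eq_sub_of_add_eq h1, map_sub, map_smul, pr_Rg, hX.2]
  · rw [Ring.inverse_non_unit _ hO]
    exact Submodule.zero_mem _

/-- The inverse of a dressed operator on the envelope. -/
def envDressInv : Module.End ℂ (Env 𝒪) :=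
  (Ring.inverse (dressOp R c w g)).restrict fun X hX => dressOp_inverse_mem hR hg c w X hX

variable {c w} (hO : IsUnit (dressOp R c w g))

include hO

theorem envDressInv_spec (X : Env 𝒪) :
    envDressInv hR hg c w X + c • envRg hR hg (envWeight w (envDressInv hR hg c w X)) = X :=
  Subtype.ext (LinearMap.congr_fun (Ring.mul_inverse_cancel _ hO) X.1)

theorem eq_zero_of_dress {X : Env 𝒪} (h : X + c • envRg hR hg (envWeight w X) = 0) : X = 0 := by
  apply Subtype.ext
  apply ((Module.End.isUnit_iff _).1 hO).injective
  change _ = dressOp R c w g 0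
  rw [map_zero]
  exact Subtype.ext_iff.1 h

end

/-- The potential `V = O⁻¹ R_g (d A + 4 N)` of a deformed current. -/
def envPot {R : Module.End ℂ psl} (hR : IsYangBaxter R) {g : SMat 𝒪} (hg : IsEvenUnit g) (c : ℂ)
    (w : Fin 3 → ℂ) (A N : Env 𝒪) : Env 𝒪 :=
  envDressInv hR hg c w (envRg hR hg (envWeight w A + (4 : ℂ) • N))

/-- The deformed current `K = A - c V`. -/
def envCur {R : Module.End ℂ psl} (hR : IsYangBaxter R) {g : SMat 𝒪} (hg : IsEvenUnit g) (c : ℂ)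
    (w : Fin 3 → ℂ) (A N : Env 𝒪) : Env 𝒪 := A - c • envPot hR hg c w A N

section

variable {R : Module.End ℂ psl} (hR : IsYangBaxter R) {g : SMat 𝒪} (hg : IsEvenUnit g) {c : ℂ}
  {w : Fin 3 → ℂ} (hO : IsUnit (dressOp R c w g)) (A N : Env 𝒪)

include hO

theorem envPot_eq : envPot hR hg c w A N =
    envRg hR hg (envWeight w (envCur hR hg c w A N) + (4 : ℂ) • N) := by
  have h := envDressInv_spec hR hg hO (envRg hR hg (envWeight w A + (4 : ℂ) • N))
  change envPot hR hg c w A N + c • envRg hR hg (envWeight w (envPot hR hg c w A N)) = _ at h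
  rw [envCur]
  simp only [map_add, map_sub, map_smul] at h ⊢
  linear_combination (norm := module) h

theorem envCur_eq : envCur hR hg c w A N =
    envDressInv hR hg c w (A - (4 * c) • envRg hR hg N) := by
  rw [← sub_eq_zero]
  apply eq_zero_of_dress hR hg hO
  have h := envDressInv_spec hR hg hO (A - (4 * c) • envRg hR hg N)
  have h' := envPot_eq hR hg hO A N
  have h'' : envCur hR hg c w A N = A - c • envPot hR hg c w A N := rfl
  simp only [map_add, map_sub, map_smul] at h h' ⊢
  linear_combination (norm := module) h'' - h - c • h'

/-- The first-order variation of the potential under a variation of the group element, the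
Maurer-Cartan form and the ghost current with parameters in a nil ideal. -/
theorem envPot_varied {S : Type*} [CommRing S] [Algebra ℂ S] (β : BodyData 𝒪 S)
    {F : Submodule ℂ 𝒪} (hF : IsNilIdeal F) {Λ a n : Env 𝒪} (hΛ : Λ.1 ∈ entriesIn F)
    (ha : a.1 ∈ entriesIn F) (hn : n.1 ∈ entriesIn F)
    (hO' : IsUnit (dressOp R c w ((1 + Λ.1) * g))) :
    ∃ v : Env 𝒪, v.1 ∈ entriesIn F ∧
      envPot hR (hF.isEvenUnit hg hΛ) c w (A + a) (N + n) = envPot hR hg c w A N + v ∧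
      v = envRg hR hg (envWeight w a - c • envWeight w v + (4 : ℂ) • n)
        + (⁅Λ, envPot hR hg c w A N⁆
          - envRg hR hg ⁅Λ, envWeight w (envCur hR hg c w A N) + (4 : ℂ) • N⁆) := by
  set V := envPot hR hg c w A N with hV
  set C := envWeight w (envCur hR hg c w A N) + (4 : ℂ) • N with hC
  set g' := hF.isEvenUnit hg hΛ
  set V' := envPot hR g' c w (A + a) (N + n) with hV'
  have hVC : V = envRg hR hg C := envPot_eq hR hg hO A N
  have hVC' := envPot_eq hR g' hO' (A + a) (N + n)
  have hK' : envCur hR g' c w (A + a) (N + n) = A + a - c • V' := rfl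
  have hK : envCur hR hg c w A N = A - c • V := rfl
  rw [← hV', hK', hF.envRg_varied hR hg hΛ] at hVC'
  set C' := envWeight w (A + a - c • V') + (4 : ℂ) • (N + n) with hC'
  -- the part of the variation with explicit parameters
  set ρ : Env 𝒪 → Env 𝒪 := fun X => ⁅Λ, envRg hR hg X⁆ - envRg hR hg ⁅Λ, X⁆ with hρ
  have hρF : ∀ X, (ρ X).1 ∈ entriesIn F := fun X =>
    Submodule.sub_mem _ (hF.lie_mem hΛ _)
      (Rg_mem_entriesIn hF.mul_right hF.mul_left (hF.lie_mem hΛ X) R g)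
  have hρ0 : ∀ X : Env 𝒪, X.1 ∈ entriesIn F → ρ X = 0 := fun X hX => by
    rw [hρ]
    change ⁅Λ, envRg hR hg X⁆ - envRg hR hg ⁅Λ, X⁆ = 0
    rw [hF.lie_eq_zero hΛ hX, hF.lie_eq_zero hΛ
      (Rg_mem_entriesIn hF.mul_right hF.mul_left hX R g), map_zero, sub_zero]
  have hCC : C' = C + (envWeight w a - c • envWeight w (V' - V) + (4 : ℂ) • n) := by
    rw [hC', hC, hK]
    simp only [map_add, map_sub, map_smul]
    module
  have hW : ∀ X : Env 𝒪, X.1 ∈ entriesIn F → (envWeight w X).1 ∈ entriesIn F :=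
    fun X hX => weightOp_mem_entriesIn w hX
  have hv : V' - V = envRg hR hg (envWeight w a - c • envWeight w (V' - V) + (4 : ℂ) • n)
      + ρ C' := by
    have h : envRg hR hg C' = V +
        envRg hR hg (envWeight w a - c • envWeight w (V' - V) + (4 : ℂ) • n) := by
      rw [hCC, map_add, hVC]
    have h' : V' = envRg hR hg C' + ρ C' := hVC'
    rw [h] at h'
    linear_combination (norm := module) h'
  -- `O (V' - V)` has entries in the ideal, and the inverse of `O` preserves ideals
  have hvF : (V' - V).1 ∈ entriesIn F := by
    refine β.mem_entriesIn_of_dressOp_mem R c w hg.unit ((Module.End.isUnit_iff _).1 hO).surjective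
      ⟨hF.mul_right, hF.mul_left⟩ ?_
    have h : V' - V + c • envRg hR hg (envWeight w (V' - V)) =
        envRg hR hg (envWeight w a + (4 : ℂ) • n) + ρ C' := by
      simp only [map_add, map_sub, map_smul] at hv ⊢
      linear_combination (norm := module) hv
    have h' := Subtype.ext_iff.1 h
    change dressOp R c w g (V' - V).1 = _ at h'
    rw [h']
    exact Submodule.add_mem _ (Rg_mem_entriesIn hF.mul_right hF.mul_left
      (Submodule.add_mem _ (hW a ha) (Submodule.smul_mem _ _ hn)) R g) (hρF _)
  refine ⟨V' - V, hvF, by abel, ?_⟩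
  conv_lhs => rw [hv]
  congr 1
  -- `C' - C` has entries in the ideal, on which `ρ` vanishes
  have h1 : ρ C' = ρ C := by
    have h2 := hρ0 (envWeight w a - c • envWeight w (V' - V) + (4 : ℂ) • n)
      (Submodule.add_mem _ (Submodule.sub_mem _ (hW a ha) (Submodule.smul_mem _ c (hW _ hvF)))
        (Submodule.smul_mem _ (4 : ℂ) hn))
    rw [hCC]
    rw [hρ] at h2 ⊢
    simp only [lie_add, map_add] at h2 ⊢
    linear_combination (norm := module) h2
  rw [h1, hVC]

end

end Current

/-! ### Field configurations and their BRST variation -/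

section Field

open SuperRing

variable {𝒪 : Type*} [Ring 𝒪] [Algebra ℂ 𝒪] [SuperRing 𝒪]

theorem off_of_odd_grade {X : Env 𝒪} {k : ℕ} (hk : Odd k)
    (h : HasGrade Complex.I envOmega k X) (i j : Idx) (hij : sgn i = sgn j) : X.1 i j = 0 := by
  have h1 : omega X.1 = Complex.I ^ k • X.1 := Subtype.ext_iff.1 h
  refine apply_eq_zero_of_odd_grade ?_ hij
  rw [h1, map_smul, h1, smul_smul, ← pow_add, ← two_mul, pow_mul, Complex.I_sq, hk.neg_one_pow,
    neg_one_smul]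

theorem diag_of_even_grade {X : Env 𝒪} {k : ℕ} (hk : Even k)
    (h : HasGrade Complex.I envOmega k X) (i j : Idx) (hij : sgn i ≠ sgn j) : X.1 i j = 0 := by
  have h1 : omega X.1 = Complex.I ^ k • X.1 := Subtype.ext_iff.1 h
  refine apply_eq_zero_of_even_grade ?_ (by rcases i with i | i <;> rcases j with j | j <;> simp_all)
  rw [h1, map_smul, h1, smul_smul, ← pow_add, ← two_mul, pow_mul, Complex.I_sq, hk.neg_one_pow,
    one_smul]

theorem hasGrade_ghostEnv {ε : 𝒪} (hε : par ε = -ε) {X : SMat 𝒪} (hX : IsGhost X) {k : ℕ}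
    (h : omega X = Complex.I ^ k • X) : HasGrade Complex.I envOmega k (ghostEnv hε hX) :=
  Subtype.ext (by
    rw [coe_envOmega, coe_ghostEnv, omega_smul_left, h, Submodule.coe_smul, coe_ghostEnv,
      smul_comm])

theorem hasGrade_envD {D : 𝒪 →ₗ[ℂ] 𝒪} (hD : IsEvenDerivation D) {X : Env 𝒪} {k : ℕ}
    (h : HasGrade Complex.I envOmega k X) : HasGrade Complex.I envOmega k (envD hD X) := by
  rw [HasGrade, ← envD_envOmega, h, map_smul]

/-- The ghosts and antighosts: odd supermatrices with commuting components, in the components of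
odd grade, with the pure spinor constraints. -/
structure IsGhosts (w3 w1 l1 l3 : SMat 𝒪) : Prop where
  w3_ghost : IsGhost w3
  w1_ghost : IsGhost w1
  l1_ghost : IsGhost l1
  l3_ghost : IsGhost l3
  w3_grade : omega w3 = Complex.I ^ 3 • w3
  w1_grade : omega w1 = Complex.I ^ 1 • w1
  l1_grade : omega l1 = Complex.I ^ 1 • l1
  l3_grade : omega l3 = Complex.I ^ 3 • l3
  l1_pure : pr (l1 * l1) = 0
  l3_pure : pr (l3 * l3) = 0

/-- A field configuration: an even invertible `g` with `A = -dg g⁻¹` in `sl(4|4)`, and ghosts. -/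
structure IsField (dp dm : 𝒪 →ₗ[ℂ] 𝒪) (Φ : Fields 𝒪) : Prop where
  g : IsEvenUnit Φ.g
  plus : str (Φ.g.map dp * Ring.inverse Φ.g) = 0
  minus : str (Φ.g.map dm * Ring.inverse Φ.g) = 0
  gh : IsGhosts Φ.w3 Φ.w1 Φ.l1 Φ.l3

theorem hasGrade_zero_antiEnv {X Y : SMat 𝒪} (hX : IsGhost X) (hY : IsGhost Y) {j k : ℕ}
    (h : omega X = Complex.I ^ j • X) (h' : omega Y = Complex.I ^ k • Y) (hjk : (j + k) % 4 = 0) :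
    HasGrade Complex.I envOmega 0 (-antiEnv hX hY) := by
  rw [HasGrade, map_neg, omega_antiEnv hX hY h h', ← pow_add, ← Nat.div_add_mod (j + k) 4, hjk,
    add_zero, pow_mul, Complex.I_pow_four, one_pow, pow_zero, smul_neg]

namespace IsGhosts

variable {w3 w1 l1 l3 : SMat 𝒪} (h : IsGhosts w3 w1 l1 l3)

/-- `N_{0-}` in the envelope. -/
def nm : Env 𝒪 := -antiEnv h.w3_ghost h.l1_ghost

/-- `N_{0+}` in the envelope. -/
def np : Env 𝒪 := -antiEnv h.w1_ghost h.l3_ghost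

theorem hasGrade_nm : HasGrade Complex.I envOmega 0 h.nm :=
  hasGrade_zero_antiEnv h.w3_ghost h.l1_ghost h.w3_grade h.l1_grade rfl

theorem hasGrade_np : HasGrade Complex.I envOmega 0 h.np :=
  hasGrade_zero_antiEnv h.w1_ghost h.l3_ghost h.w1_grade h.l3_grade rfl

theorem lie_nm {ε : 𝒪} (hε : par ε = -ε) : ⁅ghostEnv hε h.l1_ghost, h.nm⁆ = 0 := by
  rw [nm, lie_neg, lie_antiEnv_eq_zero hε h.l1_ghost h.w3_ghost h.l1_pure, neg_zero]

theorem lie_np {ε : 𝒪} (hε : par ε = -ε) : ⁅ghostEnv hε h.l3_ghost, h.np⁆ = 0 := by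
  rw [np, lie_neg, lie_antiEnv_eq_zero hε h.l3_ghost h.w1_ghost h.l3_pure, neg_zero]

end IsGhosts

section Density

variable {dp dm : 𝒪 →ₗ[ℂ] 𝒪} (hdp : IsEvenDerivation dp) (hdm : IsEvenDerivation dm)
  {R : Module.End ℂ psl} (hR : IsYangBaxter R) (η : ℝ)

include hdp hdm hR in
/-- The deformed Lagrangian density in terms of the undeformed currents. -/
theorem lagrangian_eq_sForm {g w3 w1 l1 l3 : SMat 𝒪} (hg : IsEvenUnit g)
    (h : IsGhosts w3 w1 l1 l3) (hreg : Regular R η (⟨g, w3, w1, l1, l3⟩ : Fields 𝒪)) :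
    lagrangian dp dm R η ⟨g, w3, w1, l1, l3⟩ =
      ((1 / 4 : ℂ) • sForm (envMc hdp hg) (envWeight wMinus (envMc hdm hg))
        + sForm h.np (envMc hdm hg) + sForm h.nm (envMc hdp hg) - sForm h.nm h.np
        + ((η : ℂ) / 4) • sForm (envWeight wPlus (envMc hdp hg) + (4 : ℂ) • h.np)
          (envPot hR hg (-η) wMinus (envMc hdm hg) h.nm))
      + str (w1 * l3.map dm + w3 * l1.map dp) := by
  have hOm : IsUnit (dressOp R (-η) wMinus g) := by rw [← opMinus_eq]; exact hreg.1
  have hOp : IsUnit (dressOp R η wPlus g) := by rw [← opPlus_eq]; exact hreg.2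
  have hJ := envDressInv_spec hR hg hOm (envMc hdm hg)
  have hJ' := envDressInv_spec hR hg hOp (envMc hdp hg)
  have hb := envDressInv_spec hR hg hOm (envRg hR hg h.nm)
  have hV : envPot hR hg (-η) wMinus (envMc hdm hg) h.nm =
      envRg hR hg (envWeight wMinus (envMc hdm hg) + (η : ℂ) • envWeight wMinus
        (envPot hR hg (-η) wMinus (envMc hdm hg) h.nm) + (4 : ℂ) • h.nm) := by
    conv_lhs => rw [envPot_eq hR hg hOm, envCur, neg_smul, sub_neg_eq_add,
      map_add (envWeight _), map_smul (envWeight _)]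
  have key := isInvariantForm_sForm.lagrangian_eq isGrading_env envWeight_minus envWeight_plus
    (sForm_envRg hR hg) (η : ℂ)
    (fun x hx => eq_zero_of_dress hR hg hOm (by rw [neg_smul, ← sub_eq_add_neg]; exact hx))
    h.hasGrade_np h.hasGrade_nm (by rw [neg_smul, ← sub_eq_add_neg] at hJ; exact hJ) hJ'
    (by rw [neg_smul, ← sub_eq_add_neg] at hb; exact hb)
    hV
  rw [← key]
  simp only [lagrangian, jMinus, jBarPlus, opMinusInv, opPlusInv, opMinus_eq, opPlus_eq,
    dPS_eq_weightOp]
  rw [str_add (nPlus _ * _)]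
  rfl

end Density

/-! ### Invariance of the density up to a total derivative -/

section Brst

variable {dp dm : 𝒪 →ₗ[ℂ] 𝒪} (hdp : IsEvenDerivation dp) (hdm : IsEvenDerivation dm)
  {R : Module.End ℂ psl} (hR : IsYangBaxter R) (η : ℝ)

/-- The parameter `ελ₁ + ελ₃ - η R_g (ελ₁ - ελ₃)` of the BRST transformation of `g`. -/
def brstParam {g w3 w1 l1 l3 : SMat 𝒪} (hg : IsEvenUnit g) (h : IsGhosts w3 w1 l1 l3) {ε : 𝒪}
    (hε : par ε = -ε) : Env 𝒪 :=
  ghostEnv hε h.l1_ghost + ghostEnv hε h.l3_ghost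
    - (η : ℂ) • envRg hR hg (ghostEnv hε h.l1_ghost - ghostEnv hε h.l3_ghost)

theorem coe_brstParam {g w3 w1 l1 l3 : SMat 𝒪} (hg : IsEvenUnit g) (h : IsGhosts w3 w1 l1 l3)
    {ε : 𝒪} (hε : par ε = -ε) : (brstParam hR η hg h hε).1 =
      ε • l1 - (η : ℂ) • Rg R g (ε • l1) + (ε • l3 + (η : ℂ) • Rg R g (ε • l3)) := by
  change ε • l1 + ε • l3 - (η : ℂ) • Rg R g (ε • l1 - ε • l3) = _
  rw [map_sub, smul_sub]
  abel

theorem brstParam_mem {g w3 w1 l1 l3 : SMat 𝒪} (hg : IsEvenUnit g) (h : IsGhosts w3 w1 l1 l3)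
    {ε : 𝒪} (hε : par ε = -ε) :
    (brstParam hR η hg h hε).1 ∈ entriesIn (oddIdeal 𝒪 ε) := by
  have hF := isNilIdeal_oddIdeal hε
  have h1 := smul_mem_oddIdeal ε l1
  have h3 := smul_mem_oddIdeal ε l3
  exact Submodule.sub_mem _ (Submodule.add_mem _ h1 h3) (Submodule.smul_mem _ _
    (Rg_mem_entriesIn hF.mul_right hF.mul_left (Submodule.sub_mem _ h1 h3) R g))

theorem brstW3_eq {Φ : Fields 𝒪} (hg : IsEvenUnit Φ.g) (h : IsGhosts Φ.w3 Φ.w1 Φ.l1 Φ.l3)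
    (hreg : Regular R η Φ) : brstW3 dm R η Φ =
      -(envProj 3 (envCur hR hg (-η) wMinus (envMc hdm hg) h.nm)).1 := by
  have hO : IsUnit (dressOp R (-η) wMinus Φ.g) := by rw [← opMinus_eq]; exact hreg.1
  rw [envCur_eq hR hg hO, mul_neg, neg_smul, sub_neg_eq_add, map_add, map_add, map_smul, map_smul,
    brstW3, jMinus, opMinusInv, opMinus_eq, Submodule.coe_add, neg_add, ← sub_eq_add_neg]
  rfl

theorem brstW1_eq {Φ : Fields 𝒪} (hg : IsEvenUnit Φ.g) (h : IsGhosts Φ.w3 Φ.w1 Φ.l1 Φ.l3)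
    (hreg : Regular R η Φ) : brstW1 dp R η Φ =
      -(envProj 1 (envCur hR hg η wPlus (envMc hdp hg) h.np)).1 := by
  have hO : IsUnit (dressOp R η wPlus Φ.g) := by rw [← opPlus_eq]; exact hreg.2
  rw [envCur_eq hR hg hO, map_sub, map_sub, map_smul, map_smul,
    brstW1, jBarPlus, opPlusInv, opPlus_eq, Submodule.coe_sub, neg_sub', sub_neg_eq_add]
  rfl

theorem isGhost_add_smul {ε : 𝒪} (hε : par ε = -ε) {W : SMat 𝒪} (hW : IsGhost W) {k : ℕ}
    (hk : Odd k) {K : Env 𝒪} (hK : HasGrade Complex.I envOmega k K) :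
    IsGhost (W + ε • -K.1) := by
  refine hW.add (isGhost_odd_smul hε (by rw [map_neg, K.even]) fun i j hij => ?_)
  rw [Matrix.neg_apply, off_of_odd_grade hk hK i j hij, neg_zero]

theorem antiEnv_add_smul {ε : 𝒪} (hε : par ε = -ε) {W X : SMat 𝒪} (hW : IsGhost W)
    (hX : IsGhost X) {k : ℕ} (hk : Odd k) {K : Env 𝒪} (hK : HasGrade Complex.I envOmega k K) :
    -antiEnv (isGhost_add_smul hε hW hk hK) hX = -antiEnv hW hX + ⁅ghostEnv hε hX, K⁆ := by
  apply Subtype.ext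
  have h := map_par_of_off K.even (off_of_odd_grade hk hK)
  rw [Submodule.coe_add, Submodule.coe_neg, Submodule.coe_neg, coe_antiEnv, coe_antiEnv,
    Env.coe_lie, coe_ghostEnv, mul_smul_odd hε, h, ← map_neg, ← map_neg, ← map_add]
  congr 1
  rw [add_mul, mul_add, hX.mul_smul_odd hε, smul_mul_assoc, smul_mul_assoc]
  simp only [mul_neg, neg_mul, smul_neg]
  abel

theorem str_smul_mul {ε : 𝒪} (hε : par ε = -ε) {k : ℕ} (hk : Odd k) {K : Env 𝒪}
    (hK : HasGrade Complex.I envOmega k K) (X : SMat 𝒪) :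
    str ((ε • -K.1) * X) = str (K.1 * (ε • X)) := by
  rw [mul_smul_odd hε, map_par_of_off K.even (off_of_odd_grade hk hK), smul_mul_assoc]

theorem map_const_smul {D : 𝒪 →ₗ[ℂ] 𝒪} (hD : IsEvenDerivation D) {ε : 𝒪} (h : D ε = 0)
    (X : SMat 𝒪) : (ε • X).map D = ε • X.map D := by
  ext i j
  rw [Matrix.map_apply, Matrix.smul_apply, smul_eq_mul, hD.leibniz, h, zero_mul, zero_add]
  rfl

theorem omega_add_smul {ε : 𝒪} {W : SMat 𝒪} {k : ℕ} (h : omega W = Complex.I ^ k • W)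
    {K : Env 𝒪} (hK : HasGrade Complex.I envOmega k K) :
    omega (W + ε • -K.1) = Complex.I ^ k • (W + ε • -K.1) := by
  have h' : omega K.1 = Complex.I ^ k • K.1 := Subtype.ext_iff.1 hK
  rw [map_add, omega_smul_left, map_neg, h, h', smul_add, smul_comm _ ε, smul_neg _ K.1]

theorem IsGhosts.varied {w3 w1 l1 l3 : SMat 𝒪} (h : IsGhosts w3 w1 l1 l3) {ε : 𝒪}
    (hε : par ε = -ε) {K3 K1 : Env 𝒪} (h3 : HasGrade Complex.I envOmega 3 K3)
    (h1 : HasGrade Complex.I envOmega 1 K1) :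
    IsGhosts (w3 + ε • -K3.1) (w1 + ε • -K1.1) l1 l3 :=
  { h with
    w3_ghost := isGhost_add_smul hε h.w3_ghost (by decide) h3
    w1_ghost := isGhost_add_smul hε h.w1_ghost (by decide) h1
    w3_grade := omega_add_smul h.w3_grade h3
    w1_grade := omega_add_smul h.w1_grade h1 }

theorem IsNilIdeal.str_map_mul_inverse {F : Submodule ℂ 𝒪} (hF : IsNilIdeal F)
    {D : 𝒪 →ₗ[ℂ] 𝒪} (hD : IsEvenDerivation D) (hDF : ∀ x ∈ F, D x ∈ F) {g : SMat 𝒪}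
    (hg : IsEvenUnit g) (h0 : str (g.map D * Ring.inverse g) = 0) {Λ : Env 𝒪}
    (hΛ : Λ.1 ∈ entriesIn F) :
    str (((1 + Λ.1) * g).map D * Ring.inverse ((1 + Λ.1) * g)) = 0 := by
  have h1 : (1 + Λ.1).map D = Λ.1.map D := by
    rw [Matrix.map_add _ (map_add D), hD.map_one_matrix, zero_add]
  have h2 : Λ.1.map D ∈ entriesIn F := fun i j => hDF _ (hΛ i j)
  have h3 : sPar (1 + Λ.1) = 1 + Λ.1 := by rw [map_add, map_one, Λ.even]
  have h4 : sPar (1 - Λ.1) = 1 - Λ.1 := by rw [map_sub, map_one, Λ.even]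
  have h5 : sPar (g.map D * Ring.inverse g) = g.map D * Ring.inverse g := by
    rw [map_mul, hD.sPar_map hg.even, hg.inv_even]
  rw [hF.inverse_varied hg hΛ, hD.map_mul, h1, show (Λ.1.map D * g + (1 + Λ.1) * g.map D) *
    (Ring.inverse g * (1 - Λ.1)) = Λ.1.map D * (g * Ring.inverse g)
      - Λ.1.map D * (g * Ring.inverse g) * Λ.1
      + (1 + Λ.1) * (g.map D * Ring.inverse g) * (1 - Λ.1) by noncomm_ring, hg.mul_inv, mul_one,
    hF.mul_eq_zero_of_mem h2 hΛ, sub_zero, str_add,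
    str_conj h3 h4 (hF.one_sub_mul_one_add hΛ) h5, h0, str_map, Λ.str_eq, map_zero, add_zero]

theorem map_mem_oddIdeal {D : 𝒪 →ₗ[ℂ] 𝒪} (hD : IsEvenDerivation D) {ε : 𝒪} (h : D ε = 0) :
    ∀ x ∈ oddIdeal 𝒪 ε, D x ∈ oddIdeal 𝒪 ε := by
  rintro _ ⟨x, rfl⟩
  refine ⟨D x, ?_⟩
  rw [LinearMap.mulLeft_apply, LinearMap.mulLeft_apply, hD.leibniz, h, zero_mul, zero_add]

/-- The variation of the Maurer-Cartan form under a BRST transformation. -/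
theorem mc_brst_varied {D : 𝒪 →ₗ[ℂ] 𝒪} (hD : IsEvenDerivation D) {g : SMat 𝒪}
    (hg : IsEvenUnit g) (h0 : str (g.map D * Ring.inverse g) = 0) {w3 w1 l1 l3 : SMat 𝒪}
    (h : IsGhosts w3 w1 l1 l3) {ε : 𝒪} (hε : par ε = -ε) :
    -envD hD (brstParam hR η hg h hε) + ⁅brstParam hR η hg h hε, envMc hD hg⁆ =
      -(envD hD (ghostEnv hε h.l1_ghost) + envD hD (ghostEnv hε h.l3_ghost)
        + ⁅envMc hD hg, ghostEnv hε h.l1_ghost + ghostEnv hε h.l3_ghost⁆)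
      + (η : ℂ) • envRg hR hg (envD hD (ghostEnv hε h.l1_ghost) - envD hD (ghostEnv hε h.l3_ghost)
        + ⁅envMc hD hg, ghostEnv hε h.l1_ghost - ghostEnv hε h.l3_ghost⁆) := by
  rw [brstParam]
  have h1 := envD_envRg hD hg hR h0 (ghostEnv hε h.l1_ghost - ghostEnv hε h.l3_ghost)
  rw [← lie_skew, lie_sub, lie_smul]
  rw [map_sub (envD hD) (ghostEnv _ _)] at h1
  rw [← h1]
  simp only [map_add, map_sub, map_smul]
  module

/-- The left-moving deformed current of a configuration. -/
def curMinus {Φ : Fields 𝒪} (hΦ : IsField dp dm Φ) : Env 𝒪 :=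
  envCur hR hΦ.g (-η) wMinus (envMc hdm hΦ.g) hΦ.gh.nm

/-- The right-moving deformed current of a configuration. -/
def curPlus {Φ : Fields 𝒪} (hΦ : IsField dp dm Φ) : Env 𝒪 :=
  envCur hR hΦ.g η wPlus (envMc hdp hΦ.g) hΦ.gh.np

theorem envPot_eq_curMinus {Φ : Fields 𝒪} (hΦ : IsField dp dm Φ)
    (hO : IsUnit (dressOp R (-η) wMinus Φ.g)) :
    envPot hR hΦ.g (-η) wMinus (envMc hdm hΦ.g) hΦ.gh.nm =
      envRg hR hΦ.g (envWeight wMinus (curMinus hdm hR η hΦ) + (4 : ℂ) • hΦ.gh.nm) :=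
  envPot_eq hR hΦ.g hO _ _

theorem envPot_eq_curPlus {Φ : Fields 𝒪} (hΦ : IsField dp dm Φ)
    (hO : IsUnit (dressOp R η wPlus Φ.g)) :
    envPot hR hΦ.g η wPlus (envMc hdp hΦ.g) hΦ.gh.np =
      envRg hR hΦ.g (envWeight wPlus (curPlus hdp hR η hΦ) + (4 : ℂ) • hΦ.gh.np) :=
  envPot_eq hR hΦ.g hO _ _

theorem hasGrade_envProj_three (X : Env 𝒪) : HasGrade Complex.I envOmega 3 (envProj 3 X) :=
  isGrading_env.hasGrade_proj 3 X

theorem hasGrade_envProj_one (X : Env 𝒪) : HasGrade Complex.I envOmega 1 (envProj 1 X) :=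
  isGrading_env.hasGrade_proj 1 X

theorem add_brst_eq {Φ : Fields 𝒪} (hΦ : IsField dp dm Φ) (hreg : Regular R η Φ) {ε : 𝒪}
    (hε : par ε = -ε) : Φ + brst dp dm R η ε Φ = ⟨(1 + (brstParam hR η hΦ.g hΦ.gh hε).1) * Φ.g,
      Φ.w3 + ε • -(envProj 3 (curMinus hdm hR η hΦ)).1,
      Φ.w1 + ε • -(envProj 1 (curPlus hdp hR η hΦ)).1, Φ.l1, Φ.l3⟩ := by
  apply Fields.ext
  · change Φ.g + _ * Φ.g = (1 + _) * Φ.g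
    rw [add_mul 1, one_mul, coe_brstParam]
  · change Φ.w3 + ε • brstW3 dm R η Φ = _
    rw [brstW3_eq hdm hR η hΦ.g hΦ.gh hreg]
    rfl
  · change Φ.w1 + ε • brstW1 dp R η Φ = _
    rw [brstW1_eq hdp hR η hΦ.g hΦ.gh hreg]
    rfl
  · exact add_zero _
  · exact add_zero _

theorem isUnit_dressOp_varied {S : Type*} [CommRing S] [Algebra ℂ S] (β : BodyData 𝒪 S) {ε : 𝒪}
    (hε : par ε = -ε) (hεβ : β.body ε = 0) {g : SMat 𝒪} (hg : IsEvenUnit g) {Λ : Env 𝒪}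
    (hΛ : Λ.1 ∈ entriesIn (oddIdeal 𝒪 ε)) {c : ℂ} {w : Fin 3 → ℂ}
    (hO : IsUnit (dressOp R c w g)) : IsUnit (dressOp R c w ((1 + Λ.1) * g)) := by
  have hF := isNilIdeal_oddIdeal hε
  refine β.isUnit_dressOp_of_body_eq R c w hg.unit (hF.isEvenUnit hg hΛ).unit (fun i j => ?_) hO
  have h1 : β.body ((Λ.1 * g) i j) = 0 := by
    obtain ⟨y, hy⟩ := mul_mem_entriesIn_right hF.mul_right hΛ g i j
    rw [← hy, LinearMap.mulLeft_apply, map_mul, hεβ, zero_mul]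
  rw [add_mul, one_mul, Matrix.add_apply, map_add, h1, add_zero]

theorem mc_varied_mem {D : 𝒪 →ₗ[ℂ] 𝒪} (hD : IsEvenDerivation D) {ε : 𝒪} (hε : par ε = -ε)
    (hεD : D ε = 0) {Λ : Env 𝒪} (hΛ : Λ.1 ∈ entriesIn (oddIdeal 𝒪 ε)) (A : Env 𝒪) :
    (-envD hD Λ + ⁅Λ, A⁆).1 ∈ entriesIn (oddIdeal 𝒪 ε) :=
  Submodule.add_mem _ (Submodule.neg_mem _ fun i j => map_mem_oddIdeal hD hεD _ (hΛ i j))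
    ((isNilIdeal_oddIdeal hε).lie_mem hΛ A)

include hdp hdm hR in
/-- The BRST transformation preserves the constraints on the fields and the invertibility of the
dressed operators. -/
theorem isField_add_brst {S : Type*} [CommRing S] [Algebra ℂ S] (β : BodyData 𝒪 S) {Φ : Fields 𝒪}
    (hΦ : IsField dp dm Φ) (hreg : Regular R η Φ) {ε : 𝒪} (hε : par ε = -ε) (hεp : dp ε = 0)
    (hεm : dm ε = 0) (hεβ : β.body ε = 0) :
    IsField dp dm (Φ + brst dp dm R η ε Φ) ∧ Regular R η (Φ + brst dp dm R η ε Φ) := by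
  have hF := isNilIdeal_oddIdeal hε
  have hΛ := brstParam_mem hR η hΦ.g hΦ.gh hε
  rw [add_brst_eq hdp hdm hR η hΦ hreg hε]
  refine ⟨⟨hF.isEvenUnit hΦ.g hΛ,
    hF.str_map_mul_inverse hdp (map_mem_oddIdeal hdp hεp) hΦ.g hΦ.plus hΛ,
    hF.str_map_mul_inverse hdm (map_mem_oddIdeal hdm hεm) hΦ.g hΦ.minus hΛ,
    hΦ.gh.varied hε (hasGrade_envProj_three _) (hasGrade_envProj_one _)⟩, ?_, ?_⟩
  · rw [opMinus_eq]
    exact isUnit_dressOp_varied β hε hεβ hΦ.g hΛ (by rw [← opMinus_eq]; exact hreg.1)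
  · rw [opPlus_eq]
    exact isUnit_dressOp_varied β hε hεβ hΦ.g hΛ (by rw [← opPlus_eq]; exact hreg.2)

include hdp hdm hR in
/-- Under the BRST transformation the density changes by a total derivative. -/
theorem lagrangian_add_brst (hcomm : ∀ x, dp (dm x) = dm (dp x)) {S : Type*} [CommRing S]
    [Algebra ℂ S] (β : BodyData 𝒪 S) {Φ : Fields 𝒪} (hΦ : IsField dp dm Φ) (hreg : Regular R η Φ)
    {ε : 𝒪} (hε : par ε = -ε) (hεp : dp ε = 0) (hεm : dm ε = 0) (hεβ : β.body ε = 0) :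
    lagrangian dp dm R η (Φ + brst dp dm R η ε Φ) - lagrangian dp dm R η Φ =
      dp ((1 / 4 : ℂ) • str ((ε • (Φ.l1 - Φ.l3)) * mcForm dm Φ.g))
      - dm ((1 / 4 : ℂ) • str ((ε • (Φ.l1 - Φ.l3)) * mcForm dp Φ.g)) := by
  have hreg' := (isField_add_brst hdp hdm hR η β hΦ hreg hε hεp hεm hεβ).2
  rw [add_brst_eq hdp hdm hR η hΦ hreg hε] at hreg' ⊢
  have h := hΦ.gh
  have hg := hΦ.g
  have hF := isNilIdeal_oddIdeal hε
  have hOm : IsUnit (dressOp R (-η) wMinus Φ.g) := by rw [← opMinus_eq]; exact hreg.1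
  have hOp : IsUnit (dressOp R η wPlus Φ.g) := by rw [← opPlus_eq]; exact hreg.2
  have hΛ := brstParam_mem hR η hg h hε
  have hap := mc_brst_varied hR η hdp hg hΦ.plus h hε
  have ham := mc_brst_varied hR η hdm hg hΦ.minus h hε
  have hΛdef : brstParam hR η hg h hε = ghostEnv hε h.l1_ghost + ghostEnv hε h.l3_ghost
    - (η : ℂ) • envRg hR hg (ghostEnv hε h.l1_ghost - ghostEnv hε h.l3_ghost) := rfl
  have hKm : curMinus hdm hR η hΦ = envMc hdm hg - (-η : ℂ) •
    envPot hR hg (-η) wMinus (envMc hdm hg) h.nm := rfl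
  have hKp : curPlus hdp hR η hΦ = envMc hdp hg - (η : ℂ) •
    envPot hR hg η wPlus (envMc hdp hg) h.np := rfl
  have hVm := envPot_eq_curMinus hdm hR η hΦ hOm
  have hVp := envPot_eq_curPlus hdp hR η hΦ hOp
  have hL1F : (ghostEnv hε h.l1_ghost).1 ∈ entriesIn (oddIdeal 𝒪 ε) := smul_mem_oddIdeal _ _
  have hL3F : (ghostEnv hε h.l3_ghost).1 ∈ entriesIn (oddIdeal 𝒪 ε) := smul_mem_oddIdeal _ _
  have hl1 := hasGrade_ghostEnv hε h.l1_ghost h.l1_grade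
  have hl3 := hasGrade_ghostEnv hε h.l3_ghost h.l3_grade
  have hapF := mc_varied_mem hdp hε hεp hΛ (envMc hdp hg)
  have hamF := mc_varied_mem hdm hε hεm hΛ (envMc hdm hg)
  have hnmF := hF.lie_mem hL1F (envProj 3 (curMinus hdm hR η hΦ))
  have hnpF := hF.lie_mem hL3F (envProj 1 (curPlus hdp hR η hΦ))
  have hOm' := isUnit_dressOp_varied β hε hεβ hg hΛ hOm
  obtain ⟨v, hvF, hV', hv⟩ := envPot_varied hR hg hOm (envMc hdm hg) h.nm β hF hΛ hamF hnmF hOm'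
  have h' := h.varied hε (hasGrade_envProj_three (curMinus hdm hR η hΦ))
    (hasGrade_envProj_one (curPlus hdp hR η hΦ))
  have hnm : h'.nm = h.nm + ⁅ghostEnv hε h.l1_ghost, envProj 3 (curMinus hdm hR η hΦ)⁆ :=
    antiEnv_add_smul hε h.w3_ghost h.l1_ghost (by decide) (hasGrade_envProj_three _)
  have hnp : h'.np = h.np + ⁅ghostEnv hε h.l3_ghost, envProj 1 (curPlus hdp hR η hΦ)⁆ :=
    antiEnv_add_smul hε h.w1_ghost h.l3_ghost (by decide) (hasGrade_envProj_one _)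
  have hlag := lagrangian_eq_sForm hdp hdm hR η (hF.isEvenUnit hg hΛ) h' hreg'
  rw [hF.envMc_varied hdp (map_mem_oddIdeal hdp hεp) hg hΦ.plus hΛ,
    hF.envMc_varied hdm (map_mem_oddIdeal hdm hεm) hg hΦ.minus hΛ, hnm, hnp, hV'] at hlag
  have hlag0 : lagrangian dp dm R η Φ = _ := lagrangian_eq_sForm hdp hdm hR η hg h hreg
  -- the kinetic terms of the ghosts
  have hkin : ∀ {D : 𝒪 →ₗ[ℂ] 𝒪} (hD : IsEvenDerivation D) (_ : D ε = 0) {k : ℕ} (_ : Odd k)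
      {K : Env 𝒪} (_ : HasGrade Complex.I envOmega k K) {W X : SMat 𝒪} (hX : IsGhost X),
      str ((W + ε • -K.1) * X.map D) = str (W * X.map D) + sForm K (envD hD (ghostEnv hε hX)) := by
    intro D hD hDε k hk K hK W X hX
    rw [add_mul, str_add, str_smul_mul hε hk hK, ← map_const_smul hD hDε]
    rfl
  rw [hlag, hlag0, str_add, str_add, hkin hdm hεm (by decide) (hasGrade_envProj_one _) h.l3_ghost,
    hkin hdp hεp (by decide) (hasGrade_envProj_three _) h.l1_ghost]
  -- all products of two variations vanish, having entries in the square of the ideal of `ε`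
  have hvar := isInvariantForm_sForm.lagrangian_variation (B := sForm) isGrading_env
    envWeight_minus envWeight_plus (sForm_envRg hR hg) (η : ℂ) (Ap := envMc hdp hg)
    (Am := envMc hdm hg) (Np := h.np) (Nm := h.nm)
    (Vm := envPot hR hg (-η) wMinus (envMc hdm hg) h.nm)
    (Cm := envWeight wMinus (curMinus hdm hR η hΦ) + (4 : ℂ) • h.nm) hVp
    (by rw [hKm, neg_smul, sub_neg_eq_add, map_add (envWeight _), map_smul (envWeight _)])
    (by rw [hKp, map_sub (envWeight _), map_smul (envWeight _)])
    (by rw [neg_smul, sub_neg_eq_add] at hv; exact hv)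
    (hF.sForm_eq_zero hapF (weightOp_mem_entriesIn _ hamF)) (hF.sForm_eq_zero hnpF hamF)
    (hF.sForm_eq_zero hnmF hapF) (hF.sForm_eq_zero hnmF hnpF)
    (hF.sForm_eq_zero (Submodule.add_mem _ (weightOp_mem_entriesIn _ hapF)
      (Submodule.smul_mem _ (4 : ℂ) hnpF)) hvF)
  have hbrst := isInvariantForm_sForm.brst_variation (B := sForm) isGrading_env
    envWeight_minus envWeight_plus (sForm_envRg hR hg) (envRg_lie hR hg) (η : ℂ) hl1 hl3
    (hasGrade_envD hdp hl1) (hasGrade_envD hdp hl3) (hasGrade_envD hdm hl1)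
    (hasGrade_envD hdm hl3) h.hasGrade_np h.hasGrade_nm (h.lie_nm hε) (h.lie_np hε) hVp hVm rfl rfl
    (Ap := envMc hdp hg) (Am := envMc hdm hg) (by rw [hKp]; abel) (by rw [hKm, neg_smul]; abel)
  rw [← hap, ← ham, ← hΛdef, show gradeProj 𝒪 1 = envProj 1 from rfl,
    show gradeProj 𝒪 3 = envProj 3 from rfl] at hbrst
  -- the total derivative
  have hm : ∀ A : Env 𝒪, str ((ε • (Φ.l1 - Φ.l3)) * A.1) =
      sForm (ghostEnv hε h.l1_ghost - ghostEnv hε h.l3_ghost) A := fun A => by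
    rw [smul_sub]
    rfl
  -- the curl of `A` is eliminated by the Maurer-Cartan equation
  have hflat := congrArg (sForm (ghostEnv hε h.l1_ghost - ghostEnv hε h.l3_ghost))
    (envD_envMc hdp hg hdm hΦ.plus hΦ.minus hcomm)
  have hinv : sForm ⁅envMc hdp hg, ghostEnv hε h.l1_ghost - ghostEnv hε h.l3_ghost⁆ (envMc hdm hg) =
      -sForm (ghostEnv hε h.l1_ghost - ghostEnv hε h.l3_ghost) ⁅envMc hdp hg, envMc hdm hg⁆ := by
    rw [← lie_skew, map_neg, LinearMap.neg_apply, sForm_lie]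
  rw [← coe_envMc hdm hg, ← coe_envMc hdp hg, hm, hm, map_smul, map_smul, map_sForm hdp,
    map_sForm hdm, map_sub (envD hdp), map_sub (envD hdm)]
  rw [map_neg, map_sub] at hflat
  have hsplit : ∀ X Y Z : Env 𝒪, sForm (X + Y) Z = sForm X Z + sForm Y Z := fun X Y Z => by
    rw [map_add sForm, LinearMap.add_apply]
  rw [hsplit _ ⁅envMc hdp hg, _⁆, hinv] at hbrst
  have hKm' : envMc hdm hg + (η : ℂ) • envPot hR hg (-η) wMinus (envMc hdm hg) h.nm =
      curMinus hdm hR η hΦ := by rw [hKm, neg_smul, sub_neg_eq_add]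
  have hcur : envCur hR hg (-η) wMinus (envMc hdm hg) h.nm = curMinus hdm hR η hΦ := rfl
  rw [hKm', ← hKp, hcur] at hvar
  linear_combination (norm := module) hvar + (1 / 4 : ℂ) • hbrst - (1 / 4 : ℂ) • hflat

end Brst

end Field

/-! ### The square of the BRST transformation -/

section Abstract

variable {L : Type*} [LieRing L] [LieAlgebra ℂ L] {ζ : ℂ} {Ω : Module.End ℂ L}
  {P : Fin 4 → Module.End ℂ L}

theorem IsGrading.proj_lie (hP : IsGrading ζ Ω P) {a b c : Fin 4} {l : L}
    (hl : HasGrade ζ Ω a l) (h : c = b + a) (x : L) : P c ⁅x, l⁆ = ⁅P b x, l⁆ := by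
  have key : ∀ k : Fin 4, P c ⁅P k x, l⁆ = if c = k + a then ⁅P k x, l⁆ else 0 := fun k => by
    refine hP.proj_apply_of_hasGrade c ?_
    have h1 := hP.hasGrade_lie (hP.hasGrade_proj k x) hl
    rw [HasGrade] at h1 ⊢
    rw [h1, Fin.val_add]
    congr 1
    conv_lhs => rw [← Nat.div_add_mod ((k : ℕ) + a) 4, pow_add, pow_mul, hP.pow_four, pow_zero,
      one_pow, one_mul]
  have hinj : ∀ k : Fin 4, c = k + a ↔ k = b := fun k => by
    rw [h, add_left_inj, eq_comm]
  conv_lhs => rw [← hP.sum_proj x]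
  simp only [add_lie, map_add, key, hinj]
  fin_cases b <;> simp

/-- The antisymmetry in the two odd parameters, and the Yang-Baxter equation, reduce the iterated
variation of the group element to the bracket of the ghosts. -/
theorem group_variation {𝓡 : Module.End ℂ L}
    (hcybe : ∀ x y, ⁅𝓡 x, 𝓡 y⁆ = 𝓡 (⁅𝓡 x, y⁆ + ⁅x, 𝓡 y⁆)) (η : ℂ) {l1 l3 l1' l3' : L}
    (h11 : ⁅l1, l1'⁆ = 0) (h33 : ⁅l3, l3'⁆ = 0) (h11' : ⁅l1', l1⁆ = 0) (h33' : ⁅l3', l3⁆ = 0)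
    (h13 : ⁅l3, l1'⁆ = ⁅l1, l3'⁆)
    (hs : ⁅𝓡 (l1 - l3), l1' + l3'⁆ = -⁅𝓡 (l1' - l3'), l1 + l3⁆)
    (hm : ⁅𝓡 (l1 - l3), l1' - l3'⁆ = -⁅𝓡 (l1' - l3'), l1 - l3⁆)
    {Λ Λ' : L} (hΛ : Λ = l1 + l3 - η • 𝓡 (l1 - l3)) (hΛ' : Λ' = l1' + l3' - η • 𝓡 (l1' - l3')) :
    (1 / 2 : ℂ) • ⁅Λ, Λ'⁆ - η • (⁅Λ', 𝓡 (l1 - l3)⁆ - 𝓡 ⁅Λ', l1 - l3⁆) = ⁅l1, l3'⁆ := by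
  -- only the mixed bracket of the ghosts survives the pure spinor constraints
  have hss : ⁅l1 + l3, l1' + l3'⁆ = (2 : ℂ) • ⁅l1, l3'⁆ := by
    simp only [lie_add, add_lie, h11, h33, h13]
    module
  have hsm : ⁅l1' + l3', l1 - l3⁆ = 0 := by
    have h13' : ⁅l1', l3⁆ = ⁅l3', l1⁆ := by rw [← lie_skew, h13, lie_skew]
    simp only [lie_sub, add_lie, h11', h33', h13']
    module
  -- the terms quadratic in `η` cancel by the Yang-Baxter equation
  have hb := hcybe (l1 - l3) (l1' - l3')
  rw [hm] at hb
  rw [hΛ, hΛ']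
  have e1 : ⁅l1 + l3, 𝓡 (l1' - l3')⁆ = ⁅𝓡 (l1 - l3), l1' + l3'⁆ := by rw [hs, lie_skew]
  have e2 : ⁅l1' + l3', 𝓡 (l1 - l3)⁆ = -⁅𝓡 (l1 - l3), l1' + l3'⁆ := (lie_skew _ _).symm
  have e3 : ⁅𝓡 (l1' - l3'), 𝓡 (l1 - l3)⁆ = -⁅𝓡 (l1 - l3), 𝓡 (l1' - l3')⁆ := (lie_skew _ _).symm
  have e4 : ⁅l1 - l3, 𝓡 (l1' - l3')⁆ = -⁅𝓡 (l1' - l3'), l1 - l3⁆ := (lie_skew _ _).symm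
  rw [e4] at hb
  generalize l1 - l3 = m at *
  generalize l1 + l3 = s at *
  generalize l1' - l3' = m' at *
  generalize l1' + l3' = s' at *
  simp only [lie_sub, sub_lie, smul_lie, lie_smul, hss, hsm, e1, e2, e3, map_sub, map_smul,
    map_zero, hb, map_add, map_neg]
  module

/-- The component of highest grade of the variation of a deformed current, on the equation of
motion of `l₃`. -/
theorem IsGrading.current_variation_three (hP : IsGrading ζ Ω P) {K N l1 l3 y1 y3 κ : L}
    (hl1 : HasGrade ζ Ω 1 l1) (hl3 : HasGrade ζ Ω 3 l3) (hy1 : HasGrade ζ Ω 1 y1)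
    (hy3 : HasGrade ζ Ω 3 y3) (hκ : κ = -(y1 + y3) - ⁅K, l1 + l3⁆)
    (heom : y3 + ⁅P 0 K, l3⁆ - ⁅N, l3⁆ = 0) : P 3 κ = -(⁅N, l3⁆ + ⁅P 2 K, l1⁆) := by
  have e1 : P 3 y1 = 0 := hP.proj_apply_of_hasGrade 3 (k := 1) hy1
  have e3 : P 3 y3 = y3 := hP.proj_self (k := 3) hy3
  have e4 : P 3 ⁅K, l1⁆ = ⁅P 2 K, l1⁆ := hP.proj_lie (a := 1) (b := 2) (c := 3) hl1 rfl K
  have e5 : P 3 ⁅K, l3⁆ = ⁅P 0 K, l3⁆ := hP.proj_lie (a := 3) (b := 0) (c := 3) hl3 rfl K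
  rw [hκ, lie_add]
  simp only [map_sub, map_neg, map_add, e1, e3, e4, e5]
  linear_combination (norm := module) -heom

end Abstract

section Square

open SuperRing

variable {𝒪 : Type*} [Ring 𝒪] [Algebra ℂ 𝒪] [SuperRing 𝒪]

/-- The variation of a deformed current under a BRST transformation, on the equation of motion of
one of the ghosts.  The left- and right-moving currents are both of this form, with the grades one
and three exchanged. -/
theorem envCur_varied {ζ : ℂ} {P : Fin 4 → Module.End ℂ (Env 𝒪)}
    (hP : IsGrading ζ (envOmega (𝒪 := 𝒪)) P)
    {R : Module.End ℂ psl} (hR : IsYangBaxter R) {g : SMat 𝒪} (hg : IsEvenUnit g) {c : ℂ}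
    {w : Fin 3 → ℂ} (hw : ∀ X : Env 𝒪, envWeight w X = P 1 X + (2 : ℂ) • P 2 X + (3 : ℂ) • P 3 X)
    (hO : IsUnit (dressOp R c w g)) {A N : Env 𝒪} {S : Type*} [CommRing S] [Algebra ℂ S]
    (β : BodyData 𝒪 S) {F : Submodule ℂ 𝒪} (hF : IsNilIdeal F) {Λ a n : Env 𝒪}
    (hΛ : Λ.1 ∈ entriesIn F) (ha : a.1 ∈ entriesIn F) (hn : n.1 ∈ entriesIn F)
    (hO' : IsUnit (dressOp R c w ((1 + Λ.1) * g))) {l1 l3 y1 y3 : Env 𝒪}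
    (hl1 : HasGrade ζ envOmega 1 l1) (hl3 : HasGrade ζ envOmega 3 l3)
    (hy1 : HasGrade ζ envOmega 1 y1) (hy3 : HasGrade ζ envOmega 3 y3) (hpure : ⁅l1, N⁆ = 0)
    (ha' : a = -(y1 + y3 + ⁅A, l1 + l3⁆) - c • envRg hR hg (y1 - y3 + ⁅A, l1 - l3⁆))
    (hn' : n = ⁅l1, P 3 (envCur hR hg c w A N)⁆)
    (hΛ' : Λ = l1 + l3 + c • envRg hR hg (l1 - l3))
    (heom : y3 + ⁅P 0 (envCur hR hg c w A N), l3⁆ - ⁅N, l3⁆ = 0) :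
    P 3 (envCur hR (hF.isEvenUnit hg hΛ) c w (A + a) (N + n)) - P 3 (envCur hR hg c w A N) =
      -(⁅N, l3⁆ + ⁅P 2 (envCur hR hg c w A N), l1⁆) := by
  obtain ⟨v, -, hv, hv'⟩ := envPot_varied hR hg hO A N β hF hΛ ha hn hO'
  have hV := envPot_eq hR hg hO A N
  have hκ : envCur hR (hF.isEvenUnit hg hΛ) c w (A + a) (N + n) =
      envCur hR hg c w A N + (a - c • v) := by
    rw [envCur, envCur, hv]
    module
  rw [hκ, map_add (P 3), add_sub_cancel_left]
  refine hP.current_variation_three hl1 hl3 hy1 hy3 ?_ heom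
  refine hP.current_variation (envRg_lie hR hg) (-c) hw
    (fun x hx => eq_zero_of_dress hR hg hO (by rw [neg_smul, sub_neg_eq_add] at hx; exact hx))
    hl1 hl3 hy1 hy3 hpure hV rfl (A := A) ?_ ?_ heom
  · rw [envCur]
    module
  · rw [show l1 + l3 - -c • envRg hR hg (l1 - l3) = Λ by rw [hΛ', neg_smul, sub_neg_eq_add],
      ← hn', show envWeight w (a - c • v) + (4 : ℂ) • n =
        envWeight w a - c • envWeight w v + (4 : ℂ) • n by rw [map_sub, map_smul], ← hv', ha']
    module

/-! ### Anticommutators of ghosts -/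

theorem commutator_pr_antiEnv {X Y : SMat 𝒪} (hX : IsGhost X) (hY : IsGhost Y) (Z : SMat 𝒪) :
    pr (X * Y + Y * X) * Z - Z * pr (X * Y + Y * X) =
      (X * Y + Y * X) * Z - Z * (X * Y + Y * X) := by
  obtain ⟨c, hc, h⟩ := exists_eq_pr_add (hX.sPar_anticomm hY) (hX.str_anticomm Y)
  conv_rhs => rw [h]
  rw [mul_add, add_mul, smul_mul_of_even hc, mul_one, smul_mul_assoc, one_mul,
    add_sub_add_right_eq_sub]

theorem commutator_antiEnv_self {X Y : SMat 𝒪} (hX : IsGhost X) (hY : IsGhost Y)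
    (hpure : pr (X * X) = 0) :
    pr (X * Y + Y * X) * X - X * pr (X * Y + Y * X) = 0 := by
  obtain ⟨z, hz, h⟩ := mul_self_eq_smul_one hX hpure
  rw [commutator_pr_antiEnv hX hY,
    show (X * Y + Y * X) * X - X * (X * Y + Y * X) = Y * (X * X) - X * X * Y by noncomm_ring, h,
    smul_mul_of_even hz, mul_one, smul_mul_assoc, one_mul, sub_self]

/-- The Jacobi identity of three odd elements. -/
theorem jacobi_antiEnv {X Y Z : SMat 𝒪} (hX : IsGhost X) (hY : IsGhost Y) (hZ : IsGhost Z) :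
    -(pr (X * Y + Y * X) * Z - Z * pr (X * Y + Y * X)) =
      (pr (Y * Z + Z * Y) * X - X * pr (Y * Z + Z * Y))
      + (pr (Z * X + X * Z) * Y - Y * pr (Z * X + X * Z)) := by
  rw [commutator_pr_antiEnv hX hY, commutator_pr_antiEnv hY hZ, commutator_pr_antiEnv hZ hX]
  noncomm_ring

/-- The bracket of an even element with a ghost. -/
theorem coe_lie_ghostEnv {ε : 𝒪} (hε : par ε = -ε) {X : SMat 𝒪} (hX : IsGhost X) {Z : Env 𝒪}
    {k : ℕ} (hk : Even k) (hZ : HasGrade Complex.I envOmega k Z) :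
    (⁅Z, ghostEnv hε hX⁆ : Env 𝒪).1 = ε • (Z.1 * X - X * Z.1) := by
  have hd := diag_of_even_grade hk hZ
  rw [Env.coe_lie, coe_ghostEnv, mul_smul_odd hε, map_par_of_diag Z.even hd, smul_mul_assoc,
    ← smul_sub, pr_smul_left]
  congr 1
  refine pr_eq_self_of_diag fun i => ?_
  have h : ∀ j, Z.1 i j * X j i = X i j * Z.1 j i := fun j => by
    by_cases hij : sgn i = sgn j
    · rw [hX.off i j hij, hX.off j i hij.symm, mul_zero, zero_mul]
    · rw [hd i j hij, hd j i (Ne.symm hij), mul_zero, zero_mul]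
  rw [Matrix.sub_apply, Matrix.mul_apply, Matrix.mul_apply, sub_eq_zero]
  exact Finset.sum_congr rfl fun j _ => h j

/-- The polarization identity for multiples of two odd parameters. -/
theorem lie_odd_smul {ε ε' : 𝒪} (hε : par ε = -ε) (hε' : par ε' = -ε') {X Y : SMat 𝒪}
    {a a' b b' : Env 𝒪} (ha : a.1 = ε • X) (ha' : a'.1 = ε' • X) (hb : b.1 = ε • Y)
    (hb' : b'.1 = ε' • Y) : ⁅a, b'⁆ = -⁅a', b⁆ := by
  apply Subtype.ext
  have h : ∀ U V : SMat 𝒪, (ε • U) * (ε' • V) = -((ε' • U) * (ε • V)) := fun U V => by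
    rw [smul_mul_assoc, smul_mul_assoc, mul_smul_odd hε, mul_smul_odd hε', smul_smul, smul_smul,
      mul_anticomm_of_odd ε ε' hε hε', neg_smul]
  rw [Submodule.coe_neg, Env.coe_lie, Env.coe_lie, ha, ha', hb, hb', ← map_neg, h X Y, h Y X]
  congr 1
  rw [← neg_neg ((ε' • Y) * (ε • X)), ← h Y X]
  abel

theorem Rg_odd_smul (R : Module.End ℂ psl) (g X : SMat 𝒪) :
    ∃ Y : SMat 𝒪, ∀ ε : 𝒪, par ε = -ε → Rg R g (ε • X) = ε • Y := by
  refine ⟨pr (g.map par * extend R (pr ((Ring.inverse g).map par * X * g)) * Ring.inverse g),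
    fun ε hε => ?_⟩
  rw [Rg_apply, adj_apply, adjInv_apply, mul_smul_odd hε, smul_mul_assoc, pr_smul_left,
    extend_smul_left, mul_smul_odd hε, smul_mul_assoc, pr_smul_left]

/-- The product of two multiples of odd parameters is antisymmetric in the parameters. -/
theorem mul_odd_smul_eq {ε ε' : 𝒪} (hε : par ε = -ε) (hε' : par ε' = -ε') {X : SMat 𝒪}
    {a a' : Env 𝒪} (ha : a.1 = ε • X) (ha' : a'.1 = ε' • X) :
    ∃ z : 𝒪, par z = z ∧ a.1 * a'.1 = ((1 / 2 : ℂ) • ⁅a, a'⁆ : Env 𝒪).1 + z • (1 : SMat 𝒪) := by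
  have h : a.1 * a'.1 = -(a'.1 * a.1) := by
    rw [ha, ha', smul_mul_assoc, smul_mul_assoc, mul_smul_odd hε, mul_smul_odd hε', smul_smul,
      smul_smul, mul_anticomm_of_odd ε ε' hε hε', neg_smul]
  have h2 : a.1 * a'.1 = (1 / 2 : ℂ) • (a.1 * a'.1 - a'.1 * a.1) := by
    rw [← neg_eq_iff_eq_neg.2 h]
    module
  have h3 : str (a.1 * a'.1) = 0 := by
    rw [h2, str_smul, str_commutator a.even a'.even, smul_zero]
  obtain ⟨z, hz, hz'⟩ := exists_eq_pr_add
    (show sPar (a.1 * a'.1) = a.1 * a'.1 by rw [map_mul, a.even, a'.even]) h3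
  refine ⟨z, hz, ?_⟩
  rw [Submodule.coe_smul, Env.coe_lie, ← map_smul, ← h2]
  exact hz'

/-! ### The gauge transformation generated by the square -/

/-- A supermatrix in the component of grade `k` of `psl(4|4)` with even entries. -/
structure IsBoson (k : ℕ) (X : SMat 𝒪) : Prop where
  grade : omega X = Complex.I ^ k • X
  pr_eq : pr X = X
  even : ∀ i j, par (X i j) = X i j

theorem isBoson_of_hasGrade {X : Env 𝒪} {k : ℕ} (hk : Even k)
    (h : HasGrade Complex.I envOmega k X) : IsBoson k X.1 where
  grade := Subtype.ext_iff.1 h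
  pr_eq := X.pr_eq
  even i j := congrFun (congrFun (map_par_of_diag X.even (diag_of_even_grade hk h)) i) j

theorem IsBoson.smul_even {X : SMat 𝒪} {k : ℕ} (h : IsBoson k X) {z : 𝒪} (hz : par z = z) :
    IsBoson k (z • X) where
  grade := by rw [omega_smul_left, h.grade, smul_comm]
  pr_eq := by rw [pr_smul_left, h.pr_eq]
  even i j := by rw [Matrix.smul_apply, smul_eq_mul, map_mul, hz, h.even]

/-- The iterated variation of an antighost `w` with partner `l`, on the equation of motion of the
other ghost `l'`. -/
theorem antighost_gauge {ε ε' : 𝒪} (hε : par ε = -ε) (hε' : par ε' = -ε') {w l l' : SMat 𝒪}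
    (hw : IsGhost w) (hl : IsGhost l) (hl' : IsGhost l')
    (hN : HasGrade Complex.I envOmega 0 (-antiEnv hw hl)) {K : Env 𝒪}
    (hK : HasGrade Complex.I envOmega 2 K) :
    ε • (⁅-antiEnv hw hl, ghostEnv hε' hl'⁆ + ⁅K, ghostEnv hε' hl⁆ : Env 𝒪).1 =
      ((ε * ε') • pr (l * l' + l' * l)) * w - w * ((ε * ε') • pr (l * l' + l' * l))
      + (l * ((ε * ε') • -(K.1 + pr (l' * w + w * l')))
        - ((ε * ε') • -(K.1 + pr (l' * w + w * l'))) * l) := by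
  have he := par_odd_mul_odd hε hε'
  rw [Submodule.coe_add, coe_lie_ghostEnv hε' hl' (by decide) hN,
    coe_lie_ghostEnv hε' hl (by decide) hK, Submodule.coe_neg, coe_antiEnv]
  simp only [smul_mul_of_even he, smul_mul_assoc, ← smul_sub, ← smul_add, smul_smul]
  congr 1
  have h := jacobi_antiEnv hw hl hl'
  rw [neg_mul, mul_neg, neg_mul, mul_neg, add_mul, mul_add]
  linear_combination (norm := abel) h

end Square

/-! ### The equations of motion of the ghosts -/

section Detect

variable {𝒪 : Type*} [Ring 𝒪] [Algebra ℂ 𝒪]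

theorem str_single_mul (i j : Idx) (Y : SMat 𝒪) :
    str (Matrix.single i j (1 : 𝒪) * Y) = sgn i • Y j i := by
  rw [str_eq_sum, Finset.sum_eq_single i]
  · rw [Matrix.single_mul_apply_same, one_mul]
  · intro b _ hb
    rw [Matrix.single_mul_apply_of_ne _ _ _ _ _ hb, smul_zero]
  · simp

end Detect

section Ghosts

open SuperRing

variable {𝒪 : Type*} [Ring 𝒪] [Algebra ℂ 𝒪] [SuperRing 𝒪]

/-- For a block-diagonal `X` with even entries the sign rule of the supertranspose is trivial, and
`Ω` reverses the products with arbitrary supermatrices `Y`. -/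
theorem omega_mul_of_diag {X Y : SMat 𝒪} (hX : ∀ i j, par (X i j) = X i j)
    (hX' : ∀ i j, sgn i ≠ sgn j → X i j = 0) : omega (X * Y) = -(omega Y * omega X) ∧
      omega (Y * X) = -(omega X * omega Y) := by
  have h3 := kap_mul_self
  have h4 : ∀ i j k : Idx, sgn i = sgn k ∨ sgn k = sgn j → tau i k * tau k j = tau i j := by
    intro i j k h
    rcases i with i | i <;> rcases j with j | j <;> rcases k with k | k <;>
      first
      | (norm_num [tau]; done)
      | (rw [sgn_inl, sgn_inr] at h; norm_num at h)
  constructor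
  · ext i j
    rw [omega_apply, Matrix.neg_apply, Matrix.mul_apply, Matrix.mul_apply, Finset.smul_sum,
      ← Finset.sum_neg_distrib, ← sum_swp]
    refine Finset.sum_congr rfl fun k _ => ?_
    rw [omega_apply, omega_apply, smul_mul_smul_comm, mul_comm_of_even _ (hX _ _), ← neg_smul]
    by_cases hkj : sgn k = sgn j
    · congr 1
      linear_combination (kap i * kap j * tau i k * tau k j) * h3 k +
        (kap i * kap j) * h4 i j k (Or.inr hkj)
    · rw [hX' (swp j) (swp k) (by rw [sgn_swp, sgn_swp]; exact Ne.symm hkj), mul_zero, smul_zero,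
        smul_zero]
  · ext i j
    rw [omega_apply, Matrix.neg_apply, Matrix.mul_apply, Matrix.mul_apply, Finset.smul_sum,
      ← Finset.sum_neg_distrib, ← sum_swp]
    refine Finset.sum_congr rfl fun k _ => ?_
    rw [omega_apply, omega_apply, smul_mul_smul_comm, ← mul_comm_of_even _ (hX _ _), ← neg_smul]
    by_cases hik : sgn i = sgn k
    · congr 1
      linear_combination (kap i * kap j * tau i k * tau k j) * h3 k +
        (kap i * kap j) * h4 i j k (Or.inl hik)
    · rw [hX' (swp k) (swp i) (by rw [sgn_swp, sgn_swp]; exact Ne.symm hik), zero_mul, smul_zero,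
        smul_zero]

theorem isGhost_single {i j : Idx} (hij : sgn i ≠ sgn j) :
    IsGhost (Matrix.single i j (1 : 𝒪)) where
  even a b := by
    rw [Matrix.single_apply]
    split_ifs
    · exact map_one _
    · exact map_zero _
  off a b hab := by
    rw [Matrix.single_apply, if_neg]
    rintro ⟨rfl, rfl⟩
    exact hij hab

theorem IsGhost.smul {X : SMat 𝒪} (hX : IsGhost X) (c : ℂ) : IsGhost (c • X) where
  even i j := by rw [Matrix.smul_apply, map_smul, hX.even]
  off i j hij := by rw [Matrix.smul_apply, hX.off i j hij, smul_zero]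

theorem IsGhost.proj {X : SMat 𝒪} (hX : IsGhost X) (k : ℕ) : IsGhost (proj k X) := by
  rw [proj_apply]
  have h1 := hX.omega
  have h2 := h1.omega
  exact (((hX.add (h1.smul _)).add (h2.smul _)).add (h2.omega.smul _)).smul _

/-- A ghost-like supermatrix of grade `k` whose pairing with all ghosts of the opposite grade `m`
vanishes is zero. -/
theorem eq_zero_of_forall_str {Y : SMat 𝒪} {k m : ℕ} (hkm : (m + k) % 4 = 0) (hk : Odd k)
    (hY : omega Y = Complex.I ^ k • Y)
    (h : ∀ χ : SMat 𝒪, IsGhost χ → omega χ = Complex.I ^ m • χ → str (χ * Y) = 0) : Y = 0 := by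
  have hp : Complex.I ^ m * Complex.I ^ k = 1 := by
    rw [← pow_add, ← Nat.div_add_mod (m + k) 4, hkm, add_zero, pow_mul, Complex.I_pow_four, one_pow]
  have h0 : omega (omega Y) = -Y := by
    rw [hY, map_smul, hY, smul_smul, ← pow_add, ← two_mul, pow_mul, Complex.I_sq, hk.neg_one_pow,
      neg_one_smul]
  -- `Ω` acts on the first factor of the pairing with `Y` as the scalar `i ^ m`
  have hΩ : ∀ X : SMat 𝒪, str (omega X * Y) = Complex.I ^ m • str (X * Y) := by
    intro X
    rw [← str_omega_mul_omega X Y, hY, mul_smul_comm, str_smul, smul_smul, hp, one_smul]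
  ext j i
  by_cases hij : sgn i = sgn j
  · exact apply_eq_zero_of_odd_grade h0 hij.symm
  -- test with the projection of an elementary matrix, which reads off one entry of `Y`
  · have hE := isGhost_single (𝒪 := 𝒪) hij
    have h1 := h _ (hE.proj m) (omega_proj m _)
    have h2 : str (proj m (Matrix.single i j (1 : 𝒪)) * Y) = str (Matrix.single i j (1 : 𝒪) * Y) := by
      have c1 : (-Complex.I) ^ m * Complex.I ^ m = 1 := by rw [← mul_pow]; simp
      have c2 : (-1 : ℂ) ^ m * (Complex.I ^ m * Complex.I ^ m) = 1 := by
        rw [← mul_pow, ← mul_pow]; simp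
      have c3 : Complex.I ^ m * (Complex.I ^ m * (Complex.I ^ m * Complex.I ^ m)) = 1 := by
        rw [← mul_pow, ← mul_pow, ← mul_pow]; simp
      simp only [proj_apply, smul_mul_assoc, add_mul, str_smul, str_add, hΩ, smul_smul]
      rw [c1, c2, c3]
      module
    rw [h2, str_single_mul] at h1
    have h3 := congrArg (fun x => sgn i • x) h1
    rw [smul_smul, sgn_mul_self, one_smul, smul_zero] at h3
    exact h3

theorem sForm_antiEnv {χ X : SMat 𝒪} (hχ : IsGhost χ) (hX : IsGhost X) (Z : Env 𝒪) :
    sForm (-antiEnv hχ hX) Z = str (χ * (Z.1 * X - X * Z.1)) := by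
  rw [map_neg, LinearMap.neg_apply, sForm_apply, coe_antiEnv,
    str_pr_mul (hχ.str_anticomm X) Z.str_eq, add_mul, str_add, mul_assoc X, hX.str_mul, mul_sub,
    str_sub, mul_assoc, mul_assoc]
  abel

section Variation

variable {dp dm : 𝒪 →ₗ[ℂ] 𝒪} (hdp : IsEvenDerivation dp) (hdm : IsEvenDerivation dm)
  {R : Module.End ℂ psl} (hR : IsYangBaxter R) (η : ℝ) {Φ : Fields 𝒪} (hΦ : IsField dp dm Φ)
  (hreg : Regular R η Φ)

include hreg in
/-- The variation of the density under a variation of the ghost currents. -/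
theorem density_varied (np nm v : Env 𝒪)
    (hv : v = envRg hR hΦ.g ((η : ℂ) • envWeight wMinus v + (4 : ℂ) • nm))
    (h4 : sForm nm np = 0) (h5 : sForm np v = 0) :
    ((1 / 4 : ℂ) • sForm (envMc hdp hΦ.g) (envWeight wMinus (envMc hdm hΦ.g))
        + sForm (hΦ.gh.np + np) (envMc hdm hΦ.g) + sForm (hΦ.gh.nm + nm) (envMc hdp hΦ.g)
        - sForm (hΦ.gh.nm + nm) (hΦ.gh.np + np)
        + ((η : ℂ) / 4) • sForm (envWeight wPlus (envMc hdp hΦ.g) + (4 : ℂ) • (hΦ.gh.np + np))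
          (envPot hR hΦ.g (-η) wMinus (envMc hdm hΦ.g) hΦ.gh.nm + v))
    - ((1 / 4 : ℂ) • sForm (envMc hdp hΦ.g) (envWeight wMinus (envMc hdm hΦ.g))
        + sForm hΦ.gh.np (envMc hdm hΦ.g) + sForm hΦ.gh.nm (envMc hdp hΦ.g)
        - sForm hΦ.gh.nm hΦ.gh.np
        + ((η : ℂ) / 4) • sForm (envWeight wPlus (envMc hdp hΦ.g) + (4 : ℂ) • hΦ.gh.np)
          (envPot hR hΦ.g (-η) wMinus (envMc hdm hΦ.g) hΦ.gh.nm)) =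
      sForm np (curMinus hdm hR η hΦ - hΦ.gh.nm) + sForm nm (curPlus hdp hR η hΦ - hΦ.gh.np) := by
  have hOm : IsUnit (dressOp R (-η) wMinus Φ.g) := by rw [← opMinus_eq]; exact hreg.1
  have hOp : IsUnit (dressOp R η wPlus Φ.g) := by rw [← opPlus_eq]; exact hreg.2
  have hKm : curMinus hdm hR η hΦ = envMc hdm hΦ.g - (-η : ℂ) •
    envPot hR hΦ.g (-η) wMinus (envMc hdm hΦ.g) hΦ.gh.nm := rfl
  have hKp : curPlus hdp hR η hΦ = envMc hdp hΦ.g - (η : ℂ) •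
    envPot hR hΦ.g η wPlus (envMc hdp hΦ.g) hΦ.gh.np := rfl
  have key := isInvariantForm_sForm.lagrangian_variation (B := sForm) isGrading_env
    envWeight_minus envWeight_plus (sForm_envRg hR hΦ.g) (η : ℂ) (Ap := envMc hdp hΦ.g)
    (Am := envMc hdm hΦ.g) (Np := hΦ.gh.np) (Nm := hΦ.gh.nm) (ap := 0) (am := 0) (np := np)
    (nm := nm) (v := v) (ρ := 0)
    (Vm := envPot hR hΦ.g (-η) wMinus (envMc hdm hΦ.g) hΦ.gh.nm)
    (Cm := envWeight wMinus (curMinus hdm hR η hΦ) + (4 : ℂ) • hΦ.gh.nm)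
    (envPot_eq_curPlus hdp hR η hΦ hOp)
    (by rw [hKm, neg_smul, sub_neg_eq_add, map_add (envWeight _), map_smul (envWeight _)])
    (by rw [hKp, map_sub (envWeight _), map_smul (envWeight _)])
    (by rw [map_zero, zero_add, add_zero]; exact hv) (by simp) (by simp) (by simp) h4
    (by rw [map_zero, zero_add, map_smul, LinearMap.smul_apply, h5, smul_zero])
  rw [add_zero, add_zero] at key
  rw [key, hKm, hKp, neg_smul, sub_neg_eq_add]
  simp

theorem hasGrade_sub_zero {K N : Env 𝒪} (hN : HasGrade Complex.I envOmega 0 N) :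
    HasGrade Complex.I envOmega 0 (envProj 0 K - N) := by
  have h : HasGrade Complex.I envOmega 0 (envProj 0 K) := isGrading_env.hasGrade_proj 0 K
  rw [HasGrade, map_sub, h, hN, smul_sub]

theorem sForm_grade_zero {n : Env 𝒪} (hn : HasGrade Complex.I envOmega 0 n) {K N : Env 𝒪} :
    sForm n (K - N) = sForm n (envProj 0 K - N) := by
  have h : sForm n K = sForm n (envProj 0 K) :=
    isInvariantForm_sForm.apply_proj isGrading_env 0 hn rfl K
  rw [map_sub, map_sub, h]

/-- The equation of motion of a ghost `X` of grade `k` from the pairing with its antighosts. -/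
theorem ghost_eom {D : 𝒪 →ₗ[ℂ] 𝒪} {X : SMat 𝒪} {k m : ℕ} (hkm : (m + k) % 4 = 0) (hk : Odd k)
    (hX : omega X = Complex.I ^ k • X) {Z : Env 𝒪} (hZ : HasGrade Complex.I envOmega 0 Z)
    (h : ∀ χ : SMat 𝒪, IsGhost χ → omega χ = Complex.I ^ m • χ →
      str (χ * (X.map D + (Z.1 * X - X * Z.1))) = 0) : X.map D + (Z.1 * X - X * Z.1) = 0 := by
  have hz : omega Z.1 = Z.1 := by
    have := Subtype.ext_iff.1 hZ
    rwa [pow_zero, one_smul] at this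
  have hd := diag_of_even_grade (by decide) hZ
  have hp : ∀ i j, par (Z.1 i j) = Z.1 i j := fun i j =>
    congrFun (congrFun (map_par_of_diag Z.even hd) i) j
  refine eq_zero_of_forall_str hkm hk ?_ h
  have h1 : omega (X.map D) = Complex.I ^ k • X.map D := by
    rw [omega_map, hX]
    ext i j
    exact map_smul D _ _
  rw [map_add, map_sub, h1, (omega_mul_of_diag hp hd (Y := X)).1,
    (omega_mul_of_diag hp hd (Y := X)).2, hz, hX, smul_mul_assoc, mul_smul_comm, smul_add, smul_sub]
  abel

include hdp hdm hR hreg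

/-- The equation of motion obtained by varying `ω_{1+}`. -/
theorem eom_of_w1 (h : ∀ χ : SMat 𝒪, IsGhost χ → omega χ = Complex.I ^ 1 • χ →
      lagrangian dp dm R η { Φ with w1 := Φ.w1 + χ } = lagrangian dp dm R η Φ) :
    Φ.l3.map dm + ((envProj 0 (curMinus hdm hR η hΦ) - hΦ.gh.nm).1 * Φ.l3
      - Φ.l3 * (envProj 0 (curMinus hdm hR η hΦ) - hΦ.gh.nm).1) = 0 := by
  refine ghost_eom (m := 1) rfl (by decide) hΦ.gh.l3_grade (hasGrade_sub_zero hΦ.gh.hasGrade_nm)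
    fun χ hχ hχ1 => ?_
  have hgh : IsGhosts Φ.w3 (Φ.w1 + χ) Φ.l1 Φ.l3 :=
    { hΦ.gh with
      w1_ghost := hΦ.gh.w1_ghost.add hχ
      w1_grade := by rw [map_add, hΦ.gh.w1_grade, hχ1, smul_add] }
  have h1 := h χ hχ hχ1
  have hnp : hgh.np = hΦ.gh.np + -antiEnv hχ hΦ.gh.l3_ghost := by
    apply Subtype.ext
    change -pr ((Φ.w1 + χ) * Φ.l3 + Φ.l3 * (Φ.w1 + χ)) =
      -pr (Φ.w1 * Φ.l3 + Φ.l3 * Φ.w1) + -pr (χ * Φ.l3 + Φ.l3 * χ)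
    rw [← neg_add, ← map_add]
    congr 2
    noncomm_ring
  have hnm : hgh.nm = hΦ.gh.nm := rfl
  have e1 := lagrangian_eq_sForm hdp hdm hR η hΦ.g hgh hreg
  have e0 : lagrangian dp dm R η Φ = _ := lagrangian_eq_sForm hdp hdm hR η hΦ.g hΦ.gh hreg
  rw [hnp, hnm] at e1
  have e2 := density_varied hdp hdm hR η hΦ hreg (-antiEnv hχ hΦ.gh.l3_ghost) 0 0 (by simp) (by simp)
    (by simp)
  rw [add_zero, add_zero, map_zero, LinearMap.zero_apply, add_zero,
    sForm_grade_zero (hasGrade_zero_antiEnv hχ hΦ.gh.l3_ghost hχ1 hΦ.gh.l3_grade rfl),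
    sForm_antiEnv] at e2
  rw [e1, e0, add_mul, add_right_comm (Φ.w1 * _), str_add _ (χ * _)] at h1
  rw [mul_add, str_add]
  linear_combination (norm := abel) h1 - e2

/-- The equation of motion obtained by varying `ω_{3-}`.  In contrast to the variation of `ω_{1+}`,
the potential `V-` varies as well. -/
theorem eom_of_w3 (h : ∀ χ : SMat 𝒪, IsGhost χ → omega χ = Complex.I ^ 3 • χ →
      lagrangian dp dm R η { Φ with w3 := Φ.w3 + χ } = lagrangian dp dm R η Φ) :
    Φ.l1.map dp + ((envProj 0 (curPlus hdp hR η hΦ) - hΦ.gh.np).1 * Φ.l1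
      - Φ.l1 * (envProj 0 (curPlus hdp hR η hΦ) - hΦ.gh.np).1) = 0 := by
  refine ghost_eom (m := 3) rfl (by decide) hΦ.gh.l1_grade (hasGrade_sub_zero hΦ.gh.hasGrade_np)
    fun χ hχ hχ1 => ?_
  have hOm : IsUnit (dressOp R (-η) wMinus Φ.g) := by rw [← opMinus_eq]; exact hreg.1
  have hgh : IsGhosts (Φ.w3 + χ) Φ.w1 Φ.l1 Φ.l3 :=
    { hΦ.gh with
      w3_ghost := hΦ.gh.w3_ghost.add hχ
      w3_grade := by rw [map_add, hΦ.gh.w3_grade, hχ1, smul_add] }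
  have h1 := h χ hχ hχ1
  set n : Env 𝒪 := -antiEnv hχ hΦ.gh.l1_ghost with hn
  have hnm : hgh.nm = hΦ.gh.nm + n := by
    apply Subtype.ext
    change -pr ((Φ.w3 + χ) * Φ.l1 + Φ.l1 * (Φ.w3 + χ)) =
      -pr (Φ.w3 * Φ.l1 + Φ.l1 * Φ.w3) + -pr (χ * Φ.l1 + Φ.l1 * χ)
    rw [← neg_add, ← map_add]
    congr 2
    noncomm_ring
  have hnp : hgh.np = hΦ.gh.np := rfl
  have e1 := lagrangian_eq_sForm hdp hdm hR η hΦ.g hgh hreg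
  have e0 : lagrangian dp dm R η Φ = _ := lagrangian_eq_sForm hdp hdm hR η hΦ.g hΦ.gh hreg
  obtain ⟨v, hv⟩ : ∃ v, envPot hR hΦ.g (-η) wMinus (envMc hdm hΦ.g) (hΦ.gh.nm + n) =
      envPot hR hΦ.g (-η) wMinus (envMc hdm hΦ.g) hΦ.gh.nm + v := ⟨_, (add_sub_cancel _ _).symm⟩
  have hv' : v = envRg hR hΦ.g ((η : ℂ) • envWeight wMinus v + (4 : ℂ) • n) := by
    have f1 := envPot_eq hR hΦ.g hOm (envMc hdm hΦ.g) (hΦ.gh.nm + n)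
    have f0 := envPot_eq hR hΦ.g hOm (envMc hdm hΦ.g) hΦ.gh.nm
    rw [envCur, hv] at f1
    rw [envCur] at f0
    simp only [map_add, map_sub, map_smul] at f0 f1 ⊢
    linear_combination (norm := module) f1 - f0
  rw [hnm, hnp, hv] at e1
  have e2 := density_varied hdp hdm hR η hΦ hreg 0 n v hv' (by simp) (by simp)
  rw [add_zero, map_zero, LinearMap.zero_apply, zero_add,
    sForm_grade_zero (hasGrade_zero_antiEnv hχ hΦ.gh.l1_ghost hχ1 hΦ.gh.l1_grade rfl), hn,
    sForm_antiEnv] at e2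
  rw [e1, e0, add_mul, ← add_assoc (Φ.w1 * _), str_add _ (χ * _)] at h1
  rw [mul_add, str_add]
  linear_combination (norm := abel) h1 - e2

end Variation

end Ghosts

/-! ### Nilpotency on the equations of motion of the ghosts -/

section Nilpotency

open SuperRing

variable {𝒪 : Type*} [Ring 𝒪] [Algebra ℂ 𝒪] [SuperRing 𝒪]
  {dp dm : 𝒪 →ₗ[ℂ] 𝒪} (hdp : IsEvenDerivation dp) (hdm : IsEvenDerivation dm)
  {R : Module.End ℂ psl} (hR : IsYangBaxter R) (η : ℝ)

include hR in
/-- The iterated variation of the group element: up to an even scalar it is the Lorentz rotation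
with parameter `[ελ₁, ε'λ₃]`. -/
theorem group_square {g w3 w1 l1 l3 : SMat 𝒪} (hg : IsEvenUnit g) (h : IsGhosts w3 w1 l1 l3)
    {ε ε' : 𝒪} (hε : par ε = -ε) (hε' : par ε' = -ε') :
    ∃ z : 𝒪, par z = z ∧
      (brstParam hR η ((isNilIdeal_oddIdeal hε').isEvenUnit hg (brstParam_mem hR η hg h hε')) h hε).1
        * ((1 + (brstParam hR η hg h hε').1) * g) - (brstParam hR η hg h hε).1 * g =
      (⁅ghostEnv hε h.l1_ghost, ghostEnv hε' h.l3_ghost⁆ : Env 𝒪).1 * g + z • g := by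
  have hF := isNilIdeal_oddIdeal hε'
  have hΛF := brstParam_mem hR η hg h hε'
  set Λ := brstParam hR η hg h hε with hΛ
  set Λ' := brstParam hR η hg h hε' with hΛ'
  set m := ghostEnv hε h.l1_ghost - ghostEnv hε h.l3_ghost with hm
  set m' := ghostEnv hε' h.l1_ghost - ghostEnv hε' h.l3_ghost with hm'
  set ρ : Env 𝒪 := -((η : ℂ) • (⁅Λ', envRg hR hg m⁆ - envRg hR hg ⁅Λ', m⁆)) with hρ
  have hvar : brstParam hR η (hF.isEvenUnit hg hΛF) h hε = Λ + ρ := by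
    rw [brstParam, hF.envRg_varied hR hg hΛF, ← hm, hΛ, brstParam, ← hm, hρ]
    module
  have hρF : ρ.1 ∈ entriesIn (oddIdeal 𝒪 ε') := Submodule.neg_mem _ (Submodule.smul_mem _ _
    (Submodule.sub_mem _ (hF.lie_mem hΛF _)
      (Rg_mem_entriesIn hF.mul_right hF.mul_left (hF.lie_mem hΛF _) R g)))
  obtain ⟨Y, hY⟩ := Rg_odd_smul R g (l1 - l3)
  have hRm : (envRg hR hg m).1 = ε • Y := by
    rw [← hY ε hε, smul_sub]
    rfl
  have hRm' : (envRg hR hg m').1 = ε' • Y := by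
    rw [← hY ε' hε', smul_sub]
    rfl
  have hs : (ghostEnv hε h.l1_ghost + ghostEnv hε h.l3_ghost).1 = ε • (l1 + l3) :=
    (smul_add _ _ _).symm
  have hs' : (ghostEnv hε' h.l1_ghost + ghostEnv hε' h.l3_ghost).1 = ε' • (l1 + l3) :=
    (smul_add _ _ _).symm
  have hm1 : m.1 = ε • (l1 - l3) := (smul_sub _ _ _).symm
  have hm1' : m'.1 = ε' • (l1 - l3) := (smul_sub _ _ _).symm
  have hΛ1 : Λ.1 = ε • (l1 + l3 - (η : ℂ) • Y) := by
    rw [hΛ, brstParam, Submodule.coe_sub, hs, Submodule.coe_smul, hRm, smul_sub, smul_comm]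
  have hΛ1' : Λ'.1 = ε' • (l1 + l3 - (η : ℂ) • Y) := by
    rw [hΛ', brstParam, Submodule.coe_sub, hs', Submodule.coe_smul, hRm', smul_sub, smul_comm]
  have key := group_variation (envRg_lie hR hg) (η : ℂ)
    (lie_ghostEnv_self_eq_zero hε hε' h.l1_ghost h.l1_pure)
    (lie_ghostEnv_self_eq_zero hε hε' h.l3_ghost h.l3_pure)
    (lie_ghostEnv_self_eq_zero hε' hε h.l1_ghost h.l1_pure)
    (lie_ghostEnv_self_eq_zero hε' hε h.l3_ghost h.l3_pure)
    (by
      apply Subtype.ext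
      rw [lie_ghostEnv hε hε', lie_ghostEnv hε hε', add_comm (l3 * l1)])
    (lie_odd_smul hε hε' hRm hRm' hs hs') (lie_odd_smul hε hε' hRm hRm' hm1 hm1')
    (show Λ = _ from rfl) (show Λ' = _ from rfl)
  obtain ⟨z, hz, hz'⟩ := mul_odd_smul_eq hε hε' hΛ1 hΛ1'
  refine ⟨z, hz, ?_⟩
  have h0 : ρ.1 * Λ'.1 = 0 := hF.mul_eq_zero_of_mem hρF hΛF
  have hk : (1 / 2 : ℂ) • ⁅Λ, Λ'⁆ - (η : ℂ) • (⁅Λ', envRg hR hg m⁆ - envRg hR hg ⁅Λ', m⁆) =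
      (1 / 2 : ℂ) • ⁅Λ, Λ'⁆ + ρ := sub_eq_add_neg _ _
  rw [hvar, ← key, ← hm, hk, Submodule.coe_add, Submodule.coe_add]
  have h1 : (Λ.1 + ρ.1) * ((1 + Λ'.1) * g) - Λ.1 * g =
      (Λ.1 * Λ'.1 + ρ.1 + ρ.1 * Λ'.1) * g := by noncomm_ring
  rw [h1, h0, hz', add_zero, add_right_comm, add_mul _ (z • 1), smul_mul_assoc, one_mul]

section

variable {S : Type*} [CommRing S] [Algebra ℂ S] (β : BodyData 𝒪 S) {Φ : Fields 𝒪}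
  (hΦ : IsField dp dm Φ) (hreg : Regular R η Φ) {ε' : 𝒪}
  (hε' : par ε' = -ε') (hεp : dp ε' = 0) (hεm : dm ε' = 0) (hεβ : β.body ε' = 0)

include hdp β hreg hεp hεm hεβ in
/-- The iterated variation of `ω_{3-}`, on the equation of motion obtained by varying `ω_{1+}`. -/
theorem brstW3_varied
    (heom : Φ.l3.map dm + ((envProj 0 (curMinus hdm hR η hΦ) - hΦ.gh.nm).1 * Φ.l3
      - Φ.l3 * (envProj 0 (curMinus hdm hR η hΦ) - hΦ.gh.nm).1) = 0) :
    brstW3 dm R η (Φ + brst dp dm R η ε' Φ) - brstW3 dm R η Φ =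
      (⁅hΦ.gh.nm, ghostEnv hε' hΦ.gh.l3_ghost⁆
        + ⁅envProj 2 (curMinus hdm hR η hΦ), ghostEnv hε' hΦ.gh.l1_ghost⁆ : Env 𝒪).1 := by
  have hreg' := (isField_add_brst hdp hdm hR η β hΦ hreg hε' hεp hεm hεβ).2
  have hF := isNilIdeal_oddIdeal hε'
  have hΛ := brstParam_mem hR η hΦ.g hΦ.gh hε'
  have hO : IsUnit (dressOp R (-η) wMinus Φ.g) := by rw [← opMinus_eq]; exact hreg.1
  rw [add_brst_eq hdp hdm hR η hΦ hreg hε'] at hreg' ⊢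
  have hgh' := hΦ.gh.varied hε' (hasGrade_envProj_three (curMinus hdm hR η hΦ))
    (hasGrade_envProj_one (curPlus hdp hR η hΦ))
  have hO' : IsUnit (dressOp R (-η) wMinus ((1 + (brstParam hR η hΦ.g hΦ.gh hε').1) * Φ.g)) := by
    rw [← opMinus_eq]; exact hreg'.1
  have hnm : hgh'.nm = hΦ.gh.nm + ⁅ghostEnv hε' hΦ.gh.l1_ghost,
      envProj 3 (curMinus hdm hR η hΦ)⁆ :=
    antiEnv_add_smul hε' hΦ.gh.w3_ghost hΦ.gh.l1_ghost (by decide) (hasGrade_envProj_three _)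
  have hl1 := hasGrade_ghostEnv hε' hΦ.gh.l1_ghost hΦ.gh.l1_grade
  have hl3 := hasGrade_ghostEnv hε' hΦ.gh.l3_ghost hΦ.gh.l3_grade
  have key := envCur_varied isGrading_env hR hΦ.g envWeight_minus hO β hF hΛ
    (mc_varied_mem hdm hε' hεm hΛ (envMc hdm hΦ.g))
    (hF.lie_mem (smul_mem_oddIdeal _ _ : (ghostEnv hε' hΦ.gh.l1_ghost).1 ∈ _)
      (envProj 3 (curMinus hdm hR η hΦ)))
    hO' hl1 hl3 (hasGrade_envD hdm hl1) (hasGrade_envD hdm hl3) (hΦ.gh.lie_nm hε')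
    (by rw [mc_brst_varied hR η hdm hΦ.g hΦ.minus hΦ.gh hε']; module) rfl
    (by rw [neg_smul, ← sub_eq_add_neg]; rfl)
    (by
      have h1 := coe_lie_ghostEnv hε' hΦ.gh.l3_ghost (by decide)
        (hasGrade_sub_zero (K := curMinus hdm hR η hΦ) hΦ.gh.hasGrade_nm)
      have h2 : (envD hdm (ghostEnv hε' hΦ.gh.l3_ghost)).1 = ε' • Φ.l3.map dm :=
        map_const_smul hdm hεm _
      have h3 : envD hdm (ghostEnv hε' hΦ.gh.l3_ghost)
          + ⁅envProj 0 (curMinus hdm hR η hΦ) - hΦ.gh.nm, ghostEnv hε' hΦ.gh.l3_ghost⁆ = 0 := by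
        apply Subtype.ext
        rw [Submodule.coe_add, h1, h2, ← smul_add, heom, smul_zero]
        rfl
      rw [sub_lie, ← add_sub_assoc] at h3
      exact h3)
  have e1 := brstW3_eq (dm := dm) hdm hR η (Φ := ⟨(1 + (brstParam hR η hΦ.g hΦ.gh hε').1) * Φ.g,
      Φ.w3 + ε' • -(envProj 3 (curMinus hdm hR η hΦ)).1,
      Φ.w1 + ε' • -(envProj 1 (curPlus hdp hR η hΦ)).1, Φ.l1, Φ.l3⟩) (hF.isEvenUnit hΦ.g hΛ)
    hgh' hreg'
  rw [hF.envMc_varied hdm (map_mem_oddIdeal hdm hεm) hΦ.g hΦ.minus hΛ, hnm] at e1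
  rw [e1, brstW3_eq hdm hR η hΦ.g hΦ.gh hreg, sub_neg_eq_add, neg_add_eq_sub, ← neg_sub,
    ← Submodule.coe_sub]
  rw [eq_comm, ← neg_eq_iff_eq_neg, ← Submodule.coe_neg]
  exact congrArg Subtype.val key.symm

include hdm β hreg hεp hεm hεβ in
/-- The iterated variation of `ω_{1+}`, on the equation of motion obtained by varying `ω_{3-}`. -/
theorem brstW1_varied
    (heom : Φ.l1.map dp + ((envProj 0 (curPlus hdp hR η hΦ) - hΦ.gh.np).1 * Φ.l1
      - Φ.l1 * (envProj 0 (curPlus hdp hR η hΦ) - hΦ.gh.np).1) = 0) :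
    brstW1 dp R η (Φ + brst dp dm R η ε' Φ) - brstW1 dp R η Φ =
      (⁅hΦ.gh.np, ghostEnv hε' hΦ.gh.l1_ghost⁆
        + ⁅envProj 2 (curPlus hdp hR η hΦ), ghostEnv hε' hΦ.gh.l3_ghost⁆ : Env 𝒪).1 := by
  have hreg' := (isField_add_brst hdp hdm hR η β hΦ hreg hε' hεp hεm hεβ).2
  have hF := isNilIdeal_oddIdeal hε'
  have hΛ := brstParam_mem hR η hΦ.g hΦ.gh hε'
  have hO : IsUnit (dressOp R η wPlus Φ.g) := by rw [← opPlus_eq]; exact hreg.2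
  rw [add_brst_eq hdp hdm hR η hΦ hreg hε'] at hreg' ⊢
  have hgh' := hΦ.gh.varied hε' (hasGrade_envProj_three (curMinus hdm hR η hΦ))
    (hasGrade_envProj_one (curPlus hdp hR η hΦ))
  have hO' : IsUnit (dressOp R η wPlus ((1 + (brstParam hR η hΦ.g hΦ.gh hε').1) * Φ.g)) := by
    rw [← opPlus_eq]; exact hreg'.2
  have hnp : hgh'.np = hΦ.gh.np + ⁅ghostEnv hε' hΦ.gh.l3_ghost,
      envProj 1 (curPlus hdp hR η hΦ)⁆ :=
    antiEnv_add_smul hε' hΦ.gh.w1_ghost hΦ.gh.l3_ghost (by decide) (hasGrade_envProj_one _)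
  have hl1 := hasGrade_ghostEnv hε' hΦ.gh.l1_ghost hΦ.gh.l1_grade
  have hl3 := hasGrade_ghostEnv hε' hΦ.gh.l3_ghost hΦ.gh.l3_grade
  -- the grading by powers of `-i` exchanges the grades one and three
  have e1 : (-Complex.I) ^ 1 = Complex.I ^ 3 := by rw [pow_one, Complex.I_pow_three]
  have e3 : (-Complex.I) ^ 3 = Complex.I ^ 1 := by
    rw [pow_one, Odd.neg_pow (by decide), Complex.I_pow_three, neg_neg]
  have hgr1 : ∀ {X : Env 𝒪}, HasGrade Complex.I envOmega 3 X → HasGrade (-Complex.I) envOmega 1 X :=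
    fun {X} h => by rw [HasGrade, e1]; exact h
  have hgr3 : ∀ {X : Env 𝒪}, HasGrade Complex.I envOmega 1 X → HasGrade (-Complex.I) envOmega 3 X :=
    fun {X} h => by rw [HasGrade, e3]; exact h
  have key := envCur_varied isGrading_env.neg hR hΦ.g
    (fun X => by
      change _ = gradeProj 𝒪 3 X + (2 : ℂ) • gradeProj 𝒪 2 X + (3 : ℂ) • gradeProj 𝒪 1 X
      rw [envWeight_plus]
      abel) hO β hF hΛ
    (mc_varied_mem hdp hε' hεp hΛ (envMc hdp hΦ.g))
    (hF.lie_mem (smul_mem_oddIdeal _ _ : (ghostEnv hε' hΦ.gh.l3_ghost).1 ∈ _)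
      (envProj 1 (curPlus hdp hR η hΦ)))
    hO' (hgr1 hl3) (hgr3 hl1) (hgr1 (hasGrade_envD hdp hl3)) (hgr3 (hasGrade_envD hdp hl1))
    (hΦ.gh.lie_np hε')
    (by
      have hsw : envD hdp (ghostEnv hε' hΦ.gh.l1_ghost) - envD hdp (ghostEnv hε' hΦ.gh.l3_ghost)
          + ⁅envMc hdp hΦ.g, ghostEnv hε' hΦ.gh.l1_ghost - ghostEnv hε' hΦ.gh.l3_ghost⁆ =
          -(envD hdp (ghostEnv hε' hΦ.gh.l3_ghost) - envD hdp (ghostEnv hε' hΦ.gh.l1_ghost)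
          + ⁅envMc hdp hΦ.g, ghostEnv hε' hΦ.gh.l3_ghost - ghostEnv hε' hΦ.gh.l1_ghost⁆) := by
        simp only [lie_sub]
        abel
      rw [mc_brst_varied hR η hdp hΦ.g hΦ.plus hΦ.gh hε', hsw, map_neg,
        add_comm (ghostEnv hε' hΦ.gh.l1_ghost)]
      module) rfl
    (by
      rw [brstParam, ← neg_sub (ghostEnv hε' hΦ.gh.l3_ghost), map_neg]
      module)
    (by
      have h1 := coe_lie_ghostEnv hε' hΦ.gh.l1_ghost (by decide)
        (hasGrade_sub_zero (K := curPlus hdp hR η hΦ) hΦ.gh.hasGrade_np)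
      have h2 : (envD hdp (ghostEnv hε' hΦ.gh.l1_ghost)).1 = ε' • Φ.l1.map dp :=
        map_const_smul hdp hεp _
      have h3 : envD hdp (ghostEnv hε' hΦ.gh.l1_ghost)
          + ⁅envProj 0 (curPlus hdp hR η hΦ) - hΦ.gh.np, ghostEnv hε' hΦ.gh.l1_ghost⁆ = 0 := by
        apply Subtype.ext
        rw [Submodule.coe_add, h1, h2, ← smul_add, heom, smul_zero]
        rfl
      rw [sub_lie, ← add_sub_assoc] at h3
      exact h3)
  have e1 := brstW1_eq (dp := dp) hdp hR η (Φ := ⟨(1 + (brstParam hR η hΦ.g hΦ.gh hε').1) * Φ.g,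
      Φ.w3 + ε' • -(envProj 3 (curMinus hdm hR η hΦ)).1,
      Φ.w1 + ε' • -(envProj 1 (curPlus hdp hR η hΦ)).1, Φ.l1, Φ.l3⟩) (hF.isEvenUnit hΦ.g hΛ)
    hgh' hreg'
  rw [hF.envMc_varied hdp (map_mem_oddIdeal hdp hεp) hΦ.g hΦ.plus hΛ, hnp] at e1
  rw [e1, brstW1_eq hdp hR η hΦ.g hΦ.gh hreg, sub_neg_eq_add, neg_add_eq_sub, ← neg_sub,
    ← Submodule.coe_sub]
  rw [eq_comm, ← neg_eq_iff_eq_neg, ← Submodule.coe_neg]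
  exact congrArg Subtype.val key.symm

include hdp hdm hR β hreg hΦ hε' hεp hεm hεβ in
/-- On the equations of motion obtained by varying the antighosts, the square of the BRST
transformation is a gauge transformation with parameter `M = εε' {λ₁, λ₃}`. -/
theorem brst_square {ε : 𝒪} (hε : par ε = -ε)
    (h1 : ∀ χ : SMat 𝒪, IsGhost χ → omega χ = Complex.I ^ 1 • χ →
      lagrangian dp dm R η { Φ with w1 := Φ.w1 + χ } = lagrangian dp dm R η Φ)
    (h3 : ∀ χ : SMat 𝒪, IsGhost χ → omega χ = Complex.I ^ 3 • χ →
      lagrangian dp dm R η { Φ with w3 := Φ.w3 + χ } = lagrangian dp dm R η Φ)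
    {Ψ : Fields 𝒪}
    (hΨ : Ψ = brst dp dm R η ε (Φ + brst dp dm R η ε' Φ) - brst dp dm R η ε Φ) :
    ∃ (M S S' : SMat 𝒪) (c : 𝒪), IsBoson 0 M ∧ IsBoson 2 S ∧ IsBoson 2 S' ∧ par c = c ∧
      Ψ.g = M * Φ.g + c • Φ.g ∧
      Ψ.w3 = M * Φ.w3 - Φ.w3 * M + (Φ.l1 * S - S * Φ.l1) ∧
      Ψ.w1 = M * Φ.w1 - Φ.w1 * M + (Φ.l3 * S' - S' * Φ.l3) ∧
      Ψ.l1 = M * Φ.l1 - Φ.l1 * M ∧ Ψ.l3 = M * Φ.l3 - Φ.l3 * M := by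
  have heom1 := eom_of_w1 hdp hdm hR η hΦ hreg h1
  have heom3 := eom_of_w3 hdp hdm hR η hΦ hreg h3
  have hw3 := brstW3_varied hdp hdm hR η β hΦ hreg hε' hεp hεm hεβ heom1
  have hw1 := brstW1_varied hdp hdm hR η β hΦ hreg hε' hεp hεm hεβ heom3
  have he := par_odd_mul_odd hε hε'
  have hgh := hΦ.gh
  have hgr0 : ∀ {X Y : SMat 𝒪} (hX : IsGhost X) (hY : IsGhost Y) {j k l : ℕ}, Even l →
      omega X = Complex.I ^ j • X → omega Y = Complex.I ^ k • Y → (j + k) % 4 = l % 4 →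
      IsBoson l (antiEnv hX hY).1 := by
    intro X Y hX hY j k l hl hj hk hjk
    refine isBoson_of_hasGrade hl ?_
    rw [HasGrade, omega_antiEnv hX hY hj hk, ← pow_add, Complex.I_pow_eq_pow_mod, hjk,
      ← Complex.I_pow_eq_pow_mod]
  have hneg : ∀ {k : ℕ} {X : SMat 𝒪}, IsBoson k X → IsBoson k (-X) := fun {k X} h =>
    ⟨by rw [map_neg, h.grade, smul_neg], by rw [map_neg, h.pr_eq],
      fun i j => by rw [Matrix.neg_apply, map_neg, h.even]⟩
  have hadd : ∀ {k : ℕ} {X Y : SMat 𝒪}, IsBoson k X → IsBoson k Y → IsBoson k (X + Y) :=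
    fun {k X Y} h h' => ⟨by rw [map_add, h.grade, h'.grade, smul_add],
      by rw [map_add, h.pr_eq, h'.pr_eq],
      fun i j => by rw [Matrix.add_apply, map_add, h.even, h'.even]⟩
  have hK2 : ∀ K : Env 𝒪, HasGrade Complex.I envOmega 2 (envProj 2 K) :=
    fun K => isGrading_env.hasGrade_proj 2 K
  obtain ⟨z, hz, hgz⟩ := group_square hR η hΦ.g hΦ.gh hε hε'
  refine ⟨(ε * ε') • pr (Φ.l1 * Φ.l3 + Φ.l3 * Φ.l1),
    (ε * ε') • -((envProj 2 (curMinus hdm hR η hΦ)).1 + pr (Φ.l3 * Φ.w3 + Φ.w3 * Φ.l3)),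
    (ε * ε') • -((envProj 2 (curPlus hdp hR η hΦ)).1 + pr (Φ.l1 * Φ.w1 + Φ.w1 * Φ.l1)), z,
    (hgr0 (l := 0) hgh.l1_ghost hgh.l3_ghost (by decide) hgh.l1_grade hgh.l3_grade rfl).smul_even he,
    (hneg (hadd (isBoson_of_hasGrade (by decide) (hK2 _)) (hgr0 (l := 2) hgh.l3_ghost hgh.w3_ghost
      (by decide) hgh.l3_grade hgh.w3_grade rfl))).smul_even he,
    (hneg (hadd (isBoson_of_hasGrade (by decide) (hK2 _)) (hgr0 (l := 2) hgh.l1_ghost hgh.w1_ghost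
      (by decide) hgh.l1_grade hgh.w1_grade rfl))).smul_even he, hz, ?_, ?_, ?_, ?_, ?_⟩
  · have e0 := coe_brstParam hR η hΦ.g hΦ.gh hε
    have e1 := coe_brstParam hR η ((isNilIdeal_oddIdeal hε').isEvenUnit hΦ.g
      (brstParam_mem hR η hΦ.g hΦ.gh hε')) hΦ.gh hε
    rw [e0, e1, lie_ghostEnv hε hε' hgh.l1_ghost hgh.l3_ghost] at hgz
    rw [← hgz, hΨ, add_brst_eq hdp hdm hR η hΦ hreg hε']
    rfl
  · have h := antighost_gauge hε hε' hgh.w3_ghost hgh.l1_ghost hgh.l3_ghost hgh.hasGrade_nm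
      (hK2 (curMinus hdm hR η hΦ))
    rw [← h, hΨ]
    change ε • brstW3 dm R η (Φ + brst dp dm R η ε' Φ) - ε • brstW3 dm R η Φ = _
    rw [← smul_sub, hw3]
    rfl
  · have h := antighost_gauge hε hε' hgh.w1_ghost hgh.l3_ghost hgh.l1_ghost hgh.hasGrade_np
      (hK2 (curPlus hdp hR η hΦ))
    rw [add_comm (Φ.l1 * Φ.l3), ← h, hΨ]
    change ε • brstW1 dp R η (Φ + brst dp dm R η ε' Φ) - ε • brstW1 dp R η Φ = _
    rw [← smul_sub, hw1]
    rfl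
  · rw [smul_mul_assoc, smul_mul_of_even he, ← smul_sub,
      commutator_antiEnv_self hgh.l1_ghost hgh.l3_ghost hgh.l1_pure, smul_zero, hΨ]
    exact sub_self 0
  · rw [smul_mul_assoc, smul_mul_of_even he, ← smul_sub, add_comm (Φ.l1 * Φ.l3),
      commutator_antiEnv_self hgh.l3_ghost hgh.l1_ghost hgh.l3_pure, smul_zero, hΨ]
    exact sub_self 0

end

end Nilpotency

/-! ### The ring of Grassmann-valued smooth functions -/

section GrassmannAlgebra

variable {N : ℕ}

/-- The parity automorphism of the Grassmann algebra. -/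
abbrev inv : Grassmann N →ₐ[ℝ] Grassmann N :=
  CliffordAlgebra.involute (Q := (0 : QuadraticForm ℝ (Fin N → ℝ)))

theorem ι_mul (v : Fin N → ℝ) (a : Grassmann N) :
    ExteriorAlgebra.ι ℝ v * a = inv a * ExteriorAlgebra.ι ℝ v := by
  induction a using ExteriorAlgebra.induction with
  | algebraMap r => rw [AlgHom.commutes, Algebra.commutes]
  | ι w =>
    rw [show inv (ExteriorAlgebra.ι ℝ w) = -ExteriorAlgebra.ι ℝ w from
      CliffordAlgebra.involute_ι w, neg_mul, eq_neg_iff_add_eq_zero]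
    exact ExteriorAlgebra.ι_add_mul_swap v w
  | mul a b ha hb => rw [← mul_assoc, ha, mul_assoc, hb, map_mul, mul_assoc]
  | add a b ha hb => rw [mul_add, ha, hb, map_add, add_mul]

theorem grassmann_mul_comm_of_even {a : Grassmann N} (ha : inv a = a) (b : Grassmann N) :
    a * b = b * a := by
  induction b using ExteriorAlgebra.induction with
  | algebraMap r => rw [Algebra.commutes]
  | ι w => rw [ι_mul, ha]
  | mul b c hb hc => rw [← mul_assoc, hb, mul_assoc, hc, mul_assoc]
  | add b c hb hc => rw [mul_add, hb, hc, add_mul]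

theorem grassmann_mul_of_odd {a : Grassmann N} (ha : inv a = -a) (b : Grassmann N) :
    a * b = inv b * a := by
  induction b using ExteriorAlgebra.induction with
  | algebraMap r => rw [AlgHom.commutes, Algebra.commutes]
  | ι w =>
    rw [show inv (ExteriorAlgebra.ι ℝ w) = -ExteriorAlgebra.ι ℝ w from
      CliffordAlgebra.involute_ι w, neg_mul, ι_mul, ha, neg_mul, neg_neg]
  | mul b c hb hc => rw [← mul_assoc, hb, mul_assoc, hc, map_mul, mul_assoc]
  | add b c hb hc => rw [mul_add, hb, hc, map_add, add_mul]

theorem inv_inv_apply (a : Grassmann N) : inv (inv a) = a := CliffordAlgebra.involute_involute a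

/-- The ideal of elements of degree at least `k`. -/
def grassmannFil (N k : ℕ) : Submodule ℝ (Grassmann N) :=
  LinearMap.range (ExteriorAlgebra.ι ℝ (M := Fin N → ℝ)) ^ k * ⊤

theorem top_mul_range_ι :
    (⊤ : Submodule ℝ (Grassmann N)) * LinearMap.range (ExteriorAlgebra.ι ℝ) =
      LinearMap.range (ExteriorAlgebra.ι ℝ) * ⊤ := by
  apply le_antisymm <;> rw [Submodule.mul_le]
  · rintro a - _ ⟨v, rfl⟩
    have h := ι_mul v (inv a)
    rw [inv_inv_apply] at h
    rw [← h]
    exact Submodule.mul_mem_mul ⟨v, rfl⟩ trivial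
  · rintro _ ⟨v, rfl⟩ a -
    rw [ι_mul]
    exact Submodule.mul_mem_mul trivial ⟨v, rfl⟩

theorem top_mul_range_ι_pow (k : ℕ) :
    (⊤ : Submodule ℝ (Grassmann N)) * LinearMap.range (ExteriorAlgebra.ι ℝ) ^ k =
      grassmannFil N k := by
  rw [grassmannFil]
  induction k with
  | zero => rw [pow_zero, mul_one, one_mul]
  | succ k ih => rw [pow_succ, ← mul_assoc, ih, mul_assoc, top_mul_range_ι, mul_assoc]

theorem top_mul_top : (⊤ : Submodule ℝ (Grassmann N)) * ⊤ = ⊤ :=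
  le_antisymm le_top fun x _ => by
    rw [← mul_one x]
    exact Submodule.mul_mem_mul trivial trivial

theorem grassmannFil_mul_top (k : ℕ) : grassmannFil N k * ⊤ = grassmannFil N k := by
  rw [grassmannFil, mul_assoc, top_mul_top]

theorem top_mul_grassmannFil (k : ℕ) : ⊤ * grassmannFil N k = grassmannFil N k := by
  rw [← top_mul_range_ι_pow, ← mul_assoc, top_mul_top]

theorem grassmannFil_mul (j k : ℕ) :
    grassmannFil N j * grassmannFil N k = grassmannFil N (j + k) := by
  rw [grassmannFil, mul_assoc, top_mul_grassmannFil, grassmannFil, grassmannFil, ← mul_assoc,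
    ← pow_add]

theorem grassmannFil_zero : grassmannFil N 0 = ⊤ := by rw [grassmannFil, pow_zero, one_mul]

theorem grassmannFil_eq_bot : grassmannFil N (N + 1) = ⊥ := by
  have h : Module.finrank ℝ (⋀[ℝ]^(N + 1) (Fin N → ℝ)) = 0 := by
    rw [exteriorPower.finrank_eq, Module.finrank_fin_fun, Nat.choose_succ_self]
  have h' : (⋀[ℝ]^(N + 1) (Fin N → ℝ)) = ⊥ := Submodule.finrank_eq_zero.1 h
  rw [grassmannFil, show LinearMap.range (ExteriorAlgebra.ι ℝ (M := Fin N → ℝ)) ^ (N + 1) = ⊥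
    from h', Submodule.bot_mul]

/-- The body of an element of the Grassmann algebra. -/
abbrev grassmannBody : Grassmann N →ₐ[ℝ] ℝ := ExteriorAlgebra.algebraMapInv

theorem sub_body_mem (a : Grassmann N) :
    a - algebraMap ℝ _ (grassmannBody a) ∈ grassmannFil N 1 := by
  induction a using ExteriorAlgebra.induction with
  | algebraMap r => rw [AlgHom.commutes, Algebra.algebraMap_self_apply, sub_self]; exact zero_mem _
  | ι w =>
    rw [show grassmannBody (ExteriorAlgebra.ι ℝ w) = 0 by simp [ExteriorAlgebra.algebraMapInv],
      map_zero, sub_zero, grassmannFil, pow_one, ← mul_one (ExteriorAlgebra.ι ℝ w)]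
    exact Submodule.mul_mem_mul ⟨w, rfl⟩ trivial
  | mul a b ha hb =>
    rw [map_mul, map_mul, show a * b - algebraMap ℝ _ (grassmannBody a) *
      algebraMap ℝ _ (grassmannBody b) = (a - algebraMap ℝ _ (grassmannBody a)) * b +
        algebraMap ℝ _ (grassmannBody a) * (b - algebraMap ℝ _ (grassmannBody b)) by noncomm_ring]
    refine add_mem ?_ ?_
    · rw [← grassmannFil_mul_top]
      exact Submodule.mul_mem_mul ha trivial
    · rw [← top_mul_grassmannFil]
      exact Submodule.mul_mem_mul trivial hb
  | add a b ha hb =>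
    rw [map_add, map_add, add_sub_add_comm]
    exact add_mem ha hb

theorem inv_body (a : Grassmann N) : grassmannBody (inv a) = grassmannBody a := by
  induction a using ExteriorAlgebra.induction with
  | algebraMap r => rw [AlgHom.commutes]
  | ι w =>
    rw [show inv (ExteriorAlgebra.ι ℝ w) = -ExteriorAlgebra.ι ℝ w from
      CliffordAlgebra.involute_ι w, map_neg]
    simp [ExteriorAlgebra.algebraMapInv]
  | mul a b ha hb => rw [map_mul, map_mul, map_mul, ha, hb]
  | add a b ha hb => rw [map_add, map_add, map_add, ha, hb]

end GrassmannAlgebra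

namespace Shortcut

-- Shortcuts for instance search; scoped, since they are only of use inside the proofs.
scoped instance instCommRingSmoothFn : CommRing SmoothFn := inferInstance
scoped instance instRingSmoothFn : Ring SmoothFn := inferInstance
scoped instance instSemiringSmoothFn : Semiring SmoothFn := inferInstance
scoped instance instAddCommGroupSmoothFn : AddCommGroup SmoothFn := inferInstance
scoped instance instAddCommMonoidSmoothFn : AddCommMonoid SmoothFn := inferInstance
scoped instance instAlgebraSmoothFn : Algebra ℝ SmoothFn := inferInstance
scoped instance instComplexAlgebraSmoothFn : Algebra ℂ SmoothFn := inferInstance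
scoped instance instModuleSmoothFn : Module ℝ SmoothFn := inferInstance
scoped instance instComplexModuleSmoothFn : Module ℂ SmoothFn := inferInstance
scoped instance instRingGrassmann (N : ℕ) : Ring (Grassmann N) := inferInstance
scoped instance instSemiringGrassmann (N : ℕ) : Semiring (Grassmann N) := inferInstance
scoped instance instAddCommGroupGrassmann (N : ℕ) : AddCommGroup (Grassmann N) := inferInstance
scoped instance instAddCommMonoidGrassmann (N : ℕ) : AddCommMonoid (Grassmann N) := inferInstance
scoped instance instRingSF (N : ℕ) : Ring (SF N) := inferInstance
scoped instance instSemiringSF (N : ℕ) : Semiring (SF N) := inferInstance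
scoped instance instNonUnitalNonAssocSemiringSF (N : ℕ) : NonUnitalNonAssocSemiring (SF N) :=
  inferInstance
scoped instance instAddCommGroupSF (N : ℕ) : AddCommGroup (SF N) := inferInstance
scoped instance instAddCommMonoidSF (N : ℕ) : AddCommMonoid (SF N) := inferInstance
scoped instance instModuleSF (N : ℕ) : Module ℂ (SF N) := inferInstance

end Shortcut

open scoped Shortcut

section SmoothRing

variable {N : ℕ}

/-- The parity automorphism of Grassmann-valued functions. -/
def parHom (N : ℕ) : SF N →ₐ[ℂ] SF N :=
  Algebra.TensorProduct.map (AlgHom.id ℂ SmoothFn) inv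

theorem parHom_tmul (f : SmoothFn) (a : Grassmann N) : parHom N (f ⊗ₜ a) = f ⊗ₜ inv a := rfl

theorem parHom_apply (x : SF N) : parHom N x = parity x := by
  induction x using TensorProduct.induction_on with
  | zero => rw [map_zero, map_zero]
  | tmul f a => rfl
  | add x y hx hy => rw [map_add, map_add, hx, hy]

theorem parHom_parHom (x : SF N) : parHom N (parHom N x) = x := by
  induction x using TensorProduct.induction_on with
  | zero => rw [map_zero, map_zero]
  | tmul f a => rw [parHom_tmul, parHom_tmul, inv_inv_apply]
  | add x y hx hy => rw [map_add, map_add, hx, hy]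

theorem add_parHom_mul (x y : SF N) : (x + parHom N x) * y = y * (x + parHom N x) := by
  induction x using TensorProduct.induction_on with
  | zero => rw [map_zero, add_zero, zero_mul, mul_zero]
  | add x x' hx hx' => rw [map_add, add_add_add_comm, add_mul, hx, hx', ← mul_add]
  | tmul f a =>
    induction y using TensorProduct.induction_on with
    | zero => rw [zero_mul, mul_zero]
    | add y y' hy hy' => rw [mul_add, hy, hy', add_mul]
    | tmul h b =>
      rw [parHom_tmul, ← TensorProduct.tmul_add, Algebra.TensorProduct.tmul_mul_tmul,
        Algebra.TensorProduct.tmul_mul_tmul, mul_comm f, grassmann_mul_comm_of_even]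
      rw [map_add, inv_inv_apply, add_comm]

theorem sub_parHom_mul (x y : SF N) : (x - parHom N x) * (y - parHom N y) =
    -((y - parHom N y) * (x - parHom N x)) := by
  induction x using TensorProduct.induction_on with
  | zero => rw [map_zero, sub_zero, zero_mul, mul_zero, neg_zero]
  | add x x' hx hx' => rw [map_add, add_sub_add_comm, add_mul, hx, hx', mul_add, neg_add]
  | tmul f a =>
    induction y using TensorProduct.induction_on with
    | zero => rw [map_zero, sub_zero, zero_mul, mul_zero, neg_zero]
    | add y y' hy hy' => rw [map_add, add_sub_add_comm, mul_add, hy, hy', add_mul, neg_add]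
    | tmul h b =>
      rw [parHom_tmul, parHom_tmul, ← TensorProduct.tmul_sub, ← TensorProduct.tmul_sub,
        Algebra.TensorProduct.tmul_mul_tmul, Algebra.TensorProduct.tmul_mul_tmul, mul_comm f,
        grassmann_mul_of_odd (by rw [map_sub, inv_inv_apply, neg_sub]), map_sub, inv_inv_apply,
        ← neg_sub b, neg_mul, TensorProduct.tmul_neg]

instance superRingSF : SuperRing (SF N) where
  par := parHom N
  par_par := parHom_parHom
  mul_comm_of_even x hx y := by
    have h := add_parHom_mul x y
    rw [hx, ← two_smul ℂ, smul_mul_assoc, mul_smul_comm] at h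
    exact smul_right_injective _ (two_ne_zero (α := ℂ)) h
  mul_anticomm_of_odd x y hx hy := by
    have h := sub_parHom_mul x y
    rw [hx, hy, sub_neg_eq_add, sub_neg_eq_add, ← two_smul ℂ, ← two_smul ℂ y, smul_mul_smul_comm,
      smul_mul_smul_comm, ← smul_neg] at h
    exact smul_right_injective _ (mul_ne_zero two_ne_zero (two_ne_zero (α := ℂ))) h

theorem par_eq_parity (x : SF N) : superRingSF.par x = parity x := parHom_apply x

/-- The ideal of elements of Grassmann degree at least `k`. -/
def smoothFil (N k : ℕ) : Submodule ℂ (SF N) :=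
  Submodule.span ℂ {x | ∃ f : SmoothFn, ∃ a ∈ grassmannFil N k, x = f ⊗ₜ a}

theorem tmul_mem_smoothFil {k : ℕ} (f : SmoothFn) {a : Grassmann N} (ha : a ∈ grassmannFil N k) :
    f ⊗ₜ a ∈ smoothFil N k := Submodule.subset_span ⟨f, a, ha, rfl⟩

theorem smoothFil_mul {j k : ℕ} {x y : SF N} (hx : x ∈ smoothFil N j) (hy : y ∈ smoothFil N k) :
    x * y ∈ smoothFil N (j + k) := by
  induction hx using Submodule.span_induction with
  | zero => rw [zero_mul]; exact zero_mem _
  | add x x' _ _ hx hx' => rw [add_mul]; exact add_mem hx hx'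
  | smul c x _ hx => rw [smul_mul_assoc]; exact Submodule.smul_mem _ c hx
  | mem x hx =>
    obtain ⟨f, a, ha, rfl⟩ := hx
    induction hy using Submodule.span_induction with
    | zero => rw [mul_zero]; exact zero_mem _
    | add x x' _ _ hx hx' => rw [mul_add]; exact add_mem hx hx'
    | smul c x _ hx => rw [mul_smul_comm]; exact Submodule.smul_mem _ c hx
    | mem y hy =>
      obtain ⟨h, b, hb, rfl⟩ := hy
      rw [Algebra.TensorProduct.tmul_mul_tmul]
      exact tmul_mem_smoothFil _ (by rw [← grassmannFil_mul]; exact Submodule.mul_mem_mul ha hb)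

theorem smoothFil_zero : smoothFil N 0 = ⊤ := by
  rw [eq_top_iff]
  rintro x -
  induction x using TensorProduct.induction_on with
  | zero => exact zero_mem _
  | add x y hx hy => exact add_mem hx hy
  | tmul f a => exact tmul_mem_smoothFil f (by rw [grassmannFil_zero]; trivial)

/-- The body of a Grassmann-valued function. -/
def smoothBody (N : ℕ) : SF N →ₐ[ℂ] SmoothFn :=
  (Algebra.TensorProduct.rid ℝ ℂ SmoothFn).toAlgHom.comp
    (Algebra.TensorProduct.map (AlgHom.id ℂ SmoothFn) grassmannBody)

theorem smoothBody_tmul (f : SmoothFn) (a : Grassmann N) :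
    smoothBody N (f ⊗ₜ a) = grassmannBody a • f := rfl

theorem sub_smoothBody_mem (x : SF N) :
    x - smoothBody N x ⊗ₜ (1 : Grassmann N) ∈ smoothFil N 1 := by
  induction x using TensorProduct.induction_on with
  | zero => rw [map_zero, TensorProduct.zero_tmul, sub_zero]; exact zero_mem _
  | add x y hx hy => rw [map_add, TensorProduct.add_tmul, add_sub_add_comm]; exact add_mem hx hy
  | tmul f a =>
    rw [smoothBody_tmul, TensorProduct.smul_tmul, ← Algebra.algebraMap_eq_smul_one,
      ← TensorProduct.tmul_sub]
    exact tmul_mem_smoothFil f (sub_body_mem a)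

theorem mem_smoothFil_one {x : SF N} (h : smoothBody N x = 0) : x ∈ smoothFil N 1 := by
  have := sub_smoothBody_mem x
  rwa [h, TensorProduct.zero_tmul, sub_zero] at this

/-- The body map and the degree filtration of Grassmann-valued functions. -/
def smoothBodyData (N : ℕ) : BodyData (SF N) SmoothFn where
  body := smoothBody N
  incl := Algebra.TensorProduct.includeLeft
  body_incl s := by
    rw [Algebra.TensorProduct.includeLeft_apply, smoothBody_tmul, map_one, one_smul]
  central s x := by
    induction x using TensorProduct.induction_on with
    | zero => rw [mul_zero, zero_mul]
    | add x y hx hy => rw [mul_add, hx, hy, add_mul]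
    | tmul f a =>
      rw [Algebra.TensorProduct.includeLeft_apply, Algebra.TensorProduct.tmul_mul_tmul,
        Algebra.TensorProduct.tmul_mul_tmul, one_mul, mul_one, mul_comm]
  fil := smoothFil N
  fil_zero := smoothFil_zero
  isIdeal_fil k :=
    ⟨fun x hx y => smoothFil_mul (k := 0) hx (by rw [smoothFil_zero]; trivial),
      fun x hx y => by
        have := smoothFil_mul (N := N) (j := 0) (x := y) (by rw [smoothFil_zero]; trivial) hx
        rwa [zero_add] at this⟩
  mul_mem k x y hx hy := by
    rw [add_comm]
    exact smoothFil_mul (mem_smoothFil_one hx) hy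
  mul_mem' k x y hx hy := smoothFil_mul hy (mem_smoothFil_one hx)
  len := N + 1
  fil_len := by
    rw [smoothFil, grassmannFil_eq_bot, Submodule.span_eq_bot]
    rintro _ ⟨f, a, ha, rfl⟩
    rw [(Submodule.mem_bot ℝ).1 ha, TensorProduct.tmul_zero]

/-! ### Derivations and constants -/

theorem differentiable_smooth (f : SmoothFn) : Differentiable ℝ f.1 :=
  (smoothFn_contDiff f).differentiable (by simp)

theorem smoothDeriv_mul (v : ℝ × ℝ) (f h : SmoothFn) :
    smoothDeriv v (f * h) = smoothDeriv v f * h + f * smoothDeriv v h := by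
  ext x
  change fderiv ℝ (f.1 * h.1) x v = fderiv ℝ f.1 x v * h.1 x + f.1 x * fderiv ℝ h.1 x v
  rw [fderiv_mul (differentiable_smooth f x) (differentiable_smooth h x)]
  simp only [add_apply, smul_apply, smul_eq_mul]
  ring

theorem smoothDeriv_one (v : ℝ × ℝ) : smoothDeriv v 1 = 0 := by
  ext x
  change fderiv ℝ (fun _ => (1 : ℂ)) x v = 0
  rw [fderiv_fun_const]
  rfl

theorem smoothDeriv_comm (v w : ℝ × ℝ) (f : SmoothFn) :
    smoothDeriv v (smoothDeriv w f) = smoothDeriv w (smoothDeriv v f) := by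
  ext x
  have hf := smoothFn_contDiff f
  have h1 : ∀ u u' : ℝ × ℝ, fderiv ℝ (fun y => fderiv ℝ f.1 y u) x u' =
      fderiv ℝ (fderiv ℝ f.1) x u' u := fun u u' => by
    have hd : DifferentiableAt ℝ (fderiv ℝ f.1) x :=
      ((hf.fderiv_right (m := ∞) (by simp)).differentiable (by simp)) x
    rw [fderiv_clm_apply hd (differentiableAt_const u)]
    simp
  change fderiv ℝ (fun y => fderiv ℝ f.1 y w) x v = fderiv ℝ (fun y => fderiv ℝ f.1 y v) x w
  rw [h1, h1]
  exact (hf.contDiffAt.isSymmSndFDerivAt (by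
    simp only [minSmoothness_of_isRCLikeNormedField]
    exact WithTop.coe_le_coe.2 le_top)).eq v w

/-- The derivation of Grassmann-valued functions in the direction `v`. -/
def dir (N : ℕ) (v : ℝ × ℝ) : SF N →ₗ[ℂ] SF N :=
  TensorProduct.AlgebraTensorModule.map (smoothDeriv v) LinearMap.id

theorem dir_tmul (v : ℝ × ℝ) (f : SmoothFn) (a : Grassmann N) :
    dir N v (f ⊗ₜ a) = smoothDeriv v f ⊗ₜ a := rfl

theorem isEvenDerivation_dir (v : ℝ × ℝ) : IsEvenDerivation (𝒪 := SF N) (dir N v) where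
  leibniz x y := by
    induction x using TensorProduct.induction_on with
    | zero => simp
    | add x x' hx hx' => rw [add_mul, map_add, hx, hx', map_add]; noncomm_ring
    | tmul f a =>
      induction y using TensorProduct.induction_on with
      | zero => simp
      | add y y' hy hy' => rw [mul_add, map_add, hy, hy', map_add]; noncomm_ring
      | tmul h b =>
        rw [Algebra.TensorProduct.tmul_mul_tmul, dir_tmul, dir_tmul, dir_tmul,
          Algebra.TensorProduct.tmul_mul_tmul, Algebra.TensorProduct.tmul_mul_tmul,
          smoothDeriv_mul, TensorProduct.add_tmul]
  par x := by
    induction x using TensorProduct.induction_on with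
    | zero => simp
    | add x y hx hy => rw [map_add, map_add, hx, hy, map_add, map_add]
    | tmul f a => rfl

theorem isEvenDerivation_dPlus : IsEvenDerivation (𝒪 := SF N) dPlus := isEvenDerivation_dir (1, 0)

theorem isEvenDerivation_dMinus : IsEvenDerivation (𝒪 := SF N) dMinus := isEvenDerivation_dir (0, 1)

theorem dPlus_dMinus (x : SF N) : dPlus (dMinus x) = dMinus (dPlus x) := by
  induction x using TensorProduct.induction_on with
  | zero => simp
  | add x y hx hy => rw [map_add, map_add, hx, hy, map_add, map_add]
  | tmul f a =>
    change smoothDeriv _ (smoothDeriv _ f) ⊗ₜ a = smoothDeriv _ (smoothDeriv _ f) ⊗ₜ a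
    rw [smoothDeriv_comm]

theorem dir_const (v : ℝ × ℝ) (e : Grassmann N) : dir N v (const e) = 0 := by
  rw [const, dir_tmul, smoothDeriv_one, TensorProduct.zero_tmul]

theorem par_const {e : Grassmann N} (he : IsOddConst e) :
    superRingSF.par (const e) = -const e := by
  change (1 : SmoothFn) ⊗ₜ inv e = -((1 : SmoothFn) ⊗ₜ e)
  rw [show inv e = -e from he, TensorProduct.tmul_neg]

theorem smoothBody_const {e : Grassmann N} (he : IsOddConst e) : smoothBody N (const e) = 0 := by
  have h := inv_body e
  rw [show inv e = -e from he, map_neg] at h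
  rw [const, smoothBody_tmul, show grassmannBody e = 0 by linarith, zero_smul]

/-! ### Field configurations -/

theorem isEven_iff {x : SF N} : IsEven x ↔ superRingSF.par x = x := by rw [par_eq_parity]; rfl

theorem isEvenSMat_iff {X : SMat (SF N)} : IsEvenSMat X ↔ sPar X = X := by
  rw [sPar_eq_self_iff]
  constructor
  · rintro ⟨h1, h2⟩ (i | i) (j | j)
    · rw [par_eq_parity, (h1 i j).1]; simp
    · rw [par_eq_parity, (h2 i j).1]; simp
    · rw [par_eq_parity, (h2 i j).2]; simp
    · rw [par_eq_parity, (h1 i j).2]; simp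
  · intro h
    refine ⟨fun i j => ⟨?_, ?_⟩, fun i j => ⟨?_, ?_⟩⟩
    · rw [IsEven, ← par_eq_parity, h]; simp
    · rw [IsEven, ← par_eq_parity, h]; simp
    · rw [IsOdd, ← par_eq_parity, h]; simp
    · rw [IsOdd, ← par_eq_parity, h]; simp

theorem isBosonicOfGrade_iff {k : ℕ} {X : SMat (SF N)} : IsBosonicOfGrade k X ↔ IsBoson k X := by
  constructor
  · rintro ⟨h1, h2, h3⟩
    exact ⟨proj_eq_self_iff.1 h1, h2, fun i j => isEven_iff.1 (h3 i j)⟩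
  · intro h
    exact ⟨proj_eq_self_iff.2 h.grade, h.pr_eq, fun i j => isEven_iff.2 (h.even i j)⟩

theorem IsBoson.isGhost {k : ℕ} (hk : Odd k) {X : SMat (SF N)} (h : IsBoson k X) : IsGhost X where
  even := h.even
  off i j hij := apply_eq_zero_of_odd_grade (by
    rw [h.grade, map_smul, h.grade, smul_smul, ← pow_add, ← two_mul, pow_mul, Complex.I_sq,
      hk.neg_one_pow, neg_one_smul]) hij

theorem IsGhost.isBoson {k : ℕ} {X : SMat (SF N)} (h : IsGhost X)
    (h' : PureSpinorYB.omega X = Complex.I ^ k • X) : IsBoson k X := ⟨h', h.pr_eq, h.even⟩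

theorem isConfig_iff {Φ : Fields (SF N)} : IsConfig Φ ↔ IsField dPlus dMinus Φ := by
  constructor
  · intro h
    have h3 := isBosonicOfGrade_iff.1 h.w3_mem
    have h1 := isBosonicOfGrade_iff.1 h.w1_mem
    have h1' := isBosonicOfGrade_iff.1 h.l1_mem
    have h3' := isBosonicOfGrade_iff.1 h.l3_mem
    exact ⟨⟨isEvenSMat_iff.1 h.g_even, h.g_unit⟩, h.g_plus, h.g_minus, h3.isGhost (by decide),
      h1.isGhost (by decide), h1'.isGhost (by decide), h3'.isGhost (by decide), h3.grade, h1.grade,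
      h1'.grade, h3'.grade, h.l1_pure, h.l3_pure⟩
  · intro h
    exact ⟨isEvenSMat_iff.2 h.g.even, h.g.unit, h.plus, h.minus,
      isBosonicOfGrade_iff.2 (h.gh.w3_ghost.isBoson h.gh.w3_grade),
      isBosonicOfGrade_iff.2 (h.gh.w1_ghost.isBoson h.gh.w1_grade),
      isBosonicOfGrade_iff.2 (h.gh.l1_ghost.isBoson h.gh.l1_grade),
      isBosonicOfGrade_iff.2 (h.gh.l3_ghost.isBoson h.gh.l3_grade), h.gh.l1_pure, h.gh.l3_pure⟩

end SmoothRing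

/-! ### Integrals over closed world-sheets -/

section Integral

open MeasureTheory

theorem continuous_smooth (f : SmoothFn) : Continuous f.1 := (smoothFn_contDiff f).continuous

/-- The integral over the segment from `0` to `v`. -/
def segmentIntegral (v : ℝ × ℝ) : SmoothFn →ₗ[ℝ] ℂ where
  toFun f := ∫ t in (0 : ℝ)..1, f.1 (t • v)
  map_add' f h := by
    have key : ∀ f : SmoothFn, IntervalIntegrable (fun t : ℝ => f.1 (t • v)) volume 0 1 := fun f =>
      ((continuous_smooth f).comp (by fun_prop)).intervalIntegrable _ _
    exact intervalIntegral.integral_add (key f) (key h)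
  map_smul' c f := intervalIntegral.integral_smul c fun t : ℝ => f.1 (t • v)

theorem hasDerivAt_segment (f : SmoothFn) (u q : ℝ × ℝ) (s : ℝ) :
    HasDerivAt (fun s : ℝ => f.1 (s • u + q)) (fderiv ℝ f.1 (s • u + q) u) s := by
  have h1 : HasDerivAt (fun s : ℝ => s • u + q) u s := by
    simpa using ((hasDerivAt_id s).smul_const u).add_const q
  exact (differentiable_smooth f _).hasFDerivAt.comp_hasDerivAt s h1

theorem continuous_fderiv_smooth (f : SmoothFn) (u : ℝ × ℝ) :
    Continuous fun p => fderiv ℝ f.1 p u := continuous_smooth (smoothDeriv u f)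

theorem integral_fderiv_segment (f : SmoothFn) (u q : ℝ × ℝ) :
    ∫ s in Set.Icc (0 : ℝ) 1, fderiv ℝ f.1 (s • u + q) u = f.1 (q + u) - f.1 q := by
  rw [integral_Icc_eq_integral_Ioc, ← intervalIntegral.integral_of_le zero_le_one,
    intervalIntegral.integral_eq_sub_of_hasDerivAt (fun s _ => hasDerivAt_segment f u q s)
      (((continuous_fderiv_smooth f u).comp (by fun_prop)).intervalIntegrable _ _)]
  rw [one_smul, zero_smul, zero_add, add_comm u]

theorem integrableOn_square {h : ℝ × ℝ → ℂ} (hc : Continuous h) :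
    IntegrableOn h (Set.Icc (0 : ℝ) 1 ×ˢ Set.Icc (0 : ℝ) 1) :=
  hc.continuousOn.integrableOn_compact (isCompact_Icc.prod isCompact_Icc)

theorem integral_fderiv_fst (f : SmoothFn) (u v : ℝ × ℝ) :
    ∫ p in Set.Icc (0 : ℝ) 1 ×ˢ Set.Icc (0 : ℝ) 1, fderiv ℝ f.1 (p.1 • u + p.2 • v) u =
      segmentIntegral v (smoothShift u f - f) := by
  have hc : Continuous fun p : ℝ × ℝ => fderiv ℝ f.1 (p.1 • u + p.2 • v) u :=
    (continuous_fderiv_smooth f u).comp (by fun_prop)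
  have hi := integrableOn_square hc
  rw [IntegrableOn, Measure.volume_eq_prod, ← Measure.prod_restrict] at hi
  rw [Measure.volume_eq_prod, ← Measure.prod_restrict, integral_prod_symm _ hi]
  change _ = ∫ t in (0 : ℝ)..1, (smoothShift u f - f).1 (t • v)
  rw [intervalIntegral.integral_of_le zero_le_one, ← integral_Icc_eq_integral_Ioc]
  refine integral_congr_ae (Filter.Eventually.of_forall fun t => ?_)
  exact integral_fderiv_segment f u (t • v)

theorem integral_fderiv_snd (f : SmoothFn) (u v : ℝ × ℝ) :
    ∫ p in Set.Icc (0 : ℝ) 1 ×ˢ Set.Icc (0 : ℝ) 1, fderiv ℝ f.1 (p.1 • u + p.2 • v) v =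
      segmentIntegral u (smoothShift v f - f) := by
  have hc : Continuous fun p : ℝ × ℝ => fderiv ℝ f.1 (p.1 • u + p.2 • v) v :=
    (continuous_fderiv_smooth f v).comp (by fun_prop)
  have hi := integrableOn_square hc
  rw [IntegrableOn, Measure.volume_eq_prod, ← Measure.prod_restrict] at hi
  rw [Measure.volume_eq_prod, ← Measure.prod_restrict, integral_prod _ hi]
  change _ = ∫ t in (0 : ℝ)..1, (smoothShift v f - f).1 (t • u)
  rw [intervalIntegral.integral_of_le zero_le_one, ← integral_Icc_eq_integral_Ioc]
  refine integral_congr_ae (Filter.Eventually.of_forall fun t => ?_)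
  refine Eq.trans ?_ (integral_fderiv_segment f v (t • u))
  exact integral_congr_ae (Filter.Eventually.of_forall fun s => by
    simp only [add_comm (t • u)])

/-- The divergence theorem on the period parallelogram. -/
theorem smoothIntegral_smoothDeriv (u v : ℝ × ℝ) (a b : ℝ) (f : SmoothFn) :
    smoothIntegral u v (smoothDeriv (a • u + b • v) f) = |u.1 * v.2 - u.2 * v.1| •
      (a • segmentIntegral v (smoothShift u f - f) + b • segmentIntegral u (smoothShift v f - f)) := by
  have h1 := integrableOn_square ((continuous_fderiv_smooth f u).comp
    (show Continuous fun p : ℝ × ℝ => p.1 • u + p.2 • v by fun_prop))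
  have h2 := integrableOn_square ((continuous_fderiv_smooth f v).comp
    (show Continuous fun p : ℝ × ℝ => p.1 • u + p.2 • v by fun_prop))
  have h3 := integral_add (h1.smul a) (h2.smul b)
  simp only [Pi.smul_apply, Function.comp_apply] at h3
  rw [integral_smul a, integral_smul b, integral_fderiv_fst, integral_fderiv_snd] at h3
  rw [← h3]
  refine congrArg (fun I : ℂ => |u.1 * v.2 - u.2 * v.1| • I)
    (integral_congr_ae (Filter.Eventually.of_forall fun p => ?_))
  change fderiv ℝ f.1 (p.1 • u + p.2 • v) (a • u + b • v) = _
  rw [map_add, map_smul, map_smul]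

variable {N : ℕ}

theorem integral_dir_eq_zero {u v : ℝ × ℝ} (hdet : u.1 * v.2 - u.2 * v.1 ≠ 0) (w : ℝ × ℝ)
    {F : SF N} (hu : shift u F = F) (hv : shift v F = F) :
    TensorProduct.map (smoothIntegral u v) (LinearMap.id (M := Grassmann N)) (dir N w F) = 0 := by
  -- the coordinates of the direction in the basis of the periods
  obtain ⟨a, b, hw⟩ : ∃ a b : ℝ, w = a • u + b • v := by
    refine ⟨(w.1 * v.2 - w.2 * v.1) / (u.1 * v.2 - u.2 * v.1),
      (u.1 * w.2 - u.2 * w.1) / (u.1 * v.2 - u.2 * v.1), Prod.ext ?_ ?_⟩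
    · simp only [Prod.fst_add, Prod.smul_fst, smul_eq_mul]
      rw [div_mul_eq_mul_div, div_mul_eq_mul_div, ← add_div, eq_div_iff hdet]
      ring
    · simp only [Prod.snd_add, Prod.smul_snd, smul_eq_mul]
      rw [div_mul_eq_mul_div, div_mul_eq_mul_div, ← add_div, eq_div_iff hdet]
      ring
  have key : ∀ x : SF N, TensorProduct.map (smoothIntegral u v) (LinearMap.id (M := Grassmann N))
      (dir N w x) = |u.1 * v.2 - u.2 * v.1| •
        (a • TensorProduct.map (segmentIntegral v) LinearMap.id (shift u x - x)
          + b • TensorProduct.map (segmentIntegral u) LinearMap.id (shift v x - x)) := by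
    intro x
    induction x using TensorProduct.induction_on with
    | zero => simp only [map_zero, sub_zero, smul_zero, add_zero]
    | add x y hx hy =>
      rw [map_add (dir N w), map_add, hx, hy, map_add (shift u), map_add (shift v),
        add_sub_add_comm, add_sub_add_comm, map_add, map_add]
      module
    | tmul f c =>
      rw [dir_tmul, shift, shift, TensorProduct.map_tmul, TensorProduct.map_tmul,
        TensorProduct.map_tmul, LinearMap.id_apply, ← TensorProduct.sub_tmul,
        ← TensorProduct.sub_tmul, TensorProduct.map_tmul, TensorProduct.map_tmul,
        LinearMap.id_apply, hw, smoothIntegral_smoothDeriv, TensorProduct.smul_tmul',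
        TensorProduct.smul_tmul', ← TensorProduct.add_tmul, TensorProduct.smul_tmul']
  rw [key, hu, hv, sub_self, map_zero, map_zero, smul_zero, smul_zero, add_zero, smul_zero]

/-! ### Periodic fields -/

/-- Translation as a homomorphism. -/
def shiftHom (N : ℕ) (u : ℝ × ℝ) : SF N →ₐ[ℂ] SF N :=
  Algebra.TensorProduct.map
    { toFun := smoothShift u
      map_one' := rfl
      map_mul' := fun _ _ => rfl
      map_zero' := rfl
      map_add' := fun _ _ => rfl
      commutes' := fun _ => rfl } (AlgHom.id ℝ _)

theorem shiftHom_apply (u : ℝ × ℝ) (x : SF N) : shiftHom N u x = shift u x := by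
  induction x using TensorProduct.induction_on with
  | zero => simp only [map_zero]
  | add x y hx hy => rw [map_add, map_add, hx, hy]
  | tmul f a => rfl

theorem map_shift (u : ℝ × ℝ) (X : SMat (SF N)) : X.map (shift u) = X.map (shiftHom N u) := by
  ext i j
  exact (shiftHom_apply u _).symm

theorem smoothShift_smoothDeriv (u w : ℝ × ℝ) (f : SmoothFn) :
    smoothShift u (smoothDeriv w f) = smoothDeriv w (smoothShift u f) := by
  ext x
  change fderiv ℝ f.1 (x + u) w = fderiv ℝ (fun y => f.1 (y + u)) x w
  rw [fderiv_comp_add_right]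

theorem shiftHom_dir (u w : ℝ × ℝ) (x : SF N) :
    shiftHom N u (dir N w x) = dir N w (shiftHom N u x) := by
  induction x using TensorProduct.induction_on with
  | zero => simp only [map_zero]
  | add x y hx hy => rw [map_add, map_add, hx, hy, map_add, map_add]
  | tmul f a =>
    change smoothShift u (smoothDeriv w f) ⊗ₜ a = smoothDeriv w (smoothShift u f) ⊗ₜ a
    rw [smoothShift_smoothDeriv]

end Integral

section Naturality

variable {𝒪 : Type*} [Ring 𝒪] [Algebra ℂ 𝒪]

theorem mcForm_map {D : 𝒪 →ₗ[ℂ] 𝒪} (f : 𝒪 →ₐ[ℂ] 𝒪) (hf : ∀ x, f (D x) = D (f x)) {g : SMat 𝒪}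
    (hg : IsUnit g) : (mcForm D g).map f = mcForm D (g.map f) := by
  have h1 : (g.map D).map f = (g.map f).map D := by
    ext i j
    exact hf _
  have h2 : (pr (g.map D * Ring.inverse g)).map f = pr ((g.map D * Ring.inverse g).map f) :=
    (pr_map f.toLinearMap _).symm
  rw [mcForm, mcForm, Matrix.map_neg _ (map_neg f), h2, Matrix.map_mul, h1,
    map_inverse_of_isUnit f hg]

end Naturality

section Rescale

open SuperRing

variable {𝒪 : Type*} [Ring 𝒪] [Algebra ℂ 𝒪] [SuperRing 𝒪]

/-- The Maurer-Cartan form does not depend on the representative of an element of the projective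
supergroup. -/
theorem mcForm_smul {D : 𝒪 →ₗ[ℂ] 𝒪} (hD : IsEvenDerivation D) {z : 𝒪} (hz : par z = z)
    (hu : IsUnit z) {g : SMat 𝒪} (hg : IsUnit g) : mcForm D (z • g) = mcForm D g := by
  have hzi : z * Ring.inverse z = 1 := Ring.mul_inverse_cancel z hu
  have hiz : Ring.inverse z * z = 1 := Ring.inverse_mul_cancel z hu
  have hz' : par (Ring.inverse z) = Ring.inverse z := by
    have h : z * par (Ring.inverse z) = 1 := by
      have h' := map_mul par z (Ring.inverse z)
      rw [hzi, map_one, hz] at h'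
      exact h'.symm
    rw [← one_mul (par (Ring.inverse z)), ← hiz, mul_assoc, h, mul_one]
  have hgi := Ring.mul_inverse_cancel g hg
  have hinv : Ring.inverse (z • g) = Ring.inverse z • Ring.inverse g := by
    have h1 : (z • g) * (Ring.inverse z • Ring.inverse g) = 1 := by
      rw [smul_mul_of_even hz', smul_mul_assoc, hgi, smul_smul, hiz, one_smul]
    have h2 : (Ring.inverse z • Ring.inverse g) * (z • g) = 1 := by
      rw [smul_mul_of_even hz, smul_mul_assoc, Ring.inverse_mul_cancel g hg, smul_smul, hzi,
        one_smul]
    exact Ring.inverse_unit ⟨z • g, _, h1, h2⟩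
  have hmap : (z • g).map D = D z • g + z • g.map D := by
    ext i j
    exact hD.leibniz z (g i j)
  rw [mcForm, mcForm, hinv, hmap, smul_mul_of_even hz', add_mul, smul_mul_assoc, smul_mul_assoc,
    hgi, smul_add, smul_smul, smul_smul, hiz, one_smul, map_add, pr_smul_one, zero_add]

end Rescale

section Invariance

variable {N : ℕ}

theorem mcForm_map_shiftHom {Φ : Fields (SF N)} (hg : IsUnit Φ.g) {u : ℝ × ℝ}
    (hper : HasPeriod u Φ) (w : ℝ × ℝ) :
    (mcForm (𝒪 := SF N) (dir N w) Φ.g).map (shiftHom N u) = mcForm (𝒪 := SF N) (dir N w) Φ.g := by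
  obtain ⟨⟨z, hz, hzu, hgz⟩, -⟩ := hper
  rw [map_shift] at hgz
  rw [mcForm_map _ (shiftHom_dir u w) hg, hgz,
    mcForm_smul (isEvenDerivation_dir w) (isEven_iff.1 hz) hzu hg]

theorem shift_current {Φ : Fields (SF N)} (hg : IsUnit Φ.g) {u : ℝ × ℝ}
    (hper : HasPeriod u Φ) (w : ℝ × ℝ) (e : Grassmann N) :
    shift u ((1 / 4 : ℂ) • str ((const e • (Φ.l1 - Φ.l3)) * mcForm (𝒪 := SF N) (dir N w) Φ.g)) =
      (1 / 4 : ℂ) • str ((const e • (Φ.l1 - Φ.l3)) * mcForm (𝒪 := SF N) (dir N w) Φ.g) := by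
  have hA := mcForm_map_shiftHom hg hper w
  obtain ⟨-, -, -, h1, h3⟩ := hper
  rw [map_shift] at h1 h3
  have he : shiftHom N u (const e) = const e := rfl
  have hm : (const e • (Φ.l1 - Φ.l3)).map (shiftHom N u) = const e • (Φ.l1 - Φ.l3) := by
    conv_rhs => rw [← h1, ← h3]
    ext i j
    change shiftHom N u (const e * (Φ.l1 i j - Φ.l3 i j)) = _
    rw [map_mul, he, map_sub]
    rfl
  have hs : ∀ X : SMat (SF N), shiftHom N u (str X) = str (X.map (shiftHom N u)) := fun X =>
    (str_map (shiftHom N u).toLinearMap X).symm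
  rw [← shiftHom_apply, map_smul, hs, Matrix.map_mul, hm, hA]

/-- The BRST transformation of a configuration. -/
theorem brst_invariance {R : Module.End ℂ psl} (hR : IsYangBaxter R) {η : ℝ} {Φ : Fields (SF N)}
    (hΦ : IsConfig Φ) (hreg : Regular R η Φ) {e : Grassmann N} (he : IsOddConst e) :
    IsConfig (Φ + Q R η e Φ) ∧ Regular R η (Φ + Q R η e Φ) ∧
      lagrangian dPlus dMinus R η (Φ + Q R η e Φ) - lagrangian dPlus dMinus R η Φ =
        dPlus ((1 / 4 : ℂ) • str ((const e • (Φ.l1 - Φ.l3)) * mcForm dMinus Φ.g))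
        - dMinus ((1 / 4 : ℂ) • str ((const e • (Φ.l1 - Φ.l3)) * mcForm dPlus Φ.g)) ∧
      ∀ u v : ℝ × ℝ, u.1 * v.2 - u.2 * v.1 ≠ 0 → HasPeriod u Φ → HasPeriod v Φ →
        action u v R η (Φ + Q R η e Φ) = action u v R η Φ := by
  have hf := isConfig_iff.1 hΦ
  have h1 := isField_add_brst isEvenDerivation_dPlus isEvenDerivation_dMinus hR η (smoothBodyData N)
    hf hreg (par_const he) (dir_const _ _) (dir_const _ _) (smoothBody_const he)
  have h2 := lagrangian_add_brst isEvenDerivation_dPlus isEvenDerivation_dMinus hR η dPlus_dMinus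
    (smoothBodyData N) hf hreg (par_const he) (dir_const _ _) (dir_const _ _) (smoothBody_const he)
  refine ⟨isConfig_iff.2 h1.1, h1.2, h2, fun u v hdet hu hv => ?_⟩
  rw [action, action, ← sub_eq_zero, ← map_sub]
  refine (congrArg _ h2).trans ?_
  rw [map_sub]
  have hp := integral_dir_eq_zero hdet (1, 0) (shift_current hΦ.g_unit hu (0, 1) e)
    (shift_current hΦ.g_unit hv (0, 1) e)
  have hm := integral_dir_eq_zero hdet (0, 1) (shift_current hΦ.g_unit hu (1, 0) e)
    (shift_current hΦ.g_unit hv (1, 0) e)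
  exact (congrArg₂ (· - ·) hp hm).trans (sub_zero 0)

/-- On the equations of motion obtained by varying the antighosts, the BRST transformation squares
to a gauge transformation. -/
theorem brst_nilpotent {R : Module.End ℂ psl} (hR : IsYangBaxter R) {η : ℝ} {Φ : Fields (SF N)}
    (hΦ : IsConfig Φ) (hreg : Regular R η Φ) (hos : GhostOnShell R η Φ) {e e' : Grassmann N}
    (he : IsOddConst e) (he' : IsOddConst e') : IsGauge Φ (QQ R η e' e Φ) := by
  obtain ⟨M, S, S', c, hM, hS, hS', hc, h⟩ := brst_square isEvenDerivation_dPlus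
    isEvenDerivation_dMinus hR η (smoothBodyData N) (isConfig_iff.1 hΦ) hreg (par_const he')
    (dir_const _ _) (dir_const _ _) (smoothBody_const he') (par_const he)
    (fun χ hχ h => hos.1 χ (isBosonicOfGrade_iff.2 (hχ.isBoson h)))
    (fun χ hχ h => hos.2 χ (isBosonicOfGrade_iff.2 (hχ.isBoson h))) rfl
  exact ⟨M, S, S', c, isBosonicOfGrade_iff.2 hM, isBosonicOfGrade_iff.2 hS,
    isBosonicOfGrade_iff.2 hS', isEven_iff.2 hc, h⟩

end Invariance

/-! ### Neumann series of the dressed operators -/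

section Resolvent

variable {V V' : Type*} [AddCommGroup V] [Module ℂ V] [AddCommGroup V'] [Module ℂ V']

theorem map_pow_apply {T : Module.End ℂ V} {T' : Module.End ℂ V'} {f : V →ₗ[ℂ] V'}
    (h : ∀ v, f (T v) = T' (f v)) (n : ℕ) (v : V) : f ((T ^ n) v) = (T' ^ n) (f v) := by
  induction n generalizing v with
  | zero => rfl
  | succ n ih => rw [pow_succ, Module.End.mul_apply, ih, h, pow_succ, Module.End.mul_apply]

/-- The Neumann series of an operator on a finite-dimensional space, tested on functionals. -/
theorem exists_hasSum_neumann [FiniteDimensional ℂ V] (T : Module.End ℂ V) :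
    ∃ δ > 0, ∀ c : ℂ, ‖c‖ < δ → ∀ z (ψ : V →ₗ[ℂ] ℂ),
      HasSum (fun n => c ^ n * ψ ((T ^ n) (z - c • T z))) (ψ z) := by
  set e := (Module.finBasis ℂ V).equivFun with he
  set T' := Module.End.toContinuousLinearMap (Fin (Module.finrank ℂ V) → ℂ)
    (e.toLinearMap ∘ₗ T ∘ₗ e.symm.toLinearMap) with hT'
  have hTe : ∀ v, e (T v) = T' (e v) := fun v => by
    change e (T v) = e (T (e.symm (e v)))
    rw [LinearEquiv.symm_apply_apply]
  refine ⟨(‖T'‖ + 1)⁻¹, by positivity, fun c hc z ψ => ?_⟩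
  have hlt : ‖c • T'‖ < 1 := by
    rw [norm_smul]
    have h1 : (‖T'‖ + 1)⁻¹ * (‖T'‖ + 1) = 1 := inv_mul_cancel₀ (by positivity)
    nlinarith [norm_nonneg c, norm_nonneg T']
  obtain ⟨S, hs⟩ := summable_geometric_of_norm_lt_one hlt
  have hS : S * (1 - c • T') = 1 := by rw [← hs.tsum_eq]; exact geom_series_mul_neg _ hlt
  set ψ' := LinearMap.toContinuousLinearMap (ψ ∘ₗ e.symm.toLinearMap)
  have key := (hs.mapL (ContinuousLinearMap.apply ℂ (Fin (Module.finrank ℂ V) → ℂ)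
    (e (z - c • T z)))).mapL ψ'
  have hfin : ψ' (ContinuousLinearMap.apply ℂ (Fin (Module.finrank ℂ V) → ℂ)
      (e (z - c • T z)) S) = ψ z := by
    rw [show e (z - c • T z) = (1 - c • T') (e z) by rw [map_sub, map_smul, hTe]; rfl]
    change ψ (e.symm ((S * (1 - c • T')) (e z))) = ψ z
    rw [hS]
    exact congrArg ψ (e.symm_apply_apply z)
  rw [hfin] at key
  refine key.congr_fun fun n => ?_
  have hn : ∀ (n : ℕ) v, (T' ^ n) (e v) = e ((T ^ n) v) := fun n => by
    induction n with
    | zero => exact fun v => rfl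
    | succ n ih => exact fun v => by rw [pow_succ, pow_succ, mul_apply_eq_comp, ← hTe,
        ih, Module.End.mul_apply]
  change _ = ψ (e.symm (((c • T') ^ n) (e (z - c • T z))))
  rw [smul_pow, _root_.smul_apply, hn, map_smul, map_smul, e.symm_apply_apply,
    smul_eq_mul]

/-- The Neumann series of an operator `T` which is intertwined by `f` with an operator on a
finite-dimensional space. -/
theorem exists_hasSum_inverse [FiniteDimensional ℂ V'] {T : Module.End ℂ V} {T' : Module.End ℂ V'}
    {f : V →ₗ[ℂ] V'} (h : ∀ v, f (T v) = T' (f v)) :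
    ∃ δ > 0, ∀ c : ℂ, ‖c‖ < δ → IsUnit (1 - c • T) → ∀ y (ψ : V' →ₗ[ℂ] ℂ),
      HasSum (fun n => c ^ n * ψ (f ((T ^ n) y))) (ψ (f (Ring.inverse (1 - c • T) y))) := by
  obtain ⟨δ, hδ, key⟩ := exists_hasSum_neumann T'
  refine ⟨δ, hδ, fun c hc hu y ψ => ?_⟩
  have hz : (1 - c • T) (Ring.inverse (1 - c • T) y) = y := by
    rw [← Module.End.mul_apply, Ring.mul_inverse_cancel _ hu, Module.End.one_apply]
  have hy : f y = f (Ring.inverse (1 - c • T) y) - c • T' (f (Ring.inverse (1 - c • T) y)) := by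
    conv_lhs => rw [← hz]
    rw [← h, ← map_smul, ← map_sub]
    rfl
  refine (key c hc (f (Ring.inverse (1 - c • T) y)) ψ).congr_fun fun n => ?_
  rw [← hy, map_pow_apply h]

end Resolvent

/-! ### Evaluation at a point of the world-sheet -/

section Evaluation

variable {N : ℕ}

instance finite_grassmann : Module.Finite ℝ (Grassmann N) :=
  Module.Finite.of_basis (Pi.basisFun ℝ (Fin N)).ExteriorAlgebra

/-- Evaluation of smooth functions at a point. -/
def smoothEval (x : ℝ × ℝ) : SmoothFn →ₐ[ℂ] ℂ :=
  (Pi.evalAlgHom ℂ (fun _ : ℝ × ℝ => ℂ) x).comp SmoothFn.val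

/-- Evaluation of Grassmann-valued smooth functions at a point. -/
def pointEval (x : ℝ × ℝ) : SF N →ₐ[ℂ] ℂ ⊗[ℝ] Grassmann N :=
  Algebra.TensorProduct.map (smoothEval x) (AlgHom.id ℝ (Grassmann N))

/-- The complex linear extension of a functional on the Grassmann algebra. -/
def complexDual (φ : Module.Dual ℝ (Grassmann N)) : ℂ ⊗[ℝ] Grassmann N →ₗ[ℂ] ℂ :=
  TensorProduct.AlgebraTensorModule.lift
    ((LinearMap.lsmul ℂ (Grassmann N →ₗ[ℝ] ℂ)).flip (φ.smulRight (1 : ℂ)))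

theorem evalAt_eq (x : ℝ × ℝ) (φ : Module.Dual ℝ (Grassmann N)) (y : SF N) :
    evalAt x φ y = complexDual φ (pointEval x y) := by
  induction y using TensorProduct.induction_on with
  | zero => rw [map_zero, map_zero, map_zero]
  | add a b ha hb => rw [map_add, map_add, map_add, ha, hb]
  | tmul f a =>
    change φ a • f.1 x = f.1 x • (φ a • (1 : ℂ))
    simp [mul_comm]

/-- Evaluation of supermatrices at a point. -/
def matEval (x : ℝ × ℝ) : SMat (SF N) →ₗ[ℂ] SMat (ℂ ⊗[ℝ] Grassmann N) :=
  (pointEval x).toLinearMap.mapMatrix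

theorem matEval_apply (x : ℝ × ℝ) (X : SMat (SF N)) : matEval x X = X.map (pointEval x) := rfl

/-- The functional reading off an entry of `-P_k X`. -/
def entryForm (k : ℕ) (φ : Module.Dual ℝ (Grassmann N)) (i j : Idx) :
    SMat (ℂ ⊗[ℝ] Grassmann N) →ₗ[ℂ] ℂ :=
  -(complexDual φ ∘ₗ Matrix.entryLinearMap ℂ (ℂ ⊗[ℝ] Grassmann N) i j ∘ₗ proj k)

theorem entryForm_matEval (k : ℕ) (φ : Module.Dual ℝ (Grassmann N)) (i j : Idx) (x : ℝ × ℝ)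
    (X : SMat (SF N)) : entryForm k φ i j (matEval x X) = evalAt x φ ((-proj k X) i j) := by
  change -complexDual φ (proj k (X.map (pointEval x).toLinearMap) i j) = _
  rw [proj_map, Matrix.neg_apply, map_neg, evalAt_eq]
  rfl

/-- The functional `X ↦ Str (B X)`. -/
def strForm (φ : Module.Dual ℝ (Grassmann N)) (B : SMat (ℂ ⊗[ℝ] Grassmann N)) :
    SMat (ℂ ⊗[ℝ] Grassmann N) →ₗ[ℂ] ℂ where
  toFun X := complexDual φ (str (B * X))
  map_add' X Y := by rw [mul_add, str_add, map_add]
  map_smul' c X := by rw [mul_smul_comm, str_smul, map_smul, RingHom.id_apply]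

theorem strForm_matEval (φ : Module.Dual ℝ (Grassmann N)) (x : ℝ × ℝ) (B X : SMat (SF N)) :
    strForm φ (matEval x B) (matEval x X) = evalAt x φ (str (B * X)) := by
  change complexDual φ (str (B.map (pointEval x) * X.map (pointEval x))) = _
  rw [← Matrix.map_mul, evalAt_eq]
  exact congrArg _ (str_map (pointEval x).toLinearMap _)

variable (R : Module.End ℂ psl) {g : SMat (SF N)} (hg : IsUnit g) (x : ℝ × ℝ)

include hg

theorem matEval_Rg_weightOp (w : Fin 3 → ℂ) (X : SMat (SF N)) :
    matEval x ((Rg R g * weightOp w : Module.End ℂ _) X) =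
      (Rg R (g.map (pointEval x)) * weightOp w : Module.End ℂ _) (matEval x X) := by
  rw [Module.End.mul_apply, Module.End.mul_apply, matEval_apply, matEval_apply, weightOp_map,
    Rg_map R _ hg]

theorem exists_hasSum_opMinusInv : ∃ δ > 0, ∀ η : ℝ, |η| < δ → IsUnit (opMinus R η g) →
    ∀ Y (ψ : SMat (ℂ ⊗[ℝ] Grassmann N) →ₗ[ℂ] ℂ),
      HasSum (fun n => (η : ℂ) ^ n * ψ (matEval x (((Rg R g * dPS) ^ n : Module.End ℂ _) Y)))
        (ψ (matEval x (opMinusInv R η g Y))) := by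
  have h := matEval_Rg_weightOp R hg x wMinus
  obtain ⟨δ, hδ, key⟩ := exists_hasSum_inverse h
  refine ⟨δ, hδ, fun η hη hu => ?_⟩
  rw [dPS_eq_weightOp]
  rw [opMinus, dPS_eq_weightOp] at hu
  rw [opMinusInv, opMinus, dPS_eq_weightOp]
  exact key η (by simpa using hη) hu

theorem exists_hasSum_opPlusInv : ∃ δ > 0, ∀ η : ℝ, |η| < δ → IsUnit (opPlus R η g) →
    ∀ Y (ψ : SMat (ℂ ⊗[ℝ] Grassmann N) →ₗ[ℂ] ℂ),
      HasSum (fun n => (η : ℂ) ^ n * ψ (matEval x (((-(Rg R g * dPSHat)) ^ n :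
        Module.End ℂ _) Y))) (ψ (matEval x (opPlusInv R η g Y))) := by
  have h : ∀ X, matEval x ((-(Rg R g * weightOp wPlus) : Module.End ℂ _) X) =
      (-(Rg R (g.map (pointEval x)) * weightOp wPlus) : Module.End ℂ _) (matEval x X) := fun X => by
    rw [LinearMap.neg_apply, LinearMap.neg_apply, map_neg, matEval_Rg_weightOp R hg]
  obtain ⟨δ, hδ, key⟩ := exists_hasSum_inverse h
  refine ⟨δ, hδ, fun η hη hu => ?_⟩
  have e : opPlus R η g = 1 - (η : ℂ) • -(Rg R g * weightOp wPlus) := by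
    rw [opPlus, dPSHat_eq_weightOp, smul_neg, sub_neg_eq_add]
  rw [e] at hu
  rw [dPSHat_eq_weightOp, opPlusInv, e]
  exact key η (by simpa using hη) hu

end Evaluation

/-! ### Expansion of the BRST transformations -/

theorem hasSum_of_shift {a b d : ℕ → ℂ} {c k u v : ℂ} (ha : HasSum (fun n => c ^ n * a n) u)
    (hb : HasSum (fun n => c ^ n * b n) v) (h0 : d 0 = a 0)
    (hd : ∀ n, d (n + 1) = a (n + 1) + k * b n) :
    HasSum (fun n => c ^ n * d n) (u + k * c * v) := by
  rw [← hasSum_nat_add_iff' 1] at ha ⊢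
  convert ha.add (hb.mul_left (k * c)) using 1
  · funext n
    rw [hd]
    ring
  · rw [Finset.sum_range_one, Finset.sum_range_one, h0]
    ring

section Expansion

variable {N : ℕ} (R : Module.End ℂ psl) {Φ : Fields (SF N)}

theorem evalAt_smul (x : ℝ × ℝ) (φ : Module.Dual ℝ (Grassmann N)) (c : ℂ) (y : SF N) :
    evalAt x φ (c • y) = c * evalAt x φ y := by
  rw [evalAt_eq, evalAt_eq, map_smul, map_smul, smul_eq_mul]

theorem hasSum_brstW3 (hg : IsUnit Φ.g) (x : ℝ × ℝ) : ∃ δ > 0, ∀ η : ℝ, |η| < δ →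
    IsUnit (opMinus R η Φ.g) → ∀ (φ : Module.Dual ℝ (Grassmann N)) (i j : Idx),
      HasSum (fun n : ℕ => (η : ℂ) ^ n * evalAt x φ (brstW3Coeff dMinus R Φ n i j))
        (evalAt x φ (brstW3 dMinus R η Φ i j)) := by
  obtain ⟨δ, hδ, key⟩ := exists_hasSum_opMinusInv R hg x
  refine ⟨δ, hδ, fun η hη hu φ i j => ?_⟩
  have ha := key η hη hu (mcForm dMinus Φ.g) (entryForm 3 φ i j)
  have hb := key η hη hu (Rg R Φ.g (nMinus Φ)) (entryForm 3 φ i j)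
  simp only [entryForm_matEval] at ha hb
  have hs := hasSum_of_shift (k := 4) (d := fun n => evalAt x φ (brstW3Coeff dMinus R Φ n i j))
    ha hb rfl fun n => by
      rw [← evalAt_smul, ← map_add]
      congr 1
      simp only [brstW3Coeff, map_add, map_smul, Matrix.neg_apply, Matrix.add_apply,
        Matrix.smul_apply]
      module
  convert hs using 1
  rw [← evalAt_smul, ← map_add]
  congr 1
  simp only [brstW3, jMinus, Matrix.neg_apply, Matrix.sub_apply, Matrix.smul_apply]
  module

theorem hasSum_brstW1 (hg : IsUnit Φ.g) (x : ℝ × ℝ) : ∃ δ > 0, ∀ η : ℝ, |η| < δ →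
    IsUnit (opPlus R η Φ.g) → ∀ (φ : Module.Dual ℝ (Grassmann N)) (i j : Idx),
      HasSum (fun n : ℕ => (η : ℂ) ^ n * evalAt x φ (brstW1Coeff dPlus R Φ n i j))
        (evalAt x φ (brstW1 dPlus R η Φ i j)) := by
  obtain ⟨δ, hδ, key⟩ := exists_hasSum_opPlusInv R hg x
  refine ⟨δ, hδ, fun η hη hu φ i j => ?_⟩
  have ha := key η hη hu (mcForm dPlus Φ.g) (entryForm 1 φ i j)
  have hb := key η hη hu (Rg R Φ.g (nPlus Φ)) (entryForm 1 φ i j)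
  simp only [entryForm_matEval] at ha hb
  have hs := hasSum_of_shift (k := -4) (d := fun n => evalAt x φ (brstW1Coeff dPlus R Φ n i j))
    ha hb rfl fun n => by
      rw [← evalAt_smul, ← map_add]
      congr 1
      simp only [brstW1Coeff, map_sub, map_smul, Matrix.neg_apply, Matrix.sub_apply,
        Matrix.smul_apply]
      module
  convert hs using 1
  rw [← evalAt_smul, ← map_add]
  congr 1
  simp only [brstW1, jBarPlus, Matrix.neg_apply, Matrix.add_apply, Matrix.smul_apply]
  module

end Expansion

/-! ### Expansion of the Lagrangian density -/

section Density

theorem lagrangian_zero {𝒪 : Type*} [Ring 𝒪] [Algebra ℂ 𝒪] [SuperRing 𝒪] {dp dm : 𝒪 →ₗ[ℂ] 𝒪}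
    (R : Module.End ℂ psl) {Φ : Fields 𝒪} (h : IsField dp dm Φ) :
    lagrangian dp dm R 0 Φ = lagrangianAdS dp dm Φ := by
  have h1 : opMinusInv R 0 Φ.g = 1 := by
    rw [opMinusInv, opMinus, Complex.ofReal_zero, zero_smul, sub_zero, Ring.inverse_one]
  have h2 : opPlusInv R 0 Φ.g = 1 := by
    rw [opPlusInv, opPlus, Complex.ofReal_zero, zero_smul, add_zero, Ring.inverse_one]
  have h3 : str (nMinus Φ * nPlus Φ) = str (nPlus Φ * nMinus Φ) :=
    sForm_comm h.gh.nm h.gh.np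
  rw [lagrangian, lagrangianAdS, jMinus, jBarPlus, h1, h2]
  simp only [Module.End.one_apply, Complex.ofReal_zero, mul_zero, zero_smul, sub_zero, str_add,
    str_sub, str_smul, h3]
  abel

/-- The deformation of the Lagrangian density, `η/4 Str (B₊ 𝒪₋⁻¹ R_g B₋)`. -/
theorem lagrangian_sub_lagrangianAdS {𝒪 : Type*} [Ring 𝒪] [Algebra ℂ 𝒪] [SuperRing 𝒪]
    {dp dm : 𝒪 →ₗ[ℂ] 𝒪} (hdp : IsEvenDerivation dp) (hdm : IsEvenDerivation dm)
    {R : Module.End ℂ psl} (hR : IsYangBaxter R) {η : ℝ} {Φ : Fields 𝒪} (h : IsField dp dm Φ)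
    (hreg : Regular R η Φ) :
    lagrangian dp dm R η Φ - lagrangianAdS dp dm Φ =
      ((η : ℂ) / 4) • str ((dPSHat (mcForm dp Φ.g) + (4 : ℂ) • nPlus Φ) *
        opMinusInv R η Φ.g (Rg R Φ.g (dPS (mcForm dm Φ.g) + (4 : ℂ) • nMinus Φ))) := by
  have hreg0 : Regular R 0 Φ := by
    constructor
    · rw [opMinus, Complex.ofReal_zero, zero_smul, sub_zero]; exact isUnit_one
    · rw [opPlus, Complex.ofReal_zero, zero_smul, add_zero]; exact isUnit_one
  have e1 := lagrangian_eq_sForm hdp hdm hR η h.g h.gh hreg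
  have e0 := lagrangian_eq_sForm hdp hdm hR 0 h.g h.gh hreg0
  rw [← lagrangian_zero R h, e1, e0, Complex.ofReal_zero, zero_div, zero_smul, add_zero,
    dPSHat_eq_weightOp, dPS_eq_weightOp, opMinusInv, opMinus_eq]
  rw [add_sub_add_right_eq_sub, add_sub_cancel_left]
  rfl

theorem coe_pow_apply {𝒪 : Type*} [Ring 𝒪] [Algebra ℂ 𝒪] [SuperRing 𝒪] {T : Module.End ℂ (Env 𝒪)}
    {T' : Module.End ℂ (SMat 𝒪)} (h : ∀ X, (T X).1 = T' X.1) (n : ℕ) (X : Env 𝒪) :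
    ((T ^ n) X).1 = (T' ^ n) X.1 := by
  induction n generalizing X with
  | zero => rfl
  | succ n ih => rw [pow_succ, Module.End.mul_apply, ih, h, pow_succ, Module.End.mul_apply]

/-- The coefficients of the Lagrangian density in terms of powers of `R_g d_PS`. -/
theorem lagrangianCoeff_eq {𝒪 : Type*} [Ring 𝒪] [Algebra ℂ 𝒪] [SuperRing 𝒪]
    {dp dm : 𝒪 →ₗ[ℂ] 𝒪} (hdp : IsEvenDerivation dp) (hdm : IsEvenDerivation dm)
    {R : Module.End ℂ psl} (hR : IsYangBaxter R) {Φ : Fields 𝒪} (h : IsField dp dm Φ) (n : ℕ) :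
    lagrangianCoeff dp dm R Φ n =
      (1 / 4 : ℂ) • str ((dPSHat (mcForm dp Φ.g) + (4 : ℂ) • nPlus Φ) *
        ((Rg R Φ.g * dPS) ^ n : Module.End ℂ (SMat 𝒪))
          (Rg R Φ.g (dPS (mcForm dm Φ.g) + (4 : ℂ) • nMinus Φ))) := by
  set S : Module.End ℂ (Env 𝒪) :=
    envExtend hR * envAdjInv h.g * envWeight wMinus * envAdj h.g with hS
  set T : Module.End ℂ (Env 𝒪) := envRg hR h.g * envWeight wMinus with hT
  set Bm : Env 𝒪 := envWeight wMinus (envMc hdm h.g) + (4 : ℂ) • h.gh.nm with hBm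
  set Bp : Env 𝒪 := envWeight wPlus (envMc hdp h.g) + (4 : ℂ) • h.gh.np with hBp
  have e1 : lagrangianCoeff dp dm R Φ n = -(1 / 4 : ℂ) • sForm (-envAdjInv h.g Bp)
      ((S ^ n) (envExtend hR (envAdjInv h.g Bm))) := by
    rw [lagrangianCoeff, sForm_apply, coe_pow_apply (T' := extend R * adjInv Φ.g * dPS * adj Φ.g)
      (fun X => by rw [dPS_eq_weightOp]; rfl), noetherPlus, noetherMinus, dPS_eq_weightOp,
      dPSHat_eq_weightOp]
    rfl
  have e2 : ∀ Y, envAdj h.g ((S ^ n) Y) = (T ^ n) (envAdj h.g Y) :=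
    map_pow_apply (f := envAdj h.g) (T := S) (T' := T) (fun X => rfl) n
  have e3 : str ((dPSHat (mcForm dp Φ.g) + (4 : ℂ) • nPlus Φ) *
        ((Rg R Φ.g * dPS) ^ n : Module.End ℂ (SMat 𝒪))
          (Rg R Φ.g (dPS (mcForm dm Φ.g) + (4 : ℂ) • nMinus Φ))) =
      sForm Bp ((T ^ n) (envRg hR h.g Bm)) := by
    rw [sForm_apply, coe_pow_apply (T' := Rg R Φ.g * dPS)
      (fun X => by rw [dPS_eq_weightOp]; rfl), dPS_eq_weightOp, dPSHat_eq_weightOp]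
    rfl
  rw [e1, e3, map_neg, LinearMap.neg_apply, neg_smul_neg, envAdjInv,
    sForm_envConj _ _ h.g.inv_mul h.g.mul_inv]
  exact congrArg (fun y => (1 / 4 : ℂ) • sForm Bp y) (e2 _)

theorem hasSum_lagrangian {N : ℕ} {R : Module.End ℂ psl} (hR : IsYangBaxter R)
    {Φ : Fields (SF N)} (h : IsConfig Φ) (x : ℝ × ℝ) : ∃ δ > 0, ∀ η : ℝ, |η| < δ →
    Regular R η Φ → ∀ φ : Module.Dual ℝ (Grassmann N),
      HasSum (fun n : ℕ => (η : ℂ) ^ (n + 1) *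
          evalAt x φ (lagrangianCoeff dPlus dMinus R Φ n))
        (evalAt x φ (lagrangian dPlus dMinus R η Φ - lagrangianAdS dPlus dMinus Φ)) := by
  obtain ⟨δ, hδ, key⟩ := exists_hasSum_opMinusInv R h.g_unit x
  refine ⟨δ, hδ, fun η hη hreg φ => ?_⟩
  have hF := isConfig_iff.1 h
  have hs := (key η hη hreg.1 (Rg R Φ.g (dPS (mcForm dMinus Φ.g) + (4 : ℂ) • nMinus Φ))
    (strForm φ (matEval x (dPSHat (mcForm dPlus Φ.g) + (4 : ℂ) • nPlus Φ)))).mul_left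
      ((η : ℂ) / 4)
  simp only [strForm_matEval] at hs
  rw [lagrangian_sub_lagrangianAdS isEvenDerivation_dPlus isEvenDerivation_dMinus hR hF hreg,
    evalAt_smul]
  refine hs.congr_fun fun n => ?_
  rw [lagrangianCoeff_eq isEvenDerivation_dPlus isEvenDerivation_dMinus hR hF, evalAt_smul]
  ring

/-- Expansion of the Lagrangian density and of the BRST transformations in powers of the
deformation parameter. -/
theorem expansion {N : ℕ} {R : Module.End ℂ psl} (hR : IsYangBaxter R)
    {Φ : Fields (SF N)} (h : IsConfig Φ) (x : ℝ × ℝ) : ∃ δ > 0, ∀ η : ℝ, |η| < δ →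
    Regular R η Φ → ∀ φ : Module.Dual ℝ (Grassmann N),
      HasSum (fun n : ℕ => (η : ℂ) ^ (n + 1) *
          evalAt x φ (lagrangianCoeff dPlus dMinus R Φ n))
        (evalAt x φ (lagrangian dPlus dMinus R η Φ - lagrangianAdS dPlus dMinus Φ)) ∧
      ∀ i j : Idx,
        HasSum (fun n : ℕ => (η : ℂ) ^ n * evalAt x φ (brstW3Coeff dMinus R Φ n i j))
          (evalAt x φ (brstW3 dMinus R η Φ i j)) ∧
        HasSum (fun n : ℕ => (η : ℂ) ^ n * evalAt x φ (brstW1Coeff dPlus R Φ n i j))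
          (evalAt x φ (brstW1 dPlus R η Φ i j)) := by
  obtain ⟨δ₀, h₀, k₀⟩ := hasSum_lagrangian hR h x
  obtain ⟨δ₁, h₁, k₁⟩ := hasSum_brstW1 R h.g_unit x
  obtain ⟨δ₃, h₃, k₃⟩ := hasSum_brstW3 R h.g_unit x
  refine ⟨min δ₀ (min δ₁ δ₃), lt_min h₀ (lt_min h₁ h₃), fun η hη hreg φ => ?_⟩
  rw [lt_min_iff, lt_min_iff] at hη
  exact ⟨k₀ η hη.1 hreg φ, fun i j => ⟨k₃ η hη.2.2 hreg.1 φ i j, k₁ η hη.2.1 hreg.2 φ i j⟩⟩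

end Density

/-! ### Operators at the unit element -/

section Unit

variable {𝒪 : Type*} [Ring 𝒪] [Algebra ℂ 𝒪] (R : Module.End ℂ psl)

theorem eq_sum_single (X : SMat 𝒪) :
    X = ∑ p : Idx × Idx, X p.1 p.2 • ofComplex 𝒪 (Matrix.single p.1 p.2 1) := by
  conv_lhs => rw [Matrix.matrix_eq_sum_single X]
  rw [Fintype.sum_prod_type]
  refine Finset.sum_congr rfl fun i _ => Finset.sum_congr rfl fun j _ => ?_
  ext k l
  rw [smul_ofComplex_apply, Matrix.single_apply, Matrix.single_apply]
  split_ifs <;> simp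

theorem omega_smul_ofComplex (x : 𝒪) (Z : SMat ℂ) :
    omega (x • ofComplex 𝒪 Z) = x • ofComplex 𝒪 (omega Z) := by
  rw [omega_smul_left, ofComplex, omega_map]
  rfl

theorem proj_smul_ofComplex (k : ℕ) (x : 𝒪) (Z : SMat ℂ) :
    proj k (x • ofComplex 𝒪 Z) = x • ofComplex 𝒪 (proj k Z) := by
  rw [proj_smul_left, ofComplex, proj_map]
  rfl

theorem map_smul_ofComplex (D : 𝒪 →ₗ[ℂ] 𝒪) (x : 𝒪) (Z : SMat ℂ) :
    (x • ofComplex 𝒪 Z).map D = D x • ofComplex 𝒪 Z := by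
  ext i j
  rw [Matrix.map_apply, smul_ofComplex_apply, smul_ofComplex_apply, map_smul]

theorem adj_one (X : SMat 𝒪) : adj 1 X = pr X := by
  rw [adj_apply, Ring.inverse_one, one_mul, mul_one]

theorem adjInv_one (X : SMat 𝒪) : adjInv 1 X = pr X := by
  rw [adjInv_apply, Ring.inverse_one, one_mul, mul_one]

theorem Rg_one_smul_ofComplex (x : 𝒪) (Z : SMat ℂ) :
    Rg R 1 (x • ofComplex 𝒪 Z) = x • ofComplex 𝒪 (Rg R 1 Z) := by
  have h := Rg_map R (Algebra.ofId ℂ 𝒪) (g := 1) isUnit_one Z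
  rw [Matrix.map_one _ (map_zero _) (map_one _)] at h
  rw [Rg_apply, adj_one, adjInv_one, pr_smul_left, extend_smul_left, pr_smul_left, ← adj_one,
    ← adjInv_one, ← Rg_apply]
  exact congrArg (x • ·) h

theorem weightOp_smul_ofComplex (w : Fin 3 → ℂ) (x : 𝒪) (Z : SMat ℂ) :
    weightOp w (x • ofComplex 𝒪 Z) = x • ofComplex 𝒪 (weightOp w Z) := by
  rw [weightOp_smul_left]
  exact congrArg (x • ·) (weightOp_map w (Algebra.ofId ℂ 𝒪) Z)

theorem dressOp_one_smul_ofComplex (c : ℂ) (w : Fin 3 → ℂ) (x : 𝒪) (Z : SMat ℂ) :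
    dressOp R c w 1 (x • ofComplex 𝒪 Z) = x • ofComplex 𝒪 (dressOp R c w 1 Z) := by
  rw [dressOp_apply, weightOp_smul_ofComplex, Rg_one_smul_ofComplex, dressOp_apply]
  ext i j
  simp only [Matrix.add_apply, Matrix.smul_apply c, smul_ofComplex_apply]
  rw [smul_smul, ← add_smul]
  rfl

/-- At the unit element the dressed operators over `𝒪` are extensions of complex operators. -/
theorem isUnit_dressOp_one {c : ℂ} {w : Fin 3 → ℂ} (h : IsUnit (dressOp R c w (1 : SMat ℂ))) :
    IsUnit (dressOp R c w (1 : SMat 𝒪)) := by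
  obtain ⟨W, hW, hW'⟩ : ∃ W : Module.End ℂ (SMat ℂ), (∀ Z, dressOp R c w 1 (W Z) = Z) ∧
      ∀ Z, W (dressOp R c w 1 Z) = Z :=
    ⟨Ring.inverse (dressOp R c w 1),
      fun Z => by rw [← Module.End.mul_apply, Ring.mul_inverse_cancel _ h, Module.End.one_apply],
      fun Z => by rw [← Module.End.mul_apply, Ring.inverse_mul_cancel _ h, Module.End.one_apply]⟩
  let W' : Module.End ℂ (SMat 𝒪) :=
    { toFun := fun X => ∑ p : Idx × Idx, X p.1 p.2 • ofComplex 𝒪 (W (Matrix.single p.1 p.2 1))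
      map_add' := fun X Y => by simp only [Matrix.add_apply, add_smul, Finset.sum_add_distrib]
      map_smul' := fun c X => by
        simp only [Matrix.smul_apply, smul_assoc, Finset.smul_sum, RingHom.id_apply] }
  have hW'a : ∀ X, W' X = ∑ p : Idx × Idx,
    X p.1 p.2 • ofComplex 𝒪 (W (Matrix.single p.1 p.2 1)) := fun X => rfl
  have hW'c : ∀ (x : 𝒪) (Z : SMat ℂ), W' (x • ofComplex 𝒪 Z) = x • ofComplex 𝒪 (W Z) :=
    fun x Z => by
      have hZ : Z = ∑ p : Idx × Idx, Z p.1 p.2 • Matrix.single p.1 p.2 (1 : ℂ) := by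
        conv_lhs => rw [Matrix.matrix_eq_sum_single Z]
        rw [Fintype.sum_prod_type]
        simp
      ext i j
      conv_rhs => rw [smul_ofComplex_apply, hZ, map_sum, Matrix.sum_apply, Finset.sum_smul]
      rw [hW'a, Matrix.sum_apply]
      refine Finset.sum_congr rfl fun p _ => ?_
      rw [smul_ofComplex_apply, smul_ofComplex_apply, map_smul, Matrix.smul_apply, smul_smul,
        smul_eq_mul, mul_comm]
  refine ⟨⟨dressOp R c w 1, W', LinearMap.ext fun X => ?_, LinearMap.ext fun X => ?_⟩, rfl⟩
  · rw [Module.End.mul_apply, Module.End.one_apply]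
    conv_rhs => rw [eq_sum_single X]
    rw [hW'a, map_sum]
    exact Finset.sum_congr rfl fun p _ => by rw [dressOp_one_smul_ofComplex, hW]
  · rw [Module.End.mul_apply, Module.End.one_apply]
    conv_lhs => rw [eq_sum_single X]
    conv_rhs => rw [eq_sum_single X]
    rw [map_sum, map_sum]
    exact Finset.sum_congr rfl fun p _ => by rw [dressOp_one_smul_ofComplex, hW'c, hW']

/-- A change of the group element within a nil ideal does not affect `R_g` on that ideal. -/
theorem Rg_one_add {F : Submodule ℂ 𝒪} (hF : IsNilIdeal F) {Λ X : SMat 𝒪}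
    (hΛ : Λ ∈ entriesIn F) (hX : X ∈ entriesIn F) : Rg R (1 + Λ) X = Rg R 1 X := by
  have hinv : Ring.inverse (1 + Λ) = 1 - Λ :=
    Ring.inverse_unit ⟨1 + Λ, 1 - Λ, hF.one_add_mul_one_sub hΛ, hF.one_sub_mul_one_add hΛ⟩
  have h1 : ∀ {Y : SMat 𝒪}, Y ∈ entriesIn F → adj (1 + Λ) Y = adj 1 Y := fun {Y} hY => by
    rw [adj_one, adj_apply, hinv]
    congr 1
    rw [add_mul, hF.mul_eq_zero_of_mem hΛ hY, mul_sub, add_zero, one_mul,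
      hF.mul_eq_zero_of_mem hY hΛ, sub_zero, mul_one]
  have h2 : adjInv (1 + Λ) X = adjInv 1 X := by
    rw [adjInv_one, adjInv_apply, hinv]
    congr 1
    rw [sub_mul, hF.mul_eq_zero_of_mem hΛ hX, mul_add, sub_zero, one_mul,
      hF.mul_eq_zero_of_mem hX hΛ, add_zero, mul_one]
  rw [Rg_apply, h2, h1, ← Rg_apply]
  exact extend_mem_entriesIn R (adjInv_mem_entriesIn hF.mul_right hF.mul_left hX 1)

end Unit

/-! ### Affine families of operators -/

/-- The singular values of `η` are related to the eigenvalues of `T` by `η ↦ -η⁻¹`. -/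
theorem finite_not_isUnit_one_add {V : Type*} [AddCommGroup V] [Module ℂ V]
    [FiniteDimensional ℂ V] (T : Module.End ℂ V) :
    {η : ℝ | ¬ IsUnit (1 + (η : ℂ) • T)}.Finite := by
  have hinj : Function.Injective fun η : ℝ => -(η : ℂ)⁻¹ := fun a b h => by simpa using h
  refine ((Module.End.finite_spectrum T).preimage hinj.injOn).subset fun η hη => ?_
  rw [Set.mem_preimage, spectrum.mem_iff]
  intro h
  apply hη
  by_cases h0 : η = 0
  · rw [h0, Complex.ofReal_zero, zero_smul, add_zero]
    exact isUnit_one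
  have h0' : (η : ℂ) ≠ 0 := Complex.ofReal_ne_zero.2 h0
  have e : 1 + (η : ℂ) • T =
      algebraMap ℂ (Module.End ℂ V) (-η) * (algebraMap ℂ (Module.End ℂ V) (-(η : ℂ)⁻¹) - T) := by
    rw [mul_sub, ← map_mul, neg_mul_neg, mul_inv_cancel₀ h0', map_one, ← Algebra.smul_def,
      neg_smul, sub_neg_eq_add]
  rw [e]
  exact ((IsUnit.mk0 _ (neg_ne_zero.2 h0')).map (algebraMap ℂ (Module.End ℂ V))).mul h

/-- For all but finitely many `η`, the solution `z` of `z + η T z = η r` has `ψ z ≠ -1`: otherwise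
it would be in the kernel of another operator of the form `1 + η T'`. -/
theorem finite_exists_solution {V : Type*} [AddCommGroup V] [Module ℂ V]
    [FiniteDimensional ℂ V] (T : Module.End ℂ V) (r : V) (ψ : V →ₗ[ℂ] ℂ) :
    {η : ℝ | ∃ z, z + (η : ℂ) • T z = (η : ℂ) • r ∧ ψ z = -1}.Finite := by
  refine (finite_not_isUnit_one_add (T + ψ.smulRight r)).subset fun η ⟨z, hz, hψ⟩ hu => ?_
  have h0 : (1 + (η : ℂ) • (T + ψ.smulRight r)) z = 0 := by
    change z + (η : ℂ) • (T z + ψ z • r) = 0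
    rw [smul_add, ← add_assoc, hz, hψ]
    module
  have hz0 : z = 0 := by
    obtain ⟨u, hu⟩ := hu
    have := congrArg (u⁻¹ : (Module.End ℂ V)ˣ).1 (hu ▸ h0)
    rwa [← Module.End.mul_apply, Units.inv_mul, Module.End.one_apply, map_zero] at this
  rw [hz0, map_zero] at hψ
  norm_num at hψ

/-! ### Complex ghosts -/

theorem omega_single (i j : Idx) (c : ℂ) : omega (Matrix.single i j c) =
    Matrix.single (swp j) (swp i) (-(kap i * kap j * tau j i) * c) := by
  have h : ∀ a b, swp a = b ↔ swp b = a := fun a b =>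
    ⟨fun h => by rw [← h, swp_swp], fun h => by rw [← h, swp_swp]⟩
  ext a b
  rw [omega_apply, Matrix.single_apply, Matrix.single_apply]
  by_cases hab : swp j = a ∧ swp i = b
  · obtain ⟨rfl, rfl⟩ := hab
    rw [if_pos ⟨(swp_swp i).symm, (swp_swp j).symm⟩, if_pos ⟨rfl, rfl⟩, kap_swp, kap_swp, tau_swp,
      smul_eq_mul]
    ring
  · rw [if_neg hab, if_neg (fun h' => hab ⟨by rw [h'.2, swp_swp], by rw [h'.1, swp_swp]⟩), smul_zero]

/-- The odd matrix `E_{i,j} + z E_{j',i'}` which pairs a root vector with its image under `Ω`. -/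
def oddRoot (z : ℂ) (i j i' j' : Fin 4) : SMat ℂ :=
  Matrix.single (Sum.inl i) (Sum.inr j) 1 + Matrix.single (Sum.inr j') (Sum.inl i') z

theorem omega_oddRoot {z : ℂ} (hz : z * z = -1) {i j i' j' : Fin 4}
    (hi : swp (Sum.inl i) = Sum.inl i') (hj : swp (Sum.inr j) = Sum.inr j')
    (hk : kap (Sum.inl i) * kap (Sum.inr j) = 1) :
    omega (oddRoot z i j i' j') = z • oddRoot z i j i' j' := by
  have hk' : kap (Sum.inr j') * kap (Sum.inl i') = 1 := by
    rw [← hi, ← hj, kap_swp, kap_swp, neg_mul_neg, mul_comm, hk]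
  rw [oddRoot, map_add, omega_single, omega_single, hi, hj, hk, hk', ← hi, ← hj, swp_swp, swp_swp,
    smul_add, Matrix.smul_single, Matrix.smul_single, smul_eq_mul z z, hz, smul_eq_mul, mul_one,
    add_comm]
  rw [hi, hj]
  simp [tau]

theorem oddRoot_apply_eq (z : ℂ) (i j i' j' : Fin 4) {a b : Idx} (h : sgn a = sgn b) :
    oddRoot z i j i' j' a b = 0 := by
  rcases a with a | a <;> rcases b with b | b
  · simp [oddRoot]
  · exact absurd h (by norm_num)
  · exact absurd h (by norm_num)
  · simp [oddRoot]

theorem oddRoot_mul_self (z : ℂ) {i j i' j' : Fin 4} (hi : i' ≠ i) (hj : j ≠ j') :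
    oddRoot z i j i' j' * oddRoot z i j i' j' = 0 := by
  simp [oddRoot, mul_add, add_mul, hi, hj]

theorem toPsl_oddRoot (z : ℂ) (i j i' j' : Fin 4) :
    (toPsl (oddRoot z i j i' j')).1 = oddRoot z i j i' j' :=
  pr_eq_self_of_diag fun _ => oddRoot_apply_eq _ _ _ _ _ rfl

theorem isBoson_smul_oddRoot {𝒪 : Type*} [Ring 𝒪] [Algebra ℂ 𝒪] [SuperRing 𝒪] {x : 𝒪}
    (hx : SuperRing.par x = x) {z : ℂ} {k : ℕ} (hz : z = Complex.I ^ k) (hz' : z * z = -1)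
    {i j i' j' : Fin 4}
    (hi : swp (Sum.inl i) = Sum.inl i') (hj : swp (Sum.inr j) = Sum.inr j')
    (hk : kap (Sum.inl i) * kap (Sum.inr j) = 1) :
    IsBoson k (x • ofComplex 𝒪 (oddRoot z i j i' j')) where
  grade := by
    rw [omega_smul_ofComplex, omega_oddRoot hz' hi hj hk, ← hz]
    ext a b
    rw [Matrix.smul_apply z, smul_ofComplex_apply, smul_ofComplex_apply, Matrix.smul_apply,
      smul_assoc]
  pr_eq := by rw [pr_smul_ofComplex, toPsl_oddRoot]
  even a b := by rw [smul_ofComplex_apply, map_smul, hx]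

/-! ### Failure of nilpotency off-shell -/

section OffShell

open SuperRing

variable {𝒪 : Type*} [Ring 𝒪] [Algebra ℂ 𝒪] {dp dm : 𝒪 →ₗ[ℂ] 𝒪}
  (R : Module.End ℂ psl) (η : ℝ) {a b : SMat ℂ} {s ε : 𝒪}

/-- The constant group element `1`, vanishing antighosts and the ghosts `λ₁ = a`, `λ₃ = s b`. -/
def ghostFields (s : 𝒪) (a b : SMat ℂ) : Fields 𝒪 :=
  ⟨1, 0, 0, ofComplex 𝒪 a, s • ofComplex 𝒪 b⟩

theorem brstW3_ghostFields (h1 : dm 1 = 0) : brstW3 dm R η (ghostFields s a b) = 0 := by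
  have hA : mcForm dm (1 : SMat 𝒪) = 0 := by
    have : (1 : SMat 𝒪).map dm = 0 := by
      ext i j
      rw [Matrix.map_apply, Matrix.one_apply]
      split_ifs
      · exact h1
      · exact map_zero dm
    rw [mcForm, this, zero_mul, map_zero, neg_zero]
  have hN : nMinus (ghostFields s a b) = 0 := by simp [nMinus, ghostFields]
  rw [brstW3, jMinus, hN, show (ghostFields s a b).g = 1 from rfl, hA]
  simp only [map_zero, smul_zero, neg_zero, sub_zero]

/-- The variation of `ω_{3-}` at the configuration displaced by a BRST transformation. -/
theorem brstW3_ghostFields_varied [SuperRing 𝒪] (h1 : dm 1 = 0) (hε : par ε = -ε) (hdε : dm ε = 0)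
    (hds : dm (ε * s) = ε) (hb : pr b = b)
    (hreg : Regular R η (ghostFields s a b + brst dp dm R η ε (ghostFields s a b)))
    {κ : SMat ℂ} (hκ : opMinus R η 1 κ = b + (η : ℂ) • Rg R 1 b) :
    brstW3 dm R η (ghostFields s a b + brst dp dm R η ε (ghostFields s a b)) =
      ε • ofComplex 𝒪 (proj 3 κ) := by
  have hF := isNilIdeal_oddIdeal hε
  set Φ : Fields 𝒪 := ghostFields s a b with hΦ
  set Ψ := Φ + brst dp dm R η ε Φ with hΨ
  set Λ : SMat 𝒪 := ε • ofComplex 𝒪 (a - (η : ℂ) • Rg R 1 a)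
    + (ε * s) • ofComplex 𝒪 (b + (η : ℂ) • Rg R 1 b) with hΛ
  have hΛF : Λ ∈ entriesIn (oddIdeal 𝒪 ε) := by
    rw [hΛ, mul_smul, ← smul_add]
    exact smul_mem_oddIdeal _ _
  have hg : Ψ.g = 1 + Λ := by
    change (1 : SMat 𝒪) + (ε • ofComplex 𝒪 a - (η : ℂ) • Rg R 1 (ε • ofComplex 𝒪 a)
      + (ε • (s • ofComplex 𝒪 b) + (η : ℂ) • Rg R 1 (ε • (s • ofComplex 𝒪 b)))) * 1 = 1 + Λ
    rw [mul_one, ← mul_smul, Rg_one_smul_ofComplex, Rg_one_smul_ofComplex, hΛ]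
    congr 1
    ext i j
    simp only [Matrix.add_apply, Matrix.sub_apply, Matrix.smul_apply (η : ℂ), smul_ofComplex_apply,
      sub_smul, add_smul, smul_assoc]
  have hN : nMinus Ψ = 0 := by
    have hw : Ψ.w3 = 0 := by
      change (0 : SMat 𝒪) + ε • brstW3 dm R η Φ = 0
      rw [hΦ, brstW3_ghostFields R η h1, smul_zero, add_zero]
    rw [nMinus, hw, zero_mul, mul_zero, add_zero, map_zero, neg_zero]
  have hA : mcForm dm Ψ.g = -(ε • ofComplex 𝒪 (b + (η : ℂ) • Rg R 1 b)) := by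
    have hinv : Ring.inverse (1 + Λ) = 1 - Λ :=
      Ring.inverse_unit ⟨1 + Λ, 1 - Λ, hF.one_add_mul_one_sub hΛF, hF.one_sub_mul_one_add hΛF⟩
    have hd : (1 + Λ).map dm = ε • ofComplex 𝒪 (b + (η : ℂ) • Rg R 1 b) := by
      have h1' : (1 : SMat 𝒪).map dm = 0 := by
        ext i j
        rw [Matrix.map_apply, Matrix.one_apply]
        split_ifs
        · exact h1
        · exact map_zero dm
      rw [Matrix.map_add _ (map_add dm), h1', hΛ, Matrix.map_add _ (map_add dm), map_smul_ofComplex,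
        map_smul_ofComplex, hdε, hds, zero_smul, zero_add, zero_add]
    rw [mcForm, hg, hinv, hd, mul_sub, mul_one,
      hF.mul_eq_zero_of_mem (smul_mem_oddIdeal _ _) hΛF, sub_zero, pr_smul_ofComplex]
    congr 3
    change pr _ = _
    rw [map_add, map_smul, hb, pr_Rg]
  have hJ : opMinusInv R η Ψ.g (mcForm dm Ψ.g) = -(ε • ofComplex 𝒪 κ) := by
    have e : opMinus R η Ψ.g (-(ε • ofComplex 𝒪 κ)) = mcForm dm Ψ.g := by
      rw [hA, map_neg, ← hκ, opMinus_eq, opMinus_eq, ← dressOp_one_smul_ofComplex, dressOp_apply,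
        dressOp_apply, hg, Rg_one_add R hF hΛF
          (weightOp_mem_entriesIn _ (smul_mem_oddIdeal _ _))]
    rw [← e, opMinusInv, ← Module.End.mul_apply, Ring.inverse_mul_cancel _ hreg.1,
      Module.End.one_apply]
  rw [brstW3, jMinus, hJ, hN]
  simp only [map_zero, smul_zero, sub_zero, map_neg, neg_neg, proj_smul_ofComplex]

end OffShell

/-! ### Grassmann-valued coordinates and generators -/

section Coordinate

variable {N : ℕ}

/-- The light-cone coordinate `σ⁻`. -/
def coordMinus : SmoothFn :=
  ⟨fun x => (x.2 : ℂ), mem_smoothFn (Complex.ofRealCLM.contDiff.comp contDiff_snd)⟩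

theorem smoothDeriv_coordMinus : smoothDeriv (0, 1) coordMinus = 1 := by
  ext x
  change fderiv ℝ (fun x : ℝ × ℝ => (x.2 : ℂ)) x (0, 1) = 1
  have h : HasFDerivAt (fun x : ℝ × ℝ => (x.2 : ℂ))
      (Complex.ofRealCLM.comp (ContinuousLinearMap.snd ℝ ℝ ℝ)) x :=
    (Complex.ofRealCLM.comp (ContinuousLinearMap.snd ℝ ℝ ℝ)).hasFDerivAt
  rw [h.fderiv]
  simp

theorem isOddConst_ι (w : Fin N → ℝ) : IsOddConst (ExteriorAlgebra.ι ℝ w) :=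
  CliffordAlgebra.involute_ι w

theorem ι_mul_ι_ne_zero :
    ExteriorAlgebra.ι ℝ (Pi.single 0 1 : Fin 2 → ℝ) * ExteriorAlgebra.ι ℝ (Pi.single 1 1) ≠ 0 := by
  intro h
  have := CliffordAlgebra.contractLeft_ι_mul (Q := (0 : QuadraticForm ℝ (Fin 2 → ℝ)))
    (d := LinearMap.proj 0) (Pi.single 0 1) (ExteriorAlgebra.ι ℝ (Pi.single 1 1))
  rw [show CliffordAlgebra.ι (0 : QuadraticForm ℝ (Fin 2 → ℝ)) (Pi.single 0 1) *
    ExteriorAlgebra.ι ℝ (Pi.single 1 1) = 0 from h, map_zero,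
    show ExteriorAlgebra.ι ℝ (Pi.single 1 1 : Fin 2 → ℝ) = CliffordAlgebra.ι 0 _ from rfl,
    CliffordAlgebra.contractLeft_ι] at this
  simp only [LinearMap.proj_apply, Pi.single_eq_same, one_smul, ne_eq, zero_ne_one,
    not_false_eq_true, Pi.single_eq_of_ne, map_zero, mul_zero, sub_zero] at this
  have h1 := congrFun ((ExteriorAlgebra.ι_eq_zero_iff (R := ℝ) _).1 this.symm) 1
  simp at h1

theorem const_ne_zero {a : Grassmann N} (h : a ≠ 0) : const a ≠ 0 := by
  intro h0
  refine h ((Module.forall_dual_apply_eq_zero_iff ℝ a).1 fun φ => ?_)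
  have := congrArg (evalAt 0 φ) h0
  change φ a • (1 : ℂ) = _ at this
  simpa using this

theorem isEvenSMat_one : IsEvenSMat (1 : SMat (SF N)) :=
  isEvenSMat_iff.2 (map_one sPar)

theorem isPSU_one : IsPSU (1 : SMat (SF N)) := by
  refine ⟨isEvenSMat_one, ?_, ?_, ?_⟩
  · have h1 : superTranspose (1 : SMat (SF N)) = 1 := by
      ext (i | i) (j | j) <;> simp [superTranspose, Matrix.toBlocks₁₁, Matrix.toBlocks₂₂,
        Matrix.toBlocks₁₂, Matrix.toBlocks₂₁, Matrix.one_apply, eq_comm]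
    have h2 : (1 : SMat (SF N)).map conj = 1 := by
      refine Matrix.map_one _ (map_zero _) ?_
      change smoothConj 1 ⊗ₜ (1 : Grassmann N) = 1
      congr 1
      ext x
      exact map_one (starRingEnd ℂ)
    rw [h1, h2, one_mul, mul_one]
  · rw [← Matrix.fromBlocks_one, Matrix.toBlocks_fromBlocks₂₂]
    exact isUnit_one
  · rw [← Matrix.fromBlocks_one, Matrix.toBlocks_fromBlocks₁₁, Matrix.toBlocks_fromBlocks₁₂,
      Matrix.toBlocks_fromBlocks₂₂, zero_mul, zero_mul, sub_zero]

end Coordinate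

/-- Off-shell nilpotency fails for all but finitely many values of the deformation parameter. -/
theorem finite_nilpotent {R : Module.End ℂ psl} (hR : IsYangBaxter R) :
    {η : ℝ | ¬ ∃ Φ : Fields (SF 2), IsConfig Φ ∧ Regular R η Φ ∧ IsPSU Φ.g ∧
      ∃ e e' : Grassmann 2, IsOddConst e ∧ IsOddConst e' ∧
        ¬ IsGauge Φ (QQ R η e' e Φ)}.Finite := by
  -- two ghosts with disjoint supports: commutators with `u` have no entry at the position of `v`
  set u := oddRoot Complex.I 0 0 1 1 with hu
  set v := oddRoot (-Complex.I) 2 2 3 3 with hv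
  have hI : Complex.I * Complex.I = -1 := Complex.I_mul_I
  have hk2 : kap (Sum.inl 2) * kap (Sum.inr 2) = 1 := kap_mul_self (Sum.inl 2)
  have hgv : omega v = Complex.I ^ 3 • v := by
    rw [Complex.I_pow_three]
    exact omega_oddRoot (by rw [neg_mul_neg, hI]) rfl rfl hk2
  have hpv : proj 3 v = v := proj_eq_self_iff.2 hgv
  have hdv : weightOp wMinus v = (3 : ℂ) • v := by
    rw [weightOp_apply, hpv, proj_eq_zero hgv (by norm_num [Complex.ext_iff, pow_succ]),
      proj_eq_zero hgv (by norm_num [Complex.ext_iff, pow_succ]), smul_zero, smul_zero, zero_add,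
      zero_add]
    rfl
  -- excluded are the `η` for which one of the operators at `g = 1` is singular, or the entry of the
  -- variation of `ω_{3-}` at the position of `v` vanishes
  set T : Module.End ℂ (SMat ℂ) := Rg R 1 * weightOp wMinus with hT
  set ψ : SMat ℂ →ₗ[ℂ] ℂ := Matrix.entryLinearMap ℂ ℂ (Sum.inl 2) (Sum.inr 2) ∘ₗ proj 3 with hψ
  refine (((finite_not_isUnit_one_add (-T)).union
    (finite_not_isUnit_one_add (Rg R (1 : SMat ℂ) * weightOp wPlus))).union
    (finite_exists_solution (-T) ((4 : ℂ) • Rg R 1 v) ψ)).subset fun η hη => ?_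
  by_contra hbad
  simp only [Set.mem_union, not_or, Set.mem_ofPred_eq, not_not] at hbad
  obtain ⟨⟨hm, hp⟩, hs⟩ := hbad
  apply hη
  have hm' : IsUnit (dressOp R (-η) wMinus (1 : SMat ℂ)) := by
    convert hm using 1
    refine LinearMap.ext fun X => ?_
    rw [dressOp_apply, neg_smul, ← smul_neg]
    rfl
  set Φ : Fields (SF 2) := ghostFields (coordMinus ⊗ₜ 1) u v with hΦ
  have hd1 : ∀ D : SF 2 →ₗ[ℂ] SF 2, IsEvenDerivation D → (1 : SMat (SF 2)).map D = 0 :=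
    fun D hD => hD.map_one_matrix
  have hpar : superRingSF.par ((coordMinus ⊗ₜ 1 : SF 2)) = coordMinus ⊗ₜ 1 := by
    change coordMinus ⊗ₜ inv (1 : Grassmann 2) = _
    rw [map_one]
  have hl1 : IsBoson 1 (ofComplex (SF 2) u) := by
    rw [← one_smul (SF 2) (ofComplex (SF 2) u)]
    exact isBoson_smul_oddRoot (map_one _) (pow_one _).symm hI rfl rfl (by norm_num [kap])
  have hl3 : IsBoson 3 ((coordMinus ⊗ₜ 1 : SF 2) • ofComplex (SF 2) v) :=
    isBoson_smul_oddRoot hpar Complex.I_pow_three.symm (by rw [neg_mul_neg, hI]) rfl rfl hk2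
  have h0 : ∀ k, IsBosonicOfGrade k (0 : SMat (SF 2)) := fun k => isBosonicOfGrade_iff.2
    ⟨by rw [map_zero, smul_zero], map_zero _, fun i j => map_zero _⟩
  have hcfg : IsConfig Φ :=
    { g_even := isEvenSMat_one
      g_unit := isUnit_one
      g_plus := by
        change str ((1 : SMat (SF 2)).map dPlus * _) = 0
        rw [hd1 _ isEvenDerivation_dPlus, zero_mul, str_zero]
      g_minus := by
        change str ((1 : SMat (SF 2)).map dMinus * _) = 0
        rw [hd1 _ isEvenDerivation_dMinus, zero_mul, str_zero]
      w3_mem := h0 3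
      w1_mem := h0 1
      l1_mem := isBosonicOfGrade_iff.2 hl1
      l3_mem := isBosonicOfGrade_iff.2 hl3
      l1_pure := by
        have := smul_ofComplex_mul (1 : SF 2) 1 u u
        rw [one_smul, oddRoot_mul_self _ (by decide) (by decide)] at this
        change pr (ofComplex (SF 2) u * ofComplex (SF 2) u) = 0
        rw [this]
        ext i j
        simp [pr_apply, ofComplex_apply]
      l3_pure := by
        change pr (((coordMinus ⊗ₜ 1 : SF 2) • ofComplex (SF 2) v) * (_ • ofComplex (SF 2) v)) = 0
        rw [smul_ofComplex_mul, oddRoot_mul_self _ (by decide) (by decide)]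
        ext i j
        simp [pr_apply, ofComplex_apply] }
  have hreg : Regular R η Φ := by
    constructor
    · rw [opMinus_eq]
      exact isUnit_dressOp_one R hm'
    · rw [opPlus_eq]
      exact isUnit_dressOp_one R hp
  refine ⟨Φ, hcfg, hreg, isPSU_one, ExteriorAlgebra.ι ℝ (Pi.single 0 1),
    ExteriorAlgebra.ι ℝ (Pi.single 1 1), isOddConst_ι _, isOddConst_ι _, ?_⟩
  set e := ExteriorAlgebra.ι ℝ (Pi.single 0 1 : Fin 2 → ℝ) with he
  set e' := ExteriorAlgebra.ι ℝ (Pi.single 1 1 : Fin 2 → ℝ) with he'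
  rintro ⟨M, S, S', c, -, -, -, -, -, hw, -⟩
  -- `κ = v + z` solves `𝒪₋ κ = (1 + η R) v`, since `d v = 3 v`
  set z := Ring.inverse (opMinus R η 1) ((η : ℂ) • (4 : ℂ) • Rg R 1 v) with hz
  have hzeq : opMinus R η 1 z = (η : ℂ) • (4 : ℂ) • Rg R 1 v := by
    rw [hz, ← Module.End.mul_apply, Ring.mul_inverse_cancel _ (by rw [opMinus_eq]; exact hm'),
      Module.End.one_apply]
  have hψz : ψ z ≠ -1 := fun h => hs ⟨z, by
    rw [← hzeq, opMinus_eq, dressOp_apply, LinearMap.neg_apply, smul_neg, neg_smul]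
    rfl, h⟩
  have hκ : opMinus R η 1 (v + z) = v + (η : ℂ) • Rg R 1 v := by
    rw [map_add, hzeq, opMinus_eq, dressOp_apply, hdv, map_smul]
    module
  have hvar := brstW3_ghostFields_varied (dp := dPlus) (dm := dMinus) R η (a := u) (b := v)
    (s := (coordMinus ⊗ₜ 1 : SF 2)) (ε := const e')
    (isEvenDerivation_dMinus (N := 2)).map_one (par_const (isOddConst_ι _))
    (dir_const (0, 1) _) (by
      rw [const, Algebra.TensorProduct.tmul_mul_tmul, one_mul, mul_one]
      exact congrArg (· ⊗ₜ e') smoothDeriv_coordMinus)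
    (toPsl_oddRoot _ _ _ _ _) (brst_invariance hR hcfg hreg (isOddConst_ι _)).2.1 hκ
  have h3 : (QQ R η e' e Φ).w3 = const e • (const e' • ofComplex (SF 2) (proj 3 (v + z))) := by
    change const e • brstW3 dMinus R η _ - const e • brstW3 dMinus R η Φ = _
    rw [hΦ, brstW3_ghostFields R η (isEvenDerivation_dMinus (N := 2)).map_one, smul_zero, sub_zero]
    exact congrArg (const e • ·) hvar
  have hentry := congrFun (congrFun (h3.symm.trans hw) (Sum.inl 2)) (Sum.inr 2)
  have hrhs : (M * Φ.w3 - Φ.w3 * M + (Φ.l1 * S - S * Φ.l1)) (Sum.inl 2) (Sum.inr 2) = 0 := by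
    have e1 : Φ.w3 = 0 := rfl
    have e2 : ∀ j, Φ.l1 (Sum.inl 2) j = 0 := fun j => by
      change algebraMap ℂ (SF 2) (u (Sum.inl 2) j) = 0
      rw [show u (Sum.inl 2) j = 0 by simp [hu, oddRoot], map_zero]
    have e3 : ∀ j, Φ.l1 j (Sum.inr 2) = 0 := fun j => by
      change algebraMap ℂ (SF 2) (u j (Sum.inr 2)) = 0
      rw [show u j (Sum.inr 2) = 0 by simp [hu, oddRoot], map_zero]
    rw [e1, mul_zero, zero_mul, sub_zero, zero_add, Matrix.sub_apply, Matrix.mul_apply,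
      Matrix.mul_apply]
    simp only [e2, e3, zero_mul, mul_zero, Finset.sum_const_zero, sub_zero]
  rw [hrhs, Matrix.smul_apply, smul_ofComplex_apply, smul_eq_mul, mul_smul_comm] at hentry
  have hne : const e * const e' ≠ 0 := by
    rw [const, const, Algebra.TensorProduct.tmul_mul_tmul, one_mul]
    exact const_ne_zero ι_mul_ι_ne_zero
  have hv1 : ψ v = 1 := by
    change proj 3 v (Sum.inl 2) (Sum.inr 2) = 1
    rw [hpv, hv]
    simp [oddRoot]
  have hc : ψ (v + z) = 0 := (smul_eq_zero.1 hentry).resolve_right hne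
  rw [map_add, hv1] at hc
  exact hψz (by linear_combination hc)

/-! ### An abelian `R`-matrix -/

/-- The diagonal of a Cartan element of `su(2,2)`. -/
def diagL : Idx → ℂ := Sum.elim ![Complex.I, Complex.I, -Complex.I, -Complex.I] 0

/-- The diagonal of a Cartan element of `su(4)`. -/
def diagR : Idx → ℂ := Sum.elim 0 ![Complex.I, Complex.I, -Complex.I, -Complex.I]

theorem diagonal_mem_psl (a b : ℂ) : Matrix.diagonal (a • diagL + b • diagR) ∈ psl := by
  constructor <;>
    simp [Matrix.trace, Matrix.toBlocks₁₁, Matrix.toBlocks₂₂, diagL, diagR, Fin.sum_univ_four]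

/-- The Cartan element with eigenvalues `a` times those of `diagL` plus `b` times those of
`diagR`. -/
def cartan (a b : ℂ) : psl := ⟨Matrix.diagonal (a • diagL + b • diagR), diagonal_mem_psl a b⟩

theorem coe_cartan (a b : ℂ) : (cartan a b).1 = Matrix.diagonal (a • diagL + b • diagR) := rfl

/-- The functional `X ↦ Str (diag(d) X)`. -/
def diagForm (d : Idx → ℂ) : psl →ₗ[ℂ] ℂ where
  toFun X := ∑ i, sgn i * d i * X.1 i i
  map_add' X Y := by simp [mul_add, Finset.sum_add_distrib]
  map_smul' c X := by
    rw [RingHom.id_apply, smul_eq_mul, Finset.mul_sum]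
    exact Finset.sum_congr rfl fun i _ => by
      rw [Submodule.coe_smul, Matrix.smul_apply, smul_eq_mul, mul_left_comm]

theorem diagForm_apply (d : Idx → ℂ) (X : psl) : diagForm d X = ∑ i, sgn i * d i * X.1 i i := rfl

/-- The operator `X ↦ h₁ Str (h₂ X) - h₂ Str (h₁ X)` for commuting `h₁ ∈ su(2,2)` and
`h₂ ∈ su(4)`. -/
def cartanOp : Module.End ℂ psl where
  toFun X := cartan (diagForm diagR X) (-diagForm diagL X)
  map_add' X Y := Subtype.ext (by
    simp only [cartan, map_add, Submodule.coe_add, Matrix.diagonal_add]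
    congr 1
    funext i
    simp only [Pi.add_apply, Pi.smul_apply, smul_eq_mul]
    ring)
  map_smul' c X := Subtype.ext (by
    simp only [cartan, map_smul, Submodule.coe_smul, RingHom.id_apply, ← Matrix.diagonal_smul]
    congr 1
    funext i
    simp only [Pi.add_apply, Pi.smul_apply, smul_eq_mul]
    ring)

theorem cartanOp_apply (X : psl) :
    cartanOp X = cartan (diagForm diagR X) (-diagForm diagL X) := rfl

theorem cartanOp_congr {X Y : psl} (h : ∀ i, X.1 i i = Y.1 i i) : cartanOp X = cartanOp Y := by
  simp only [cartanOp_apply, diagForm_apply, h]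

theorem cartanOp_eq_zero {X : psl} (h : ∀ i, X.1 i i = 0) : cartanOp X = 0 := by
  rw [← map_zero cartanOp]
  exact cartanOp_congr h

theorem str_diagonal_mul (d : Idx → ℂ) (X : SMat ℂ) :
    str (Matrix.diagonal d * X) = ∑ i, sgn i * d i * X i i := by
  simp [str_eq_sum, mul_assoc]

theorem str_mul_diagonal (d : Idx → ℂ) (X : SMat ℂ) :
    str (X * Matrix.diagonal d) = ∑ i, sgn i * d i * X i i := by
  simp [str_eq_sum, mul_assoc, mul_comm]

theorem oddPart_diagonal (d : Idx → ℂ) : oddPart (Matrix.diagonal d) = 0 := by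
  ext (i | i) (j | j) <;> simp [oddPart, Matrix.toBlocks₁₂, Matrix.toBlocks₂₁]

theorem diagonal_commutator_apply_self (d : Idx → ℂ) (X : SMat ℂ) (i : Idx) :
    (Matrix.diagonal d * X - X * Matrix.diagonal d) i i = 0 := by
  rw [Matrix.sub_apply, Matrix.diagonal_mul, Matrix.mul_diagonal, mul_comm, sub_self]

theorem toPsl_apply_self {X : SMat ℂ} (h : ∀ i, X i i = 0) (i : Idx) : (toPsl X).1 i i = 0 := by
  rw [show (toPsl X).1 = X from pr_eq_self_of_diag h, h]

theorem isYangBaxter_cartanOp : IsYangBaxter cartanOp where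
  even X Y h := by
    have h1 : cartanOp Y = cartanOp X := cartanOp_congr fun i => by
      rw [h, gam_mul_mul_gam_apply, sgn_mul_self, one_mul]
    rw [h1, cartanOp_apply, coe_cartan]
    ext i j
    rw [gam_mul_mul_gam_apply]
    by_cases hij : i = j
    · rw [hij, sgn_mul_self, one_mul]
    · rw [Matrix.diagonal_apply_ne _ hij, mul_zero]
  antisymm X Y := by
    have h : ∀ a b : ℂ, ∀ Z : psl, (∑ i, sgn i * (a • diagL + b • diagR) i * Z.1 i i) =
        a * diagForm diagL Z + b * diagForm diagR Z := fun a b Z => by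
      simp only [diagForm_apply, Finset.mul_sum, ← Finset.sum_add_distrib, Pi.add_apply,
        Pi.smul_apply, smul_eq_mul]
      exact Finset.sum_congr rfl fun i _ => by ring
    rw [cartanOp_apply, cartanOp_apply, cartan, cartan, str_diagonal_mul, str_mul_diagonal, h, h]
    ring
  cybe X Y := by
    have h1 : superBracket (cartanOp X) (cartanOp Y) = 0 := by
      rw [superBracket, cartanOp_apply, cartanOp_apply, cartan, cartan, oddPart_diagonal, zero_mul,
        Matrix.diagonal_mul_diagonal, Matrix.diagonal_mul_diagonal, smul_zero, add_zero]
      rw [show (fun i => (diagForm diagR X • diagL + -diagForm diagL X • diagR) i *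
        (diagForm diagR Y • diagL + -diagForm diagL Y • diagR) i) = fun i =>
        (diagForm diagR Y • diagL + -diagForm diagL Y • diagR) i *
        (diagForm diagR X • diagL + -diagForm diagL X • diagR) i from
          funext fun i => mul_comm _ _, sub_self, map_zero]
    rw [h1, eq_comm]
    refine cartanOp_eq_zero fun i => ?_
    rw [Submodule.coe_add, Matrix.add_apply, superBracket, superBracket, cartanOp_apply,
      cartanOp_apply, cartan, cartan, oddPart_diagonal, oddPart_diagonal, zero_mul, mul_zero,
      smul_zero, add_zero, add_zero, toPsl_apply_self (diagonal_commutator_apply_self _ _),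
      toPsl_apply_self (fun i => ?_), add_zero]
    rw [← neg_sub, Matrix.neg_apply, diagonal_commutator_apply_self, neg_zero]

/-- The diagonal of the Hermitian form. -/
def hermDiag : Idx → ℂ := Sum.elim ![1, 1, -1, -1] fun _ => Complex.I

theorem hermForm_eq_diagonal : hermForm = Matrix.diagonal hermDiag := by
  ext (i | i) (j | j) <;>
    simp [hermForm, hermDiag, Matrix.diagonal_apply, Matrix.one_apply]

theorem hermDiag_ne_zero (i : Idx) : hermDiag i ≠ 0 := by
  rcases i with i | i
  · fin_cases i <;> simp [hermDiag]
  · simp [hermDiag]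

theorem IsPsu.conj_apply_self {X : psl} (h : IsPsu X) (i : Idx) :
    (starRingEnd ℂ) (X.1 i i) = -X.1 i i := by
  have h1 := congrFun (congrFun h i) i
  rw [hermForm_eq_diagonal, Matrix.add_apply, Matrix.mul_diagonal, Matrix.diagonal_mul,
    Matrix.map_apply, superTranspose_apply, show tau i i = 1 by rcases i with i | i <;> rfl,
    one_smul, mul_comm, ← mul_add, Matrix.zero_apply] at h1
  exact eq_neg_of_add_eq_zero_left ((mul_eq_zero.1 h1).resolve_left (hermDiag_ne_zero i))

theorem superTranspose_diagonal {𝒪 : Type*} [Ring 𝒪] [Algebra ℂ 𝒪] (d : Idx → 𝒪) :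
    superTranspose (Matrix.diagonal d) = Matrix.diagonal d := by
  ext i j
  rw [superTranspose_apply]
  by_cases h : i = j
  · subst h
    rw [show tau i i = 1 by rcases i with i | i <;> rfl, one_smul]
  · rw [Matrix.diagonal_apply_ne _ h, Matrix.diagonal_apply_ne' _ h, smul_zero]

theorem conj_diagL (i : Idx) : (starRingEnd ℂ) (diagL i) = -diagL i := by
  rcases i with i | i
  · fin_cases i <;> simp [diagL]
  · simp [diagL]

theorem conj_diagR (i : Idx) : (starRingEnd ℂ) (diagR i) = -diagR i := by
  rcases i with i | i
  · simp [diagR]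
  · fin_cases i <;> simp [diagR]

theorem isRealOperator_cartanOp : IsRealOperator cartanOp := by
  intro X hX
  have h : ∀ d : Idx → ℂ, (∀ i, (starRingEnd ℂ) (d i) = -d i) →
      (starRingEnd ℂ) (diagForm d X) = diagForm d X := fun d hd => by
    have hs : ∀ i, (starRingEnd ℂ) (sgn i) = sgn i := fun i => by rcases i with i | i <;> simp
    simp only [diagForm_apply, map_sum, map_mul, hd, hX.conj_apply_self, hs, mul_neg, neg_mul,
      neg_neg]
  rw [IsPsu, cartanOp_apply, cartan, superTranspose_diagonal, Matrix.diagonal_map (map_zero _),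
    hermForm_eq_diagonal, Matrix.diagonal_mul_diagonal, Matrix.diagonal_mul_diagonal,
    Matrix.diagonal_add, ← Matrix.diagonal_zero]
  congr 1
  funext i
  simp only [Pi.add_apply, Pi.smul_apply, smul_eq_mul, map_add, map_mul, map_neg, conj_diagL,
    conj_diagR, h diagL conj_diagL, h diagR conj_diagR]
  ring

/-! ### A geodesic dressed by a fermionic direction -/

/-- The Cartan generator `h₁ + h₂` of the geodesic. -/
def geoH : SMat ℂ := (cartan 1 1).1

/-- The fermionic direction `E_{0,2} + i E_{2,0}` in `psu(2,2|4)`. -/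
def geoPsi : SMat ℂ := oddRoot Complex.I 0 2 0 2

/-- The commutator of the fermionic direction with the Cartan generator. -/
def geoComm : SMat ℂ := geoPsi * geoH - geoH * geoPsi

theorem geoH_eq : geoH = Matrix.diagonal (diagL + diagR) := by
  rw [geoH, coe_cartan, one_smul, one_smul]

theorem omega_geoH : omega geoH = -geoH := by
  ext i j
  rw [omega_apply, geoH_eq, Matrix.neg_apply]
  by_cases h : i = j
  · subst h
    rw [kap_mul_self, Matrix.diagonal_apply_eq, Matrix.diagonal_apply_eq]
    rcases i with i | i <;> fin_cases i <;> simp [tau, swp, diagL, diagR]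
  · rw [Matrix.diagonal_apply_ne _ h, Matrix.diagonal_apply_ne, smul_zero, neg_zero]
    intro h'
    apply h
    rw [← swp_swp i, ← h', swp_swp]

theorem weightOp_geoH {w : Fin 3 → ℂ} : weightOp w geoH = w 1 • geoH := by
  have hg : omega geoH = Complex.I ^ 2 • geoH := by
    rw [Complex.I_sq, neg_one_smul, omega_geoH]
  rw [weightOp_apply, proj_eq_self_iff.2 hg,
    proj_eq_zero hg (by norm_num [Complex.ext_iff]),
    proj_eq_zero hg (by norm_num [Complex.ext_iff, pow_succ]), smul_zero, smul_zero, zero_add,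
    add_zero]

theorem pr_geoH : pr geoH = geoH := (pr_eq_self_iff _).2 (cartan 1 1).2

theorem geoComm_apply (i j : Idx) : geoComm i j =
    geoPsi i j * (diagL + diagR) j - (diagL + diagR) i * geoPsi i j := by
  rw [geoComm, geoH_eq, Matrix.sub_apply, Matrix.mul_diagonal, Matrix.diagonal_mul]

theorem geoComm_eq_zero {i j : Idx} (h : sgn i = sgn j) : geoComm i j = 0 := by
  rw [geoComm_apply, geoPsi, oddRoot_apply_eq _ _ _ _ _ h, zero_mul, mul_zero, sub_zero]

theorem weightOp_apply_eq_zero (w : Fin 3 → ℂ) {X : SMat ℂ} (h : ∀ i, X i i = 0) (i : Idx) :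
    weightOp w X i i = 0 := by
  have ho : ∀ {Y : SMat ℂ}, (∀ i, Y i i = 0) → ∀ i, omega Y i i = 0 := fun {Y} hY i => by
    rw [omega_apply_self, hY, neg_zero]
  have hp : ∀ k, proj k X i i = 0 := fun k => by
    rw [proj_apply]
    simp only [Matrix.smul_apply, Matrix.add_apply, h, ho h, ho (ho h), ho (ho (ho h)), smul_zero,
      add_zero]
  rw [weightOp_apply]
  simp only [Matrix.add_apply, Matrix.smul_apply, hp, smul_zero, add_zero]

theorem cartanOp_geoH : cartanOp (cartan 1 1) = cartan 4 4 := by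
  have h1 : diagForm diagR (cartan 1 1) = 4 := by
    simp [diagForm_apply, cartan, diagL, diagR, Fin.sum_univ_four]
    norm_num
  have h2 : diagForm diagL (cartan 1 1) = -4 := by
    simp [diagForm_apply, cartan, diagL, diagR, Fin.sum_univ_four]
    norm_num
  rw [cartanOp_apply, h1, h2, neg_neg]

section Geodesic

open SuperRing

/-- The phases `e^{τ h}` along the geodesic, with `p` and `q` standing for `e^{±iτ}`. -/
def phase {𝒪 : Type*} [Zero 𝒪] (p q : 𝒪) : SMat 𝒪 :=
  Matrix.diagonal (Sum.elim ![p, p, q, q] ![p, p, q, q])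

theorem phase_mul_phase {𝒪 : Type*} [Ring 𝒪] {p q : 𝒪} (hpq : p * q = 1) (hqp : q * p = 1) :
    phase p q * phase q p = 1 := by
  rw [phase, phase, Matrix.diagonal_mul_diagonal, ← Matrix.diagonal_one]
  congr 1
  funext i
  rcases i with i | i <;> fin_cases i <;> simp [hpq, hqp]

variable {𝒪 : Type*} [Ring 𝒪] [Algebra ℂ 𝒪]

theorem extend_cartanOp_congr {X Y : SMat 𝒪} (h : ∀ i, X i i = Y i i) :
    extend cartanOp X = extend cartanOp Y := by
  ext k l
  rw [extend_apply, extend_apply]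
  refine Finset.sum_congr rfl fun i _ => Finset.sum_congr rfl fun j _ => ?_
  by_cases hij : i = j
  · rw [hij, h]
  · have : cartanOp (toPsl (Matrix.single i j 1)) = 0 := cartanOp_eq_zero <|
      toPsl_apply_self fun k => Matrix.single_apply_of_ne _ _ _ _ _ (fun h => hij (h.1.trans h.2.symm))
    rw [this]
    simp

theorem pr_apply_self_congr {X Y : SMat 𝒪} (h : ∀ i, X i i = Y i i) (i : Idx) :
    pr X i i = pr Y i i := by
  rw [pr_apply, pr_apply]
  simp only [h]

theorem smul_ofComplex_mul_ofComplex (x : 𝒪) (Z W : SMat ℂ) :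
    (x • ofComplex 𝒪 Z) * ofComplex 𝒪 W = x • ofComplex 𝒪 (Z * W) := by
  have := smul_ofComplex_mul x 1 Z W
  rwa [one_smul, mul_one] at this

theorem ofComplex_mul_smul_ofComplex (x : 𝒪) (Z W : SMat ℂ) :
    ofComplex 𝒪 Z * (x • ofComplex 𝒪 W) = x • ofComplex 𝒪 (Z * W) := by
  have := smul_ofComplex_mul 1 x Z W
  rwa [one_smul, one_mul] at this

theorem pr_ofComplex (Z : SMat ℂ) : pr (ofComplex 𝒪 Z) = ofComplex 𝒪 (pr Z) := by
  have := pr_smul_ofComplex (1 : 𝒪) Z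
  rwa [one_smul, one_smul] at this

theorem ofComplex_geoH_mul_phase (p q : 𝒪) :
    ofComplex 𝒪 geoH * phase p q = phase p q * ofComplex 𝒪 geoH := by
  ext i j
  rw [phase, Matrix.mul_diagonal, Matrix.diagonal_mul, ofComplex_apply, geoH_eq]
  by_cases h : i = j
  · rw [h, Algebra.commutes]
  · rw [Matrix.diagonal_apply_ne _ h, map_zero, zero_mul, mul_zero]

/-- The fermionic dressing of the geodesic. -/
def geoLam (θ : 𝒪) : SMat 𝒪 := θ • ofComplex 𝒪 geoPsi

theorem geoLam_mem (θ : 𝒪) : geoLam θ ∈ entriesIn (oddIdeal 𝒪 θ) := smul_mem_oddIdeal _ _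

/-- The group element `(1 + θ ψ) e^{τ h}`. -/
def geoG (p q θ : 𝒪) : SMat 𝒪 := (1 + geoLam θ) * phase p q

/-- The current of the geodesic, `h + θ [ψ, h]`. -/
def geoK (θ : 𝒪) : SMat 𝒪 := ofComplex 𝒪 geoH + θ • ofComplex 𝒪 geoComm

theorem pr_geoK (θ : 𝒪) : pr (geoK θ) = geoK θ := by
  rw [geoK, map_add, pr_smul_ofComplex, pr_ofComplex, pr_geoH]
  congr 2
  exact congrArg _ (pr_eq_self_of_diag fun _ => geoComm_eq_zero rfl)

theorem phase_map {p q : 𝒪} {D : 𝒪 →ₗ[ℂ] 𝒪} (hp : D p = Complex.I • p)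
    (hq : D q = -Complex.I • q) : (phase p q).map D = ofComplex 𝒪 geoH * phase p q := by
  rw [ofComplex, geoH_eq, Matrix.diagonal_map (map_zero _), phase, Matrix.diagonal_map (map_zero _),
    Matrix.diagonal_mul_diagonal]
  congr 1
  funext i
  rw [Algebra.linearMap_apply, ← Algebra.smul_def]
  rcases i with i | i <;> fin_cases i <;> simp [diagL, diagR, hp, hq]

variable [SuperRing 𝒪] {p q θ : 𝒪} (hθ : par θ = -θ)

include hθ

theorem conj_geoH : (1 + geoLam θ) * ofComplex 𝒪 geoH * (1 - geoLam θ) = geoK θ := by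
  have h0 := (isNilIdeal_oddIdeal hθ).mul_mul_eq_zero (geoLam_mem θ) (geoLam_mem θ)
    (ofComplex 𝒪 geoH)
  have h1 : geoLam θ * ofComplex 𝒪 geoH = θ • ofComplex 𝒪 (geoPsi * geoH) :=
    smul_ofComplex_mul_ofComplex _ _ _
  have h2 : ofComplex 𝒪 geoH * geoLam θ = θ • ofComplex 𝒪 (geoH * geoPsi) :=
    ofComplex_mul_smul_ofComplex _ _ _
  have h3 : ofComplex 𝒪 geoComm = ofComplex 𝒪 (geoPsi * geoH) - ofComplex 𝒪 (geoH * geoPsi) := by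
    ext i j
    simp only [geoComm, ofComplex_apply, Matrix.sub_apply, map_sub]
  rw [add_mul, one_mul, mul_sub, mul_one, add_mul, h0, h1, h2, geoK, h3, smul_sub]
  abel

section Inverse

variable (hpq : p * q = 1) (hqp : q * p = 1)

include hpq hqp

theorem inverse_geoG_aux : geoG p q θ * (phase q p * (1 - geoLam θ)) = 1 ∧
    phase q p * (1 - geoLam θ) * geoG p q θ = 1 := by
  have hF := isNilIdeal_oddIdeal hθ
  constructor
  · rw [geoG, mul_assoc, ← mul_assoc (phase p q), phase_mul_phase hpq hqp, one_mul,
      hF.one_add_mul_one_sub (geoLam_mem θ)]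
  · rw [geoG, mul_assoc, ← mul_assoc (1 - geoLam θ), hF.one_sub_mul_one_add (geoLam_mem θ),
      one_mul, phase_mul_phase hqp hpq]

theorem isUnit_geoG : IsUnit (geoG p q θ) :=
  ⟨⟨_, _, (inverse_geoG_aux hθ hpq hqp).1, (inverse_geoG_aux hθ hpq hqp).2⟩, rfl⟩

theorem inverse_geoG : Ring.inverse (geoG p q θ) = phase q p * (1 - geoLam θ) :=
  Ring.inverse_unit ⟨_, _, (inverse_geoG_aux hθ hpq hqp).1, (inverse_geoG_aux hθ hpq hqp).2⟩

theorem conj_geoG : geoG p q θ * ofComplex 𝒪 geoH * Ring.inverse (geoG p q θ) = geoK θ := by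
  rw [inverse_geoG hθ hpq hqp, ← conj_geoH hθ, geoG, mul_assoc (1 + geoLam θ),
    ← ofComplex_geoH_mul_phase, mul_assoc, mul_assoc, mul_assoc, ← mul_assoc (phase p q),
    phase_mul_phase hpq hqp, one_mul]

theorem map_geoG_mul_inverse {D : 𝒪 →ₗ[ℂ] 𝒪} (hD : IsEvenDerivation D)
    (hp : D p = Complex.I • p) (hq : D q = -Complex.I • q) (hDθ : D θ = 0) :
    (geoG p q θ).map D * Ring.inverse (geoG p q θ) = geoK θ := by
  have h1 : (1 + geoLam θ).map D = 0 := by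
    rw [Matrix.map_add _ (map_add D), hD.map_one_matrix, geoLam, map_smul_ofComplex, hDθ, zero_smul,
      add_zero]
  rw [← conj_geoG hθ hpq hqp]
  congr 1
  rw [geoG, hD.map_mul, h1, zero_mul, zero_add, phase_map hp hq, mul_assoc,
    ofComplex_geoH_mul_phase]

/-- The operator `cartanOp` depends on the diagonal only, and the terms with `θ` do not contribute
to the diagonal. -/
theorem adjInv_geoG_apply_self (W : SMat ℂ) (hW : ∀ i, W i i = 0) (i : Idx) :
    (Ring.inverse (geoG p q θ) * (ofComplex 𝒪 geoH + θ • ofComplex 𝒪 W) * geoG p q θ) i i =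
      ofComplex 𝒪 geoH i i := by
  have hF := isNilIdeal_oddIdeal hθ
  have hL := geoLam_mem θ
  have h1 : geoLam θ * ofComplex 𝒪 geoH = θ • ofComplex 𝒪 (geoPsi * geoH) :=
    smul_ofComplex_mul_ofComplex _ _ _
  have h2 : ofComplex 𝒪 geoH * geoLam θ = θ • ofComplex 𝒪 (geoH * geoPsi) :=
    ofComplex_mul_smul_ofComplex _ _ _
  have hmid : (1 - geoLam θ) * (ofComplex 𝒪 geoH + θ • ofComplex 𝒪 W) * (1 + geoLam θ) =
      ofComplex 𝒪 geoH + θ • ofComplex 𝒪 W - θ • ofComplex 𝒪 (geoPsi * geoH)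
        + θ • ofComplex 𝒪 (geoH * geoPsi) := by
    -- `θ² = 0`
    have e1 : geoLam θ * (θ • ofComplex 𝒪 W) = 0 := hF.mul_eq_zero_of_mem hL (smul_mem_oddIdeal _ _)
    have e2 : (θ • ofComplex 𝒪 W) * geoLam θ = 0 := hF.mul_eq_zero_of_mem (smul_mem_oddIdeal _ _) hL
    have e3 := hF.mul_mul_eq_zero hL hL (ofComplex 𝒪 geoH)
    rw [sub_mul, one_mul, mul_add (geoLam θ), e1, add_zero, mul_add, mul_one, sub_mul, e3, sub_zero,
      add_mul, e2, add_zero, h1, h2]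
  rw [inverse_geoG hθ hpq hqp, geoG, mul_assoc (phase q p), mul_assoc (phase q p),
    ← mul_assoc (_ * _) _ (phase p q), hmid, phase, phase, Matrix.diagonal_mul,
    Matrix.mul_diagonal]
  simp only [Matrix.add_apply, Matrix.sub_apply, smul_ofComplex_apply, hW]
  have hz : ∀ i, geoPsi i i = 0 := fun i => oddRoot_apply_eq _ _ _ _ _ rfl
  rw [geoH_eq, Matrix.mul_diagonal, Matrix.diagonal_mul, hz, zero_mul, mul_zero, zero_smul,
    add_zero, sub_zero, add_zero, ofComplex_apply, Algebra.commutes, ← mul_assoc]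
  rcases i with i | i <;> fin_cases i <;> simp [hpq, hqp]

/-- The current is an eigenvector of `R_g d`: `d` doubles the even part `h`, and the `R`-matrix maps
`h` to `4 h`.  The same holds for `d̂`, as only the coefficient of grade two matters. -/
theorem Rg_weightOp_geoK {w : Fin 3 → ℂ} (hw : w 1 = 2) :
    Rg cartanOp (geoG p q θ) (weightOp w (geoK θ)) = (8 : ℂ) • geoK θ := by
  have h1 : weightOp w (geoK θ) = (2 : ℂ) • (ofComplex 𝒪 geoH
      + θ • ofComplex 𝒪 ((1 / 2 : ℂ) • weightOp w geoComm)) := by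
    have := weightOp_smul_ofComplex w (1 : 𝒪) geoH
    rw [one_smul, one_smul] at this
    rw [geoK, map_add, weightOp_smul_ofComplex, this, weightOp_geoH, hw]
    ext i j
    simp only [Matrix.add_apply, Matrix.smul_apply (2 : ℂ), smul_ofComplex_apply,
      Matrix.smul_apply (1 / 2 : ℂ), ofComplex_apply, smul_eq_mul, map_mul, smul_add, smul_smul]
    rw [← Algebra.smul_def]
    congr 2
    ring
  have h2 : extend cartanOp (ofComplex 𝒪 geoH) = (4 : ℂ) • ofComplex 𝒪 geoH := by
    rw [extend_ofComplex, geoH, toPsl_coe, cartanOp_geoH]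
    ext i j
    have : (cartan 4 4).1 i j = 4 * (cartan 1 1).1 i j := by
      rw [coe_cartan, coe_cartan]
      by_cases h : i = j
      · subst h
        simp
        ring
      · rw [Matrix.diagonal_apply_ne _ h, Matrix.diagonal_apply_ne _ h, mul_zero]
    rw [ofComplex_apply, this, Matrix.smul_apply, ofComplex_apply, map_mul, Algebra.smul_def]
  have h3 := adjInv_geoG_apply_self hθ hpq hqp ((1 / 2 : ℂ) • weightOp w geoComm)
    (fun i => by
      rw [Matrix.smul_apply, weightOp_apply_eq_zero w (fun _ => geoComm_eq_zero rfl), smul_zero])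
  rw [h1, map_smul, Rg_apply, adjInv_apply, extend_cartanOp_congr (pr_apply_self_congr h3),
    pr_ofComplex, pr_geoH, h2, map_smul, adj_apply, conj_geoG hθ hpq hqp, pr_geoK, smul_smul]
  norm_num

end Inverse

end Geodesic

theorem proj_geoK {𝒪 : Type*} [Ring 𝒪] [Algebra ℂ 𝒪] (θ : 𝒪) {k : ℕ} (hk : Odd k) :
    proj k (geoK θ) = θ • ofComplex 𝒪 (proj k geoComm) := by
  have hg : omega geoH = Complex.I ^ 2 • geoH := by
    rw [Complex.I_sq, neg_one_smul, omega_geoH]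
  have hne : Complex.I ^ k ≠ Complex.I ^ 2 := by
    intro h
    have h2 := congrArg (· ^ 2) h
    simp only [← pow_mul, mul_comm k 2, pow_mul Complex.I 2 k, Complex.I_sq, hk.neg_one_pow] at h2
    norm_num at h2
  have h0 := proj_smul_ofComplex k (1 : 𝒪) geoH
  rw [one_smul, one_smul, proj_eq_zero hg hne] at h0
  rw [geoK, map_add, proj_smul_ofComplex, h0]
  ext i j
  simp [ofComplex_apply]

theorem proj_three_geoComm : proj 3 geoComm (Sum.inl 0) (Sum.inr 2) = -Complex.I := by
  simp [proj_apply, omega_apply, geoComm_apply, geoPsi, oddRoot, kap, tau, swp, diagL, diagR]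
  ring

theorem proj_one_geoComm : proj 1 geoComm (Sum.inl 0) (Sum.inr 2) = -Complex.I := by
  simp [proj_apply, omega_apply, geoComm_apply, geoPsi, oddRoot, kap, tau, swp, diagL, diagR]
  ring

theorem geoPsi_psu :
    (superTranspose geoPsi).map (starRingEnd ℂ) * hermForm + hermForm * geoPsi = 0 := by
  ext i j
  rw [hermForm_eq_diagonal, Matrix.add_apply, Matrix.mul_diagonal, Matrix.diagonal_mul,
    Matrix.map_apply, superTranspose_apply, Matrix.zero_apply]
  rcases i with i | i <;> rcases j with j | j
  · simp [geoPsi, oddRoot]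
  · fin_cases i <;> fin_cases j <;> simp [geoPsi, oddRoot, tau, hermDiag]
  · fin_cases i <;> fin_cases j <;> simp [geoPsi, oddRoot, tau, hermDiag]
  · simp [geoPsi, oddRoot]

/-! ### The geodesic as a field of the model -/

/-- The plane wave `e^{c (σ⁺ + σ⁻)}`. -/
def wave (c : ℂ) : SmoothFn :=
  ⟨fun x => Complex.exp (c * ((x.1 + x.2 : ℝ) : ℂ)), mem_smoothFn (Complex.contDiff_exp.comp
    (contDiff_const.mul (Complex.ofRealCLM.contDiff.comp (contDiff_fst.add contDiff_snd))))⟩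

theorem wave_mul_wave_neg (c : ℂ) : wave c * wave (-c) = 1 := by
  ext x
  change Complex.exp _ * Complex.exp _ = 1
  rw [← Complex.exp_add, neg_mul, add_neg_cancel, Complex.exp_zero]

theorem smoothDeriv_wave (v : ℝ × ℝ) (c : ℂ) :
    smoothDeriv v (wave c) = (c * ((v.1 + v.2 : ℝ) : ℂ)) • wave c := by
  ext x
  change fderiv ℝ (fun x : ℝ × ℝ => Complex.exp (c * ((x.1 + x.2 : ℝ) : ℂ))) x v =
    (c * ((v.1 + v.2 : ℝ) : ℂ)) * Complex.exp (c * ((x.1 + x.2 : ℝ) : ℂ))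
  have h : HasFDerivAt (fun x : ℝ × ℝ => c * ((x.1 + x.2 : ℝ) : ℂ)) (c • Complex.ofRealCLM.comp
      (ContinuousLinearMap.fst ℝ ℝ ℝ + ContinuousLinearMap.snd ℝ ℝ ℝ)) x :=
    (Complex.ofRealCLM.comp (ContinuousLinearMap.fst ℝ ℝ ℝ
      + ContinuousLinearMap.snd ℝ ℝ ℝ)).hasFDerivAt.const_mul c
  rw [h.cexp.fderiv]
  simp
  ring

theorem smoothConj_wave (c : ℂ) : smoothConj (wave c) = wave ((starRingEnd ℂ) c) := by
  ext x
  change (starRingEnd ℂ) (Complex.exp _) = Complex.exp _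
  rw [← Complex.exp_conj, map_mul, Complex.conj_ofReal]

section Fields

variable {N : ℕ}

/-- A plane wave as a Grassmann-valued function. -/
def waveSF (N : ℕ) (c : ℂ) : SF N := wave c ⊗ₜ 1

theorem waveSF_mul_neg (c : ℂ) : waveSF N c * waveSF N (-c) = 1 := by
  rw [waveSF, waveSF, Algebra.TensorProduct.tmul_mul_tmul, wave_mul_wave_neg, one_mul]
  rfl

theorem waveSF_neg_mul (c : ℂ) : waveSF N (-c) * waveSF N c = 1 := by
  have := waveSF_mul_neg (N := N) (-c)
  rwa [neg_neg] at this

theorem par_waveSF (c : ℂ) : superRingSF.par (waveSF N c) = waveSF N c := by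
  change wave c ⊗ₜ inv (1 : Grassmann N) = _
  rw [map_one]
  rfl

theorem dir_waveSF {v : ℝ × ℝ} (hv : v.1 + v.2 = 1) (c : ℂ) :
    dir N v (waveSF N c) = c • waveSF N c := by
  rw [waveSF, dir_tmul, smoothDeriv_wave, hv, Complex.ofReal_one, mul_one]
  rfl

theorem conj_wave_mul (c z : ℂ) (e : Grassmann N) : conj (z • (waveSF N c * const e)) =
    (starRingEnd ℂ) z • (waveSF N ((starRingEnd ℂ) c) * const e) := by
  rw [waveSF, waveSF, const, Algebra.TensorProduct.tmul_mul_tmul,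
    Algebra.TensorProduct.tmul_mul_tmul, mul_one, mul_one, one_mul, TensorProduct.smul_tmul',
    TensorProduct.smul_tmul']
  change smoothConj (z • wave c) ⊗ₜ e = _
  rw [← smoothConj_wave]
  congr 1
  ext x
  exact map_mul (starRingEnd ℂ) _ _

end Fields

/-! ### Non-terminating series of BRST transformations -/

/-- The phase `e^{iτ}` along the geodesic. -/
def geoP : SF 1 := waveSF 1 Complex.I

/-- The phase `e^{-iτ}` along the geodesic. -/
def geoQ : SF 1 := waveSF 1 (-Complex.I)

/-- The generator of the Grassmann algebra. -/
def geoTheta : SF 1 := const (ExteriorAlgebra.ι ℝ (Pi.single 0 1))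

theorem geoTheta_odd : superRingSF.par geoTheta = -geoTheta := par_const (isOddConst_ι _)

theorem geoTheta_ne_zero : geoTheta ≠ 0 := const_ne_zero fun h => by
  have := congrFun ((ExteriorAlgebra.ι_eq_zero_iff (R := ℝ) _).1 h) 0
  simp at this

theorem geoP_mul : geoP * geoQ = 1 := waveSF_mul_neg _

theorem geoQ_mul : geoQ * geoP = 1 := waveSF_neg_mul _

theorem phase_entry (i : Idx) : ∃ c : ℂ,
    Sum.elim ![geoP, geoP, geoQ, geoQ] ![geoP, geoP, geoQ, geoQ] i = waveSF 1 c ∧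
      Sum.elim ![geoQ, geoQ, geoP, geoP] ![geoQ, geoQ, geoP, geoP] i =
        waveSF 1 ((starRingEnd ℂ) c) := by
  have h1 : geoP = waveSF 1 Complex.I ∧ geoQ = waveSF 1 ((starRingEnd ℂ) Complex.I) :=
    ⟨rfl, by rw [Complex.conj_I]; rfl⟩
  have h2 : geoQ = waveSF 1 (-Complex.I) ∧ geoP = waveSF 1 ((starRingEnd ℂ) (-Complex.I)) :=
    ⟨rfl, by rw [map_neg, Complex.conj_I, neg_neg]; rfl⟩
  rcases i with i | i <;> fin_cases i
  exacts [⟨_, h1⟩, ⟨_, h1⟩, ⟨_, h2⟩, ⟨_, h2⟩, ⟨_, h1⟩, ⟨_, h1⟩, ⟨_, h2⟩, ⟨_, h2⟩]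

/-- The hermitian conjugate of the group element. -/
theorem superTranspose_geoG_map_conj : (superTranspose (geoG geoP geoQ geoTheta)).map conj =
    phase geoQ geoP *
      (1 + geoTheta • ofComplex (SF 1) ((superTranspose geoPsi).map (starRingEnd ℂ))) := by
  ext i j
  obtain ⟨c, hc, hc'⟩ := phase_entry i
  rw [Matrix.map_apply, superTranspose_apply, geoG, phase, phase, Matrix.mul_diagonal,
    Matrix.diagonal_mul, hc, hc', Matrix.add_apply, Matrix.add_apply, geoLam, smul_ofComplex_apply,
    smul_ofComplex_apply, Matrix.map_apply, superTranspose_apply]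
  by_cases h : i = j
  · subst h
    have h0 : geoPsi i i = 0 := oddRoot_apply_eq _ _ _ _ _ rfl
    have h1 := conj_wave_mul c 1 (1 : Grassmann 1)
    rw [show const (1 : Grassmann 1) = 1 from rfl, mul_one, mul_one, map_one, one_smul,
      one_smul] at h1
    rw [h0, smul_zero, map_zero, zero_smul, add_zero, Matrix.one_apply_eq, one_mul, mul_one,
      show tau i i = 1 by rcases i with i | i <;> rfl, one_smul, h1]
  · rw [Matrix.one_apply_ne h, Matrix.one_apply_ne' h, zero_add, zero_add, smul_mul_assoc,
      superRingSF.mul_comm_of_even _ (par_waveSF _) |> fun h' => (h' geoTheta).symm, smul_smul,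
      geoTheta, conj_wave_mul, mul_smul_comm, smul_eq_mul]

theorem isEvenSMat_geoG : IsEvenSMat (geoG geoP geoQ geoTheta) := by
  refine isEvenSMat_iff.2 ?_
  have h1 : sPar (geoLam geoTheta) = geoLam geoTheta := by
    have hg : IsGhost (ofComplex (SF 1) geoPsi) :=
      ⟨fun i j => AlgHom.commutes _ _, fun i j h => by
        rw [ofComplex_apply, geoPsi, oddRoot_apply_eq _ _ _ _ _ h, map_zero]⟩
    exact (ghostEnv geoTheta_odd hg).even
  have h2 : sPar (phase geoP geoQ) = phase geoP geoQ := by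
    refine sPar_eq_self_iff.2 fun i j => ?_
    rw [phase]
    by_cases h : i = j
    · subst h
      obtain ⟨c, hc, -⟩ := phase_entry i
      rw [Matrix.diagonal_apply_eq, hc, par_waveSF, sgn_mul_self, one_smul]
    · rw [Matrix.diagonal_apply_ne _ h, map_zero, smul_zero]
  rw [geoG, map_mul, map_add, map_one, h1, h2]

theorem hermForm_map : hermForm.map (algebraMap ℂ (SF 1)) = ofComplex (SF 1) hermForm := rfl

theorem geoG_unitary : (superTranspose (geoG geoP geoQ geoTheta)).map conj *
    hermForm.map (algebraMap ℂ (SF 1)) * geoG geoP geoQ geoTheta =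
      hermForm.map (algebraMap ℂ (SF 1)) := by
  set ψ' := (superTranspose geoPsi).map (starRingEnd ℂ) with hψ'
  have hF := isNilIdeal_oddIdeal (𝒪 := SF 1) geoTheta_odd
  have h1 : (1 + geoTheta • ofComplex (SF 1) ψ') * ofComplex (SF 1) hermForm *
      (1 + geoLam geoTheta) = ofComplex (SF 1) hermForm := by
    have e0 := hF.mul_mul_eq_zero (smul_mem_oddIdeal geoTheta (ofComplex (SF 1) ψ'))
      (geoLam_mem geoTheta) (ofComplex (SF 1) hermForm)
    have e1 : (geoTheta • ofComplex (SF 1) ψ') * ofComplex (SF 1) hermForm =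
      geoTheta • ofComplex (SF 1) (ψ' * hermForm) := smul_ofComplex_mul_ofComplex _ _ _
    have e2 : ofComplex (SF 1) hermForm * geoLam geoTheta =
      geoTheta • ofComplex (SF 1) (hermForm * geoPsi) := ofComplex_mul_smul_ofComplex _ _ _
    have e3 : geoTheta • ofComplex (SF 1) (ψ' * hermForm)
        + geoTheta • ofComplex (SF 1) (hermForm * geoPsi) = 0 := by
      have h := congrArg (fun Z => geoTheta • ofComplex (SF 1) Z) geoPsi_psu
      ext i j
      have hij := congrFun (congrFun h i) j
      simp only [smul_ofComplex_apply, Matrix.add_apply, Matrix.zero_apply, zero_smul,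
        add_smul] at hij ⊢
      exact hij
    rw [add_mul, one_mul, mul_add, mul_one, add_mul, e0, e1, e2, add_zero, add_assoc, e3, add_zero]
  have h2 : phase geoQ geoP * ofComplex (SF 1) hermForm = ofComplex (SF 1) hermForm *
      phase geoQ geoP := by
    ext i j
    rw [phase, Matrix.mul_diagonal, Matrix.diagonal_mul, ofComplex_apply, hermForm_eq_diagonal]
    by_cases h : i = j
    · rw [h, Algebra.commutes]
    · rw [Matrix.diagonal_apply_ne _ h, map_zero, zero_mul, mul_zero]
  have h3 : phase geoQ geoP * (1 + geoTheta • ofComplex (SF 1) ψ') * ofComplex (SF 1) hermForm *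
      ((1 + geoLam geoTheta) * phase geoP geoQ) = phase geoQ geoP *
        ((1 + geoTheta • ofComplex (SF 1) ψ') * ofComplex (SF 1) hermForm * (1 + geoLam geoTheta)) *
          phase geoP geoQ := by
    simp only [mul_assoc]
  rw [superTranspose_geoG_map_conj, hermForm_map, geoG, h3, h1, h2, mul_assoc,
    phase_mul_phase geoQ_mul geoP_mul, mul_one]

theorem isPSU_geoG : IsPSU (geoG geoP geoQ geoTheta) := by
  have hF := isNilIdeal_oddIdeal (𝒪 := SF 1) geoTheta_odd
  have hent : ∀ i j, geoG geoP geoQ geoTheta i j = (1 + geoLam geoTheta) i j *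
      Sum.elim ![geoP, geoP, geoQ, geoQ] ![geoP, geoP, geoQ, geoQ] j := fun i j => by
    rw [geoG, phase, Matrix.mul_diagonal]
  have hdiag : ∀ i j : Idx, sgn i = sgn j → (1 + geoLam geoTheta) i j =
      (1 : SMat (SF 1)) i j := fun i j h => by
    rw [Matrix.add_apply, geoLam, smul_ofComplex_apply, geoPsi, oddRoot_apply_eq _ _ _ _ _ h,
      zero_smul, add_zero]
  have hL : (geoG geoP geoQ geoTheta).toBlocks₁₁ = Matrix.diagonal ![geoP, geoP, geoQ, geoQ] := by
    ext i j
    change geoG geoP geoQ geoTheta (Sum.inl i) (Sum.inl j) = _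
    rw [hent, hdiag (Sum.inl i) (Sum.inl j) rfl, ← Matrix.mul_diagonal, one_mul, Matrix.diagonal_apply,
      Matrix.diagonal_apply]
    simp only [Sum.inl.injEq, Sum.elim_inl]
  have hR : (geoG geoP geoQ geoTheta).toBlocks₂₂ = Matrix.diagonal ![geoP, geoP, geoQ, geoQ] := by
    ext i j
    change geoG geoP geoQ geoTheta (Sum.inr i) (Sum.inr j) = _
    rw [hent, hdiag (Sum.inr i) (Sum.inr j) rfl, ← Matrix.mul_diagonal, one_mul, Matrix.diagonal_apply,
      Matrix.diagonal_apply]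
    simp only [Sum.inr.injEq, Sum.elim_inr]
  have hoff : ∀ i j : Idx, sgn i ≠ sgn j → geoG geoP geoQ geoTheta i j ∈ oddIdeal (SF 1) geoTheta :=
    fun i j h => by
      rw [hent, Matrix.add_apply, Matrix.one_apply_ne (fun hij => h (by rw [hij])), zero_add]
      exact hF.mul_right _ (geoLam_mem geoTheta i j) _
  have hBC : ∀ M : Matrix (Fin 4) (Fin 4) (SF 1), (geoG geoP geoQ geoTheta).toBlocks₁₂ * M *
      (geoG geoP geoQ geoTheta).toBlocks₂₁ = 0 := fun M => by
    ext i j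
    rw [Matrix.mul_apply, Matrix.zero_apply]
    refine Finset.sum_eq_zero fun k _ => hF.mul_eq_zero _ ?_ _ (hoff _ _ (by norm_num))
    rw [Matrix.mul_apply]
    exact Submodule.sum_mem _ fun l _ => hF.mul_right _ (hoff _ _ (by norm_num)) _
  refine ⟨isEvenSMat_geoG, geoG_unitary, ?_, ?_⟩
  · rw [hR]
    have key : ∀ a b : SF 1, a * b = 1 → b * a = 1 → Matrix.diagonal ![a, a, b, b] *
        Matrix.diagonal ![b, b, a, a] = 1 := fun a b h h' => by
      rw [Matrix.diagonal_mul_diagonal, ← Matrix.diagonal_one]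
      congr 1
      funext i
      fin_cases i <;> simp [h, h']
    exact ⟨⟨_, _, key _ _ geoP_mul geoQ_mul, key _ _ geoQ_mul geoP_mul⟩, rfl⟩
  · rw [hBC, sub_zero, hL, hR]

/-- The geodesic with constant ghosts and vanishing antighosts. -/
def geoFields : Fields (SF 1) := ⟨geoG geoP geoQ geoTheta, 0, 0,
  ofComplex (SF 1) (oddRoot Complex.I 2 0 3 1), ofComplex (SF 1) (oddRoot (-Complex.I) 2 0 3 1)⟩

theorem geo_map_mul_inverse {v : ℝ × ℝ} (hv : v.1 + v.2 = 1) :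
    (geoG geoP geoQ geoTheta).map (dir 1 v) * Ring.inverse (geoG geoP geoQ geoTheta) =
      geoK geoTheta :=
  map_geoG_mul_inverse (𝒪 := SF 1) geoTheta_odd geoP_mul geoQ_mul (isEvenDerivation_dir v)
    (dir_waveSF hv _) (dir_waveSF hv _) (dir_const v _)

theorem mcForm_geoG {v : ℝ × ℝ} (hv : v.1 + v.2 = 1) :
    mcForm (dir 1 v) (geoG geoP geoQ geoTheta) = -geoK geoTheta := by
  rw [mcForm, geo_map_mul_inverse hv, pr_geoK]

theorem str_geoK : str (geoK geoTheta) = 0 := by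
  have h1 : str geoH = 0 := by
    simp [geoH_eq, str_eq_sum, diagL, diagR, Fin.sum_univ_four]
  have h2 : str (ofComplex (SF 1) geoH) = 0 := by
    rw [ofComplex, str_map, h1, map_zero]
  rw [geoK, str_add, h2, zero_add, str_eq_sum]
  refine Finset.sum_eq_zero fun i _ => ?_
  rw [smul_ofComplex_apply, geoComm_eq_zero rfl, zero_smul, smul_zero]

theorem isConfig_geoFields : IsConfig geoFields := by
  have hk : kap (Sum.inl 2) * kap (Sum.inr 0) = 1 := by simp [kap]
  have hI : Complex.I * Complex.I = -1 := Complex.I_mul_I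
  have hl1 : IsBoson 1 (ofComplex (SF 1) (oddRoot Complex.I 2 0 3 1)) := by
    rw [← one_smul (SF 1) (ofComplex (SF 1) _)]
    exact isBoson_smul_oddRoot (map_one _) (pow_one _).symm hI rfl rfl hk
  have hl3 : IsBoson 3 (ofComplex (SF 1) (oddRoot (-Complex.I) 2 0 3 1)) := by
    rw [← one_smul (SF 1) (ofComplex (SF 1) _)]
    exact isBoson_smul_oddRoot (map_one _) Complex.I_pow_three.symm
      (by rw [neg_mul_neg, hI]) rfl rfl hk
  have h0 : ∀ k, IsBosonicOfGrade k (0 : SMat (SF 1)) := fun k => isBosonicOfGrade_iff.2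
    ⟨by rw [map_zero, smul_zero], map_zero _, fun i j => map_zero _⟩
  have hpure : ∀ z : ℂ, pr (ofComplex (SF 1) (oddRoot z 2 0 3 1) *
      ofComplex (SF 1) (oddRoot z 2 0 3 1)) = 0 := fun z => by
    have := smul_ofComplex_mul (1 : SF 1) 1 (oddRoot z 2 0 3 1) (oddRoot z 2 0 3 1)
    rw [one_smul, oddRoot_mul_self _ (by decide) (by decide)] at this
    rw [this]
    ext i j
    simp [pr_apply, ofComplex_apply]
  exact
    { g_even := isEvenSMat_geoG
      g_unit := isUnit_geoG (𝒪 := SF 1) geoTheta_odd geoP_mul geoQ_mul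
      g_plus := (congrArg str (geo_map_mul_inverse (v := (1, 0)) (by norm_num))).trans str_geoK
      g_minus := (congrArg str (geo_map_mul_inverse (v := (0, 1)) (by norm_num))).trans str_geoK
      w3_mem := h0 3
      w1_mem := h0 1
      l1_mem := isBosonicOfGrade_iff.2 hl1
      l3_mem := isBosonicOfGrade_iff.2 hl3
      l1_pure := hpure _
      l3_pure := hpure _ }

theorem pow_apply_eigen {V : Type*} [AddCommGroup V] [Module ℂ V] {T : Module.End ℂ V} {c : ℂ}
    {v : V} (h : T v = c • v) (n : ℕ) : (T ^ n) v = c ^ n • v := by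
  induction n with
  | zero => rw [pow_zero, pow_zero, one_smul, Module.End.one_apply]
  | succ n ih => rw [pow_succ', Module.End.mul_apply, ih, map_smul, h, smul_smul, pow_succ]

theorem brstW3Coeff_geoFields (n : ℕ) : brstW3Coeff dMinus cartanOp geoFields n =
    (8 : ℂ) ^ n • proj 3 (geoK geoTheta) := by
  have hA : mcForm dMinus geoFields.g = -geoK geoTheta := mcForm_geoG (v := (0, 1)) (by norm_num)
  have hN : nMinus geoFields = 0 := by simp [nMinus, geoFields]
  cases n with
  | zero => rw [brstW3Coeff, hA, map_neg, neg_neg, pow_zero, one_smul]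
  | succ n =>
    rw [brstW3Coeff, hA, hN, map_zero, map_zero, smul_zero, add_zero, map_neg,
      pow_apply_eigen (c := 8) (by
        rw [Module.End.mul_apply, dPS_eq_weightOp]
        exact Rg_weightOp_geoK (𝒪 := SF 1) geoTheta_odd geoP_mul geoQ_mul rfl), map_neg, neg_neg,
      map_smul]

theorem brstW1Coeff_geoFields (n : ℕ) : brstW1Coeff dPlus cartanOp geoFields n =
    (-8 : ℂ) ^ n • proj 1 (geoK geoTheta) := by
  have hA : mcForm dPlus geoFields.g = -geoK geoTheta := mcForm_geoG (v := (1, 0)) (by norm_num)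
  have hN : nPlus geoFields = 0 := by simp [nPlus, geoFields]
  cases n with
  | zero => rw [brstW1Coeff, hA, map_neg, neg_neg, pow_zero, one_smul]
  | succ n =>
    rw [brstW1Coeff, hA, hN, map_zero, map_zero, smul_zero, sub_zero, map_neg,
      pow_apply_eigen (c := -8) (by
        rw [LinearMap.neg_apply, Module.End.mul_apply, dPSHat_eq_weightOp, neg_smul]
        exact congrArg Neg.neg
          (Rg_weightOp_geoK (𝒪 := SF 1) geoTheta_odd geoP_mul geoQ_mul rfl)), map_neg, neg_neg,
      map_smul]

/-- Commutators with the constant ghosts have no component along the fermionic direction of the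
geodesic. -/
theorem commutator_ghost_apply (z : ℂ) (S : SMat (SF 1)) :
    (ofComplex (SF 1) (oddRoot z 2 0 3 1) * S - S * ofComplex (SF 1) (oddRoot z 2 0 3 1))
      (Sum.inl 0) (Sum.inr 2) = 0 := by
  have e2 : ∀ j, ofComplex (SF 1) (oddRoot z 2 0 3 1) (Sum.inl 0) j = 0 := fun j => by
    rw [ofComplex_apply, show oddRoot z 2 0 3 1 (Sum.inl 0) j = 0 by simp [oddRoot], map_zero]
  have e3 : ∀ j, ofComplex (SF 1) (oddRoot z 2 0 3 1) j (Sum.inr 2) = 0 := fun j => by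
    rw [ofComplex_apply, show oddRoot z 2 0 3 1 j (Sum.inr 2) = 0 by simp [oddRoot], map_zero]
  rw [Matrix.sub_apply, Matrix.mul_apply, Matrix.mul_apply]
  simp only [e2, e3, zero_mul, mul_zero, Finset.sum_const_zero, sub_zero]

theorem smul_proj_geoK_apply_ne_zero {k : ℕ} (hk : Odd k) {c : ℂ} (hc : c ≠ 0)
    (h : proj k geoComm (Sum.inl 0) (Sum.inr 2) = -Complex.I) :
    (c • proj k (geoK geoTheta)) (Sum.inl 0) (Sum.inr 2) ≠ 0 := by
  rw [Matrix.smul_apply, proj_geoK _ hk, smul_ofComplex_apply, h]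
  exact smul_ne_zero hc (smul_ne_zero (neg_ne_zero.2 Complex.I_ne_zero) geoTheta_ne_zero)

/-- None of the coefficients of the expansion is a gauge transformation along the geodesic. -/
theorem exists_nonterminating : ∃ (R : Module.End ℂ psl), IsYangBaxter R ∧ IsRealOperator R ∧
    ∃ (N : ℕ) (Φ : Fields (SF N)), IsConfig Φ ∧ IsPSU Φ.g ∧ ∀ n : ℕ,
      (∀ S : SMat (SF N), proj 2 S = S →
        brstW3Coeff dMinus R Φ n ≠ Φ.l1 * S - S * Φ.l1) ∧
      (∀ S : SMat (SF N), proj 2 S = S →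
        brstW1Coeff dPlus R Φ n ≠ Φ.l3 * S - S * Φ.l3) := by
  refine ⟨cartanOp, isYangBaxter_cartanOp, isRealOperator_cartanOp, 1, geoFields,
    isConfig_geoFields, isPSU_geoG, fun n => ⟨fun S _ h => ?_, fun S _ h => ?_⟩⟩
  · refine smul_proj_geoK_apply_ne_zero (k := 3) (by decide)
      (pow_ne_zero n (by norm_num : (8 : ℂ) ≠ 0)) proj_three_geoComm ?_
    rw [← brstW3Coeff_geoFields, h]
    exact commutator_ghost_apply _ S
  · refine smul_proj_geoK_apply_ne_zero (k := 1) (by decide)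
      (pow_ne_zero n (by norm_num : (-8 : ℂ) ≠ 0)) proj_one_geoComm ?_
    rw [← brstW1Coeff_geoFields, h]
    exact commutator_ghost_apply _ S

end PureSpinorYB

end

open PureSpinorYB in
theorem mainTheorem2 :
    -- BRST invariance of the deformed action, and nilpotency on-shell
    (∀ (R : Module.End ℂ psl), IsYangBaxter R → ∀ (η : ℝ) (N : ℕ) (Φ : Fields (SF N)),
      IsConfig Φ → Regular R η Φ →
      (∀ e : Grassmann N, IsOddConst e →
        IsConfig (Φ + Q R η e Φ) ∧ Regular R η (Φ + Q R η e Φ) ∧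
        lagrangian dPlus dMinus R η (Φ + Q R η e Φ) - lagrangian dPlus dMinus R η Φ =
          dPlus ((1 / 4 : ℂ) • str ((const e • (Φ.l1 - Φ.l3)) * mcForm dMinus Φ.g))
          - dMinus ((1 / 4 : ℂ) • str ((const e • (Φ.l1 - Φ.l3)) * mcForm dPlus Φ.g)) ∧
        ∀ u v : ℝ × ℝ, u.1 * v.2 - u.2 * v.1 ≠ 0 → HasPeriod u Φ → HasPeriod v Φ →
          action u v R η (Φ + Q R η e Φ) = action u v R η Φ) ∧
      (GhostOnShell R η Φ → ∀ e e' : Grassmann N, IsOddConst e → IsOddConst e' →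
        IsGauge Φ (QQ R η e' e Φ))) ∧
    -- off-shell, nilpotency fails, even up to gauge transformations
    (∀ (R : Module.End ℂ psl), IsYangBaxter R →
      {η : ℝ | ¬ ∃ Φ : Fields (SF 2), IsConfig Φ ∧ Regular R η Φ ∧ IsPSU Φ.g ∧
        ∃ e e' : Grassmann 2, IsOddConst e ∧ IsOddConst e' ∧
          ¬ IsGauge Φ (QQ R η e' e Φ)}.Finite) ∧
    -- expansion of the action and of the BRST operator in powers of the deformation parameter
    (∀ (R : Module.End ℂ psl), IsYangBaxter R → ∀ (N : ℕ) (Φ : Fields (SF N)), IsConfig Φ →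
      ∀ x : ℝ × ℝ, ∃ δ > 0, ∀ η : ℝ, |η| < δ → Regular R η Φ →
        ∀ φ : Module.Dual ℝ (Grassmann N),
          HasSum (fun n : ℕ => (η : ℂ) ^ (n + 1) *
              evalAt x φ (lagrangianCoeff dPlus dMinus R Φ n))
            (evalAt x φ (lagrangian dPlus dMinus R η Φ - lagrangianAdS dPlus dMinus Φ)) ∧
          ∀ i j : Idx,
            HasSum (fun n : ℕ => (η : ℂ) ^ n * evalAt x φ (brstW3Coeff dMinus R Φ n i j))
              (evalAt x φ (brstW3 dMinus R η Φ i j)) ∧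
            HasSum (fun n : ℕ => (η : ℂ) ^ n * evalAt x φ (brstW1Coeff dPlus R Φ n i j))
              (evalAt x φ (brstW1 dPlus R η Φ i j))) ∧
    -- in general the series of the BRST operator in the ghost sector does not terminate
    (∃ (R : Module.End ℂ psl), IsYangBaxter R ∧ IsRealOperator R ∧
      ∃ (N : ℕ) (Φ : Fields (SF N)), IsConfig Φ ∧ IsPSU Φ.g ∧ ∀ n : ℕ,
        (∀ S : SMat (SF N), proj 2 S = S →
          brstW3Coeff dMinus R Φ n ≠ Φ.l1 * S - S * Φ.l1) ∧
        (∀ S : SMat (SF N), proj 2 S = S →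
          brstW1Coeff dPlus R Φ n ≠ Φ.l3 * S - S * Φ.l3)) := by
  refine ⟨fun R hR η N Φ hΦ hreg => ⟨fun e he => ?_, fun hos e e' he he' => ?_⟩,
    fun R hR => finite_nilpotent hR, fun R hR N Φ hΦ x => expansion hR hΦ x, exists_nonterminating⟩
  · exact brst_invariance hR hΦ hreg he
  · exact brst_nilpotent hR hΦ hreg hos he he'
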